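/- **Theorem 3.1.** Let $M$ be a smooth manifold (Hausdorff, second countable, without boundary, of dimension $d$). *Pre-Courant algebroids.* A pre-Courant algebroid over $M$ is a smooth vector bundle $E \to M$ of finite rank with a pseudo-Euclidean metric $\langle\cdot,\cdot\rangle$ (a smooth family of nondegenerate symmetric bilinear forms on the fibres), a vector bundle morphism $\rho : E \to TM$ over $\mathrm{id}_M$ whose kernel is coisotropic, $(\ker\rho)^{\perp}\subseteq\ker\rho$, and a binary operation $\circ$ on the smooth sections of $E$ such that, for all sections $e_1,e_2,e_3$, $$\rho(e_1\circ e_2)=[\rho(e_1),\rho(e_2)],\qquad e_1\circ e_2+e_2\circ e_1=\mathcal D\langle e_1,e_2\rangle,\qquad \rho(e_1)\langle e_2,e_3\rangle=\langle e_1\circ e_2,e_3\rangle+\langle e_2,e_1\circ e_3\rangle ,$$ where $\mathcal D f$ is the section with $\langle \mathcal D f,e\rangle=\rho(e)f$. The Jacobi identity is not required. An isomorphism is a vector bundle isomorphism over $\mathrm{id}_M$ that preserves $\langle\cdot,\cdot\rangle$, $\rho$ and $\circ$. *Symplectic almost Lie 2-algebroids.* A graded bundle $F_2$ of degree $2$ over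 $M$ that is an N-manifold is given by its sheaf of polynomial functions $\mathcal A=\bigoplus_{k\ge 0}\mathcal A^k$ on $M$: a sheaf of $\mathbb N$-graded real algebras that are graded commutative (Grassmann parity is weight mod $2$), with $\mathcal A^0=C^\infty_M$, and locally free as a graded commutative algebra over $C^\infty_M$ on $q$ generators of weight $1$ and $r$ generators of weight $2$. A symplectic almost Lie 2-algebroid with such an underlying graded bundle consists of $F_2$, a nondegenerate Poisson bracket $\{\cdot,\cdot\}$ of weight $-2$ on $\mathcal A$, and a (necessarily odd) global function $\Theta\in\mathcal A^3(M)$ such that $\{\{\Theta,\Theta\},f\}=0$ for all $f\in C^\infty(M)$. An isomorphism is an isomorphism of sheaves of graded algebras that is the identity on $C^\infty_M$ and preserves the bracket and $\Theta$. *Derived data.* We say that $P=(E,\langle\cdot,\cdot\rangle,\rho,\circ)$ is derived from $S=(F_2,\{\cdot,\cdot\},\Theta)$ through a $C^\infty(M)$-linear isomorphism $\varphi:\mathrm{Sec}(E)\to\mathcal A^1(M)$ if, for all sections $\sigma,\psi$ and all $f\in C^\infty(M)$ (weight-one functions being odd, so that $(-1)^{\tilde\sigma}=-1$), $$\langle\sigma,\psi\rangle=\{\varphi\sigma,\varphi\psi\},\qquad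 \rho(\sigma)f=-\{\{\Theta,\varphi\sigma\},f\},\qquad \varphi(\sigma\circ\psi)=-\{\{\Theta,\varphi\sigma\},\varphi\psi\}.$$ Then the following hold. 1. There is a bijection $\Phi$ from the isomorphism classes of symplectic almost Lie 2-algebroids over $M$ whose underlying graded bundle is an N-manifold onto the isomorphism classes of pre-Courant algebroids over $M$, such that $\Phi([S])=[P]$ if and only if $P$ is derived from $S$ through some $\varphi$. 2. If $P$ is derived from $S$ through $\varphi$ and $P'$ is derived from $S'$ through $\varphi'$, then for every isomorphism $a:S\to S'$ there is exactly one isomorphism $b:P\to P'$ with $a\circ\varphi=\varphi'\circ b$ on sections, and for every isomorphism $b:P\to P'$ there is exactly one isomorphism $a:S\to S'$ with $a\circ\varphi=\varphi'\circ b$. -/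

import Mathlib

open scoped Manifold ContDiff Bundle
open TopologicalSpace

universe u

noncomputable section

namespace PreCourant

/-- Smooth real functions on `M` (`d` is the dimension of `M`). -/
abbrev Fn (d : ℕ) (M : Type u) [TopologicalSpace M]
    [ChartedSpace (EuclideanSpace ℝ (Fin d)) M] : Type u :=
  C^∞⟮𝓡 d, M; 𝓘(ℝ, ℝ), ℝ⟯

/-- Restriction of smooth functions from an open set `V` to an open set `U ⊆ V`. -/
def Fn.res {d : ℕ} {M : Type u} [TopologicalSpace M]
    [ChartedSpace (EuclideanSpace ℝ (Fin d)) M] {U V : Opens M} (h : U ≤ V) (f : Fn d V) :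
    Fn d U :=
  ⟨fun y => f (Set.inclusion h y), f.contMDiff.comp (contMDiff_inclusion h)⟩

/-- Restriction of a smooth function on `M` to an open subset. -/
def Fn.toOpen {d : ℕ} {M : Type u} [TopologicalSpace M]
    [ChartedSpace (EuclideanSpace ℝ (Fin d)) M] (U : Opens M) (f : Fn d M) : Fn d U :=
  ⟨fun y => f y.1, f.contMDiff.comp contMDiff_subtype_val⟩

/-! ### Vector bundles and pre-Courant algebroids -/

/-- A smooth real vector bundle of finite rank over `M`. -/
structure VBundle (d : ℕ) (M : Type u) [TopologicalSpace M]
    [ChartedSpace (EuclideanSpace ℝ (Fin d)) M] where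
  rank : ℕ
  fib : M → Type u
  [addCommGroup : ∀ x, AddCommGroup (fib x)]
  [module : ∀ x, Module ℝ (fib x)]
  [topFib : ∀ x, TopologicalSpace (fib x)]
  [topTotal : TopologicalSpace (Bundle.TotalSpace (Fin rank → ℝ) fib)]
  [fiberBundle : FiberBundle (Fin rank → ℝ) fib]
  [vectorBundle : VectorBundle ℝ (Fin rank → ℝ) fib]
  [smooth : ContMDiffVectorBundle ∞ (Fin rank → ℝ) fib (𝓡 d)]

attribute [instance] VBundle.addCommGroup VBundle.module VBundle.topFib VBundle.topTotal
  VBundle.fiberBundle VBundle.vectorBundle VBundle.smooth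

/-- The space of global smooth sections of a vector bundle. -/
abbrev VBundle.Sec {d : ℕ} {M : Type u} [TopologicalSpace M]
    [ChartedSpace (EuclideanSpace ℝ (Fin d)) M] (E : VBundle d M) : Type u :=
  Cₛ^∞⟮𝓡 d; (Fin E.rank → ℝ), E.fib⟯

/-- A pre-Courant algebroid over `M`: a pseudo-Euclidean vector bundle with an anchor whose kernel
is coisotropic, and with a pre-bracket on its sections. -/
structure PreCourantAlgebroid (d : ℕ) (M : Type u) [TopologicalSpace M]
    [ChartedSpace (EuclideanSpace ℝ (Fin d)) M] extends VBundle d M where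
  /-- The pseudo-Euclidean metric: a smooth family of nondegenerate symmetric bilinear forms. -/
  metric : ∀ x, fib x →ₗ[ℝ] fib x →ₗ[ℝ] ℝ
  metric_symm : ∀ x v w, metric x v w = metric x w v
  metric_nondeg : ∀ x v, (∀ w, metric x v w = 0) → v = 0
  metric_smooth : ∀ s t : toVBundle.Sec,
    ContMDiff (𝓡 d) 𝓘(ℝ, ℝ) ∞ (fun x => metric x (s x) (t x))
  /-- The anchor `ρ : E → TM`, a vector bundle map over the identity of `M`. -/
  anchor : ∀ x, fib x →ₗ[ℝ] TangentSpace (𝓡 d) x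
  /-- The anchor is smooth: it maps smooth sections to vector fields under which the derivative
  of every smooth function is smooth. -/
  anchor_smooth : ∀ (s : toVBundle.Sec) (f : Fn d M),
    ContMDiff (𝓡 d) 𝓘(ℝ, ℝ) ∞ (fun x => mvfderiv (𝓡 d) f x (anchor x (s x)))
  /-- The kernel of the anchor is coisotropic: `(ker ρ)ᗮ ⊆ ker ρ`. -/
  coisotropic : ∀ x v, (∀ w, anchor x w = 0 → metric x v w = 0) → anchor x v = 0
  /-- The pre-bracket `e₁ ∘ e₂`. -/
  circ : toVBundle.Sec → toVBundle.Sec → toVBundle.Sec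
  /-- `ρ (e₁ ∘ e₂) = [ρ e₁, ρ e₂]`, the Lie bracket of vector fields being the commutator of
  their actions on functions. -/
  anchor_circ : ∀ (e₁ e₂ : toVBundle.Sec) (f : Fn d M) (x : M),
    mvfderiv (𝓡 d) f x (anchor x (circ e₁ e₂ x)) =
      mvfderiv (𝓡 d) (fun y => mvfderiv (𝓡 d) f y (anchor y (e₂ y))) x (anchor x (e₁ x)) -
      mvfderiv (𝓡 d) (fun y => mvfderiv (𝓡 d) f y (anchor y (e₁ y))) x (anchor x (e₂ x))
  /-- `e₁ ∘ e₂ + e₂ ∘ e₁ = 𝒟⟨e₁, e₂⟩`, where `𝒟 f` is the section determined by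
  `⟨𝒟 f, v⟩ = ρ(v) f`. -/
  circ_symm : ∀ (e₁ e₂ : toVBundle.Sec) (x : M) (v : fib x),
    metric x (circ e₁ e₂ x + circ e₂ e₁ x) v =
      mvfderiv (𝓡 d) (fun y => metric y (e₁ y) (e₂ y)) x (anchor x v)
  /-- `ρ(e₁)⟨e₂, e₃⟩ = ⟨e₁ ∘ e₂, e₃⟩ + ⟨e₂, e₁ ∘ e₃⟩`. -/
  circ_metric : ∀ (e₁ e₂ e₃ : toVBundle.Sec) (x : M),
    mvfderiv (𝓡 d) (fun y => metric y (e₂ y) (e₃ y)) x (anchor x (e₁ x)) =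
      metric x (circ e₁ e₂ x) (e₃ x) + metric x (e₂ x) (circ e₁ e₃ x)

namespace PreCourantAlgebroid

variable {d : ℕ} {M : Type u} [TopologicalSpace M] [ChartedSpace (EuclideanSpace ℝ (Fin d)) M]

/-- Sections of the underlying vector bundle. -/
abbrev Sec (P : PreCourantAlgebroid d M) : Type u := P.toVBundle.Sec

/-- The smooth function `⟨s, t⟩`. -/
def pairing (P : PreCourantAlgebroid d M) (s t : P.Sec) : Fn d M :=
  ⟨fun x => P.metric x (s x) (t x), P.metric_smooth s t⟩

/-- The smooth function `ρ(s) f`. -/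
def act (P : PreCourantAlgebroid d M) (s : P.Sec) (f : Fn d M) : Fn d M :=
  ⟨fun x => mvfderiv (𝓡 d) f x (P.anchor x (s x)), P.anchor_smooth s f⟩

/-- An isomorphism of pre-Courant algebroids over the identity of `M`: a fibrewise linear
isomorphism that identifies the smooth sections and respects metric, anchor and pre-bracket. -/
structure Iso (P Q : PreCourantAlgebroid d M) where
  onFib : ∀ x, P.fib x ≃ₗ[ℝ] Q.fib x
  onSec : P.Sec ≃ Q.Sec
  onSec_apply : ∀ s x, onSec s x = onFib x (s x)
  metric_eq : ∀ x v w, Q.metric x (onFib x v) (onFib x w) = P.metric x v w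
  anchor_eq : ∀ x v, Q.anchor x (onFib x v) = P.anchor x v
  circ_eq : ∀ s t, onSec (P.circ s t) = Q.circ (onSec s) (onSec t)

/-- The identity isomorphism. -/
def Iso.refl (P : PreCourantAlgebroid d M) : Iso P P where
  onFib _ := LinearEquiv.refl ℝ _
  onSec := Equiv.refl _
  onSec_apply _ _ := rfl
  metric_eq _ _ _ := rfl
  anchor_eq _ _ := rfl
  circ_eq _ _ := rfl

/-- The inverse isomorphism. -/
def Iso.symm {P Q : PreCourantAlgebroid d M} (a : Iso P Q) : Iso Q P where
  onFib x := (a.onFib x).symm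
  onSec := a.onSec.symm
  onSec_apply s x := by
    rw [LinearEquiv.eq_symm_apply, ← a.onSec_apply, Equiv.apply_symm_apply]
  metric_eq x v w := by simp [← a.metric_eq]
  anchor_eq x v := by simp [← a.anchor_eq]
  circ_eq s t := by rw [Equiv.symm_apply_eq, a.circ_eq]; simp

/-- Composition of isomorphisms. -/
def Iso.trans {P Q R : PreCourantAlgebroid d M} (a : Iso P Q) (b : Iso Q R) : Iso P R where
  onFib x := (a.onFib x).trans (b.onFib x)
  onSec := a.onSec.trans b.onSec
  onSec_apply s x := by simp [a.onSec_apply, b.onSec_apply]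
  metric_eq x v w := by simp [a.metric_eq, b.metric_eq]
  anchor_eq x v := by simp [a.anchor_eq, b.anchor_eq]
  circ_eq s t := by simp [a.circ_eq, b.circ_eq]

variable (d M) in
/-- Isomorphism over the identity of `M`, as an equivalence relation. -/
def isoSetoid : Setoid (PreCourantAlgebroid d M) where
  r P Q := Nonempty (Iso P Q)
  iseqv := ⟨fun P => ⟨Iso.refl P⟩, fun ⟨a⟩ => ⟨a.symm⟩, fun ⟨a⟩ ⟨b⟩ => ⟨a.trans b⟩⟩

end PreCourantAlgebroid

/-! ### N-manifolds of degree 2 -/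

/-- The monomial `ξ^S p^α = ∏_{i ∈ S} ξ_i ∏_a p_a^{α_a}`, factors in increasing order. -/
def monomial {A : Type u} [Ring A] {q r : ℕ} (ξ : Fin q → A) (p : Fin r → A)
    (m : Finset (Fin q) × (Fin r → ℕ)) : A :=
  (List.ofFn fun i => if i ∈ m.1 then ξ i else 1).prod * (List.ofFn fun a => p a ^ m.2 a).prod

/-- A graded bundle of degree 2 over `M` that is an N-manifold, given by its sheaf of polynomial
functions: a sheaf `A = ⨁ₖ Aᵏ` of `ℕ`-graded real algebras on `M`, commutative in the graded sense
with Grassmann parity equal to the weight mod 2, whose weight-zero part is the sheaf of smooth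
functions of `M`, and which is locally free (as a graded commutative algebra over the smooth
functions) on `q` generators `ξ` of weight 1 and `r` generators `p` of weight 2.
As `A U` is a direct sum of its homogeneous parts, gluing is required for each weight. -/
structure NManifold (d : ℕ) (M : Type u) [TopologicalSpace M]
    [ChartedSpace (EuclideanSpace ℝ (Fin d)) M] where
  A : Opens M → Type u
  [ring : ∀ U, Ring (A U)]
  [algebra : ∀ U, Algebra ℝ (A U)]
  /-- The functions of weight `k`. -/
  deg : ∀ U, ℕ → Submodule ℝ (A U)
  [graded : ∀ U, GradedAlgebra (deg U)]
  graded_comm : ∀ U i j, ∀ a ∈ deg U i, ∀ b ∈ deg U j, a * b = (-1) ^ (i * j) * (b * a)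
  res : ∀ {U V : Opens M}, U ≤ V → A V →ₐ[ℝ] A U
  res_deg : ∀ {U V : Opens M} (h : U ≤ V) (k : ℕ), ∀ a ∈ deg V k, res h a ∈ deg U k
  res_self : ∀ (U : Opens M) (a : A U), res le_rfl a = a
  res_res : ∀ {U V W : Opens M} (h : U ≤ V) (h' : V ≤ W) (a : A W),
    res h (res h' a) = res (h.trans h') a
  /-- The sheaf condition, in each weight. -/
  glue : ∀ {ι : Type u} (U : Opens M) (V : ι → Opens M) (hV : ∀ i, V i ≤ U), U ≤ ⨆ i, V i →
    ∀ (k : ℕ) (s : ∀ i, A (V i)), (∀ i, s i ∈ deg (V i) k) →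
    (∀ i j, res (inf_le_left : V i ⊓ V j ≤ V i) (s i) =
      res (inf_le_right : V i ⊓ V j ≤ V j) (s j)) →
    ∃! t : A U, t ∈ deg U k ∧ ∀ i, res (hV i) t = s i
  /-- The identification of smooth functions with the functions of weight zero. -/
  base : ∀ U : Opens M, Fn d U →ₐ[ℝ] A U
  base_injective : ∀ U, Function.Injective (base U)
  base_range : ∀ U (a : A U), a ∈ deg U 0 ↔ ∃ f, base U f = a
  base_res : ∀ {U V : Opens M} (h : U ≤ V) (f : Fn d V), res h (base V f) = base U (f.res h)
  /-- The number of local coordinates of weight 1. -/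
  q : ℕ
  /-- The number of local coordinates of weight 2. -/
  r : ℕ
  /-- Around every point there are local coordinates of weight 1 and 2: every function is, on
  every smaller open set, uniquely a finite combination of the monomials in them, with smooth
  coefficients. -/
  local_coord : ∀ m : M, ∃ U : Opens M, m ∈ U ∧ ∃ (ξ : Fin q → A U) (p : Fin r → A U),
    (∀ i, ξ i ∈ deg U 1) ∧ (∀ a, p a ∈ deg U 2) ∧
    ∀ (V : Opens M) (h : V ≤ U) (a : A V),
      ∃! c : (Finset (Fin q) × (Fin r → ℕ)) →₀ Fn d V,
        a = c.sum fun s f => base V f * res h (monomial ξ p s)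

attribute [instance] NManifold.ring NManifold.algebra NManifold.graded

namespace NManifold

variable {d : ℕ} {M : Type u} [TopologicalSpace M] [ChartedSpace (EuclideanSpace ℝ (Fin d)) M]

/-- Homogeneous local coordinates `(x, ξ, p)`, of weights 0, 1, 2, on an open subset `U` of the
domain of the preferred chart of `M` at `m`, which provides the coordinates `x`. -/
structure Coord (N : NManifold d M) (m : M) (U : Opens M) where
  mem : m ∈ U
  subset : ∀ y ∈ U, y ∈ (chartAt (EuclideanSpace ℝ (Fin d)) m).source
  x : Fin d → Fn d U
  ξ : Fin N.q → N.A U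
  p : Fin N.r → N.A U
  x_apply : ∀ a y, x a y = chartAt (EuclideanSpace ℝ (Fin d)) m y.1 a
  ξ_deg : ∀ i, ξ i ∈ N.deg U 1
  p_deg : ∀ a, p a ∈ N.deg U 2
  free : ∀ (V : Opens M) (h : V ≤ U) (a : N.A V),
    ∃! c : (Finset (Fin N.q) × (Fin N.r → ℕ)) →₀ Fn d V,
      a = c.sum fun s f => N.base V f * N.res h (monomial ξ p s)

/-- All coordinates together, as functions on the N-manifold. -/
def Coord.all {N : NManifold d M} {m : M} {U : Opens M} (z : N.Coord m U) :
    Fin d ⊕ Fin N.q ⊕ Fin N.r → N.A U :=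
  Sum.elim (fun a => N.base U (z.x a)) (Sum.elim z.ξ z.p)

/-- A smooth function on `M`, as a global function of weight zero on the N-manifold. -/
def fn (N : NManifold d M) (f : Fn d M) : N.A ⊤ := N.base ⊤ (f.toOpen ⊤)

end NManifold

/-- An N-manifold of degree 2 with a nondegenerate Poisson bracket of weight `-2`. -/
structure SymplecticNManifold (d : ℕ) (M : Type u) [TopologicalSpace M]
    [ChartedSpace (EuclideanSpace ℝ (Fin d)) M] extends NManifold d M where
  bracket : ∀ U, A U →ₗ[ℝ] A U →ₗ[ℝ] A U
  bracket_res : ∀ {U V : Opens M} (h : U ≤ V) (a b : A V),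
    res h (bracket V a b) = bracket U (res h a) (res h b)
  /-- The bracket has weight `-2`. -/
  bracket_deg : ∀ U i j k, k + 2 = i + j → ∀ a ∈ deg U i, ∀ b ∈ deg U j, bracket U a b ∈ deg U k
  /-- There are no functions of negative weight. -/
  bracket_low : ∀ U i j, i + j < 2 → ∀ a ∈ deg U i, ∀ b ∈ deg U j, bracket U a b = 0
  bracket_antisymm : ∀ U i j, ∀ a ∈ deg U i, ∀ b ∈ deg U j,
    bracket U a b = -((-1) ^ (i * j) * bracket U b a)
  bracket_leibniz : ∀ U i j, ∀ a ∈ deg U i, ∀ b ∈ deg U j, ∀ c,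
    bracket U a (b * c) = bracket U a b * c + (-1) ^ (i * j) * (b * bracket U a c)
  bracket_jacobi : ∀ U i j, ∀ a ∈ deg U i, ∀ b ∈ deg U j, ∀ c,
    bracket U a (bracket U b c) =
      bracket U (bracket U a b) c + (-1) ^ (i * j) * bracket U b (bracket U a c)
  /-- Nondegeneracy: the matrix of brackets of suitable local coordinates around any given point
  is invertible. -/
  bracket_nondeg : ∀ m : M, ∃ (U : Opens M) (z : toNManifold.Coord m U),
    IsUnit (Matrix.of fun i j => bracket U (z.all i) (z.all j))

/-- A symplectic almost Lie 2-algebroid over `M` whose underlying graded bundle is an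
N-manifold. -/
structure SymplecticAlmostLie2Algebroid (d : ℕ) (M : Type u) [TopologicalSpace M]
    [ChartedSpace (EuclideanSpace ℝ (Fin d)) M] extends SymplecticNManifold d M where
  /-- The pre-homological potential, odd as its weight is. -/
  Θ : A ⊤
  Θ_deg : Θ ∈ deg ⊤ 3
  Θ_almost : ∀ f : Fn d M, bracket ⊤ (bracket ⊤ Θ Θ) (toNManifold.fn f) = 0

namespace SymplecticAlmostLie2Algebroid

variable {d : ℕ} {M : Type u} [TopologicalSpace M] [ChartedSpace (EuclideanSpace ℝ (Fin d)) M]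

/-- An isomorphism of symplectic almost Lie 2-algebroids over the identity of `M`: an isomorphism
of sheaves of algebras which respects weights, smooth functions on `M`, brackets and potentials. -/
structure Iso (S T : SymplecticAlmostLie2Algebroid d M) where
  map : ∀ U, S.A U ≃ₐ[ℝ] T.A U
  map_res : ∀ {U V : Opens M} (h : U ≤ V) (a : S.A V), map U (S.res h a) = T.res h (map V a)
  map_deg : ∀ U k a, map U a ∈ T.deg U k ↔ a ∈ S.deg U k
  map_base : ∀ U f, map U (S.base U f) = T.base U f
  map_bracket : ∀ U a b, map U (S.bracket U a b) = T.bracket U (map U a) (map U b)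
  map_Θ : map ⊤ S.Θ = T.Θ

/-- The identity isomorphism. -/
def Iso.refl (S : SymplecticAlmostLie2Algebroid d M) : Iso S S where
  map _ := AlgEquiv.refl
  map_res _ _ := rfl
  map_deg _ _ _ := Iff.rfl
  map_base _ _ := rfl
  map_bracket _ _ _ := rfl
  map_Θ := rfl

/-- The inverse isomorphism. -/
def Iso.symm {S T : SymplecticAlmostLie2Algebroid d M} (a : Iso S T) : Iso T S where
  map U := (a.map U).symm
  map_res h b := by rw [AlgEquiv.symm_apply_eq, a.map_res]; simp
  map_deg U k b := by rw [← a.map_deg]; simp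
  map_base U f := by rw [AlgEquiv.symm_apply_eq, a.map_base]
  map_bracket U b c := by rw [AlgEquiv.symm_apply_eq, a.map_bracket]; simp
  map_Θ := by rw [AlgEquiv.symm_apply_eq, a.map_Θ]

/-- Composition of isomorphisms. -/
def Iso.trans {S T R : SymplecticAlmostLie2Algebroid d M} (a : Iso S T) (b : Iso T R) :
    Iso S R where
  map U := (a.map U).trans (b.map U)
  map_res h c := by simp [a.map_res, b.map_res]
  map_deg U k c := by simp [a.map_deg, b.map_deg]
  map_base U f := by simp [a.map_base, b.map_base]
  map_bracket U c e := by simp [a.map_bracket, b.map_bracket]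
  map_Θ := by simp [a.map_Θ, b.map_Θ]

variable (d M) in
/-- Isomorphism over the identity of `M`, as an equivalence relation. -/
def isoSetoid : Setoid (SymplecticAlmostLie2Algebroid d M) where
  r S T := Nonempty (Iso S T)
  iseqv := ⟨fun S => ⟨Iso.refl S⟩, fun ⟨a⟩ => ⟨a.symm⟩, fun ⟨a⟩ ⟨b⟩ => ⟨a.trans b⟩⟩

end SymplecticAlmostLie2Algebroid

/-! ### Derived brackets -/

/-- An identification of the functions of weight 1 on `S` with the sections of `P`, linear over the
smooth functions, under which pairing, anchor and pre-bracket of `P` are the derived ones of `S`: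
`⟨σ, ψ⟩ = {σ, ψ}`, `ρ(σ) f = (-1)^σ {{Θ, σ}, f}`, `σ ∘ ψ = (-1)^σ {{Θ, σ}, ψ}`. Here `σ` is odd,
so that `(-1)^σ = -1`. -/
structure DerivedData {d : ℕ} {M : Type u} [TopologicalSpace M]
    [ChartedSpace (EuclideanSpace ℝ (Fin d)) M]
    (S : SymplecticAlmostLie2Algebroid d M) (P : PreCourantAlgebroid d M) where
  φ : P.Sec ≃ S.deg ⊤ 1
  φ_add : ∀ s t, (φ (s + t) : S.A ⊤) = φ s + φ t
  φ_smul : ∀ (f : Fn d M) (s t : P.Sec), (∀ x, t x = f x • s x) → (φ t : S.A ⊤) = S.fn f * φ s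
  pairing_eq : ∀ s t, S.fn (P.pairing s t) = S.bracket ⊤ (φ s) (φ t)
  anchor_eq : ∀ s f, S.fn (P.act s f) = -S.bracket ⊤ (S.bracket ⊤ S.Θ (φ s)) (S.fn f)
  circ_eq : ∀ s t, (φ (P.circ s t) : S.A ⊤) = -S.bracket ⊤ (S.bracket ⊤ S.Θ (φ s)) (φ t)

/-- An isomorphism `a : S ≅ S'` and an isomorphism `b : P ≅ P'` correspond to each other under given
identifications of weight 1 functions with sections. -/
def Corresponds {d : ℕ} {M : Type u} [TopologicalSpace M]
    [ChartedSpace (EuclideanSpace ℝ (Fin d)) M]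
    {S S' : SymplecticAlmostLie2Algebroid d M} {P P' : PreCourantAlgebroid d M}
    (D : DerivedData S P) (D' : DerivedData S' P')
    (a : SymplecticAlmostLie2Algebroid.Iso S S') (b : PreCourantAlgebroid.Iso P P') : Prop :=
  ∀ s : P.Sec, a.map ⊤ (D.φ s) = D'.φ (b.onSec s)

end PreCourant

end

/-!
A polynomial function `a` on a symplectic N-manifold of degree 2 is determined by the values along
`M` of its iterated brackets `{l₁, {l₂, ⋯ {lₙ, a}}}` with functions `lᵢ` of weight zero and one
(the *letters*): nondegeneracy implies that a function of positive weight that commutes with all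
letters is zero. Once the functions of weight one are identified with the sections of a bundle `E`,
`a` becomes a function `jet a` on words whose letters are the sections of `E` and the smooth
functions on `M`. This expansion turns multiplication into the shuffle product, since letters act by
derivations, and the Poisson bracket into the bracket `pb`, of which the letters are derivations and
whose weight-zero part `Br` involves only the metric and the symbols of functions of weight two. The
functions on words that occur satisfy the relations `Rel`, which mention only the bundle and the
metric. All of this makes sense for any pre-Courant algebroid `P`.

*From `P` to `S`.* The functions on words that satisfy these relations, with smooth values and
bounded weight, form an algebra `polyAlg` that is closed under `pb` (`IsPoly.mul`, `IsPoly.pb`). The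
bracket satisfies the Jacobi identity (`jacobi`): letters are derivations, so it is enough to look at
the empty word; there a triple of homogeneous functions contributes only if its weights add up to
four, and then one of the functions has weight at most one, so that it is locally a letter. A chart of
`M` and a frame of `E` provide local coordinates (`frameCoord`): those of weight two are the momenta of
a metric connection. Brackets with coordinates give derivations dual to the coordinates, and an
argument with Euler fields shows that the monomials form a basis (`DualCoord.existsUnique`). The
potential is the function of weight three with the values `⟨e₁ ∘ e₂, e₃⟩` and `ρ(e) f`. It satisfies
the relations because the pre-bracket is compatible with the metric (`rel_potential`). Coisotropy and
the compatibility of the pre-bracket with the anchor yield `𝒟 f ∘ e = 0`, that is `{𝒟 f, Θ} = 0`, and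
hence `{{Θ, Θ}, f} = 0` (`D_pb_potential`).

*Uniqueness.* If `P` is derived from `S`, then the expansion is an isomorphism from `S` onto the
algebroid of polynomial functions of `P` (`DerivedData.isoPoly`): locally both algebras are free on
monomials in corresponding coordinates (`jetHom_bijective_of_coord`), and the homogeneous parts glue.
As an isomorphism out of `S` is determined by its action on letters, isomorphisms of `S` and of `P`
correspond to each other (`existsUnique_iso_right`, `existsUnique_iso_left`).

*From `S` to `P`.* The form `{a, b}(x)` on the global functions of weight one has a kernel, and the
quotients by these kernels are the fibres of a smooth vector bundle whose sections are the functions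
of weight one (`secEquiv`). The derived bracket and anchor make it a pre-Courant algebroid
(`preCourant`). The identity `{{Θ, Θ}, f} = 0` yields `{{Θ, f}, {Θ, g}} = 0`, which is coisotropy of
the kernel of the anchor because the orthogonal complement of this kernel is spanned by the `{Θ, f}`
(`anchor_coisotropic`), and it makes the anchor compatible with the brackets (`ham_der_fn`).
-/

set_option linter.unusedSectionVars false

/-! ### The shuffle superalgebra of functions on words -/

noncomputable section

namespace PreCourant

/-- An alphabet whose letters carry weights; a letter is odd if its weight is. -/
class Weighted (L : Type*) where
  wt : L → ℕ

/-- The functions on words in the alphabet `L` with values in `R`. The value at a word stands for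
an iterated bracket of the letters with the function, the first letter being applied first. -/
def Shuf (L R : Type*) : Type _ := List L → R

namespace Shuf

variable {L R : Type*} [Weighted L]

/-- The weight of a word. -/
def wtw (w : List L) : ℕ := (w.map Weighted.wt).sum

@[simp] lemma wtw_nil : wtw ([] : List L) = 0 := rfl

@[simp] lemma wtw_cons (l : L) (w : List L) : wtw (l :: w) = Weighted.wt l + wtw w := by
  simp [wtw]

/-- The sign of a letter. -/
def sg (l : L) : ℤˣ := (-1) ^ Weighted.wt l

variable [CommRing R]

instance : AddCommGroup (Shuf L R) := inferInstanceAs (AddCommGroup (List L → R))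

instance {S : Type*} [Semiring S] [Module S R] : Module S (Shuf L R) :=
  inferInstanceAs (Module S (List L → R))

@[ext] lemma ext {a b : Shuf L R} (h : ∀ w, a w = b w) : a = b := funext h

@[simp] lemma add_apply (a b : Shuf L R) (w : List L) : (a + b) w = a w + b w := rfl
@[simp] lemma neg_apply (a : Shuf L R) (w : List L) : (-a) w = -a w := rfl
@[simp] lemma zero_apply (w : List L) : (0 : Shuf L R) w = 0 := rfl
@[simp] lemma smul_apply {S : Type*} [Semiring S] [Module S R] (s : S) (a : Shuf L R)
    (w : List L) : (s • a) w = s • a w := rfl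
@[simp] lemma usmul_apply (s : ℤˣ) (a : Shuf L R) (w : List L) : (s • a) w = s • a w := rfl

lemma sum_apply {ι : Type*} (s : Finset ι) (f : ι → Shuf L R) (w : List L) :
    (∑ i ∈ s, f i) w = ∑ i ∈ s, f i w := Finset.sum_apply w s f

/-- The action of a letter. -/
def D (l : L) : Shuf L R →ₗ[R] Shuf L R where
  toFun a w := a (l :: w)
  map_add' _ _ := rfl
  map_smul' _ _ := rfl

@[simp] lemma D_apply (l : L) (a : Shuf L R) (w : List L) : D l a w = a (l :: w) := rfl

@[simp] lemma D_usmul (l : L) (s : ℤˣ) (a : Shuf L R) : D l (s • a) = s • D l a := rfl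

lemma D_smul' {S : Type*} [Semiring S] [Module S R] (l : L) (s : S) (a : Shuf L R) :
    D l (s • a) = s • D l a := rfl

/-- The automorphism that multiplies functions of weight `k` by `s ^ k`. -/
def θ (s : ℤˣ) : Shuf L R →ₗ[R] Shuf L R where
  toFun a w := s ^ wtw w • a w
  map_add' a b := by ext w; exact smul_add _ _ _
  map_smul' r a := by ext w; exact mul_smul_comm _ r (a w) |>.symm

lemma θ_apply (s : ℤˣ) (a : Shuf L R) (w : List L) : θ s a w = s ^ wtw w • a w := rfl

@[simp] lemma θ_nil (s : ℤˣ) (a : Shuf L R) : θ s a [] = a [] := by simp [θ_apply]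

@[simp] lemma θ_one (a : Shuf L R) : θ 1 a = a := by ext w; simp [θ_apply]

lemma θ_smul' {S : Type*} [Semiring S] [Module S R] (t : ℤˣ) (s : S) (a : Shuf L R) :
    θ t (s • a) = s • θ t a := by
  ext w
  rw [θ_apply, smul_apply, smul_apply, θ_apply, smul_comm]

lemma θ_usmul (t s : ℤˣ) (a : Shuf L R) : θ t (s • a) = s • θ t a := by
  ext w
  rw [θ_apply, usmul_apply, usmul_apply, θ_apply, smul_comm]

lemma θ_θ (s t : ℤˣ) (a : Shuf L R) : θ s (θ t a) = θ (s * t) a := by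
  ext w; simp [θ_apply, mul_pow, mul_smul]

lemma θ_comm (s t : ℤˣ) (a : Shuf L R) : θ s (θ t a) = θ t (θ s a) := by
  rw [θ_θ, θ_θ, mul_comm]

lemma D_θ (l : L) (s : ℤˣ) (a : Shuf L R) :
    D l (θ s a) = s ^ Weighted.wt l • θ s (D l a) := by
  ext w; simp [θ_apply, pow_add, mul_smul]

/-- The value of a product at a word, by recursion on the word: letters act by derivations. -/
def mulAux : List L → Shuf L R → Shuf L R → R
  | [], a, b => a [] * b []
  | l :: w, a, b => mulAux w (D l a) b + mulAux w (θ (sg l) a) (D l b)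

instance : Mul (Shuf L R) := ⟨fun a b w => mulAux w a b⟩

/-- The constant function `r`. -/
def const (r : R) : Shuf L R
  | [] => r
  | _ :: _ => 0

instance : One (Shuf L R) := ⟨const 1⟩

@[simp] lemma mul_nil (a b : Shuf L R) : (a * b) [] = a [] * b [] := rfl

lemma mul_cons (a b : Shuf L R) (l : L) (w : List L) :
    (a * b) (l :: w) = (D l a * b) w + (θ (sg l) a * D l b) w := rfl

lemma D_mul (l : L) (a b : Shuf L R) : D l (a * b) = D l a * b + θ (sg l) a * D l b := rfl

@[simp] lemma const_nil (r : R) : (const r : Shuf L R) [] = r := rfl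
@[simp] lemma const_cons (r : R) (l : L) (w : List L) : (const r : Shuf L R) (l :: w) = 0 := rfl
@[simp] lemma D_const (l : L) (r : R) : D l (const r : Shuf L R) = 0 := rfl

@[simp] lemma θ_const (s : ℤˣ) (r : R) : θ s (const r : Shuf L R) = const r := by
  ext w; cases w <;> simp [θ_apply]

lemma one_def : (1 : Shuf L R) = const 1 := rfl

protected lemma add_mul' (a b c : Shuf L R) : (a + b) * c = a * c + b * c := by
  ext w
  induction w generalizing a b c with
  | nil => simp [add_mul]
  | cons l w ih => simp only [mul_cons, map_add, ih, add_apply]; abel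

protected lemma mul_add' (a b c : Shuf L R) : a * (b + c) = a * b + a * c := by
  ext w
  induction w generalizing a b c with
  | nil => simp [mul_add]
  | cons l w ih => simp only [mul_cons, map_add, ih, add_apply]; abel

protected lemma smul_mul' {S : Type*} [CommSemiring S] [Algebra S R] (s : S) (a b : Shuf L R) :
    (s • a) * b = s • (a * b) := by
  ext w
  induction w generalizing a b with
  | nil => simp
  | cons l w ih =>
    simp only [mul_cons, D_smul', θ_smul', ih, smul_apply, smul_add]

protected lemma mul_smul' {S : Type*} [CommSemiring S] [Algebra S R] (s : S) (a b : Shuf L R) :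
    a * (s • b) = s • (a * b) := by
  ext w
  induction w generalizing a b with
  | nil => simp
  | cons l w ih =>
    simp only [mul_cons, D_smul', ih, smul_apply, smul_add]

protected lemma usmul_mul (s : ℤˣ) (a b : Shuf L R) : (s • a) * b = s • (a * b) := by
  rcases Int.units_eq_one_or s with rfl | rfl
  · simp
  · have := Shuf.smul_mul' (-1 : R) a b
    simpa using this

protected lemma mul_usmul (s : ℤˣ) (a b : Shuf L R) : a * (s • b) = s • (a * b) := by
  rcases Int.units_eq_one_or s with rfl | rfl
  · simp
  · have := Shuf.mul_smul' (-1 : R) a b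
    simpa using this

lemma θ_mul (s : ℤˣ) (a b : Shuf L R) : θ s (a * b) = θ s a * θ s b := by
  ext w
  induction w generalizing a b with
  | nil => simp
  | cons l w ih =>
    have h1 := ih (D l a) b
    have h2 := ih (θ (sg l) a) (D l b)
    simp only [θ_apply] at h1 h2
    simp only [θ_apply, mul_cons, D_θ, Shuf.usmul_mul, Shuf.mul_usmul, usmul_apply, wtw_cons,
      pow_add, mul_smul, smul_add, h1, h2, θ_comm s]

protected lemma mul_assoc' (a b c : Shuf L R) : a * b * c = a * (b * c) := by
  ext w
  induction w generalizing a b c with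
  | nil => simp [mul_assoc]
  | cons l w ih =>
    simp only [mul_cons, D_mul, θ_mul, Shuf.add_mul', Shuf.mul_add', ih, add_apply]
    abel

protected lemma const_mul' (r : R) (a : Shuf L R) : const r * a = r • a := by
  ext w
  induction w generalizing a with
  | nil => simp
  | cons l w ih =>
    have h0 : (0 : Shuf L R) * a = 0 := by
      have := Shuf.smul_mul' (0 : R) 0 a
      simpa using this
    simp [mul_cons, ih, h0]

protected lemma mul_const' (r : R) (a : Shuf L R) : a * const r = r • a := by
  ext w
  induction w generalizing a with
  | nil => simp [mul_comm]
  | cons l w ih =>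
    have h0 (b : Shuf L R) : b * (0 : Shuf L R) = 0 := by
      have := Shuf.mul_smul' (0 : R) b 0
      simpa using this
    simp [mul_cons, ih, h0]

instance : Ring (Shuf L R) :=
  { (inferInstance : AddCommGroup (Shuf L R)) with
    mul := (· * ·)
    one := 1
    left_distrib := Shuf.mul_add'
    right_distrib := Shuf.add_mul'
    zero_mul := fun a => by simpa using Shuf.smul_mul' (0 : R) 0 a
    mul_zero := fun a => by simpa using Shuf.mul_smul' (0 : R) a 0
    mul_assoc := Shuf.mul_assoc'
    one_mul := fun a => by rw [one_def, Shuf.const_mul', one_smul]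
    mul_one := fun a => by rw [one_def, Shuf.mul_const', one_smul] }

instance {S : Type*} [CommSemiring S] [Algebra S R] : Algebra S (Shuf L R) :=
  Algebra.ofModule Shuf.smul_mul' Shuf.mul_smul'

lemma const_mul (r : R) (a : Shuf L R) : const r * a = r • a := Shuf.const_mul' r a

lemma mul_const (r : R) (a : Shuf L R) : a * const r = r • a := Shuf.mul_const' r a

lemma algebraMap_eq {S : Type*} [CommSemiring S] [Algebra S R] (s : S) :
    algebraMap S (Shuf L R) s = const (algebraMap S R s) := by
  rw [Algebra.algebraMap_eq_smul_one, one_def]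
  ext w
  cases w <;> simp [Algebra.algebraMap_eq_smul_one]

/-- Functions of parity `s`: the even ones for `s = 1`, the odd ones for `s = -1`. -/
def IsPar (a : Shuf L R) (s : ℤˣ) : Prop := θ (-1) a = s • a

lemma IsPar.θ_pow {a : Shuf L R} {s : ℤˣ} (h : IsPar a s) (n : ℕ) :
    θ ((-1) ^ n) a = s ^ n • a := by
  rcases Nat.even_or_odd n with hn | hn
  · rw [hn.neg_one_pow, θ_one]
    have : s ^ n = 1 := by
      obtain ⟨k, rfl⟩ := hn
      rw [← two_mul, pow_mul, Int.units_sq, one_pow]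
    rw [this, one_smul]
  · rw [hn.neg_one_pow, h]
    obtain ⟨k, rfl⟩ := hn
    rw [pow_add, pow_mul, Int.units_sq, one_pow, one_mul, pow_one]

lemma IsPar.θ_sg {a : Shuf L R} {s : ℤˣ} (h : IsPar a s) (l : L) :
    θ (sg l) a = s ^ Weighted.wt l • a := h.θ_pow _

lemma IsPar.D {a : Shuf L R} {s : ℤˣ} (h : IsPar a s) (l : L) : IsPar (D l a) (s * sg l) := by
  have h1 := congrArg (Shuf.D l) h
  rw [D_θ, D_usmul] at h1
  unfold IsPar sg
  rw [mul_comm, mul_smul, ← h1, smul_smul, ← mul_pow]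
  simp

lemma IsPar.θ {a : Shuf L R} {s : ℤˣ} (h : IsPar a s) (t : ℤˣ) : IsPar (θ t a) s := by
  unfold IsPar at *
  rw [θ_comm, h, θ_usmul]

lemma IsPar.mul {a b : Shuf L R} {s t : ℤˣ} (h : IsPar a s) (h' : IsPar b t) :
    IsPar (a * b) (s * t) := by
  unfold IsPar at *
  rw [θ_mul, h, h', Shuf.usmul_mul, Shuf.mul_usmul, smul_smul]

/-- The shuffle product is commutative in the graded sense. -/
lemma IsPar.mul_comm {a : Shuf L R} {s : ℤˣ} (h : IsPar a s) (b : Shuf L R) :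
    a * b = Shuf.θ s b * a := by
  ext w
  induction w generalizing a b s with
  | nil => simp [_root_.mul_comm]
  | cons l w ih =>
    rw [mul_cons, mul_cons, ih (h.D l) b, ih (h.θ (sg l)) (Shuf.D l b), D_θ, Shuf.usmul_mul,
      h.θ_sg l, Shuf.mul_usmul, θ_θ, add_comm, _root_.mul_comm s (sg l)]

/-- Functions supported on the words of weight `k`. Negative weights are allowed, so that acting
by a letter always lowers the weight. -/
def Hom (a : Shuf L R) (k : ℤ) : Prop := ∀ w, (wtw w : ℤ) ≠ k → a w = 0

lemma Hom.D {a : Shuf L R} {k : ℤ} (h : Hom a k) (l : L) : Hom (D l a) (k - Weighted.wt l) := by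
  intro w hw
  apply h
  simp only [wtw_cons]
  push_cast
  omega

lemma Hom.θ {a : Shuf L R} {k : ℤ} (h : Hom a k) (s : ℤˣ) : Hom (θ s a) k := by
  intro w hw
  rw [θ_apply, h w hw, smul_zero]

lemma Hom.add {a b : Shuf L R} {k : ℤ} (h : Hom a k) (h' : Hom b k) : Hom (a + b) k := by
  intro w hw
  rw [add_apply, h w hw, h' w hw, add_zero]

lemma Hom.smul {S : Type*} [Semiring S] [Module S R] {a : Shuf L R} {k : ℤ} (h : Hom a k)
    (s : S) : Hom (s • a) k := by
  intro w hw
  rw [smul_apply, h w hw, smul_zero]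

lemma hom_zero (k : ℤ) : Hom (0 : Shuf L R) k := fun _ _ => rfl

lemma hom_const (r : R) : Hom (const r : Shuf L R) 0 := by
  intro w hw
  cases w with
  | nil => simp at hw
  | cons l w => rfl

lemma Hom.eq_zero_of_neg {a : Shuf L R} {k : ℤ} (h : Hom a k) (hk : k < 0) : a = 0 := by
  ext w
  exact h w (by omega)

lemma Hom.mul {a b : Shuf L R} {i j : ℤ} (h : Hom a i) (h' : Hom b j) : Hom (a * b) (i + j) := by
  intro w
  induction w generalizing a b i j with
  | nil =>
    intro hw
    rw [mul_nil]
    by_cases hi : i = 0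
    · rw [h' [] (by simp at hw ⊢; omega), mul_zero]
    · rw [h [] (by simp; omega), zero_mul]
  | cons l w ih =>
    intro hw
    simp only [wtw_cons] at hw
    push_cast at hw
    rw [mul_cons, ih (h.D l) h' (by omega), ih (h.θ _) (h'.D l) (by omega), add_zero]

lemma Hom.isPar {a : Shuf L R} {k : ℕ} (h : Hom a k) : IsPar a ((-1) ^ k) := by
  unfold IsPar
  ext w
  rw [θ_apply, usmul_apply]
  by_cases hw : (wtw w : ℤ) = k
  · rw [show wtw w = k by exact_mod_cast hw]
  · rw [h w hw, smul_zero, smul_zero]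

/-- The component of weight `k`. -/
def proj (k : ℤ) : Shuf L R →ₗ[R] Shuf L R where
  toFun a w := if (wtw w : ℤ) = k then a w else 0
  map_add' a b := by
    ext w
    change (if _ then a w + b w else 0) = (if _ then a w else 0) + (if _ then b w else 0)
    split_ifs <;> simp
  map_smul' r a := by
    ext w
    change (if _ then r * a w else 0) = r * (if _ then a w else 0)
    split_ifs <;> simp

lemma proj_apply (k : ℤ) (a : Shuf L R) (w : List L) :
    proj k a w = if (wtw w : ℤ) = k then a w else 0 := rfl

lemma hom_proj (k : ℤ) (a : Shuf L R) : Hom (proj k a) k := fun w hw => by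
  rw [proj_apply, if_neg hw]

lemma Hom.proj_eq {a : Shuf L R} {k : ℤ} (h : Hom a k) : proj k a = a := by
  ext w
  rw [proj_apply]
  split_ifs with hw
  · rfl
  · exact (h w hw).symm

lemma Hom.proj_ne {a : Shuf L R} {k j : ℤ} (h : Hom a k) (hj : j ≠ k) : proj j a = 0 := by
  ext w
  rw [proj_apply]
  split_ifs with hw
  · exact h w (by omega)
  · rfl

lemma D_proj (l : L) (k : ℤ) (a : Shuf L R) :
    D l (proj k a) = proj (k - Weighted.wt l) (D l a) := by
  ext w
  simp only [D_apply, proj_apply, wtw_cons]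
  push_cast
  congr 1
  exact propext ⟨fun h => by omega, fun h => by omega⟩

lemma Hom.proj_mul {a : Shuf L R} {i : ℤ} (h : Hom a i) (k : ℤ) (b : Shuf L R) :
    proj k (a * b) = a * proj (k - i) b := by
  ext w
  induction w generalizing a b i k with
  | nil =>
    simp only [proj_apply, mul_nil, wtw_nil, Nat.cast_zero]
    by_cases hi : i = 0
    · simp [hi]
    · rw [h [] (by simp; omega)]; simp
  | cons l w ih =>
    change Shuf.D l (proj k (a * b)) w = _
    rw [D_proj, D_mul, map_add, add_apply, ih (h.D l), ih (h.θ _), mul_cons, D_proj,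
      show k - Weighted.wt l - (i - Weighted.wt l) = k - i by ring, sub_right_comm k]

/-- Values may be extended along a ring homomorphism, for example a restriction. -/
def mapHom {R' : Type*} [CommRing R'] (φ : R →+* R') (a : Shuf L R) : Shuf L R' := fun w => φ (a w)

section mapHom

variable {R' : Type*} [CommRing R'] (φ : R →+* R')

@[simp] lemma mapHom_apply (a : Shuf L R) (w : List L) : mapHom φ a w = φ (a w) := rfl

lemma mapHom_D (l : L) (a : Shuf L R) : mapHom φ (D l a) = D l (mapHom φ a) := rfl

lemma mapHom_usmul (s : ℤˣ) (a : Shuf L R) : mapHom φ (s • a) = s • mapHom φ a := by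
  ext w
  rcases Int.units_eq_one_or s with rfl | rfl <;> simp

lemma mapHom_θ (s : ℤˣ) (a : Shuf L R) : mapHom φ (θ s a) = θ s (mapHom φ a) := by
  ext w
  exact congrFun (mapHom_usmul φ (s ^ wtw w) a) w

lemma mapHom_add (a b : Shuf L R) : mapHom φ (a + b) = mapHom φ a + mapHom φ b := by
  ext w; simp

lemma mapHom_smul (r : R) (a : Shuf L R) : mapHom φ (r • a) = φ r • mapHom φ a := by
  ext w; simp

lemma mapHom_mul (a b : Shuf L R) : mapHom φ (a * b) = mapHom φ a * mapHom φ b := by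
  ext w
  induction w generalizing a b with
  | nil => simp
  | cons l w ih =>
    have h1 := ih (D l a) b
    have h2 := ih (θ (sg l) a) (D l b)
    rw [mapHom_apply] at h1 h2
    rw [mapHom_apply, mul_cons, map_add, h1, h2, mul_cons, mapHom_θ, mapHom_D, mapHom_D]

lemma mapHom_const (r : R) : mapHom φ (const r : Shuf L R) = const (φ r) := by
  ext w; cases w <;> simp

lemma mapHom_proj (k : ℤ) (a : Shuf L R) : mapHom φ (proj k a) = proj k (mapHom φ a) := by
  ext w
  simp only [mapHom_apply, proj_apply]
  split_ifs <;> simp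

lemma Hom.mapHom {a : Shuf L R} {k : ℤ} (h : Hom a k) : Hom (mapHom φ a) k := fun w hw => by
  rw [mapHom_apply, h w hw, map_zero]

end mapHom

/-! ### Brackets defined by recursion on words -/

/-- The value at a word of the bracket with the given weight-zero part `B`, determined by the
requirement that letters act by derivations of the bracket. -/
def brAux (B : Shuf L R → Shuf L R → R) : List L → Shuf L R → Shuf L R → R
  | [], a, b => B a b
  | l :: w, a, b => brAux B w (D l a) b + brAux B w (θ (sg l) a) (D l b)

/-- The bracket with weight-zero part `B` of which the letters are derivations. -/
def br (B : Shuf L R → Shuf L R → R) (a b : Shuf L R) : Shuf L R := fun w => brAux B w a b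

variable {B : Shuf L R → Shuf L R → R}

@[simp] lemma br_nil (a b : Shuf L R) : br B a b [] = B a b := rfl

lemma br_cons (a b : Shuf L R) (l : L) (w : List L) :
    br B a b (l :: w) = br B (D l a) b w + br B (θ (sg l) a) (D l b) w := rfl

/-- A family of functions that is stable under letters and under the parity automorphism. -/
structure Stable (A : Set (Shuf L R)) : Prop where
  D_mem : ∀ (l : L), ∀ a ∈ A, D l a ∈ A
  θ_mem : ∀ (s : ℤˣ), ∀ a ∈ A, θ s a ∈ A

variable {A : Set (Shuf L R)}

lemma br_add_left (hA : Stable A)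
    (hB : ∀ a ∈ A, ∀ b ∈ A, ∀ c ∈ A, B (a + b) c = B a c + B b c) {a b c : Shuf L R}
    (ha : a ∈ A) (hb : b ∈ A) (hc : c ∈ A) : br B (a + b) c = br B a c + br B b c := by
  ext w
  induction w generalizing a b c with
  | nil => exact hB a ha b hb c hc
  | cons l w ih =>
    have h1 := ih (hA.D_mem l a ha) (hA.D_mem l b hb) hc
    have h2 := ih (hA.θ_mem (sg l) a ha) (hA.θ_mem (sg l) b hb) (hA.D_mem l c hc)
    rw [add_apply] at h1 h2
    rw [br_cons, map_add, map_add, h1, h2, add_apply, br_cons, br_cons]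
    abel

lemma br_add_right (hA : Stable A)
    (hB : ∀ a ∈ A, ∀ b ∈ A, ∀ c ∈ A, B a (b + c) = B a b + B a c) {a b c : Shuf L R}
    (ha : a ∈ A) (hb : b ∈ A) (hc : c ∈ A) : br B a (b + c) = br B a b + br B a c := by
  ext w
  induction w generalizing a b c with
  | nil => exact hB a ha b hb c hc
  | cons l w ih =>
    have h1 := ih (hA.D_mem l a ha) hb hc
    have h2 := ih (hA.θ_mem (sg l) a ha) (hA.D_mem l b hb) (hA.D_mem l c hc)
    rw [add_apply] at h1 h2
    rw [br_cons, map_add, h1, h2, add_apply, br_cons, br_cons]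
    abel

lemma br_smul_left {S : Type*} [CommSemiring S] [Algebra S R] (hA : Stable A)
    (hB : ∀ (s : S), ∀ a ∈ A, ∀ b ∈ A, B (s • a) b = s • B a b) (s : S) {a b : Shuf L R}
    (ha : a ∈ A) (hb : b ∈ A) : br B (s • a) b = s • br B a b := by
  ext w
  induction w generalizing a b with
  | nil => exact hB s a ha b hb
  | cons l w ih =>
    rw [br_cons, D_smul', θ_smul', ih (hA.D_mem l a ha) hb,
      ih (hA.θ_mem (sg l) a ha) (hA.D_mem l b hb), smul_apply, smul_apply, smul_apply, br_cons,
      smul_add]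

lemma br_smul_right {S : Type*} [CommSemiring S] [Algebra S R] (hA : Stable A)
    (hB : ∀ (s : S), ∀ a ∈ A, ∀ b ∈ A, B a (s • b) = s • B a b) (s : S) {a b : Shuf L R}
    (ha : a ∈ A) (hb : b ∈ A) : br B a (s • b) = s • br B a b := by
  ext w
  induction w generalizing a b with
  | nil => exact hB s a ha b hb
  | cons l w ih =>
    rw [br_cons, D_smul', ih (hA.D_mem l a ha) hb,
      ih (hA.θ_mem (sg l) a ha) (hA.D_mem l b hb), smul_apply, smul_apply, smul_apply, br_cons,
      smul_add]

lemma Hom.br {i j : ℤ} (hB : ∀ (a b : Shuf L R) (i j : ℤ), Hom a i → Hom b j → i + j ≠ 2 → B a b = 0)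
    {a b : Shuf L R} (h : Hom a i) (h' : Hom b j) : Hom (br B a b) (i + j - 2) := by
  intro w
  induction w generalizing a b i j with
  | nil =>
    intro hw
    simp only [wtw_nil, Nat.cast_zero] at hw
    exact hB a b i j h h' (by omega)
  | cons l w ih =>
    intro hw
    simp only [wtw_cons] at hw
    push_cast at hw
    rw [br_cons, ih (h.D l) h' (by omega), ih (h.θ _) (h'.D l) (by omega), add_zero]

lemma mapHom_br {R' : Type*} [CommRing R'] (φ : R →+* R') {B' : Shuf L R' → Shuf L R' → R'}
    (hA : Stable A) (hB : ∀ a ∈ A, ∀ b ∈ A, φ (B a b) = B' (mapHom φ a) (mapHom φ b))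
    {a b : Shuf L R} (ha : a ∈ A) (hb : b ∈ A) :
    mapHom φ (br B a b) = br B' (mapHom φ a) (mapHom φ b) := by
  ext w
  induction w generalizing a b with
  | nil => exact hB a ha b hb
  | cons l w ih =>
    have h1 := ih (hA.D_mem l a ha) hb
    have h2 := ih (hA.θ_mem (sg l) a ha) (hA.D_mem l b hb)
    rw [mapHom_apply] at h1 h2
    rw [mapHom_apply, br_cons, map_add, h1, h2, br_cons, mapHom_D, mapHom_D, mapHom_θ]

end Shuf

end PreCourant

end

/-! ### Smooth functions and derivations at a point -/

noncomputable section

namespace PreCourant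

open Filter Topology

/-- Hadamard's lemma. -/
lemma hadamard {d : ℕ} {f : EuclideanSpace ℝ (Fin d) → ℝ} (hf : ContDiff ℝ ∞ f)
    (p : EuclideanSpace ℝ (Fin d)) :
    ∃ h : Fin d → EuclideanSpace ℝ (Fin d) → ℝ, (∀ i, ContDiff ℝ ∞ (h i)) ∧
      ∀ y, f y = f p + ∑ i, (y i - p i) * h i y := by
  -- The integral over `[0, 1]` is written as a convolution, whose smoothness in the parameter
  -- is known; the cutoff `χ` provides the compact support that this requires.
  let χ : ContDiffBump (0 : ℝ) := ⟨2, 3, by norm_num, by norm_num⟩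
  let g : Fin d → EuclideanSpace ℝ (Fin d) → ℝ → ℝ := fun i y t =>
    χ t * fderiv ℝ f (p + (-t) • (y - p)) (EuclideanSpace.single i 1)
  let I : ℝ → ℝ := Set.indicator (Set.Ioc 0 1) (fun _ => 1)
  have hI : MeasureTheory.LocallyIntegrable I := by
    apply MeasureTheory.Integrable.locallyIntegrable
    exact (MeasureTheory.integrable_indicator_iff measurableSet_Ioc).2
      (MeasureTheory.integrableOn_const (by simp))
  let L := ContinuousLinearMap.mul ℝ ℝ
  let h : Fin d → EuclideanSpace ℝ (Fin d) → ℝ := fun i y =>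
    MeasureTheory.convolution I (g i y) L MeasureTheory.volume (0 : ℝ)
  have hfd : ContDiff ℝ ∞ (fderiv ℝ f) := hf.fderiv_right (by simp)
  refine ⟨h, fun i => ?_, fun y => ?_⟩
  · have hg : ContDiff ℝ ∞ ↿(g i) := by
      have h1 : ContDiff ℝ ∞ fun q : EuclideanSpace ℝ (Fin d) × ℝ => χ q.2 :=
        χ.contDiff.comp contDiff_snd
      have h2 : ContDiff ℝ ∞ fun q : EuclideanSpace ℝ (Fin d) × ℝ =>
          p + (-q.2) • (q.1 - p) := by fun_prop
      exact h1.mul ((hfd.comp h2).clm_apply contDiff_const)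
    have := MeasureTheory.contDiffOn_convolution_right_with_param_comp (𝕜 := ℝ) (n := ⊤)
      (μ := MeasureTheory.volume) L (s := Set.univ)
      (v := fun _ : EuclideanSpace ℝ (Fin d) => (0 : ℝ)) contDiffOn_const (f := I) (g := g i)
      (k := Metric.closedBall 0 3) isOpen_univ (isCompact_closedBall _ _) ?_ hI hg.contDiffOn
    · exact contDiffOn_univ.1 this
    · intro y t _ ht
      have : χ t = 0 := χ.zero_of_le_dist (by
        simp only [Metric.mem_closedBall, not_le] at ht
        exact ht.le)
      simp [g, this]
  · have hh : ∀ i, h i y = ∫ t in (0 : ℝ)..1,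
        fderiv ℝ f (p + t • (y - p)) (EuclideanSpace.single i 1) := by
      intro i
      rw [intervalIntegral.integral_of_le zero_le_one,
        ← MeasureTheory.integral_indicator measurableSet_Ioc]
      change ∫ t, L (I t) (g i y (0 - t)) = _
      congr 1
      ext t
      by_cases ht : t ∈ Set.Ioc (0 : ℝ) 1
      · have : χ (-t) = 1 := χ.one_of_mem_closedBall (by
          simp only [Metric.mem_closedBall, dist_zero_right, norm_neg, Real.norm_eq_abs]
          rw [abs_of_pos ht.1]
          exact ht.2.trans one_le_two)
        simp [L, I, g, ht, this]
      · simp [L, I, g, ht]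
    have hcont : ∀ i, Continuous fun t : ℝ =>
        fderiv ℝ f (p + t • (y - p)) (EuclideanSpace.single i 1) := by
      intro i
      have h2 : Continuous fun t : ℝ => p + t • (y - p) := by fun_prop
      exact (hfd.continuous.comp h2).clm_apply continuous_const
    have hder : ∀ t : ℝ, HasDerivAt (fun t : ℝ => f (p + t • (y - p)))
        (∑ i, (y i - p i) * fderiv ℝ f (p + t • (y - p)) (EuclideanSpace.single i 1)) t := by
      intro t
      have h1 : HasDerivAt (fun t : ℝ => p + t • (y - p)) (y - p) t := by
        simpa using ((hasDerivAt_id t).smul_const (y - p)).const_add p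
      have h2 := ((hf.differentiable (by simp)) (p + t • (y - p))).hasFDerivAt.comp_hasDerivAt t h1
      refine HasDerivAt.congr_deriv (f := fun t : ℝ => f (p + t • (y - p))) h2 ?_
      have hsum : y - p = ∑ i, (y i - p i) • EuclideanSpace.single i (1 : ℝ) := by
        ext j; simp [PiLp.sub_apply, Finset.sum_apply, Pi.single_apply]
      refine (congrArg (fderiv ℝ f (p + t • (y - p))) hsum).trans ?_
      rw [map_sum]
      simp only [map_smul, smul_eq_mul]
    have hftc := intervalIntegral.integral_eq_sub_of_hasDerivAt (a := 0) (b := 1)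
      (fun t _ => hder t) (Continuous.intervalIntegrable
        (continuous_finsetSum _ fun i _ => continuous_const.mul (hcont i)) 0 1)
    rw [intervalIntegral.integral_finsetSum (f := fun i t => (y i - p i) *
        fderiv ℝ f (p + t • (y - p)) (EuclideanSpace.single i 1))
      fun i _ => (continuous_const.mul (hcont i)).intervalIntegrable 0 1] at hftc
    simp only [intervalIntegral.integral_const_mul, ← hh] at hftc
    rw [hftc]
    simp

variable {d : ℕ} {M : Type u} [TopologicalSpace M] [ChartedSpace (EuclideanSpace ℝ (Fin d)) M]

lemma Fn.ext {f g : Fn d M} (h : ∀ x, f x = g x) : f = g := ContMDiffMap.ext h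

/-- Extension of a function by zero. -/
def extZero {U : Opens M} (f : U → ℝ) (y : M) : ℝ := by
  classical exact if h : y ∈ U then f ⟨y, h⟩ else 0

lemma extZero_of_mem {U : Opens M} (f : U → ℝ) {y : M} (h : y ∈ U) : extZero f y = f ⟨y, h⟩ := by
  simp [extZero, h]

lemma Fn.sum_apply {ι : Type*} (s : Finset ι) (f : ι → Fn d M) (x : M) :
    (∑ i ∈ s, f i) x = ∑ i ∈ s, f i x := by
  classical
  induction s using Finset.induction_on with
  | empty => rfl
  | insert i s hi ih => rw [Finset.sum_insert hi, Finset.sum_insert hi, ← ih]; rfl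

section Bump

variable [T2Space M] [IsManifold (𝓡 d) ∞ M]

/-- Cutoff functions. -/
lemma exists_bump {U : Set M} (hU : IsOpen U) {x : M} (hx : x ∈ U) :
    ∃ χ : Fn d M, (∀ᶠ y in 𝓝 x, χ y = 1) ∧ tsupport χ ⊆ U := by
  obtain ⟨χ, -, hχ⟩ := (SmoothBumpFunction.nhds_basis_tsupport (I := 𝓡 d) x).mem_iff.1
    (hU.mem_nhds hx)
  exact ⟨⟨χ, χ.contMDiff⟩, χ.eventuallyEq_one, hχ⟩

/-- A function that is smooth around a point agrees there with a global smooth function. -/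
lemma exists_fn_eventuallyEq {U : Set M} (hU : IsOpen U) {x : M} (hx : x ∈ U) {f : M → ℝ}
    (hf : ContMDiffOn (𝓡 d) 𝓘(ℝ, ℝ) ∞ f U) : ∃ g : Fn d M, ∀ᶠ y in 𝓝 x, g y = f y := by
  obtain ⟨χ, h1, h2⟩ := exists_bump (d := d) hU hx
  refine ⟨⟨fun y => χ y * f y, ?_⟩, ?_⟩
  · apply contMDiff_of_tsupport
    intro y hy
    have hyU : y ∈ U := h2 (closure_mono (Function.support_mul_subset_left _ _) hy)
    exact χ.contMDiff.contMDiffAt.mul (hf.contMDiffAt (hU.mem_nhds hyU))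
  · filter_upwards [h1] with y hy
    change χ y * f y = f y
    rw [hy, one_mul]

/-- A function on an open set that is smooth extends to `M` around every point. -/
lemma exists_fn_germ {U : Opens M} {f : U → ℝ} (hf : ContMDiff (𝓡 d) 𝓘(ℝ, ℝ) ∞ f) (x : U) :
    ∃ g : Fn d M, ∀ᶠ y in 𝓝 x.1, ∀ h : y ∈ U, g y = f ⟨y, h⟩ := by
  have h1 : ContMDiffOn (𝓡 d) 𝓘(ℝ, ℝ) ∞ (extZero f) (U : Set M) := fun y hy =>
    ((contMDiffAt_subtype_iff (f := extZero f) (x := ⟨y, hy⟩)).1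
      ((hf.contMDiffAt (x := ⟨y, hy⟩)).congr_of_eventuallyEq (Eventually.of_forall fun z =>
        extZero_of_mem f z.2))).contMDiffWithinAt
  obtain ⟨g, hg⟩ := exists_fn_eventuallyEq (d := d) U.isOpen x.2 h1
  exact ⟨g, hg.mono fun y hy h => by rw [hy, extZero_of_mem f h]⟩

end Bump

/-- Derivations at a point, as real-valued functions of smooth functions. -/
structure IsDer (x : M) (δ : Fn d M → ℝ) : Prop where
  add : ∀ f g, δ (f + g) = δ f + δ g
  mul : ∀ f g, δ (f * g) = f x * δ g + g x * δ f
  const : ∀ c : ℝ, δ (algebraMap ℝ (Fn d M) c) = 0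

lemma mvfderiv_congr {f g : M → ℝ} {x : M} (h : f =ᶠ[𝓝 x] g) (v : TangentSpace (𝓡 d) x) :
    mvfderiv (𝓡 d) f x v = mvfderiv (𝓡 d) g x v := by
  change (mfderiv (𝓡 d) 𝓘(ℝ, ℝ) f x v : ℝ) = mfderiv (𝓡 d) 𝓘(ℝ, ℝ) g x v
  exact congrArg (fun L : EuclideanSpace ℝ (Fin d) →L[ℝ] ℝ => L v) h.mfderiv_eq

lemma Fn.mdifferentiableAt (f : Fn d M) (x : M) : MDifferentiableAt (𝓡 d) 𝓘(ℝ, ℝ) f x :=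
  f.contMDiff.contMDiffAt.mdifferentiableAt (by simp)

lemma isDer_mvfderiv (x : M) (v : TangentSpace (𝓡 d) x) :
    IsDer x fun f : Fn d M => mvfderiv (𝓡 d) f x v where
  add f g := by
    have := mvfderiv_add (f.mdifferentiableAt x) (g.mdifferentiableAt x)
    exact congrArg (fun L => L v) this
  mul f g := by
    have := mvfderiv_mul (f.mdifferentiableAt x) (g.mdifferentiableAt x)
    exact congrArg (fun L => L v) this
  const c := by
    have := mvfderiv_const (I := 𝓡 d) (M := M) c (x := x)
    exact congrArg (fun L => L v) this

namespace IsDer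

variable {x : M} {δ δ' : Fn d M → ℝ}

lemma zero (h : IsDer x δ) : δ 0 = 0 := by
  have := h.add 0 0
  rw [add_zero] at this
  linarith

lemma neg (h : IsDer x δ) (f : Fn d M) : δ (-f) = -δ f := by
  have := h.add f (-f)
  rw [add_neg_cancel, h.zero] at this
  linarith

lemma sum (h : IsDer x δ) {ι : Type*} (s : Finset ι) (f : ι → Fn d M) :
    δ (∑ i ∈ s, f i) = ∑ i ∈ s, δ (f i) := by
  classical
  induction s using Finset.induction_on with
  | empty => simp [h.zero]
  | insert i s hi ih => rw [Finset.sum_insert hi, Finset.sum_insert hi, h.add, ih]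

variable [T2Space M] [IsManifold (𝓡 d) ∞ M]

lemma congr (h : IsDer x δ) {f g : Fn d M} (hfg : ∀ᶠ y in 𝓝 x, f y = g y) : δ f = δ g := by
  obtain ⟨U, hU, hUo, hx⟩ := eventually_nhds_iff.1 hfg
  obtain ⟨χ, h1, h2⟩ := exists_bump (d := d) hUo hx
  have h3 : χ * (f - g) = 0 := by
    apply Fn.ext
    intro y
    change χ y * (f y - g y) = 0
    by_cases hy : y ∈ U
    · rw [hU y hy, sub_self, mul_zero]
    · rw [image_eq_zero_of_notMem_tsupport fun h => hy (h2 h), zero_mul]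
  have h4 := h.mul χ (f - g)
  have h5 : (f - g) x = 0 := by
    change f x - g x = 0
    rw [hU x hx, sub_self]
  rw [h3, h.zero, h1.self_of_nhds, h5, sub_eq_add_neg, h.add, h.neg] at h4
  linarith

end IsDer

section Coordinates

variable [T2Space M] [IsManifold (𝓡 d) ∞ M]

/-- The coordinates of a chart extend to global functions around every point. -/
lemma exists_coord (m : M) {x : M} (hx : x ∈ (chartAt (EuclideanSpace ℝ (Fin d)) m).source) :
    ∃ X : Fin d → Fn d M, ∀ i, ∀ᶠ y in 𝓝 x,
      X i y = chartAt (EuclideanSpace ℝ (Fin d)) m y i := by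
  have h : ∀ i, ContMDiffOn (𝓡 d) 𝓘(ℝ, ℝ) ∞
      (fun y => chartAt (EuclideanSpace ℝ (Fin d)) m y i)
      (chartAt (EuclideanSpace ℝ (Fin d)) m).source := by
    intro i
    have h1 : ContMDiffOn (𝓡 d) (𝓡 d) ∞ (chartAt (EuclideanSpace ℝ (Fin d)) m)
      (chartAt (EuclideanSpace ℝ (Fin d)) m).source := contMDiffOn_chart
    have h2 : ContMDiff (𝓡 d) 𝓘(ℝ, ℝ) ∞ (fun z : EuclideanSpace ℝ (Fin d) => z i) := by
      rw [contMDiff_iff_contDiff]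
      fun_prop
    exact h2.comp_contMDiffOn h1
  choose X hX using fun i => exists_fn_eventuallyEq (d := d)
    (chartAt (EuclideanSpace ℝ (Fin d)) m).open_source hx (h i)
  exact ⟨X, hX⟩

/-- Around a point, a smooth function is a combination of the coordinates. -/
lemma exists_taylor (m : M) {x : M} (hx : x ∈ (chartAt (EuclideanSpace ℝ (Fin d)) m).source)
    {X : Fin d → Fn d M} (hX : ∀ i, ∀ᶠ y in 𝓝 x,
      X i y = chartAt (EuclideanSpace ℝ (Fin d)) m y i) (f : Fn d M) :
    ∃ H : Fin d → Fn d M, ∀ᶠ y in 𝓝 x, f y = f x + ∑ i, (X i y - X i x) * H i y := by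
  set e := chartAt (EuclideanSpace ℝ (Fin d)) m with he
  have hsymm : ContMDiffOn (𝓡 d) (𝓡 d) ∞ e.symm e.target := contMDiffOn_chart_symm
  have h1 : ContMDiffOn (𝓡 d) 𝓘(ℝ, ℝ) ∞ (f ∘ e.symm) e.target :=
    f.contMDiff.comp_contMDiffOn hsymm
  obtain ⟨F, hF⟩ := exists_fn_eventuallyEq (d := d) e.open_target (e.map_source hx) h1
  obtain ⟨h, hh, hFh⟩ := hadamard (contMDiff_iff_contDiff.1 F.contMDiff) (e x)
  have h2 : ∀ i, ContMDiffOn (𝓡 d) 𝓘(ℝ, ℝ) ∞ (fun y => h i (e y)) e.source := fun i =>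
    (contMDiff_iff_contDiff.2 (hh i)).comp_contMDiffOn contMDiffOn_chart
  choose H hH using fun i => exists_fn_eventuallyEq (d := d) e.open_source hx (h2 i)
  refine ⟨H, ?_⟩
  filter_upwards [(e.continuousAt hx).eventually hF, e.open_source.mem_nhds hx,
    eventually_all.2 hX, eventually_all.2 hH] with y h3 h4 h5 h6
  have h7 := hF.self_of_nhds
  simp only [Function.comp_apply, e.left_inv h4, e.left_inv hx] at h3 h7
  rw [← h3, hFh, h7]
  congr 1
  refine Finset.sum_congr rfl fun i _ => ?_
  rw [h5, h6, (hX i).self_of_nhds]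

/-- A derivation at a point is determined by its values on the coordinates. -/
lemma IsDer.ext_coord (m : M) {x : M}
    (hx : x ∈ (chartAt (EuclideanSpace ℝ (Fin d)) m).source)
    {X : Fin d → Fn d M} (hX : ∀ i, ∀ᶠ y in 𝓝 x,
      X i y = chartAt (EuclideanSpace ℝ (Fin d)) m y i) {δ δ' : Fn d M → ℝ}
    (h : IsDer x δ) (h' : IsDer x δ') (hδ : ∀ i, δ (X i) = δ' (X i)) (f : Fn d M) :
    δ f = δ' f := by
  obtain ⟨H, hH⟩ := exists_taylor m hx hX f
  have key : ∀ {δ : Fn d M → ℝ}, IsDer x δ → δ f = ∑ i, H i x * δ (X i) := by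
    intro δ h
    have h1 : ∀ᶠ y in 𝓝 x, f y = (algebraMap ℝ (Fn d M) (f x) +
        ∑ i, (X i + algebraMap ℝ (Fn d M) (-X i x)) * H i) y := by
      filter_upwards [hH] with y hy
      rw [hy, ContMDiffMap.coe_add, Pi.add_apply, Fn.sum_apply]
      rfl
    rw [h.congr h1, h.add, h.const, zero_add, h.sum]
    refine Finset.sum_congr rfl fun i _ => ?_
    rw [h.mul, h.add, h.const, add_zero]
    have : (X i + algebraMap ℝ (Fn d M) (-X i x)) x = 0 := by
      change X i x + -X i x = 0
      ring
    rw [this, zero_mul, zero_add]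
  rw [key h, key h']
  exact Finset.sum_congr rfl fun i _ => by rw [hδ]

lemma mvfderiv_coord {x : M} {X : Fin d → Fn d M} (hX : ∀ i, ∀ᶠ y in 𝓝 x,
      X i y = chartAt (EuclideanSpace ℝ (Fin d)) x y i) (v : TangentSpace (𝓡 d) x) (i : Fin d) :
    mvfderiv (𝓡 d) (X i) x v = (show EuclideanSpace ℝ (Fin d) from v) i := by
  rw [((X i).mdifferentiableAt x).mvfderiv]
  have h1 : writtenInExtChartAt (𝓡 d) 𝓘(ℝ, ℝ) x (X i) =ᶠ[𝓝 (extChartAt (𝓡 d) x x)]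
      fun y : EuclideanSpace ℝ (Fin d) => y i := by
    have h2 : ContinuousAt (extChartAt (𝓡 d) x).symm (extChartAt (𝓡 d) x x) :=
      continuousAt_extChartAt_symm x
    have h3 := hX i
    rw [← extChartAt_to_inv (I := 𝓡 d) x] at h3
    filter_upwards [h2.eventually h3, extChartAt_target_mem_nhds (I := 𝓡 d) x] with y hy hy'
    simp only [writtenInExtChartAt, extChartAt_model_space_eq_id, Function.comp_apply,
      PartialEquiv.refl_coe, id_eq]
    rw [hy]
    have := (extChartAt (𝓡 d) x).right_inv hy'
    simp only [extChartAt_to_inv]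
    exact congrArg (fun z : EuclideanSpace ℝ (Fin d) => z i) this
  simp only [modelWithCornersSelf_coe, Set.range_id, fderivWithin_univ]
  rw [h1.fderiv_eq]
  exact congrArg (fun L : EuclideanSpace ℝ (Fin d) →L[ℝ] ℝ => L v)
    (EuclideanSpace.proj i : EuclideanSpace ℝ (Fin d) →L[ℝ] ℝ).fderiv

/-- Derivations at a point are tangent vectors. -/
lemma IsDer.exists_vec {x : M} {δ : Fn d M → ℝ} (h : IsDer x δ) :
    ∃ v : TangentSpace (𝓡 d) x, ∀ f : Fn d M, mvfderiv (𝓡 d) f x v = δ f := by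
  obtain ⟨X, hX⟩ := exists_coord x (mem_chart_source (EuclideanSpace ℝ (Fin d)) x)
  refine ⟨(WithLp.toLp 2 fun i => δ (X i) : EuclideanSpace ℝ (Fin d)), fun f => ?_⟩
  refine (isDer_mvfderiv x _).ext_coord x (mem_chart_source _ x) hX h (fun i => ?_) f
  exact mvfderiv_coord hX _ i

/-- Tangent vectors are separated by the differentials of functions. -/
lemma tangent_ext {x : M} {v w : TangentSpace (𝓡 d) x}
    (h : ∀ f : Fn d M, mvfderiv (𝓡 d) f x v = mvfderiv (𝓡 d) f x w) : v = w := by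
  obtain ⟨X, hX⟩ := exists_coord x (mem_chart_source (EuclideanSpace ℝ (Fin d)) x)
  have : (show EuclideanSpace ℝ (Fin d) from v) = (show EuclideanSpace ℝ (Fin d) from w) := by
    ext i
    rw [← mvfderiv_coord hX, ← mvfderiv_coord hX, h]
  exact this

/-- Every covector is the differential of a global function. -/
lemma exists_differential {x : M} (l : TangentSpace (𝓡 d) x →ₗ[ℝ] ℝ) :
    ∃ f : Fn d M, ∀ v, mvfderiv (𝓡 d) f x v = l v := by
  obtain ⟨X, hX⟩ := exists_coord x (mem_chart_source (EuclideanSpace ℝ (Fin d)) x)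
  let l' : EuclideanSpace ℝ (Fin d) →ₗ[ℝ] ℝ := l
  refine ⟨∑ i, algebraMap ℝ (Fn d M) (l' (EuclideanSpace.single i 1)) * X i, fun v => ?_⟩
  have h := isDer_mvfderiv (d := d) x v
  have h1 := h.sum Finset.univ
    fun i => algebraMap ℝ (Fn d M) (l' (EuclideanSpace.single i 1)) * X i
  refine h1.trans ?_
  have h2 : (show EuclideanSpace ℝ (Fin d) from v) =
      ∑ i, (show EuclideanSpace ℝ (Fin d) from v) i • EuclideanSpace.single i (1 : ℝ) := by
    ext j; simp [Finset.sum_apply, Pi.single_apply]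
  change _ = l' v
  refine Eq.trans ?_ (congrArg l' h2).symm
  rw [map_sum]
  refine Finset.sum_congr rfl fun i _ => ?_
  rw [h.mul, h.const, mvfderiv_coord hX, map_smul, smul_eq_mul, mul_zero, add_zero, mul_comm]
  rfl

end Coordinates

end PreCourant

end

/-! ### Sections and frames of vector bundles -/

noncomputable section

namespace PreCourant

open Filter Topology

variable {d : ℕ} {M : Type u} [TopologicalSpace M] [ChartedSpace (EuclideanSpace ℝ (Fin d)) M]

namespace VBundle

variable {E : VBundle d M}

/-- The product of a smooth function and a smooth section. -/
def smulSec (f : Fn d M) (e : E.Sec) : E.Sec :=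
  ⟨fun x => f x • e x, f.contMDiff.smul_section e.contMDiff⟩

@[simp] lemma smulSec_apply (f : Fn d M) (e : E.Sec) (x : M) : smulSec f e x = f x • e x := rfl

lemma Sec.ext {s t : E.Sec} (h : ∀ x, s x = t x) : s = t := ContMDiffSection.ext h

lemma sec_add_apply (s t : E.Sec) (x : M) : (s + t) x = s x + t x := rfl

lemma sec_sum_apply {ι : Type*} (s : Finset ι) (f : ι → E.Sec) (x : M) :
    (∑ i ∈ s, f i) x = ∑ i ∈ s, f i x := by
  classical
  induction s using Finset.induction_on with
  | empty => rfl
  | insert i s hi ih => rw [Finset.sum_insert hi, Finset.sum_insert hi, ← ih]; rfl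

/-- A section that agrees around every point with a smooth section is smooth. -/
def secOfGerm (s : ∀ x, E.fib x) (h : ∀ x, ∃ t : E.Sec, ∀ᶠ y in 𝓝 x, s y = t y) : E.Sec :=
  ⟨s, fun x => by
    obtain ⟨t, ht⟩ := h x
    refine (t.contMDiff x).congr_of_eventuallyEq ?_
    filter_upwards [ht] with y hy
    rw [hy]⟩

variable (E) in
/-- A local frame by global sections, together with its coefficient functionals. -/
structure Frame (V : Opens M) where
  e : Fin E.rank → E.Sec
  /-- The coefficients of a vector, which are meaningful over `V` only. -/
  c : Fin E.rank → ∀ x, E.fib x →ₗ[ℝ] ℝ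
  sum_eq : ∀ x ∈ V, ∀ v : E.fib x, ∑ i, c i x v • e i x = v
  c_e : ∀ x ∈ V, ∀ i j, c i x (e j x) = if i = j then 1 else 0
  smooth : ∀ (s : E.Sec) (i : Fin E.rank),
    ContMDiffOn (𝓡 d) 𝓘(ℝ, ℝ) ∞ (fun x => c i x (s x)) V

variable [T2Space M] [IsManifold (𝓡 d) ∞ M]

variable (E) in
lemma exists_frame (x : M) : ∃ V : Opens M, x ∈ V ∧ Nonempty (E.Frame V) := by
  have : ContMDiffVectorBundle 1 (Fin E.rank → ℝ) E.fib (𝓡 d) :=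
    ContMDiffVectorBundle.of_le (n := ∞) (by simp)
  let t := trivializationAt (Fin E.rank → ℝ) E.fib x
  let b := Pi.basisFun ℝ (Fin E.rank)
  have hx : x ∈ t.baseSet := FiberBundle.mem_baseSet_trivializationAt' x
  obtain ⟨χ, h1, h2⟩ := exists_bump (d := d) t.open_baseSet hx
  obtain ⟨W, hW, hWo, hxW⟩ := eventually_nhds_iff.1 h1
  let V : Opens M := ⟨W ∩ t.baseSet, hWo.inter t.open_baseSet⟩
  have hfr := t.isLocalFrameOn_localFrame_baseSet (𝓡 d) ∞ b
  have he : ∀ i, ∀ y ∈ V, χ y • t.localFrame b i y = t.localFrame b i y := fun i y hy => by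
    rw [hW y hy.1, one_smul]
  refine ⟨V, ⟨hxW, hx⟩, ⟨{
    e := fun i => ⟨fun y => χ y • t.localFrame b i y, ?_⟩
    c := fun i y => t.localFrameCoeff (𝓡 d) b i y
    sum_eq := ?_
    c_e := ?_
    smooth := ?_ }⟩⟩
  · have := ContMDiffOn.smul_section_of_tsupport (I := 𝓡 d) (n := ∞) (F := Fin E.rank → ℝ)
      (V := E.fib) (ψ := χ) (u := t.baseSet) (s := t.localFrame b i)
      χ.contMDiff.contMDiffOn t.open_baseSet h2 (hfr.contMDiffOn i)
    exact this
  · intro y hy v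
    have h3 := t.eq_sum_localFrameCoeff_smul (I := 𝓡 d) (b := b)
      (s := FiberBundle.extend (Fin E.rank → ℝ) v) hy.2
    simp only [FiberBundle.extend_apply_self] at h3
    refine Eq.trans (Finset.sum_congr rfl fun i _ => ?_) h3.symm
    change _ • (χ y • t.localFrame b i y) = _
    rw [he i y hy]
  · intro y hy i j
    change t.localFrameCoeff (𝓡 d) b i y (χ y • t.localFrame b j y) = _
    rw [he j y hy, t.localFrameCoeff_apply_of_mem_baseSet b hy.2,
      t.localFrame_apply_of_mem_baseSet b hy.2]
    simp [Finsupp.single_apply, eq_comm]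
  · intro s i
    have := contMDiffOn_baseSet_localFrameCoeff (I := 𝓡 d) (k := ∞) (e := t) b
      (s := fun y => s y) s.contMDiff.contMDiffOn i
    exact this.mono fun y hy => hy.2

variable (E) in
/-- The fibres are spanned by the values of global sections. -/
lemma exists_sec {x : M} (v : E.fib x) : ∃ s : E.Sec, s x = v := by
  obtain ⟨V, hx, ⟨F⟩⟩ := exists_frame E x
  refine ⟨∑ i, smulSec (algebraMap ℝ (Fn d M) (F.c i x v)) (F.e i), ?_⟩
  rw [sec_sum_apply]
  exact F.sum_eq x hx v

/-- Around a point, sections are combinations of a frame with globally defined coefficients. -/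
lemma Frame.exists_coeff {V : Opens M} (F : E.Frame V) {x : M} (hx : x ∈ V) (s : E.Sec) :
    ∃ f : Fin E.rank → Fn d M, (∀ i, ∀ᶠ y in 𝓝 x, f i y = F.c i y (s y)) ∧
      ∀ᶠ y in 𝓝 x, s y = (∑ i, smulSec (f i) (F.e i)) y := by
  choose f hf using fun i => exists_fn_eventuallyEq (d := d) V.isOpen hx (F.smooth s i)
  refine ⟨f, hf, ?_⟩
  filter_upwards [eventually_all.2 hf, V.isOpen.mem_nhds hx] with y h1 h2
  rw [sec_sum_apply]
  refine (F.sum_eq y h2 (s y)).symm.trans ?_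
  exact Finset.sum_congr rfl fun i _ => by
    rw [smulSec_apply, h1]

end VBundle

end PreCourant

end

/-! ### Polynomial functions as functions on words -/

noncomputable section

namespace PreCourant

open Filter Topology Shuf VBundle

variable {d : ℕ} {M : Type u} [TopologicalSpace M] [ChartedSpace (EuclideanSpace ℝ (Fin d)) M]

instance instWeightedSum {Γ C : Type*} : Weighted (Γ ⊕ C) :=
  ⟨Sum.elim (fun _ => 1) fun _ => 2⟩

@[simp] lemma wt_inl {Γ C : Type*} (e : Γ) : Weighted.wt (Sum.inl e : Γ ⊕ C) = 1 := rfl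
@[simp] lemma wt_inr {Γ C : Type*} (f : C) : Weighted.wt (Sum.inr f : Γ ⊕ C) = 2 := rfl
@[simp] lemma sg_inl {Γ C : Type*} (e : Γ) : sg (Sum.inl e : Γ ⊕ C) = -1 := by simp [sg]
@[simp] lemma sg_inr {Γ C : Type*} (f : C) : sg (Sum.inr f : Γ ⊕ C) = 1 := by simp [sg]

variable (P : PreCourantAlgebroid d M)

/-- The functions on words in the sections of `P` and the smooth functions on `M`, with values in
the functions on `U`. -/
abbrev Amb (U : Opens M) : Type u := Shuf (P.Sec ⊕ Fn d M) (U → ℝ)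

/-- The letter of a section. -/
abbrev ls (e : P.Sec) : P.Sec ⊕ Fn d M := Sum.inl e

/-- The letter of a smooth function. -/
abbrev lf (f : Fn d M) : P.Sec ⊕ Fn d M := Sum.inr f

variable {P} {U V W : Opens M}

/-- The restriction of a function on `M` to an open set. -/
def fr (U : Opens M) (f : Fn d M) : U → ℝ := fun y => f y.1

/-- A section, as a function of weight one: its values are its pairings with letters. -/
def hat (U : Opens M) (e : P.Sec) : Amb P U
  | [Sum.inl e'] => fun y => P.metric y.1 (e y.1) (e' y.1)
  | _ => 0

@[simp] lemma hat_nil (e : P.Sec) : hat U e [] = 0 := rfl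

lemma D_hat_inl (e e' : P.Sec) :
    D (ls P e') (hat U e) = const (fr U (P.pairing e e')) := by
  ext w : 1
  cases w <;> rfl

lemma D_hat_inr (e : P.Sec) (f : Fn d M) : D (lf P f) (hat U e) = 0 := rfl

lemma hat_cons_cons (e : P.Sec) (l l' : P.Sec ⊕ Fn d M) (w : List (P.Sec ⊕ Fn d M)) :
    hat U e (l :: l' :: w) = 0 := by
  cases l <;> rfl

lemma hom_hat (e : P.Sec) : Hom (hat U e) 1 := by
  intro w hw
  match w, hw with
  | [], _ => rfl
  | [Sum.inl e'], hw => exact absurd rfl hw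
  | [Sum.inr f], _ => rfl
  | _ :: _ :: _, _ => exact hat_cons_cons e _ _ _

lemma isPar_hat (e : P.Sec) : IsPar (hat U e) (-1) := by
  have := Hom.isPar (k := 1) (hom_hat (U := U) e)
  rwa [pow_one] at this

lemma θ_hat (s : ℤˣ) (e : P.Sec) : θ s (hat U e) = s • hat U e := by
  rcases Int.units_eq_one_or s with rfl | rfl
  · simp
  · exact isPar_hat e

lemma hat_mul (e : P.Sec) (a : Amb P U) : hat U e * a = θ (-1) a * hat U e :=
  (isPar_hat e).mul_comm a

/-- The relations that hold between the iterated brackets with a polynomial function: letters act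
`ℝ`-linearly, and by derivations in the letter, and their supercommutators are given by the metric.
As `D l a` stands for `{l, a}`, these are the Leibniz rule in the first argument of the bracket and
the Jacobi identity with two letters. -/
structure Rel (a : Amb P U) : Prop where
  add_sec : ∀ e e', D (ls P (e + e')) a = D (ls P e) a + D (ls P e') a
  smul_sec : ∀ f e, D (ls P (smulSec f e)) a = fr U f • D (ls P e) a + hat U e * D (lf P f) a
  add_fn : ∀ f g, D (lf P (f + g)) a = D (lf P f) a + D (lf P g) a
  mul_fn : ∀ f g, D (lf P (f * g)) a = fr U f • D (lf P g) a + fr U g • D (lf P f) a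
  const_fn : ∀ c : ℝ, D (lf P (algebraMap ℝ _ c)) a = 0
  comm_sec : ∀ e e', D (ls P e) (D (ls P e') a) + D (ls P e') (D (ls P e) a) =
    D (lf P (P.pairing e e')) a
  comm_sec_fn : ∀ e f, D (ls P e) (D (lf P f) a) = D (lf P f) (D (ls P e) a)
  comm_fn : ∀ f g, D (lf P f) (D (lf P g) a) = D (lf P g) (D (lf P f) a)

lemma Rel.zero : Rel (0 : Amb P U) := by
  constructor <;> intros <;> simp

lemma Rel.add {a b : Amb P U} (ha : Rel a) (hb : Rel b) : Rel (a + b) where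
  add_sec e e' := by simp only [map_add, ha.add_sec, hb.add_sec]; abel
  smul_sec f e := by simp only [map_add, ha.smul_sec, hb.smul_sec, smul_add, mul_add]; abel
  add_fn f g := by simp only [map_add, ha.add_fn, hb.add_fn]; abel
  mul_fn f g := by simp only [map_add, ha.mul_fn, hb.mul_fn, smul_add]; abel
  const_fn c := by simp only [map_add, ha.const_fn, hb.const_fn, add_zero]
  comm_sec e e' := by simp only [map_add, ← ha.comm_sec, ← hb.comm_sec]; abel
  comm_sec_fn e f := by simp only [map_add, ha.comm_sec_fn, hb.comm_sec_fn]
  comm_fn f g := by rw [map_add, map_add, ha.comm_fn, hb.comm_fn, map_add, map_add]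

lemma Rel.smul {a : Amb P U} (ha : Rel a) (r : U → ℝ) : Rel (r • a) where
  add_sec e e' := by simp only [map_smul, ha.add_sec, smul_add]
  smul_sec f e := by
    simp only [map_smul, ha.smul_sec, smul_add, mul_smul_comm, smul_comm r]
  add_fn f g := by simp only [map_smul, ha.add_fn, smul_add]
  mul_fn f g := by simp only [map_smul, ha.mul_fn, smul_add, smul_comm r]
  const_fn c := by simp only [map_smul, ha.const_fn, smul_zero]
  comm_sec e e' := by simp only [map_smul, ← ha.comm_sec, smul_add]
  comm_sec_fn e f := by simp only [map_smul, ha.comm_sec_fn]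
  comm_fn f g := by rw [map_smul, map_smul, ha.comm_fn, map_smul, map_smul]

lemma Rel.usmul {a : Amb P U} (ha : Rel a) (s : ℤˣ) : Rel (s • a) := by
  rcases Int.units_eq_one_or s with rfl | rfl
  · simpa using ha
  · simpa using ha.smul (-1)

lemma Rel.θ {a : Amb P U} (ha : Rel a) (s : ℤˣ) : Rel (Shuf.θ s a) := by
  rcases Int.units_eq_one_or s with rfl | rfl
  · simpa using ha
  have h1 : ∀ (e : P.Sec) (b : Amb P U), D (ls P e) (Shuf.θ (-1) b) =
      -Shuf.θ (-1) (D (ls P e) b) := fun e b => by rw [D_θ]; simp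
  have h2 : ∀ (f : Fn d M) (b : Amb P U), D (lf P f) (Shuf.θ (-1) b) =
      Shuf.θ (-1) (D (lf P f) b) := fun f b => by rw [D_θ]; simp
  constructor
  · intro e e'
    simp only [h1, ha.add_sec, map_add]; abel
  · intro f e
    simp only [h1, h2, ha.smul_sec, map_add, map_smul, θ_mul, θ_hat]
    simp
    abel
  · intro f g
    simp only [h2, ha.add_fn, map_add]
  · intro f g
    simp only [h2, ha.mul_fn, map_add, map_smul]
  · intro c
    simp only [h2, ha.const_fn, map_zero]
  · intro e e'
    simp only [h1, h2, ← ha.comm_sec, map_add, map_neg, neg_neg]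
  · intro e f
    simp only [h1, h2, ha.comm_sec_fn, map_neg]
  · intro f g
    rw [h2, h2, ha.comm_fn, h2, h2]

lemma Rel.mul {a b : Amb P U} (ha : Rel a) (hb : Rel b) : Rel (a * b) := by
  have h1 : ∀ (e : P.Sec) (b : Amb P U), D (ls P e) (Shuf.θ (-1) b) =
      -Shuf.θ (-1) (D (ls P e) b) := fun e b => by rw [D_θ]; simp
  have h2 : ∀ (f : Fn d M) (b : Amb P U), D (lf P f) (Shuf.θ (-1) b) =
      Shuf.θ (-1) (D (lf P f) b) := fun f b => by rw [D_θ]; simp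
  have h3 : ∀ (e : P.Sec) (a b : Amb P U), D (ls P e) (a * b) =
      D (ls P e) a * b + Shuf.θ (-1) a * D (ls P e) b := fun e a b => by
    rw [D_mul, sg_inl]
  have h4 : ∀ (f : Fn d M) (a b : Amb P U), D (lf P f) (a * b) =
      D (lf P f) a * b + a * D (lf P f) b := fun f a b => by
    rw [D_mul, sg_inr, θ_one]
  constructor
  · intro e e'
    simp only [h3, ha.add_sec, hb.add_sec, add_mul, mul_add]; abel
  · intro f e
    simp only [h3, h4, ha.smul_sec, hb.smul_sec, add_mul, mul_add, smul_add, smul_mul_assoc,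
      mul_smul_comm, ← mul_assoc]
    rw [hat_mul e a]
    abel
  · intro f g
    simp only [h4, ha.add_fn, hb.add_fn, add_mul, mul_add]; abel
  · intro f g
    simp only [h4, ha.mul_fn, hb.mul_fn, add_mul, mul_add, smul_mul_assoc, mul_smul_comm,
      smul_add]; abel
  · intro c
    simp only [h4, ha.const_fn, hb.const_fn, zero_mul, mul_zero, add_zero]
  · intro e e'
    simp only [h1, h3, h4, map_add, ← ha.comm_sec, ← hb.comm_sec, add_mul, mul_add, θ_θ]
    simp only [neg_mul, mul_neg, neg_neg, one_mul, θ_one]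
    abel
  · intro e f
    simp only [h2, h3, h4, map_add, ha.comm_sec_fn, hb.comm_sec_fn]
    abel
  · intro f g
    simp only [h4, map_add, ha.comm_fn f g, hb.comm_fn f g]
    abel

lemma Rel.proj {a : Amb P U} (ha : Rel a) (k : ℤ) : Rel (proj k a) := by
  constructor
  · intro e e'
    simp only [D_proj, wt_inl, ha.add_sec, map_add]
  · intro f e
    simp only [D_proj, wt_inl, wt_inr, ha.smul_sec, map_add, map_smul, (hom_hat e).proj_mul]
    congr 3
    push_cast
    ring_nf
  · intro f g
    simp only [D_proj, wt_inr, ha.add_fn, map_add]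
  · intro f g
    simp only [D_proj, wt_inr, ha.mul_fn, map_add, map_smul]
  · intro c
    simp only [D_proj, ha.const_fn, map_zero]
  · intro e e'
    simp only [D_proj, wt_inl, wt_inr, ← map_add, ha.comm_sec]
    congr 1
    push_cast
    ring_nf
  · intro e f
    simp only [D_proj, wt_inl, wt_inr, ha.comm_sec_fn]
    congr 1
    push_cast
    ring_nf
  · intro f g
    simp only [D_proj, wt_inr]
    rw [ha.comm_fn]

lemma rel_const (r : U → ℝ) : Rel (const r : Amb P U) := by
  constructor <;> intros <;> simp

lemma pairing_add_right (e e' e'' : P.Sec) :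
    P.pairing e (e' + e'') = P.pairing e e' + P.pairing e e'' := by
  apply Fn.ext
  intro x
  exact map_add (P.metric x (e x)) _ _

lemma pairing_smul_right (f : Fn d M) (e e' : P.Sec) :
    P.pairing e (smulSec f e') = f * P.pairing e e' := by
  apply Fn.ext
  intro x
  exact map_smul (P.metric x (e x)) _ _

lemma pairing_comm (e e' : P.Sec) : P.pairing e e' = P.pairing e' e :=
  Fn.ext fun x => P.metric_symm x _ _

lemma rel_hat (e : P.Sec) : Rel (hat U e) := by
  constructor
  · intro e' e''
    rw [D_hat_inl, D_hat_inl, D_hat_inl, pairing_add_right]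
    ext w : 1
    cases w
    · rfl
    · simp
  · intro f e'
    rw [D_hat_inl, D_hat_inl, D_hat_inr, mul_zero, add_zero, pairing_smul_right]
    ext w : 1
    cases w
    · rfl
    · simp
  all_goals intros; simp [D_hat_inl, D_hat_inr]

/-- The iterated action of the letters of a word. -/
def Dw : List (P.Sec ⊕ Fn d M) → Amb P U → Amb P U
  | [], a => a
  | l :: w, a => Dw w (D l a)

lemma Dw_add (w : List (P.Sec ⊕ Fn d M)) (a b : Amb P U) : Dw w (a + b) = Dw w a + Dw w b := by
  induction w generalizing a b with
  | nil => rfl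
  | cons l w ih => simp only [Dw, map_add, ih]

/-- The polynomial functions on `U` over a pre-Courant algebroid: the relations hold after any
number of brackets with letters, the weight is bounded, and the values are smooth. -/
structure IsPoly (a : Amb P U) : Prop where
  rel : ∀ w, Rel (Dw w a)
  bdd : ∃ n : ℕ, ∀ w, n < wtw w → a w = 0
  smooth : ∀ w, ContMDiff (𝓡 d) 𝓘(ℝ, ℝ) ∞ (a w)

namespace IsPoly

variable {a b : Amb P U}

lemma rel' (ha : IsPoly a) : Rel a := ha.rel []

lemma D (ha : IsPoly a) (l : P.Sec ⊕ Fn d M) : IsPoly (D l a) where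
  rel w := ha.rel (l :: w)
  bdd := by
    obtain ⟨n, hn⟩ := ha.bdd
    exact ⟨n, fun w hw => hn _ (by rw [wtw_cons]; omega)⟩
  smooth w := ha.smooth (l :: w)

lemma add (ha : IsPoly a) (hb : IsPoly b) : IsPoly (a + b) where
  rel w := by rw [Dw_add]; exact (ha.rel w).add (hb.rel w)
  bdd := by
    obtain ⟨n, hn⟩ := ha.bdd
    obtain ⟨m, hm⟩ := hb.bdd
    exact ⟨max n m, fun w hw => by
      rw [Shuf.add_apply, hn w (by omega), hm w (by omega), add_zero]⟩
  smooth w := (ha.smooth w).add (hb.smooth w)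

lemma smul (ha : IsPoly a) {r : U → ℝ} (hr : ContMDiff (𝓡 d) 𝓘(ℝ, ℝ) ∞ r) : IsPoly (r • a) where
  rel w := by
    have : Dw w (r • a) = r • Dw w a := by
      clear ha
      induction w generalizing a with
      | nil => rfl
      | cons l w ih => exact ih
    rw [this]
    exact (ha.rel w).smul r
  bdd := by
    obtain ⟨n, hn⟩ := ha.bdd
    exact ⟨n, fun w hw => by rw [Shuf.smul_apply, hn w hw, smul_zero]⟩
  smooth w := hr.mul (ha.smooth w)

lemma rsmul (ha : IsPoly a) (r : ℝ) : IsPoly (r • a) :=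
  ha.smul (r := fun _ => r) contMDiff_const

lemma neg (ha : IsPoly a) : IsPoly (-a) := by
  simpa using ha.rsmul (-1)

lemma sub (ha : IsPoly a) (hb : IsPoly b) : IsPoly (a - b) := by
  rw [sub_eq_add_neg]
  exact ha.add hb.neg

lemma usmul (ha : IsPoly a) (s : ℤˣ) : IsPoly (s • a) := by
  rcases Int.units_eq_one_or s with rfl | rfl
  · simpa using ha
  · simpa using ha.neg

lemma θ (ha : IsPoly a) (s : ℤˣ) : IsPoly (Shuf.θ s a) where
  rel w := by
    have : ∀ t : ℤˣ, Rel (t • Dw w (Shuf.θ s a)) := by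
      have h := ha.rel w
      clear ha
      induction w generalizing a with
      | nil => exact fun t => (h.θ s).usmul t
      | cons l w ih =>
        intro t
        have h1 : ∀ (t : ℤˣ) (b : Amb P U), Dw w (t • b) = t • Dw w b := by
          intro t b
          clear ih h
          induction w generalizing b with
          | nil => rfl
          | cons l w ih => exact ih _
        rw [Dw, D_θ, h1, smul_smul]
        exact ih h _
    simpa using this 1
  bdd := by
    obtain ⟨n, hn⟩ := ha.bdd
    exact ⟨n, fun w hw => by rw [θ_apply, hn w hw, smul_zero]⟩
  smooth w := by
    rw [θ_apply]
    rcases Int.units_eq_one_or (s ^ wtw w) with h | h <;> rw [h]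
    · simpa using ha.smooth w
    · rw [Units.neg_smul, one_smul]
      exact (ha.smooth w).neg

lemma mul (ha : IsPoly a) (hb : IsPoly b) : IsPoly (a * b) where
  rel w := by
    induction w generalizing a b with
    | nil => exact ha.rel'.mul hb.rel'
    | cons l w ih =>
      rw [Dw, D_mul, Dw_add]
      exact (ih (ha.D l) hb).add (ih (ha.θ _) (hb.D l))
  bdd := by
    obtain ⟨n, hn⟩ := ha.bdd
    obtain ⟨m, hm⟩ := hb.bdd
    refine ⟨n + m, fun w => ?_⟩
    clear ha hb
    induction w generalizing a b n m with
    | nil => intro hw; simp at hw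
    | cons l w ih =>
      intro hw
      rw [wtw_cons] at hw
      rw [mul_cons]
      have h1 : (Shuf.D l a * b) w = 0 := by
        by_cases hl : Weighted.wt l ≤ n
        · exact ih (a := Shuf.D l a) (b := b) (n - Weighted.wt l)
            (fun w hw => hn _ (by rw [wtw_cons]; omega)) m hm (by omega)
        · have : Shuf.D l a = 0 := by
            ext w : 1
            exact hn _ (by rw [wtw_cons]; omega)
          rw [this, zero_mul, Shuf.zero_apply]
      have h2 : (Shuf.θ (sg l) a * Shuf.D l b) w = 0 := by
        by_cases hl : Weighted.wt l ≤ m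
        · exact ih (a := Shuf.θ (sg l) a) (b := Shuf.D l b) n
            (fun w hw => by rw [θ_apply, hn w hw, smul_zero]) (m - Weighted.wt l)
            (fun w hw => hm _ (by rw [wtw_cons]; omega)) (by omega)
        · have : Shuf.D l b = 0 := by
            ext w : 1
            exact hm _ (by rw [wtw_cons]; omega)
          rw [this, mul_zero, Shuf.zero_apply]
      rw [h1, h2, add_zero]
  smooth w := by
    induction w generalizing a b with
    | nil => exact (ha.smooth []).mul (hb.smooth [])
    | cons l w ih =>
      rw [mul_cons]
      exact (ih (ha.D l) hb).add (ih (ha.θ _) (hb.D l))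

lemma proj (ha : IsPoly a) (k : ℤ) : IsPoly (proj k a) where
  rel w := by
    have h := ha.rel w
    clear ha
    induction w generalizing a k with
    | nil => exact h.proj k
    | cons l w ih =>
      rw [Dw, D_proj]
      exact ih _ h
  bdd := by
    obtain ⟨n, hn⟩ := ha.bdd
    exact ⟨n, fun w hw => by rw [proj_apply, hn w hw, ite_self]⟩
  smooth w := by
    rw [proj_apply]
    split_ifs
    · exact ha.smooth w
    · exact contMDiff_const

end IsPoly

lemma Dw_zero (w : List (P.Sec ⊕ Fn d M)) : Dw w (0 : Amb P U) = 0 := by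
  induction w with
  | nil => rfl
  | cons l w ih => exact ih

lemma isPoly_const {r : U → ℝ} (hr : ContMDiff (𝓡 d) 𝓘(ℝ, ℝ) ∞ r) :
    IsPoly (const r : Amb P U) where
  rel w := by
    cases w with
    | nil => exact rel_const r
    | cons l w => rw [Dw, D_const, Dw_zero]; exact Rel.zero
  bdd := ⟨0, fun w hw => hom_const r w (by omega)⟩
  smooth w := by
    cases w
    · exact hr
    · exact contMDiff_const

lemma isPoly_zero : IsPoly (0 : Amb P U) where
  rel w := by rw [Dw_zero]; exact Rel.zero
  bdd := ⟨0, fun _ _ => rfl⟩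
  smooth _ := contMDiff_const

lemma contMDiff_fr (f : Fn d M) : ContMDiff (𝓡 d) 𝓘(ℝ, ℝ) ∞ (fr U f) :=
  (f.toOpen U).contMDiff

lemma isPoly_hat (e : P.Sec) : IsPoly (hat U e) where
  rel w := by
    match w with
    | [] => exact rel_hat e
    | Sum.inl e' :: w =>
      have := (isPoly_const (P := P) (contMDiff_fr (U := U) (P.pairing e e'))).rel w
      rwa [← D_hat_inl] at this
    | Sum.inr f :: w =>
      rw [Dw, D_hat_inr, Dw_zero]
      exact Rel.zero
  bdd := ⟨1, fun w hw => hom_hat e w (by omega)⟩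
  smooth w := by
    match w with
    | [] => exact contMDiff_const
    | [Sum.inl e'] => exact contMDiff_fr (P.pairing e e')
    | [Sum.inr f] => exact contMDiff_const
    | _ :: _ :: _ => rw [hat_cons_cons]; exact contMDiff_const

/-- The function on words given by a letter: the function whose bracket is the letter. -/
def ι (U : Opens M) : P.Sec ⊕ Fn d M → Amb P U
  | Sum.inl e => hat U e
  | Sum.inr f => const (fr U f)

lemma isPoly_ι (l : P.Sec ⊕ Fn d M) : IsPoly (ι U l) := by
  cases l
  · exact isPoly_hat _
  · exact isPoly_const (contMDiff_fr _)

/-! ### Restriction to open subsets -/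

/-- The restriction of functions, as a ring homomorphism. -/
def resFun (h : U ≤ V) : (V → ℝ) →+* (U → ℝ) := RingHom.pi fun y => Pi.evalRingHom _ (Set.inclusion h y)

@[simp] lemma resFun_apply (h : U ≤ V) (f : V → ℝ) (y : U) :
    resFun h f y = f (Set.inclusion h y) := rfl

lemma resFun_smooth (h : U ≤ V) {f : V → ℝ} (hf : ContMDiff (𝓡 d) 𝓘(ℝ, ℝ) ∞ f) :
    ContMDiff (𝓡 d) 𝓘(ℝ, ℝ) ∞ (resFun h f) :=
  hf.comp (contMDiff_inclusion h)

/-- Restriction of functions on words. -/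
def resA (h : U ≤ V) : Amb P V → Amb P U := mapHom (resFun h)

lemma resA_apply (h : U ≤ V) (a : Amb P V) (w : List (P.Sec ⊕ Fn d M)) (y : U) :
    resA h a w y = a w (Set.inclusion h y) := rfl

lemma resA_add (h : U ≤ V) (a b : Amb P V) : resA h (a + b) = resA h a + resA h b :=
  mapHom_add _ _ _

lemma resA_smul (h : U ≤ V) (r : V → ℝ) (a : Amb P V) :
    resA h (r • a) = resFun h r • resA h a := mapHom_smul _ _ _

lemma resA_mul (h : U ≤ V) (a b : Amb P V) : resA h (a * b) = resA h a * resA h b :=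
  mapHom_mul _ _ _

lemma resA_const (h : U ≤ V) (r : V → ℝ) : resA h (const r : Amb P V) = const (resFun h r) :=
  mapHom_const _ _

lemma resA_θ (h : U ≤ V) (s : ℤˣ) (a : Amb P V) : resA h (θ s a) = θ s (resA h a) :=
  mapHom_θ _ _ _

lemma resA_hat (h : U ≤ V) (e : P.Sec) : resA h (hat V e) = hat U e := by
  ext w y
  rw [resA_apply]
  match w with
  | [] => rfl
  | [Sum.inl e'] => rfl
  | [Sum.inr f] => rfl
  | _ :: _ :: _ => rw [hat_cons_cons, hat_cons_cons]; rfl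

lemma Rel.res {a : Amb P V} (ha : Rel a) (h : U ≤ V) : Rel (resA h a) where
  add_sec e e' := by
    have := congrArg (mapHom (resFun h)) (ha.add_sec e e')
    rwa [mapHom_add] at this
  smul_sec f e := by
    have := congrArg (mapHom (resFun h)) (ha.smul_sec f e)
    rw [mapHom_add, mapHom_mul, mapHom_smul] at this
    rw [← resA_hat h]
    exact this
  add_fn f g := by
    have := congrArg (mapHom (resFun h)) (ha.add_fn f g)
    rwa [mapHom_add] at this
  mul_fn f g := by
    have := congrArg (mapHom (resFun h)) (ha.mul_fn f g)
    rwa [mapHom_add, mapHom_smul, mapHom_smul] at this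
  const_fn c := congrArg (mapHom (resFun h)) (ha.const_fn c)
  comm_sec e e' := by
    have := congrArg (mapHom (resFun h)) (ha.comm_sec e e')
    rwa [mapHom_add] at this
  comm_sec_fn e f := congrArg (mapHom (resFun h)) (ha.comm_sec_fn e f)
  comm_fn f g := congrArg (mapHom (resFun h)) (ha.comm_fn f g)

lemma Dw_res (h : U ≤ V) (w : List (P.Sec ⊕ Fn d M)) (a : Amb P V) :
    Dw w (resA h a) = resA h (Dw w a) := by
  induction w generalizing a with
  | nil => rfl
  | cons l w ih => exact ih _

lemma IsPoly.res {a : Amb P V} (ha : IsPoly a) (h : U ≤ V) : IsPoly (resA h a) where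
  rel w := by rw [Dw_res]; exact (ha.rel w).res h
  bdd := by
    obtain ⟨n, hn⟩ := ha.bdd
    exact ⟨n, fun w hw => by
      ext y
      rw [resA_apply, hn w hw]
      rfl⟩
  smooth w := resFun_smooth h (ha.smooth w)

lemma amb_ext_of_cover {a b : Amb P U}
    (h : ∀ x : U, ∃ (V : Opens M) (hV : V ≤ U), x.1 ∈ V ∧ resA hV a = resA hV b) : a = b := by
  ext w x
  obtain ⟨V, hV, hx, hab⟩ := h x
  have := congrFun (congrFun hab w) ⟨x.1, hx⟩
  simpa [resA_apply] using this

lemma Rel.of_cover {a : Amb P U}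
    (h : ∀ x : U, ∃ (V : Opens M) (hV : V ≤ U), x.1 ∈ V ∧ Rel (resA hV a)) : Rel a := by
  constructor
  · intro e e'
    refine amb_ext_of_cover fun x => ?_
    obtain ⟨V, hV, hx, hr⟩ := h x
    exact ⟨V, hV, hx, (hr.add_sec e e').trans (resA_add hV _ _).symm⟩
  · intro f e
    refine amb_ext_of_cover fun x => ?_
    obtain ⟨V, hV, hx, hr⟩ := h x
    refine ⟨V, hV, hx, (hr.smul_sec f e).trans ?_⟩
    rw [resA_add, resA_smul, resA_mul, resA_hat]
    rfl
  · intro f g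
    refine amb_ext_of_cover fun x => ?_
    obtain ⟨V, hV, hx, hr⟩ := h x
    exact ⟨V, hV, hx, (hr.add_fn f g).trans (resA_add hV _ _).symm⟩
  · intro f g
    refine amb_ext_of_cover fun x => ?_
    obtain ⟨V, hV, hx, hr⟩ := h x
    refine ⟨V, hV, hx, (hr.mul_fn f g).trans ?_⟩
    rw [resA_add, resA_smul, resA_smul]
    rfl
  · intro c
    refine amb_ext_of_cover fun x => ?_
    obtain ⟨V, hV, hx, hr⟩ := h x
    exact ⟨V, hV, hx, hr.const_fn c⟩
  · intro e e'
    refine amb_ext_of_cover fun x => ?_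
    obtain ⟨V, hV, hx, hr⟩ := h x
    exact ⟨V, hV, hx, (resA_add hV _ _).trans (hr.comm_sec e e')⟩
  · intro e f
    refine amb_ext_of_cover fun x => ?_
    obtain ⟨V, hV, hx, hr⟩ := h x
    exact ⟨V, hV, hx, hr.comm_sec_fn e f⟩
  · intro f g
    refine amb_ext_of_cover fun x => ?_
    obtain ⟨V, hV, hx, hr⟩ := h x
    exact ⟨V, hV, hx, hr.comm_fn f g⟩

end PreCourant

end

/-! ### Values at a point of polynomial functions -/

noncomputable section

namespace PreCourant

open Filter Topology Shuf VBundle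

variable {d : ℕ} {M : Type u} [TopologicalSpace M] [ChartedSpace (EuclideanSpace ℝ (Fin d)) M]
variable {P : PreCourantAlgebroid d M} {U V W : Opens M}

lemma Fn.isUnit {f : Fn d V} (h : ∀ y, f y ≠ 0) : IsUnit f := by
  refine IsUnit.of_mul_eq_one ⟨fun y => (f y)⁻¹, f.contMDiff.inv₀ h⟩ ?_
  ext y
  exact mul_inv_cancel₀ (h y)

lemma eventually_subtype {x : U} {p : M → Prop} (h : ∀ᶠ y in 𝓝 x.1, p y) : ∀ᶠ y in 𝓝 x, p y.1 :=
  (continuous_subtype_val.continuousAt (x := x)).eventually h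

lemma contMDiff_of_eventuallyEq {f : U → ℝ} (h : ∀ x : U, ∃ g : U → ℝ,
    ContMDiff (𝓡 d) 𝓘(ℝ, ℝ) ∞ g ∧ ∀ᶠ y in 𝓝 x, f y = g y) :
    ContMDiff (𝓡 d) 𝓘(ℝ, ℝ) ∞ f := by
  intro x
  obtain ⟨g, hg, hfg⟩ := h x
  exact (hg x).congr_of_eventuallyEq hfg

lemma Rel.isDer {a : Amb P U} (ha : Rel a) (w : List (P.Sec ⊕ Fn d M)) (x : U) :
    IsDer x.1 fun f => a (lf P f :: w) x where
  add f g := congrFun (congrFun (ha.add_fn f g) w) x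
  mul f g := congrFun (congrFun (ha.mul_fn f g) w) x
  const c := congrFun (congrFun (ha.const_fn c) w) x

/-- Real-valued functions of sections that are linear over the values at a point of the smooth
functions. -/
structure IsTens (x : M) (α : P.Sec → ℝ) : Prop where
  add : ∀ e e', α (e + e') = α e + α e'
  smul : ∀ f e, α (smulSec f e) = f x * α e

lemma Rel.isTens {a : Amb P U} (ha : Rel a) (x : U) : IsTens x.1 fun e => a [ls P e] x where
  add e e' := congrFun (congrFun (ha.add_sec e e') []) x
  smul f e := by
    have h := congrFun (congrFun (ha.smul_sec f e) []) x
    rw [Shuf.add_apply, mul_nil, hat_nil, zero_mul, add_zero] at h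
    exact h

lemma isTens_metric {x : M} (v : P.fib x) : IsTens (P := P) x fun e => P.metric x v (e x) where
  add _ _ := map_add (P.metric x v) _ _
  smul _ _ := map_smul (P.metric x v) _ _

namespace IsTens

variable {x : M} {α β : P.Sec → ℝ}

lemma zero (h : IsTens x α) : α 0 = 0 := by
  have := h.add 0 0
  rw [add_zero] at this
  linarith

lemma sum (h : IsTens x α) {κ : Type*} (s : Finset κ) (e : κ → P.Sec) :
    α (∑ i ∈ s, e i) = ∑ i ∈ s, α (e i) := by
  classical
  induction s using Finset.induction_on with
  | empty => simp [h.zero]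
  | insert i s hi ih => rw [Finset.sum_insert hi, Finset.sum_insert hi, h.add, ih]

end IsTens

section

variable [T2Space M] [IsManifold (𝓡 d) ∞ M]

/-- A section vanishing around a point is a multiple of itself by a function vanishing there. -/
lemma exists_smulSec_eq {x : M} {e : P.Sec} (h : ∀ᶠ y in 𝓝 x, e y = 0) :
    ∃ f : Fn d M, f x = 0 ∧ (∀ᶠ y in 𝓝 x, f y = 0) ∧ smulSec f e = e := by
  obtain ⟨S, hS, hSo, hx⟩ := eventually_nhds_iff.1 h
  obtain ⟨χ, h1, h2⟩ := exists_bump (d := d) hSo hx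
  refine ⟨1 - χ, ?_, ?_, ?_⟩
  · change 1 - χ x = 0
    rw [h1.self_of_nhds, sub_self]
  · filter_upwards [h1] with y hy
    change 1 - χ y = 0
    rw [hy, sub_self]
  · apply Sec.ext
    intro y
    change (1 - χ y) • e y = e y
    by_cases hy : y ∈ S
    · rw [hS y hy, smul_zero]
    · rw [image_eq_zero_of_notMem_tsupport fun h => hy (h2 h), sub_zero, one_smul]

lemma IsTens.congr {x : M} {α : P.Sec → ℝ} (h : IsTens x α) {e e' : P.Sec}
    (he : ∀ᶠ y in 𝓝 x, e y = e' y) : α e = α e' := by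
  obtain ⟨f, hf, -, hfe⟩ := exists_smulSec_eq (P := P) (e := e - e') (x := x) (by
    filter_upwards [he] with y hy
    change e y - e' y = 0
    rw [hy, sub_self])
  have h1 : α (e - e') = 0 := by rw [← hfe, h.smul, hf, zero_mul]
  have h2 : e = e' + (e - e') := by abel
  rw [h2, h.add, h1, add_zero]

lemma IsTens.ext_frame {V : Opens M} (F : P.toVBundle.Frame V) {x : M} (hx : x ∈ V)
    {α β : P.Sec → ℝ} (hα : IsTens x α) (hβ : IsTens x β) (h : ∀ i, α (F.e i) = β (F.e i))
    (e : P.Sec) : α e = β e := by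
  obtain ⟨f, -, he⟩ := F.exists_coeff hx e
  rw [hα.congr he, hβ.congr he, hα.sum, hβ.sum]
  exact Finset.sum_congr rfl fun i _ => by rw [hα.smul, hβ.smul, h]

/-- The Gram matrix of a frame. -/
def gram {V : Opens M} (F : P.toVBundle.Frame V) :
    Matrix (Fin P.rank) (Fin P.rank) (Fn d V) :=
  Matrix.of fun i j => (P.pairing (F.e i) (F.e j)).toOpen V

lemma isUnit_gram {V : Opens M} (F : P.toVBundle.Frame V) : IsUnit (gram F).det := by
  apply Fn.isUnit
  intro y hy
  let ev : Fn d V →+* ℝ := ⟨⟨⟨fun f => f y, rfl⟩, fun _ _ => rfl⟩, rfl, fun _ _ => rfl⟩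
  have h1 : ((gram F).map ev).det = 0 := by
    rw [← RingHom.mapMatrix_apply, ← RingHom.map_det]
    exact hy
  obtain ⟨v, hv, hGv⟩ := Matrix.exists_mulVec_eq_zero_iff.2 h1
  apply hv
  have h2 : ∑ j, v j • F.e j y.1 = 0 := by
    apply P.metric_nondeg
    intro w
    rw [← F.sum_eq y.1 y.2 w, map_sum]
    refine Finset.sum_eq_zero fun i _ => ?_
    rw [map_smul, P.metric_symm, map_sum]
    have h3 := congrFun hGv i
    simp only [Matrix.mulVec, dotProduct, Matrix.map_apply, Pi.zero_apply] at h3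
    refine smul_eq_zero_of_right _ (Eq.trans (Finset.sum_congr rfl fun j _ => ?_) h3)
    rw [map_smul, smul_eq_mul, mul_comm]
    rfl
  ext i
  have h3 := congrArg (F.c i y.1) h2
  rw [map_sum, map_zero] at h3
  simp only [map_smul, F.c_e y.1 y.2, smul_eq_mul, mul_ite, mul_one, mul_zero,
    Finset.sum_ite_eq, Finset.mem_univ, if_true] at h3
  exact h3

lemma gram_inv_mul {V : Opens M} (F : P.toVBundle.Frame V) (y : V) (i k : Fin P.rank) :
    ∑ j, (gram F)⁻¹ i j y * P.metric y.1 (F.e j y.1) (F.e k y.1) = if i = k then 1 else 0 := by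
  have h := congrFun (congrFun (Matrix.nonsing_inv_mul (gram F) (isUnit_gram F)) i) k
  let ev : Fn d V →+* ℝ := ⟨⟨⟨fun f => f y, rfl⟩, fun _ _ => rfl⟩, rfl, fun _ _ => rfl⟩
  have h1 := congrArg ev h
  rw [Matrix.mul_apply, map_sum] at h1
  refine Eq.trans ?_ (h1.trans ?_)
  · rfl
  · rw [Matrix.one_apply]
    split_ifs
    · exact map_one ev
    · exact map_zero ev

/-- Linear functionals on a fibre are given by the metric. -/
lemma IsTens.exists_vec {x : M} {α : P.Sec → ℝ} (h : IsTens x α) :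
    ∃ v : P.fib x, ∀ e : P.Sec, P.metric x v (e x) = α e := by
  obtain ⟨V, hx, ⟨F⟩⟩ := exists_frame P.toVBundle x
  refine ⟨∑ j, (∑ i, α (F.e i) * (gram F)⁻¹ i j ⟨x, hx⟩) • F.e j x, fun e => ?_⟩
  refine (isTens_metric _).ext_frame F hx h (fun k => ?_) e
  simp only [map_sum, map_smul, LinearMap.sum_apply, LinearMap.smul_apply, smul_eq_mul,
    Finset.sum_mul]
  rw [Finset.sum_comm]
  have h1 := fun i => gram_inv_mul F ⟨x, hx⟩ i k
  simp only at h1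
  simp only [mul_assoc, ← Finset.mul_sum, h1]
  simp

/-- A smooth family of linear functionals on the fibres is given around every point by a section. -/
lemma exists_sec_germ {α : P.Sec → U → ℝ} (h : ∀ x : U, IsTens x.1 fun e => α e x)
    (hs : ∀ e, ContMDiff (𝓡 d) 𝓘(ℝ, ℝ) ∞ (α e)) (x : U) :
    ∃ e₀ : P.Sec, ∀ᶠ y in 𝓝 x.1, ∀ hy : y ∈ U, ∀ e : P.Sec,
      P.metric y (e₀ y) (e y) = α e ⟨y, hy⟩ := by
  obtain ⟨V, hx, ⟨F⟩⟩ := exists_frame P.toVBundle x.1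
  let W : Opens M := U ⊓ V
  have hWU : W ≤ U := inf_le_left
  have hWV : W ≤ V := inf_le_right
  choose f hf using fun j => exists_fn_germ (d := d) (U := W)
    (f := fun y => ∑ i, α (F.e i) (Set.inclusion hWU y) *
      (gram F)⁻¹ i j (Set.inclusion hWV y)) (by
        refine ContMDiff.sum fun i _ => ?_
        exact ((hs _).comp (contMDiff_inclusion hWU)).mul
          (((gram F)⁻¹ i j).contMDiff.comp (contMDiff_inclusion hWV))) ⟨x.1, x.2, hx⟩
  refine ⟨∑ j, smulSec (f j) (F.e j), ?_⟩
  filter_upwards [eventually_all.2 hf, V.isOpen.mem_nhds hx] with y hy hyV hyU e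
  refine (isTens_metric _).ext_frame F hyV (h ⟨y, hyU⟩) (fun k => ?_) e
  simp only [sec_sum_apply, smulSec_apply, map_sum, map_smul, LinearMap.sum_apply,
    LinearMap.smul_apply, smul_eq_mul]
  simp only [hy _ ⟨hyU, hyV⟩, Finset.sum_mul]
  rw [Finset.sum_comm]
  have h1 := fun i => gram_inv_mul F ⟨y, hyV⟩ i k
  simp only at h1
  have h2 : ∀ i, ∑ j, α (F.e i) ⟨y, hyU⟩ * (gram F)⁻¹ i j ⟨y, hyV⟩ *
      P.metric y (F.e j y) (F.e k y) = α (F.e i) ⟨y, hyU⟩ * if i = k then 1 else 0 := fun i => by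
    rw [← h1, Finset.mul_sum]
    simp only [mul_assoc]
  refine (Finset.sum_congr rfl fun i _ => h2 i).trans ?_
  simp

lemma fib_ext {x : M} {v w : P.fib x}
    (h : ∀ e : P.Sec, P.metric x v (e x) = P.metric x w (e x)) : v = w := by
  rw [← sub_eq_zero]
  apply P.metric_nondeg
  intro z
  obtain ⟨e, rfl⟩ := exists_sec P.toVBundle z
  rw [map_sub, LinearMap.sub_apply, h, sub_self]

end

/-! ### The weight-zero part of the Poisson bracket -/

/-- The vector of the fibre that represents a linear functional, or zero if there is none. -/
def musOf (x : M) (α : P.Sec → ℝ) : P.fib x := by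
  classical exact
    if h : ∃ v : P.fib x, ∀ e : P.Sec, P.metric x v (e x) = α e then h.choose else 0

/-- The tangent vector that represents a derivation at a point, or zero if there is none. -/
def vecOf (x : M) (δ : Fn d M → ℝ) : TangentSpace (𝓡 d) x := by
  classical exact
    if h : ∃ v : TangentSpace (𝓡 d) x, ∀ f : Fn d M, mvfderiv (𝓡 d) f x v = δ f then h.choose
    else 0

/-- The part of weight one at a point, as a vector. -/
def mus (a : Amb P U) (x : U) : P.fib x.1 := musOf x.1 fun e => a [ls P e] x

/-- The symbol of the part of weight two at a point, as a tangent vector. -/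
def vec (a : Amb P U) (x : U) : TangentSpace (𝓡 d) x.1 := vecOf x.1 fun f => a [lf P f] x

/-- The weight-zero part of the bracket: functions of weight two differentiate functions of weight
zero through their symbols, and functions of weight one are paired by the metric. The functions of
weight zero are extended by zero from `U` to `M` in order to be differentiated at points of `U`. -/
def Br (a b : Amb P U) : U → ℝ := fun x =>
  mvfderiv (𝓡 d) (extZero (a [])) x.1 (vec b x) - mvfderiv (𝓡 d) (extZero (b [])) x.1 (vec a x) +
    P.metric x.1 (mus a x) (mus b x)

section

variable [T2Space M] [IsManifold (𝓡 d) ∞ M] {a b c : Amb P U}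

lemma vec_spec (ha : Rel a) (x : U) (f : Fn d M) :
    mvfderiv (𝓡 d) f x.1 (vec a x) = a [lf P f] x := by
  have h : ∃ v : TangentSpace (𝓡 d) x.1, ∀ f : Fn d M,
    mvfderiv (𝓡 d) f x.1 v = a [lf P f] x := (ha.isDer [] x).exists_vec
  rw [vec, vecOf, dif_pos h]
  exact h.choose_spec f

lemma mus_spec (ha : Rel a) (x : U) (e : P.Sec) :
    P.metric x.1 (mus a x) (e x.1) = a [ls P e] x := by
  have h : ∃ v : P.fib x.1, ∀ e : P.Sec, P.metric x.1 v (e x.1) = a [ls P e] x :=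
    (ha.isTens x).exists_vec
  rw [mus, musOf, dif_pos h]
  exact h.choose_spec e

lemma vec_eq (ha : Rel a) {x : U} {v : TangentSpace (𝓡 d) x.1}
    (h : ∀ f : Fn d M, mvfderiv (𝓡 d) f x.1 v = a [lf P f] x) : vec a x = v :=
  tangent_ext fun f => by rw [vec_spec ha, h]

lemma mus_eq (ha : Rel a) {x : U} {v : P.fib x.1}
    (h : ∀ e : P.Sec, P.metric x.1 v (e x.1) = a [ls P e] x) : mus a x = v :=
  fib_ext fun e => by rw [mus_spec ha, h]

lemma vec_eq_zero {x : U} (h : ∀ f, a [lf P f] x = 0) : vec a x = 0 := by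
  have h0 : ∃ v : TangentSpace (𝓡 d) x.1, ∀ f : Fn d M,
    mvfderiv (𝓡 d) f x.1 v = a [lf P f] x := ⟨0, fun f => by rw [map_zero, h]⟩
  rw [vec, vecOf, dif_pos h0]
  exact tangent_ext fun f => by rw [h0.choose_spec f, map_zero, h]

lemma mus_eq_zero {x : U} (h : ∀ e, a [ls P e] x = 0) : mus a x = 0 := by
  have h0 : ∃ v : P.fib x.1, ∀ e : P.Sec, P.metric x.1 v (e x.1) = a [ls P e] x :=
    ⟨0, fun e => by rw [map_zero, LinearMap.zero_apply, h]⟩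
  rw [mus, musOf, dif_pos h0]
  exact fib_ext fun e => by rw [h0.choose_spec e, map_zero, LinearMap.zero_apply, h]

/-- The weight-zero part of the bracket, computed with letters that represent the parts of weights
zero and one around a point. -/
lemma Br_eq (ha : IsPoly a) (hb : IsPoly b) {x : U} {f g : Fn d M} {e : P.Sec}
    (hf : ∀ᶠ y in 𝓝 x.1, ∀ h : y ∈ U, f y = a [] ⟨y, h⟩)
    (hg : ∀ᶠ y in 𝓝 x.1, ∀ h : y ∈ U, g y = b [] ⟨y, h⟩)
    (he : ∀ e' : P.Sec, P.metric x.1 (e x.1) (e' x.1) = a [ls P e'] x) :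
    Br a b x = b [lf P f] x - a [lf P g] x + b [ls P e] x := by
  have h1 : ∀ {f : Fn d M} {s : U → ℝ}, (∀ᶠ y in 𝓝 x.1, ∀ h : y ∈ U, f y = s ⟨y, h⟩) →
      extZero s =ᶠ[𝓝 x.1] f := by
    intro f s h
    filter_upwards [h, U.isOpen.mem_nhds x.2] with y hy hyU
    rw [extZero_of_mem s hyU, hy hyU]
  rw [Br, mvfderiv_congr (h1 hf), mvfderiv_congr (h1 hg), vec_spec ha.rel', vec_spec hb.rel',
    mus_eq ha.rel' he, P.metric_symm, mus_spec hb.rel']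

lemma IsPoly.exists_fn (ha : IsPoly a) (x : U) :
    ∃ f : Fn d M, ∀ᶠ y in 𝓝 x.1, ∀ h : y ∈ U, f y = a [] ⟨y, h⟩ :=
  exists_fn_germ (ha.smooth []) x

lemma IsPoly.exists_sec (ha : IsPoly a) (x : U) : ∃ e : P.Sec, ∀ᶠ y in 𝓝 x.1, ∀ h : y ∈ U,
    ∀ e' : P.Sec, P.metric y (e y) (e' y) = a [ls P e'] ⟨y, h⟩ :=
  exists_sec_germ (α := fun e => a [ls P e]) (fun x => ha.rel'.isTens x)
    (fun _ => ha.smooth _) x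

lemma Br_eq' (ha : IsPoly a) (x : U) : ∃ (f : Fn d M) (e : P.Sec),
    (∀ᶠ y in 𝓝 x.1, ∀ h : y ∈ U, f y = a [] ⟨y, h⟩) ∧
    ∀ {b : Amb P U} {g : Fn d M}, IsPoly b →
      (∀ᶠ y in 𝓝 x.1, ∀ h : y ∈ U, g y = b [] ⟨y, h⟩) →
      Br a b x = b [lf P f] x - a [lf P g] x + b [ls P e] x := by
  obtain ⟨f, hf⟩ := ha.exists_fn x
  obtain ⟨e, he⟩ := ha.exists_sec x
  exact ⟨f, e, hf, fun hb hg => Br_eq ha hb hf hg (he.self_of_nhds x.2)⟩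

lemma Br_smooth (ha : IsPoly a) (hb : IsPoly b) : ContMDiff (𝓡 d) 𝓘(ℝ, ℝ) ∞ (Br a b) := by
  apply contMDiff_of_eventuallyEq
  intro x
  obtain ⟨f, hf⟩ := ha.exists_fn x
  obtain ⟨g, hg⟩ := hb.exists_fn x
  obtain ⟨e, he⟩ := ha.exists_sec x
  refine ⟨fun y => b [lf P f] y - a [lf P g] y + b [ls P e] y,
    ((hb.smooth _).sub (ha.smooth _)).add (hb.smooth _), ?_⟩
  filter_upwards [eventually_subtype hf.eventually_nhds, eventually_subtype hg.eventually_nhds,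
    eventually_subtype he] with y h1 h2 h3
  exact Br_eq ha hb h1 h2 (h3 y.2)

lemma Br_res {V : Opens M} (h : V ≤ U) (a b : Amb P U) :
    resFun h (Br a b) = Br (resA h a) (resA h b) := by
  ext y
  have h1 : ∀ s : U → ℝ, extZero s =ᶠ[𝓝 y.1] extZero (resFun h s) := by
    intro s
    filter_upwards [V.isOpen.mem_nhds y.2] with z hz
    rw [extZero_of_mem s (h hz), extZero_of_mem _ hz]
    rfl
  rw [resFun_apply, Br, Br, mvfderiv_congr (h1 _), mvfderiv_congr (h1 _)]
  rfl

lemma Br_hom {i j : ℤ} (ha : Hom a i) (hb : Hom b j) (hij : i + j ≠ 2) : Br a b = 0 := by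
  ext x
  have h0 : ∀ v : TangentSpace (𝓡 d) x.1, mvfderiv (𝓡 d) (extZero (0 : U → ℝ)) x.1 v = 0 := by
    intro v
    have : extZero (0 : U → ℝ) = ((0 : Fn d M) : M → ℝ) := by
      ext y
      by_cases hy : y ∈ U <;> simp [extZero, hy]
    rw [this]
    exact (isDer_mvfderiv x.1 v).zero
  have h1 : mvfderiv (𝓡 d) (extZero (a [])) x.1 (vec b x) = 0 := by
    by_cases hi : i = 0
    · rw [vec_eq_zero fun f => by rw [hb _ (by simp; omega)]; rfl, map_zero]
    · rw [ha [] (by simp; omega), h0]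
  have h2 : mvfderiv (𝓡 d) (extZero (b [])) x.1 (vec a x) = 0 := by
    by_cases hi : j = 0
    · rw [vec_eq_zero fun f => by rw [ha _ (by simp; omega)]; rfl, map_zero]
    · rw [hb [] (by simp; omega), h0]
  have h3 : P.metric x.1 (mus a x) (mus b x) = 0 := by
    by_cases hi : i = 1
    · rw [mus_eq_zero (a := b) fun f => by rw [hb _ (by simp; omega)]; rfl, map_zero]
    · rw [mus_eq_zero (a := a) fun f => by rw [ha _ (by simp; omega)]; rfl, map_zero,
        LinearMap.zero_apply]
  rw [Br, h1, h2, h3]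
  simp

lemma germ_add {x : U} {f g : Fn d M} (hf : ∀ᶠ y in 𝓝 x.1, ∀ h : y ∈ U, f y = a [] ⟨y, h⟩)
    (hg : ∀ᶠ y in 𝓝 x.1, ∀ h : y ∈ U, g y = b [] ⟨y, h⟩) :
    ∀ᶠ y in 𝓝 x.1, ∀ h : y ∈ U, (f + g) y = (a + b) [] ⟨y, h⟩ := by
  filter_upwards [hf, hg] with y h1 h2 h
  change f y + g y = a [] ⟨y, h⟩ + b [] ⟨y, h⟩
  rw [h1 h, h2 h]

lemma germ_mul {x : U} {f g : Fn d M} (hf : ∀ᶠ y in 𝓝 x.1, ∀ h : y ∈ U, f y = a [] ⟨y, h⟩)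
    (hg : ∀ᶠ y in 𝓝 x.1, ∀ h : y ∈ U, g y = b [] ⟨y, h⟩) :
    ∀ᶠ y in 𝓝 x.1, ∀ h : y ∈ U, (f * g) y = (a * b) [] ⟨y, h⟩ := by
  filter_upwards [hf, hg] with y h1 h2 h
  change f y * g y = a [] ⟨y, h⟩ * b [] ⟨y, h⟩
  rw [h1 h, h2 h]

lemma Br_add_right (ha : IsPoly a) (hb : IsPoly b) (hc : IsPoly c) :
    Br a (b + c) = Br a b + Br a c := by
  ext x
  obtain ⟨f, e, -, h⟩ := Br_eq' ha x
  obtain ⟨g, hg⟩ := hb.exists_fn x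
  obtain ⟨k, hk⟩ := hc.exists_fn x
  rw [Pi.add_apply, h hb hg, h hc hk, h (hb.add hc) (germ_add hg hk)]
  have h1 : a [lf P (g + k)] x = a [lf P g] x + a [lf P k] x := (ha.rel'.isDer [] x).add g k
  rw [h1]
  change b [lf P f] x + c [lf P f] x - _ + (b [ls P e] x + c [ls P e] x) = _
  ring

lemma Br_mul_right (ha : IsPoly a) (hb : IsPoly b) (hc : IsPoly c) :
    Br a (b * c) = Br a b * c [] + b [] * Br a c := by
  ext x
  obtain ⟨f, e, -, h⟩ := Br_eq' ha x
  obtain ⟨g, hg⟩ := hb.exists_fn x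
  obtain ⟨k, hk⟩ := hc.exists_fn x
  rw [Pi.add_apply, Pi.mul_apply, Pi.mul_apply, h hb hg, h hc hk, h (hb.mul hc) (germ_mul hg hk)]
  have h1 := (ha.rel'.isDer [] x).mul g k
  simp only [hg.self_of_nhds x.2, hk.self_of_nhds x.2] at h1
  rw [h1]
  simp only [mul_cons, mul_nil, θ_nil, D_apply, Pi.add_apply, Pi.mul_apply]
  ring

/-- The weight-zero part of the bracket with an element of parity `s` is antisymmetric. -/
lemma Br_antisymm (hb : IsPoly b) {s : ℤˣ} (hs : IsPar a s) :
    Br a b = -Br (θ s b) a := by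
  ext x
  have hθ := hb.θ s
  have h1 : vec (θ s b) x = vec b x := vec_eq hθ.rel' fun f => by
    rw [vec_spec hb.rel', θ_apply]
    rcases Int.units_eq_one_or s with rfl | rfl <;> simp
  have h2 : P.metric x.1 (mus (θ s b) x) (mus a x) = -P.metric x.1 (mus a x) (mus b x) := by
    rcases Int.units_eq_one_or s with rfl | rfl
    · have h3 : mus a x = 0 := mus_eq_zero fun e => by
        have h4 := congrFun (congrFun hs [ls P e]) x
        simp only [θ_apply, wtw_cons, wt_inl, wtw_nil, add_zero, pow_one, one_smul,
          Units.neg_smul, Pi.neg_apply] at h4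
        linarith
      rw [h3, map_zero, map_zero, LinearMap.zero_apply, neg_zero]
    · have h3 : mus (θ (-1) b) x = -mus b x := mus_eq hθ.rel' fun e => by
        rw [map_neg, LinearMap.neg_apply, mus_spec hb.rel', θ_apply]
        simp
      rw [h3, map_neg, LinearMap.neg_apply, P.metric_symm]
  rw [Pi.neg_apply, Br, Br, h1, h2, θ_nil]
  ring

end

end PreCourant

end

/-! ### The Poisson bracket of polynomial functions -/

noncomputable section

namespace PreCourant

open Filter Topology Shuf VBundle

variable {d : ℕ} {M : Type u} [TopologicalSpace M] [ChartedSpace (EuclideanSpace ℝ (Fin d)) M]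
variable {P : PreCourantAlgebroid d M} {U V W : Opens M}

/-- The Poisson bracket of functions on words. -/
def pb (a b : Amb P U) : Amb P U := br Br a b

variable (P U) in
lemma stable_isPoly : Stable {a : Amb P U | IsPoly a} :=
  ⟨fun l _ ha => IsPoly.D ha l, fun s _ ha => IsPoly.θ ha s⟩

lemma D_pb (l : P.Sec ⊕ Fn d M) (a b : Amb P U) :
    D l (pb a b) = pb (D l a) b + pb (θ (sg l) a) (D l b) := rfl

lemma pb_nil (a b : Amb P U) : pb a b [] = Br a b := rfl

variable [T2Space M] [IsManifold (𝓡 d) ∞ M] {a b c : Amb P U}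

lemma pb_hom {i j : ℤ} (ha : Hom a i) (hb : Hom b j) : Hom (pb a b) (i + j - 2) :=
  Hom.br (fun _ _ _ _ ha hb h => Br_hom ha hb h) ha hb

lemma Br_add_left (ha : IsPoly a) (hb : IsPoly b) (hc : IsPoly c) :
    Br (a + b) c = Br a c + Br b c := by
  ext x
  obtain ⟨f, hf⟩ := ha.exists_fn x
  obtain ⟨g, hg⟩ := hb.exists_fn x
  obtain ⟨k, hk⟩ := hc.exists_fn x
  obtain ⟨e, he⟩ := ha.exists_sec x
  obtain ⟨e', he'⟩ := hb.exists_sec x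
  rw [Pi.add_apply, Br_eq ha hc hf hk (he.self_of_nhds x.2),
    Br_eq hb hc hg hk (he'.self_of_nhds x.2),
    Br_eq (e := e + e') (ha.add hb) hc (germ_add hf hg) hk fun e'' => ?_]
  · have h1 : c [lf P (f + g)] x = c [lf P f] x + c [lf P g] x := (hc.rel'.isDer [] x).add f g
    have h2 : c [ls P (e + e')] x = c [ls P e] x + c [ls P e'] x := (hc.rel'.isTens x).add e e'
    rw [h1, h2]
    change _ - (a [lf P k] x + b [lf P k] x) + _ = _
    ring
  · change P.metric x.1 (e x.1 + e' x.1) _ = a [ls P e''] x + b [ls P e''] x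
    rw [map_add, LinearMap.add_apply, he.self_of_nhds x.2, he'.self_of_nhds x.2]

lemma Br_const_right (ha : IsPoly a) (r : ℝ) : Br a (const fun _ => r) = 0 := by
  ext x
  obtain ⟨f, e, -, h⟩ := Br_eq' ha x
  rw [h (g := algebraMap ℝ (Fn d M) r) (isPoly_const contMDiff_const)
    (Eventually.of_forall fun y _ => rfl)]
  have h1 : a [lf P (algebraMap ℝ (Fn d M) r)] x = 0 := (ha.rel'.isDer [] x).const r
  rw [h1]
  simp

lemma rsmul_eq (r : ℝ) (a : Amb P U) : r • a = const (fun _ => r) * a := by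
  rw [const_mul]
  rfl

lemma Br_smul_right (r : ℝ) (ha : IsPoly a) (hb : IsPoly b) : Br a (r • b) = r • Br a b := by
  rw [rsmul_eq, Br_mul_right ha (isPoly_const contMDiff_const) hb, Br_const_right ha]
  ext x
  simp

lemma Br_smul_left (r : ℝ) (ha : IsPoly a) (hc : IsPoly c) : Br (r • a) c = r • Br a c := by
  ext x
  obtain ⟨f, hf⟩ := ha.exists_fn x
  obtain ⟨k, hk⟩ := hc.exists_fn x
  obtain ⟨e, he⟩ := ha.exists_sec x
  have hf' : ∀ᶠ y in 𝓝 x.1, ∀ h : y ∈ U, (algebraMap ℝ (Fn d M) r * f) y = (r • a) [] ⟨y, h⟩ := by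
    filter_upwards [hf] with y hy h
    change r * f y = r * a [] ⟨y, h⟩
    rw [hy]
  rw [Pi.smul_apply, Br_eq ha hc hf hk (he.self_of_nhds x.2),
    Br_eq (e := smulSec (algebraMap ℝ (Fn d M) r) e) (ha.rsmul r) hc hf' hk fun e'' => ?_]
  · have h1 : c [lf P (algebraMap ℝ (Fn d M) r * f)] x = r * c [lf P f] x + f x.1 *
      c [lf P (algebraMap ℝ (Fn d M) r)] x := (hc.rel'.isDer [] x).mul _ f
    have h2 : c [ls P (smulSec (algebraMap ℝ (Fn d M) r) e)] x = r * c [ls P e] x :=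
      (hc.rel'.isTens x).smul _ e
    have h3 : c [lf P (algebraMap ℝ (Fn d M) r)] x = 0 := (hc.rel'.isDer [] x).const r
    rw [h1, h2, h3]
    change _ - (r * a [lf P k] x) + _ = r * _
    ring
  · change P.metric x.1 (r • e x.1) _ = r * a [ls P e''] x
    rw [map_smul, LinearMap.smul_apply, he.self_of_nhds x.2, smul_eq_mul]

lemma pb_add_left (ha : IsPoly a) (hb : IsPoly b) (hc : IsPoly c) :
    pb (a + b) c = pb a c + pb b c :=
  br_add_left (stable_isPoly P U) (fun _ ha _ hb _ hc => Br_add_left ha hb hc) ha hb hc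

lemma pb_add_right (ha : IsPoly a) (hb : IsPoly b) (hc : IsPoly c) :
    pb a (b + c) = pb a b + pb a c :=
  br_add_right (stable_isPoly P U) (fun _ ha _ hb _ hc => Br_add_right ha hb hc) ha hb hc

lemma pb_smul_left (r : ℝ) (ha : IsPoly a) (hb : IsPoly b) : pb (r • a) b = r • pb a b :=
  br_smul_left (stable_isPoly P U) (fun r _ ha _ hb => Br_smul_left r ha hb) r ha hb

lemma pb_smul_right (r : ℝ) (ha : IsPoly a) (hb : IsPoly b) : pb a (r • b) = r • pb a b :=
  br_smul_right (stable_isPoly P U) (fun r _ ha _ hb => Br_smul_right r ha hb) r ha hb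

lemma pb_neg_left (ha : IsPoly a) (hb : IsPoly b) : pb (-a) b = -pb a b := by
  simpa using pb_smul_left (-1) ha hb

lemma pb_neg_right (ha : IsPoly a) (hb : IsPoly b) : pb a (-b) = -pb a b := by
  simpa using pb_smul_right (-1) ha hb

lemma pb_usmul_left (s : ℤˣ) (ha : IsPoly a) (hb : IsPoly b) : pb (s • a) b = s • pb a b := by
  rcases Int.units_eq_one_or s with rfl | rfl
  · simp
  · simpa using pb_neg_left ha hb

lemma pb_usmul_right (s : ℤˣ) (ha : IsPoly a) (hb : IsPoly b) : pb a (s • b) = s • pb a b := by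
  rcases Int.units_eq_one_or s with rfl | rfl
  · simp
  · simpa using pb_neg_right ha hb

lemma pb_zero_left (hb : IsPoly b) : pb 0 b = 0 := by
  simpa using pb_smul_left 0 (isPoly_zero (P := P) (U := U)) hb

lemma pb_zero_right (hb : IsPoly b) : pb b 0 = 0 := by
  simpa using pb_smul_right 0 hb (isPoly_zero (P := P) (U := U))

lemma pb_res {V : Opens M} (h : V ≤ U) (ha : IsPoly a) (hb : IsPoly b) :
    resA h (pb a b) = pb (resA h a) (resA h b) :=
  mapHom_br (resFun h) (stable_isPoly P U) (fun a _ b _ => Br_res h a b) ha hb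

lemma Br_θ (s : ℤˣ) (ha : IsPoly a) (hb : IsPoly b) : Br (θ s a) (θ s b) = Br a b := by
  rcases Int.units_eq_one_or s with rfl | rfl
  · simp
  have h1 : ∀ {b : Amb P U}, IsPoly b → ∀ x, vec (θ (-1) b) x = vec b x := fun hb x =>
    vec_eq (hb.θ _).rel' fun f => by rw [vec_spec hb.rel', θ_apply]; simp
  have h2 : ∀ {b : Amb P U}, IsPoly b → ∀ x, mus (θ (-1) b) x = -mus b x := fun hb x =>
    mus_eq (hb.θ _).rel' fun e => by
      rw [map_neg, LinearMap.neg_apply, mus_spec hb.rel', θ_apply]; simp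
  ext x
  rw [Br, Br, h1 ha, h1 hb, h2 ha, h2 hb, θ_nil, θ_nil, map_neg, map_neg, LinearMap.neg_apply,
    neg_neg]

lemma pb_θ (s : ℤˣ) (ha : IsPoly a) (hb : IsPoly b) : θ s (pb a b) = pb (θ s a) (θ s b) := by
  ext w : 1
  induction w generalizing a b with
  | nil => rw [θ_nil, pb_nil, pb_nil, Br_θ s ha hb]
  | cons l w ih =>
    change D l (θ s (pb a b)) w = D l (pb (θ s a) (θ s b)) w
    rw [D_θ, D_pb, D_pb, D_θ, D_θ, pb_usmul_left _ ((ha.D l).θ s) (hb.θ s),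
      pb_usmul_right _ ((ha.θ s).θ _) ((hb.D l).θ s), map_add, usmul_apply, Shuf.add_apply,
      ih (ha.D l) hb, ih (ha.θ _) (hb.D l), smul_add, θ_comm]
    rfl

/-- The bracket with a letter is the action of the letter. -/
lemma pb_ι (l : P.Sec ⊕ Fn d M) (ha : IsPoly a) : pb (ι U l) a = D l a := by
  ext w : 1
  induction w generalizing l a with
  | nil =>
    rw [pb_nil]
    ext x
    obtain ⟨g, hg⟩ := ha.exists_fn x
    rcases l with e | f
    · rw [Br_eq (isPoly_ι _) ha (f := 0) (e := e) (Eventually.of_forall fun y _ => rfl) hg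
        fun e' => rfl]
      have h1 : a [lf P 0] x = 0 := (ha.rel'.isDer [] x).zero
      have h2 : ι U (ls P e) [lf P g] x = 0 := rfl
      rw [h1, h2, sub_zero, zero_add]
      rfl
    · rw [Br_eq (isPoly_ι _) ha (f := f) (e := 0) (Eventually.of_forall fun y _ => rfl) hg
        fun e' => by
          change P.metric x.1 0 (e' x.1) = 0
          rw [map_zero, LinearMap.zero_apply]]
      have h1 : a [ls P 0] x = 0 := (ha.rel'.isTens x).zero
      have h2 : ι U (lf P f) [lf P g] x = 0 := rfl
      rw [h1, h2, sub_zero, add_zero]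
      rfl
  | cons l' w ih =>
    change D l' (pb (ι U l) a) w = D l' (D l a) w
    rw [D_pb]
    rcases l with e | f <;> rcases l' with e' | f'
    · have h1 : D (ls P e') (ι U (ls P e)) = ι U (lf P (P.pairing e e')) := D_hat_inl e e'
      have h2 : θ (sg (ls P e')) (ι U (ls P e)) = -ι U (ls P e) := by
        rw [sg_inl]
        have := θ_hat (P := P) (U := U) (-1) e
        rw [Units.neg_smul, one_smul] at this
        exact this
      rw [h1, h2, pb_neg_left (isPoly_ι _) (ha.D _), Shuf.add_apply, Shuf.neg_apply, ih _ ha,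
        ih _ (ha.D _), ← ha.rel'.comm_sec]
      simp
    · have h1 : D (lf P f') (ι U (ls P e)) = 0 := D_hat_inr e f'
      rw [h1, sg_inr, θ_one, pb_zero_left ha, zero_add, ih _ (ha.D _), ha.rel'.comm_sec_fn]
    · have h1 : D (ls P e') (ι U (lf P f)) = 0 := D_const _ _
      have h2 : θ (sg (ls P e')) (ι U (lf P f)) = ι U (lf P f) := θ_const _ _
      rw [h1, h2, pb_zero_left ha, zero_add, ih _ (ha.D _), ha.rel'.comm_sec_fn]
    · have h1 : D (lf P f') (ι U (lf P f)) = 0 := D_const _ _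
      rw [h1, sg_inr, θ_one, pb_zero_left ha, zero_add, ih _ (ha.D _), ha.rel'.comm_fn]

lemma pb_hat (e : P.Sec) (ha : IsPoly a) : pb (hat U e) a = D (ls P e) a := pb_ι (ls P e) ha

/-- Antisymmetry of the bracket. -/
lemma pb_antisymm (ha : IsPoly a) (hb : IsPoly b) {s : ℤˣ} (hs : IsPar a s) :
    pb a b = -pb (θ s b) a := by
  ext w : 1
  induction w generalizing a b s with
  | nil => exact Br_antisymm hb hs
  | cons l w ih =>
    change D l (pb a b) w = -D l (pb (θ s b) a) w
    rw [D_pb, D_pb, Shuf.add_apply, Shuf.add_apply, ih (ha.D l) hb (hs.D l),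
      ih (ha.θ _) (hb.D l) (hs.θ _), D_θ, hs.θ_sg, Shuf.neg_apply, Shuf.neg_apply, θ_θ,
      pb_usmul_left _ ((hb.D l).θ s) ha, pb_usmul_right _ ((hb.D l).θ s) ha, mul_comm s]
    abel

/-- The Leibniz rule. -/
lemma pb_mul (ha : IsPoly a) (hb : IsPoly b) (hc : IsPoly c) {s : ℤˣ} (hs : IsPar a s) :
    pb a (b * c) = pb a b * c + θ s b * pb a c := by
  ext w : 1
  induction w generalizing a b c s with
  | nil => simpa [pb_nil] using Br_mul_right ha hb hc
  | cons l w ih =>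
    change D l (pb a (b * c)) w = D l (pb a b * c + θ s b * pb a c) w
    have h1 := ih (ha.D l) hb hc (hs.D l)
    have h2 := ih (ha.θ (sg l)) (hb.D l) hc (hs.θ _)
    have h3 := ih (ha.θ (sg l)) (hb.θ (sg l)) (hc.D l) (hs.θ _)
    rw [D_pb, D_mul, pb_add_right (ha.θ _) ((hb.D l).mul hc) ((hb.θ _).mul (hc.D l)),
      Shuf.add_apply, Shuf.add_apply, h1, h2, h3, ← Shuf.add_apply, ← Shuf.add_apply]
    refine congrFun (?_ : (_ : Amb P U) = _) w
    rw [map_add, D_mul, D_mul, D_pb, D_pb, D_θ, pb_θ _ ha hb, hs.θ_sg,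
      pb_usmul_left _ ha hc, pb_usmul_left _ ha (hb.D l), pb_usmul_left _ ha (hb.θ _),
      pb_usmul_left _ ha (hc.D l), θ_θ, θ_θ, mul_comm s]
    simp only [add_mul, mul_add, Shuf.usmul_mul, Shuf.mul_usmul]
    abel

/-- The Leibniz rule in the first argument. -/
lemma mul_pb (ha : IsPoly a) (hb : IsPoly b) (hc : IsPoly c) {s t r : ℤˣ} (hs : IsPar a s)
    (ht : IsPar b t) (hr : IsPar c r) :
    pb (a * b) c = pb a (θ t c) * b + θ r a * pb b (θ s c) := by
  rw [pb_antisymm (ha.mul hb) hc (hs.mul ht), pb_mul (hc.θ _) ha hb (hr.θ _),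
    pb_antisymm ha (hc.θ t) hs, pb_antisymm hb (hc.θ s) ht, θ_θ, θ_θ, mul_comm t s]
  simp only [neg_mul, mul_neg, neg_add]

lemma IsPoly.exists_par (ha : IsPoly a) : ∃ a₀ a₁ : Amb P U, IsPoly a₀ ∧ IsPoly a₁ ∧
    IsPar a₀ 1 ∧ IsPar a₁ (-1) ∧ a = a₀ + a₁ := by
  refine ⟨(1 / 2 : ℝ) • (a + Shuf.θ (-1) a), (1 / 2 : ℝ) • (a - Shuf.θ (-1) a),
    (ha.add (ha.θ _)).rsmul _, (ha.sub (ha.θ _)).rsmul _, ?_, ?_, ?_⟩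
  · rw [IsPar, θ_smul', map_add, θ_θ]
    simp [add_comm]
  · rw [IsPar, θ_smul', map_sub, θ_θ]
    simp [← smul_neg]
  · rw [← smul_add]
    have : a + Shuf.θ (-1) a + (a - Shuf.θ (-1) a) = (2 : ℝ) • a := by
      rw [two_smul]; abel
    rw [this, smul_smul]
    norm_num

lemma isPar_fr (f : Fn d M) : IsPar (const (fr U f) : Amb P U) 1 := by
  rw [IsPar, θ_const, one_smul]

/-- The relations hold for a bracket. In the relations for `f • e` and `f * g`, the products
that come from `{fe, {a, b}}` agree with those in `{{fe, a}, b}` and `{a, {fe, b}}` up to the terms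
`{f, a} * {e, b}` and `{e, a} * {f, b}`, which cancel. -/
lemma rel_pb_of_par (ha : IsPoly a) (hb : IsPoly b) {s t : ℤˣ} (hs : IsPar a s) (ht : IsPar b t) :
    Rel (pb a b) := by
  have hθ : θ (-1) a = s • a := hs
  have De : ∀ (e : P.Sec) {a b : Amb P U}, D (ls P e) (pb a b) =
      pb (D (ls P e) a) b + pb (θ (-1) a) (D (ls P e) b) := fun e a b => by rw [D_pb, sg_inl]
  have Df : ∀ (f : Fn d M) {a b : Amb P U}, D (lf P f) (pb a b) =
      pb (D (lf P f) a) b + pb a (D (lf P f) b) := fun f a b => by rw [D_pb, sg_inr, θ_one]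
  have De' : ∀ (e : P.Sec), D (ls P e) (pb a b) =
      pb (D (ls P e) a) b + s • pb a (D (ls P e) b) := fun e => by
    rw [De, hθ, pb_usmul_left _ ha (hb.D _)]
  have hf := fun f : Fn d M => isPoly_ι (P := P) (U := U) (lf P f)
  have he := fun e : P.Sec => isPoly_hat (P := P) (U := U) e
  have sf : ∀ (f : Fn d M) (b : Amb P U), fr U f • b = ι U (lf P f) * b := fun f b =>
    (const_mul _ _).symm
  -- brackets with products with a letter, in either argument
  have L1 : ∀ (f : Fn d M) {y : Amb P U} {r : ℤˣ}, IsPoly y → IsPar y r →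
      pb (fr U f • y) b = y * D (lf P f) b + fr U f • pb y b := fun f y r hy hr => by
    rw [sf, mul_pb (hf f) hy hb (isPar_fr f) hr ht, pb_ι _ (hb.θ r), D_θ, θ_one,
      hr.mul_comm (D (lf P f) b), show θ t (ι U (lf P f)) = ι U (lf P f) from θ_const _ _, sf]
    simp
  have L2 : ∀ (e : P.Sec) {y : Amb P U} {r : ℤˣ}, IsPoly y → IsPar y r →
      pb (hat U e * y) b = r • (y * D (ls P e) b) + hat U e * pb y b := fun e y r hy hr => by
    have h1 : θ (-1) b = t • b := ht
    rw [mul_pb (he e) hy hb (isPar_hat e) hr ht, pb_hat _ (hb.θ r), D_θ,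
      hr.mul_comm (D (ls P e) b), θ_hat, h1,
      pb_usmul_right _ hy hb]
    simp only [Shuf.usmul_mul, Shuf.mul_usmul, smul_smul, Int.units_mul_self, one_smul, wt_inl,
      pow_one]
  have R1 : ∀ (f : Fn d M) {y : Amb P U}, IsPoly y →
      pb a (fr U f • y) = -(D (lf P f) a * y) + fr U f • pb a y := fun f y hy => by
    rw [sf, pb_mul ha (hf f) hy hs, pb_antisymm ha (hf f) hs,
      show θ s (ι U (lf P f)) = ι U (lf P f) from θ_const _ _, pb_ι _ ha, neg_mul, sf]
  have R2 : ∀ (e : P.Sec) {y : Amb P U}, IsPoly y →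
      pb a (hat U e * y) = -(s • (D (ls P e) a * y)) + s • (hat U e * pb a y) := fun e y hy => by
    have h1 : pb a (hat U e) = -(s • D (ls P e) a) := by
      rw [pb_antisymm ha (he e) hs, θ_hat, pb_usmul_left _ (he e) ha, pb_hat _ ha]
    rw [pb_mul ha (he e) hy hs, θ_hat, h1, neg_mul,
      Shuf.usmul_mul, Shuf.usmul_mul]
  have hDf := fun f => hs.D (lf P f)
  have hDe := fun e => hs.D (ls P e)
  simp only [sg_inr, mul_one] at hDf
  simp only [sg_inl, mul_neg, mul_one] at hDe
  constructor
  · intro e e'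
    rw [De', De', De', ha.rel'.add_sec, hb.rel'.add_sec, pb_add_left (ha.D _) (ha.D _) hb,
      pb_add_right ha (hb.D _) (hb.D _), smul_add]
    abel
  · intro f e
    rw [De', De', Df, ha.rel'.smul_sec, hb.rel'.smul_sec,
      pb_add_left ((ha.D _).smul (contMDiff_fr f)) ((he e).mul (ha.D _)) hb,
      pb_add_right ha ((hb.D _).smul (contMDiff_fr f)) ((he e).mul (hb.D _)),
      L1 f (ha.D _) (hDe e), L2 e (ha.D _) (hDf f), R1 f (hb.D _), R2 e (hb.D _)]
    rcases Int.units_eq_one_or s with rfl | rfl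
    · simp only [one_smul, smul_add, mul_add]
      abel
    · simp only [Units.neg_smul, one_smul, smul_add, mul_add, smul_neg, neg_neg]
      abel
  · intro f g
    rw [Df, Df, Df, ha.rel'.add_fn, hb.rel'.add_fn, pb_add_left (ha.D _) (ha.D _) hb,
      pb_add_right ha (hb.D _) (hb.D _)]
    abel
  · intro f g
    rw [Df, Df, Df, ha.rel'.mul_fn, hb.rel'.mul_fn,
      pb_add_left ((ha.D _).smul (contMDiff_fr f)) ((ha.D _).smul (contMDiff_fr g)) hb,
      pb_add_right ha ((hb.D _).smul (contMDiff_fr f)) ((hb.D _).smul (contMDiff_fr g)),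
      L1 f (ha.D _) (hDf g), L1 g (ha.D _) (hDf f), R1 f (hb.D _), R1 g (hb.D _)]
    simp only [smul_add]
    abel
  · intro c
    rw [Df, ha.rel'.const_fn, hb.rel'.const_fn, pb_zero_left hb, pb_zero_right ha, add_zero]
  · intro e e'
    have h1 : ∀ e : P.Sec, θ (-1) (D (ls P e) a) = -(s • D (ls P e) a) := fun e => by
      have := hDe e
      rw [IsPar] at this
      rw [this, Units.neg_smul]
    have h2 : ∀ e e' : P.Sec, D (ls P e) (D (ls P e') (pb a b)) =
        pb (D (ls P e) (D (ls P e') a)) b - s • pb (D (ls P e') a) (D (ls P e) b) +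
          s • pb (D (ls P e) a) (D (ls P e') b) +
          pb a (D (ls P e) (D (ls P e') b)) := fun e e' => by
      rw [De', map_add, D_usmul, De, De, h1, hθ, pb_neg_left ((ha.D _).usmul s) (hb.D _),
        pb_usmul_left _ (ha.D _) (hb.D _), pb_usmul_left _ ha ((hb.D _).D _), smul_add, smul_smul,
        Int.units_mul_self, one_smul]
      abel
    rw [h2, h2, Df, ← ha.rel'.comm_sec e e', ← hb.rel'.comm_sec e e',
      pb_add_left ((ha.D _).D _) ((ha.D _).D _) hb,
      pb_add_right ha ((hb.D _).D _) ((hb.D _).D _)]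
    abel
  · intro e f
    rw [Df, map_add, De, De, De, map_add, Df, Df, ha.rel'.comm_sec_fn, hb.rel'.comm_sec_fn,
      D_θ]
    simp only [wt_inr, Int.units_sq, one_smul]
    abel
  · intro f g
    rw [Df, Df, map_add, map_add, Df, Df, Df, Df, ha.rel'.comm_fn f g, hb.rel'.comm_fn f g]
    abel

lemma IsPoly.pb (ha : IsPoly a) (hb : IsPoly b) : IsPoly (pb a b) where
  rel w := by
    induction w generalizing a b with
    | nil =>
      obtain ⟨a₀, a₁, ha₀, ha₁, h₀, h₁, rfl⟩ := ha.exists_par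
      obtain ⟨b₀, b₁, hb₀, hb₁, k₀, k₁, rfl⟩ := hb.exists_par
      rw [pb_add_left ha₀ ha₁ hb, pb_add_right ha₀ hb₀ hb₁, pb_add_right ha₁ hb₀ hb₁]
      exact ((rel_pb_of_par ha₀ hb₀ h₀ k₀).add (rel_pb_of_par ha₀ hb₁ h₀ k₁)).add
        ((rel_pb_of_par ha₁ hb₀ h₁ k₀).add (rel_pb_of_par ha₁ hb₁ h₁ k₁))
    | cons l w ih =>
      rw [Dw, D_pb, Dw_add]
      exact (ih (ha.D l) hb).add (ih (ha.θ _) (hb.D l))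
  bdd := by
    have h0 : ∀ {a : Amb P U} {n : ℕ}, (∀ w, n < wtw w → a w = 0) →
        ∀ l, ∀ w, n - Weighted.wt l < wtw w → Shuf.D l a w = 0 := fun h l w hw =>
      h _ (by rw [wtw_cons]; omega)
    obtain ⟨n, hn⟩ := ha.bdd
    obtain ⟨m, hm⟩ := hb.bdd
    refine ⟨n + m, fun w => ?_⟩
    have hz : ∀ {a b : Amb P U}, IsPoly a → IsPoly b → (∀ w, a w = 0) ∨ (∀ w, b w = 0) →
        PreCourant.pb a b = 0 := by
      rintro a b ha hb (h | h)
      · rw [show a = 0 from Shuf.ext h, pb_zero_left hb]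
      · rw [show b = 0 from Shuf.ext h, pb_zero_right ha]
    induction w generalizing a b n m with
    | nil => intro hw; simp at hw
    | cons l w ih =>
      intro hw
      rw [wtw_cons] at hw
      change (PreCourant.pb (Shuf.D l a) b + PreCourant.pb (Shuf.θ (sg l) a) (Shuf.D l b)) w = 0
      have h1 : PreCourant.pb (Shuf.D l a) b w = 0 := by
        by_cases hl : Weighted.wt l ≤ n
        · exact ih (ha.D l) hb _ (h0 hn l) m hm (by omega)
        · rw [hz (ha.D l) hb (.inl fun w => hn _ (by rw [wtw_cons]; omega)), Shuf.zero_apply]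
      have h2 : PreCourant.pb (Shuf.θ (sg l) a) (Shuf.D l b) w = 0 := by
        by_cases hl : Weighted.wt l ≤ m
        · exact ih (ha.θ _) (hb.D l) n (fun w hw => by rw [θ_apply, hn w hw, smul_zero]) _
            (h0 hm l) (by omega)
        · rw [hz (ha.θ _) (hb.D l) (.inr fun w => hm _ (by rw [wtw_cons]; omega)),
            Shuf.zero_apply]
      rw [Shuf.add_apply, h1, h2, add_zero]
  smooth w := by
    induction w generalizing a b with
    | nil => exact Br_smooth ha hb
    | cons l w ih => exact (ih (ha.D l) hb).add (ih (ha.θ _) (hb.D l))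

end PreCourant

end

/-! ### The Jacobi identity -/

noncomputable section

namespace PreCourant

open Filter Topology Shuf VBundle

variable {d : ℕ} {M : Type u} [TopologicalSpace M] [ChartedSpace (EuclideanSpace ℝ (Fin d)) M]
variable {P : PreCourantAlgebroid d M} {U V W : Opens M}

lemma θ_ι (s : ℤˣ) (l : P.Sec ⊕ Fn d M) : θ s (ι U l) = s ^ Weighted.wt l • ι U l := by
  cases l with
  | inl e => rw [wt_inl, pow_one]; exact θ_hat s e
  | inr f =>
    rw [wt_inr, Int.units_sq, one_smul]
    exact θ_const _ _

lemma isPar_ι (l : P.Sec ⊕ Fn d M) : IsPar (ι U l) (sg l) := θ_ι _ _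

lemma IsPar.eq_zero_of_ne {a : Amb P U} {s t : ℤˣ} (hs : IsPar a s) (ht : IsPar a t) (h : s ≠ t) :
    a = 0 := by
  have h1 : (1 : ℤˣ) • a = (-1 : ℤˣ) • a := by
    rcases Int.units_eq_one_or s with rfl | rfl <;> rcases Int.units_eq_one_or t with rfl | rfl
    · exact absurd rfl h
    · exact hs.symm.trans ht
    · exact ht.symm.trans hs
    · exact absurd rfl h
  ext w x
  have h2 := congrFun (congrFun h1 w) x
  simp only [one_smul, Units.neg_smul, Shuf.neg_apply, Pi.neg_apply] at h2
  simp only [Shuf.zero_apply, Pi.zero_apply]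
  linarith

lemma IsPoly.exists_sum_proj {a : Amb P U} (ha : IsPoly a) :
    ∃ n : ℕ, a = ∑ k ∈ Finset.range n, Shuf.proj (k : ℤ) a := by
  obtain ⟨n, hn⟩ := ha.bdd
  refine ⟨n + 1, ?_⟩
  ext w : 1
  rw [Shuf.sum_apply]
  by_cases hw : n < wtw w
  · rw [hn w hw]
    refine (Finset.sum_eq_zero fun k hk => ?_).symm
    rw [proj_apply, hn w hw, ite_self]
  · rw [Finset.sum_eq_single_of_mem (wtw w) (by simp; omega)]
    · rw [proj_apply, if_pos rfl]
    · intro k _ hk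
      rw [proj_apply, if_neg (by exact_mod_cast hk.symm)]

/-- A property of polynomial functions follows from the homogeneous case by additivity. -/
lemma IsPoly.hom_induction {p : Amb P U → Prop} (h0 : p 0)
    (hadd : ∀ a b, IsPoly a → IsPoly b → p a → p b → p (a + b))
    (hhom : ∀ (a : Amb P U) (k : ℕ), IsPoly a → Hom a k → p a) {a : Amb P U} (ha : IsPoly a) :
    p a := by
  obtain ⟨n, hn⟩ := ha.exists_sum_proj
  rw [hn]
  suffices h : ∀ n : ℕ, IsPoly (∑ k ∈ Finset.range n, Shuf.proj (k : ℤ) a) ∧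
      p (∑ k ∈ Finset.range n, Shuf.proj (k : ℤ) a) from (h n).2
  intro n
  induction n with
  | zero => exact ⟨by simpa using isPoly_zero, by simpa using h0⟩
  | succ n ih =>
    rw [Finset.sum_range_succ]
    exact ⟨ih.1.add (ha.proj n), hadd _ _ ih.1 (ha.proj n) ih.2 (hhom _ n (ha.proj n) (hom_proj _ _))⟩

variable [T2Space M] [IsManifold (𝓡 d) ∞ M] {a b c : Amb P U}

/-- Around every point a function of weight at most one is a letter. -/
lemma exists_letter (ha : IsPoly a) {i : ℤ} (hi : Hom a i) (h : i ≤ 1) (x : U) :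
    ∃ (V : Opens M) (hV : V ≤ U), x.1 ∈ V ∧ ∃ l, resA hV a = ι V l := by
  have hrest : ∀ (w : List (P.Sec ⊕ Fn d M)) (l : P.Sec ⊕ Fn d M), 1 < wtw (l :: w) →
      a (l :: w) = 0 := fun w l hw => hi _ (by omega)
  rcases lt_or_ge i 1 with hi1 | hi1
  · obtain ⟨f, hf⟩ := ha.exists_fn x
    obtain ⟨V, hV, hVo, hx⟩ := eventually_nhds_iff.1 hf
    refine ⟨⟨V, hVo⟩ ⊓ U, inf_le_right, ⟨hx, x.2⟩, lf P f, ?_⟩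
    ext w y
    rw [resA_apply]
    match w with
    | [] => exact (hV y.1 y.2.1 y.2.2).symm
    | l :: w =>
      rw [hi (l :: w) (by rw [wtw_cons]; rcases l with e | f <;> push_cast <;> simp <;> omega)]
      rfl
  · obtain rfl : i = 1 := le_antisymm h hi1
    obtain ⟨e, he⟩ := ha.exists_sec x
    obtain ⟨V, hV, hVo, hx⟩ := eventually_nhds_iff.1 he
    refine ⟨⟨V, hVo⟩ ⊓ U, inf_le_right, ⟨hx, x.2⟩, ls P e, ?_⟩
    ext w y
    rw [resA_apply]
    match w with
    | [] =>
      rw [hi [] (by simp)]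
      rfl
    | [Sum.inl e'] => exact (hV y.1 y.2.1 y.2.2 e').symm
    | [Sum.inr f] =>
      rw [hrest _ _ (by simp)]
      rfl
    | l :: l' :: w =>
      rw [hrest _ _ (by rcases l with e | f <;> rcases l' with e' | f' <;> simp <;> omega)]
      exact (congrFun (hat_cons_cons e l l' w) y).symm

lemma pb_ι_right (l : P.Sec ⊕ Fn d M) (ha : IsPoly a) {s : ℤˣ} (hs : IsPar a s) :
    pb a (ι U l) = -(s ^ Weighted.wt l • D l a) := by
  rw [pb_antisymm ha (isPoly_ι l) hs, θ_ι, pb_usmul_left _ (isPoly_ι l) ha, pb_ι l ha]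

/-- The Jacobi identity when one of the functions is a letter. -/
lemma jacobi_letter (ha : IsPoly a) (hb : IsPoly b) (hc : IsPoly c) {s t : ℤˣ} (hs : IsPar a s)
    (ht : IsPar b t) (h : ∃ l, a = ι U l ∨ b = ι U l ∨ c = ι U l) :
    pb a (pb b c) = pb (pb a b) c + pb (θ s b) (pb a c) := by
  obtain ⟨l, rfl | rfl | rfl⟩ := h
  · by_cases hl : s = sg l
    · rw [pb_ι l (hb.pb hc), pb_ι l hb, pb_ι l hc, hl, D_pb]
    · rw [IsPar.eq_zero_of_ne hs (isPar_ι l) hl, pb_zero_left (hb.pb hc), pb_zero_left hb,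
        pb_zero_left hc, pb_zero_right (hb.θ s), add_zero]
  · rw [pb_ι l hc, pb_ι_right l ha hs, θ_ι, pb_usmul_left _ (isPoly_ι l) (ha.pb hc),
      pb_ι l (ha.pb hc), D_pb, hs.θ_sg, pb_neg_left ((ha.D l).usmul _) hc,
      pb_usmul_left _ (ha.D l) hc, pb_usmul_left _ ha (hc.D l), smul_add, smul_smul,
      ← mul_pow, Int.units_mul_self, one_pow, one_smul]
    abel
  · have h1 := pb_antisymm (ha.D l) hb (hs.D l)
    rw [← θ_θ, ht.θ_sg, θ_usmul, pb_usmul_left _ (hb.θ s) (ha.D l)] at h1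
    have h2 : IsPar (pb a b) (s * t) := by
      unfold IsPar
      rw [pb_θ _ ha hb, show θ (-1) a = s • a from hs, show θ (-1) b = t • b from ht,
        pb_usmul_left _ ha (hb.usmul t), pb_usmul_right _ ha hb, smul_smul]
    rw [pb_ι_right l hb ht, pb_ι_right l ha hs, pb_ι_right l (ha.pb hb) h2, D_pb, hs.θ_sg, h1,
      pb_usmul_left _ ha (hb.D l), pb_neg_right ha ((hb.D l).usmul _), pb_usmul_right _ ha (hb.D l),
      pb_neg_right (hb.θ s) ((ha.D l).usmul _), pb_usmul_right _ (hb.θ s) (ha.D l), smul_add,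
      smul_neg, smul_smul, smul_smul, mul_pow]
    have h3 : s ^ Weighted.wt l * t ^ Weighted.wt l * t ^ Weighted.wt l = s ^ Weighted.wt l := by
      rw [mul_assoc, ← mul_pow t, Int.units_mul_self, one_pow, mul_one]
    have h4 : s ^ Weighted.wt l * t ^ Weighted.wt l * s ^ Weighted.wt l = t ^ Weighted.wt l := by
      rw [mul_right_comm, ← mul_pow s, Int.units_mul_self, one_pow, one_mul]
    rw [h3, h4]
    abel

/-- The Jacobi identity for homogeneous functions. At the empty word it is trivial unless the
weights add up to four, and then one of the functions has weight at most one. -/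
lemma jacobi_hom (ha : IsPoly a) (hb : IsPoly b) (hc : IsPoly c) {s t : ℤˣ} (hs : IsPar a s)
    (ht : IsPar b t) {i j k : ℤ} (hi : Hom a i) (hj : Hom b j) (hk : Hom c k) :
    pb a (pb b c) = pb (pb a b) c + pb (θ s b) (pb a c) := by
  ext w : 1
  induction w generalizing a b c s t i j k with
  | nil =>
    by_cases h4 : i + j + k = 4
    · ext x
      have key : ∃ (V : Opens M) (hV : V ≤ U), x.1 ∈ V ∧
          ∃ l, resA hV a = ι V l ∨ resA hV b = ι V l ∨ resA hV c = ι V l := by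
        rcases (by omega : i ≤ 1 ∨ j ≤ 1 ∨ k ≤ 1) with h | h | h
        · obtain ⟨V, hV, hx, l, hl⟩ := exists_letter ha hi h x
          exact ⟨V, hV, hx, l, .inl hl⟩
        · obtain ⟨V, hV, hx, l, hl⟩ := exists_letter hb hj h x
          exact ⟨V, hV, hx, l, .inr (.inl hl)⟩
        · obtain ⟨V, hV, hx, l, hl⟩ := exists_letter hc hk h x
          exact ⟨V, hV, hx, l, .inr (.inr hl)⟩
      obtain ⟨V, hV, hx, l, hl⟩ := key
      have h1 : IsPar (resA hV a) s := by
        unfold IsPar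
        rw [← resA_θ, hs]
        exact mapHom_usmul _ _ _
      have h2 : IsPar (resA hV b) t := by
        unfold IsPar
        rw [← resA_θ, ht]
        exact mapHom_usmul _ _ _
      have h3 := jacobi_letter (ha.res hV) (hb.res hV) (hc.res hV) h1 h2 ⟨l, hl⟩
      rw [← resA_θ, ← pb_res hV hb hc, ← pb_res hV ha hb, ← pb_res hV ha hc,
        ← pb_res hV ha (hb.pb hc), ← pb_res hV (ha.pb hb) hc, ← pb_res hV (hb.θ s) (ha.pb hc),
        ← resA_add] at h3
      exact congrFun (congrFun h3 []) ⟨x.1, hx⟩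
    · rw [Shuf.add_apply, pb_hom hi (pb_hom hj hk) [] (by simp; omega),
        pb_hom (pb_hom hi hj) hk [] (by simp; omega),
        pb_hom (hj.θ s) (pb_hom hi hk) [] (by simp; omega), add_zero]
  | cons l w ih =>
    change D l (pb a (pb b c)) w = D l (pb (pb a b) c + pb (θ s b) (pb a c)) w
    have h1 := ih (ha.D l) hb hc (hs.D l) ht (hi.D l) hj hk
    have h2 := ih (ha.θ (sg l)) (hb.D l) hc (hs.θ _) (ht.D l) (hi.θ _) (hj.D l) hk
    have h3 := ih (ha.θ (sg l)) (hb.θ (sg l)) (hc.D l) (hs.θ _) (ht.θ _) (hi.θ _) (hj.θ _) (hk.D l)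
    rw [D_pb, D_pb, pb_add_right (ha.θ _) ((hb.D l).pb hc) ((hb.θ _).pb (hc.D l)),
      Shuf.add_apply, Shuf.add_apply, h1, h2, h3, ← Shuf.add_apply, ← Shuf.add_apply]
    refine congrFun (?_ : (_ : Amb P U) = _) w
    rw [map_add, D_pb, D_pb, D_pb, D_pb, D_θ, pb_θ _ ha hb, hs.θ_sg, θ_θ, θ_θ, mul_comm (sg l) s,
      pb_add_left ((ha.D l).pb hb) ((ha.usmul _).pb (hb.D l)) hc,
      pb_add_right (hb.θ _) ((ha.D l).pb hc) ((ha.usmul _).pb (hc.D l)),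
      pb_usmul_left _ ((hb.D l).θ s) (ha.pb hc), pb_usmul_left _ ha hc,
      pb_usmul_right _ ((hb.D l).θ s) (ha.pb hc)]
    abel

/-- The Jacobi identity. -/
lemma jacobi (ha : IsPoly a) (hb : IsPoly b) (hc : IsPoly c) {i j : ℕ} (hi : Hom a i)
    (hj : Hom b j) : pb a (pb b c) = pb (pb a b) c + pb (θ ((-1) ^ i) b) (pb a c) := by
  refine IsPoly.hom_induction (p := fun c =>
    pb a (pb b c) = pb (pb a b) c + pb (θ ((-1) ^ i) b) (pb a c)) ?_ ?_ ?_ hc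
  · rw [pb_zero_right hb, pb_zero_right ha, pb_zero_right (ha.pb hb), pb_zero_right (hb.θ _),
      add_zero]
  · intro c e hc he h1 h2
    rw [pb_add_right hb hc he, pb_add_right ha (hb.pb hc) (hb.pb he), h1, h2,
      pb_add_right (ha.pb hb) hc he, pb_add_right ha hc he,
      pb_add_right (hb.θ _) (ha.pb hc) (ha.pb he)]
    abel
  · intro c k hc hk
    exact jacobi_hom ha hb hc hi.isPar hj.isPar hi hj hk

end PreCourant

end

/-! ### Monomials in coordinates of weight one and two -/

noncomputable section

namespace PreCourant

/-- Generators `ξ` and `p` of weight one and two of a graded commutative algebra over its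
weight-zero part `R`, with derivations `dp` and `dξ` dual to them, such that an element of positive
weight is zero if all of these derivations kill it. The derivations `dξ` may fail to kill the
generators `p`, and to anticommute, except on the common kernel of the `dp`. Only those instances
of the Leibniz rule are recorded where the first factor is a generator. -/
structure DualCoord (R A : Type*) [CommRing R] [Ring A] [Algebra R A] (q r : ℕ) where
  ξ : Fin q → A
  p : Fin r → A
  dξ : Fin q → A →ₗ[R] A
  dp : Fin r → A →ₗ[R] A
  /-- The elements of a given weight. -/
  Wt : ℕ → Submodule R A
  isUnit_natCast : ∀ n : ℕ, n ≠ 0 → IsUnit (n : R)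
  ξ_ξ : ∀ i j, ξ i * ξ j = -(ξ j * ξ i)
  p_ξ : ∀ a i, p a * ξ i = ξ i * p a
  p_p : ∀ a b, p a * p b = p b * p a
  dξ_one : ∀ i, dξ i 1 = 0
  dp_one : ∀ a, dp a 1 = 0
  dξ_ξ_mul : ∀ i j x, dξ i (ξ j * x) = (if i = j then x else 0) - ξ j * dξ i x
  dp_ξ_mul : ∀ a j x, dp a (ξ j * x) = ξ j * dp a x
  dp_p_mul : ∀ a b x, dp a (p b * x) = (if a = b then x else 0) + p b * dp a x
  dp_dp : ∀ a b x, dp a (dp b x) = dp b (dp a x)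
  dp_dξ : ∀ a i x, dp a (dξ i x) = dξ i (dp a x)
  dξ_dξ : ∀ i j x, (∀ a, dp a x = 0) → dξ i (dξ j x) = -dξ j (dξ i x)
  dξ_wt : ∀ i k, ∀ x ∈ Wt (k + 1), dξ i x ∈ Wt k
  dξ_zero : ∀ i, ∀ x ∈ Wt 0, dξ i x = 0
  dp_wt : ∀ a k, ∀ x ∈ Wt (k + 2), dp a x ∈ Wt k
  dp_low : ∀ a k, k < 2 → ∀ x ∈ Wt k, dp a x = 0
  ξ_wt : ∀ i k, ∀ x ∈ Wt k, ξ i * x ∈ Wt (k + 1)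
  p_wt : ∀ a k, ∀ x ∈ Wt k, p a * x ∈ Wt (k + 2)
  wt_zero : ∀ x ∈ Wt 0, ∃ f : R, algebraMap R A f = x
  injective : Function.Injective (algebraMap R A)
  iSup_wt : ∀ x, x ∈ ⨆ k, Wt k
  sep : ∀ k, k ≠ 0 → ∀ x ∈ Wt k, (∀ i, dξ i x = 0) → (∀ a, dp a x = 0) → x = 0

/-- The product of the factors of a monomial of weight one that occur in a list. -/
def prodξ {A : Type*} [Monoid A] {q : ℕ} (ξ : Fin q → A) (S : Finset (Fin q)) (l : List (Fin q)) :
    A := (l.map fun i => if i ∈ S then ξ i else 1).prod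

/-- The product of the factors of a monomial of weight two that occur in a list. -/
def prodp {A : Type*} [Monoid A] {r : ℕ} (p : Fin r → A) (α : Fin r → ℕ) (l : List (Fin r)) : A :=
  (l.map fun a => p a ^ α a).prod

lemma monomial_eq {A : Type u} [Ring A] {q r : ℕ} (ξ : Fin q → A) (p : Fin r → A)
    (S : Finset (Fin q)) (α : Fin r → ℕ) :
    monomial ξ p (S, α) = prodξ ξ S (List.finRange q) * prodp p α (List.finRange r) := by
  rw [monomial, prodξ, prodp, List.ofFn_eq_map, List.ofFn_eq_map]

namespace DualCoord

variable {R : Type*} {A : Type u} [CommRing R] [Ring A] [Algebra R A] {q r : ℕ}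
variable (Z : DualCoord R A q r)

lemma smul_cancel (Z : DualCoord R A q r) {n : ℕ} (hn : n ≠ 0) {x y : A} (h : n • x = n • y) :
    x = y := by
  obtain ⟨u, hu⟩ := Z.isUnit_natCast n hn
  have h1 : ∀ z : A, (u⁻¹ : Rˣ) • n • z = z := fun z => by
    rw [← Nat.cast_smul_eq_nsmul R, ← hu]
    exact inv_smul_smul u z
  rw [← h1 x, h, h1]

lemma ξ_sq (i : Fin q) : Z.ξ i * Z.ξ i = 0 := by
  refine Z.smul_cancel two_ne_zero ?_
  rw [two_smul, smul_zero]
  nth_rewrite 2 [Z.ξ_ξ i i]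
  exact add_neg_cancel _

lemma ξ_mul_prodξ {i : Fin q} {S : Finset (Fin q)} (hi : i ∉ S) {l : List (Fin q)} (hl : l.Nodup)
    (hil : i ∈ l) : ∃ s : ℤˣ, Z.ξ i * prodξ Z.ξ S l = s • prodξ Z.ξ (insert i S) l := by
  induction l with
  | nil => simp at hil
  | cons j l ih =>
    rw [List.nodup_cons] at hl
    by_cases hij : i = j
    · subst hij
      refine ⟨1, ?_⟩
      simp only [prodξ, List.map_cons, List.prod_cons, hi, if_false, one_mul,
        Finset.mem_insert_self, if_true, one_smul]
      congr 2
      refine List.map_congr_left fun k hk => ?_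
      have : k ≠ i := fun h => hl.1 (h ▸ hk)
      simp [this]
    · obtain ⟨s, hs⟩ := ih hl.2 (by simpa [hij] using hil)
      simp only [prodξ, List.map_cons, List.prod_cons] at hs ⊢
      have hj : j ∈ insert i S ↔ j ∈ S := by simp [Ne.symm hij]
      simp only [hj]
      split_ifs
      · refine ⟨-s, ?_⟩
        rw [← mul_assoc, Z.ξ_ξ, neg_mul, mul_assoc, hs, Units.neg_smul, mul_smul_comm]
      · exact ⟨s, by rw [one_mul, one_mul, hs]⟩

lemma ξ_mul_prodξ_self {i : Fin q} {S : Finset (Fin q)} (hi : i ∈ S) {l : List (Fin q)}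
    (hl : l.Nodup) (hil : i ∈ l) : Z.ξ i * prodξ Z.ξ S l = 0 := by
  induction l with
  | nil => simp at hil
  | cons j l ih =>
    rw [List.nodup_cons] at hl
    simp only [prodξ, List.map_cons, List.prod_cons] at ih ⊢
    by_cases hij : i = j
    · subst hij
      rw [if_pos hi, ← mul_assoc, Z.ξ_sq, zero_mul]
    · have := ih hl.2 (by simpa [hij] using hil)
      split_ifs
      · rw [← mul_assoc, Z.ξ_ξ, neg_mul, mul_assoc, this, mul_zero, neg_zero]
      · rw [one_mul, this]

lemma p_mul_prodξ (a : Fin r) (S : Finset (Fin q)) (l : List (Fin q)) :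
    Z.p a * prodξ Z.ξ S l = prodξ Z.ξ S l * Z.p a := by
  refine (Commute.list_prod_right _ (Z.p a) fun x hx => ?_ :
    Commute (Z.p a) (prodξ Z.ξ S l))
  obtain ⟨i, -, rfl⟩ := List.mem_map.1 hx
  split_ifs
  · exact Z.p_ξ a i
  · exact Commute.one_right _

lemma p_mul_prodp (b : Fin r) (α : Fin r → ℕ) {l : List (Fin r)} (hl : l.Nodup) (hb : b ∈ l) :
    Z.p b * prodp Z.p α l = prodp Z.p (α + Pi.single b 1) l := by
  induction l with
  | nil => simp at hb
  | cons c l ih =>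
    rw [List.nodup_cons] at hl
    simp only [prodp, List.map_cons, List.prod_cons] at ih ⊢
    by_cases hbc : b = c
    · subst hbc
      rw [← mul_assoc, Pi.add_apply, Pi.single_eq_same, pow_succ']
      congr 2
      refine List.map_congr_left fun k hk => ?_
      have : k ≠ b := fun h => hl.1 (h ▸ hk)
      rw [Pi.add_apply, Pi.single_eq_of_ne this, add_zero]
    · have := ih hl.2 (by simpa [hbc] using hb)
      rw [Pi.add_apply, Pi.single_eq_of_ne (Ne.symm hbc), add_zero, ← this, ← mul_assoc,
        ← mul_assoc, ((show Commute (Z.p b) (Z.p c) from Z.p_p b c).pow_right (α c)).eq]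

/-- The span of the monomials. -/
def span : Submodule R A := Submodule.span R (Set.range (monomial Z.ξ Z.p))

lemma mem_span (m : Finset (Fin q) × (Fin r → ℕ)) : monomial Z.ξ Z.p m ∈ Z.span :=
  Submodule.subset_span ⟨m, rfl⟩

lemma mul_mem_span {y : A} (hy : ∀ m, y * monomial Z.ξ Z.p m ∈ Z.span) {x : A} (hx : x ∈ Z.span) :
    y * x ∈ Z.span := by
  refine (Submodule.span_le (p := Z.span.comap (LinearMap.mulLeft R y))).2 ?_ hx
  rintro _ ⟨m, rfl⟩
  exact hy m

lemma ξ_mul_mem (i : Fin q) {x : A} (hx : x ∈ Z.span) : Z.ξ i * x ∈ Z.span := by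
  refine Z.mul_mem_span (fun ⟨S, α⟩ => ?_) hx
  rw [monomial_eq, ← mul_assoc]
  by_cases hi : i ∈ S
  · rw [Z.ξ_mul_prodξ_self hi (List.nodup_finRange q) (List.mem_finRange i), zero_mul]
    exact Z.span.zero_mem
  · obtain ⟨s, hs⟩ := Z.ξ_mul_prodξ hi (List.nodup_finRange q) (List.mem_finRange i)
    rw [hs, smul_mul_assoc, ← monomial_eq]
    rcases Int.units_eq_one_or s with rfl | rfl
    · rw [one_smul]; exact Z.mem_span _
    · rw [Units.neg_smul, one_smul]; exact Z.span.neg_mem (Z.mem_span _)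

lemma p_mul_mem (a : Fin r) {x : A} (hx : x ∈ Z.span) : Z.p a * x ∈ Z.span := by
  refine Z.mul_mem_span (fun ⟨S, α⟩ => ?_) hx
  rw [monomial_eq, ← mul_assoc, Z.p_mul_prodξ, mul_assoc,
    Z.p_mul_prodp a α (List.nodup_finRange r) (List.mem_finRange a), ← monomial_eq]
  exact Z.mem_span _

lemma monomial_zero : monomial Z.ξ Z.p (∅, 0) = 1 := by
  rw [monomial_eq]
  simp [prodξ, prodp]

lemma mem_span_of_nsmul {n : ℕ} (hn : n ≠ 0) {x : A} (h : n • x ∈ Z.span) : x ∈ Z.span := by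
  obtain ⟨u, hu⟩ := Z.isUnit_natCast n hn
  have := Z.span.smul_mem ((u⁻¹ : Rˣ) : R) h
  rwa [← Nat.cast_smul_eq_nsmul R, ← hu, ← Units.smul_def, ← Units.smul_def, inv_smul_smul] at this

/-- On the common kernel of the `dp`, the Euler field of the generators of weight one multiplies
by the weight. -/
lemma euler_ξ (k : ℕ) {x : A} (hx : x ∈ Z.Wt k) (h : ∀ a, Z.dp a x = 0) :
    ∑ i, Z.ξ i * Z.dξ i x = k • x := by
  induction k generalizing x with
  | zero => simp [Z.dξ_zero _ x hx]
  | succ k ih =>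
    refine sub_eq_zero.1 (Z.sep (k + 1) k.succ_ne_zero _ (Submodule.sub_mem _
      (Submodule.sum_mem _ fun i _ => Z.ξ_wt i k _ (Z.dξ_wt i k x hx))
      (nsmul_mem hx _)) (fun j => ?_) fun a => ?_)
    · have h1 := ih (Z.dξ_wt j k x hx) fun a => by rw [Z.dp_dξ, h a, map_zero]
      have h2 : ∀ i, Z.dξ j (Z.dξ i x) = -Z.dξ i (Z.dξ j x) := fun i => Z.dξ_dξ j i x h
      rw [map_sub, map_sum, map_nsmul, succ_nsmul, ← h1]
      simp only [Z.dξ_ξ_mul, h2, mul_neg, sub_neg_eq_add, Finset.sum_add_distrib,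
        Finset.sum_ite_eq, Finset.mem_univ, if_true]
      abel
    · rw [map_sub, map_sum, map_nsmul, h a, smul_zero, sub_zero]
      refine Finset.sum_eq_zero fun i _ => ?_
      rw [Z.dp_ξ_mul, Z.dp_dξ, h a, map_zero, mul_zero]

/-- The Euler field of the generators of weight two. -/
def eulerP : A →ₗ[R] A := ∑ b, LinearMap.mulLeft R (Z.p b) ∘ₗ Z.dp b

lemma eulerP_apply (x : A) : Z.eulerP x = ∑ b, Z.p b * Z.dp b x := by
  simp [eulerP, LinearMap.sum_apply]

lemma dp_eulerP (c : Fin r) (x : A) : Z.dp c (Z.eulerP x) = Z.dp c x + Z.eulerP (Z.dp c x) := by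
  simp only [eulerP_apply, map_sum, Z.dp_p_mul, Finset.sum_add_distrib, Finset.sum_ite_eq,
    Finset.mem_univ, if_true, Z.dp_dp c]

/-- Elements killed by any `m` of the derivations `dp`. -/
def Nil : ℕ → A → Prop
  | 0, x => x = 0
  | m + 1, x => ∀ b, Nil m (Z.dp b x)

/-- The Euler field multiplies polynomials of degree at most `m` in the generators of weight two
by `m`, up to polynomials of lower degree. -/
lemma nil_eulerP (m : ℕ) {x : A} (h : Z.Nil (m + 1) x) : Z.Nil m (Z.eulerP x - m • x) := by
  induction m generalizing x with
  | zero =>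
    have h' : ∀ b, Z.dp b x = 0 := h
    simp [Nil, eulerP_apply, h']
  | succ m ih =>
    intro c
    have := ih (h c)
    rw [map_sub, map_nsmul, dp_eulerP, succ_nsmul]
    rwa [show Z.dp c x + Z.eulerP (Z.dp c x) - (m • Z.dp c x + Z.dp c x) =
      Z.eulerP (Z.dp c x) - m • Z.dp c x by abel]

lemma nil_zero (m : ℕ) : Z.Nil m 0 := by
  induction m with
  | zero => rfl
  | succ m ih => intro b; rwa [map_zero]

lemma nil_of_wt (k : ℕ) {x : A} (hx : x ∈ Z.Wt k) : Z.Nil (k + 1) x := by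
  induction k using Nat.strong_induction_on generalizing x with
  | _ k ih =>
    intro b
    by_cases hk : k < 2
    · rw [Z.dp_low b k hk x hx]
      exact Z.nil_zero _
    · obtain ⟨l, rfl⟩ : ∃ l, k = l + 2 := ⟨k - 2, by omega⟩
      have := ih l (by omega) (Z.dp_wt b l x hx)
      exact fun c => ih' Z l (this c)
where
  ih' (Z : DualCoord R A q r) (m : ℕ) {x : A} (h : Z.Nil m x) : Z.Nil (m + 1) x := by
    induction m generalizing x with
    | zero => rw [show x = 0 from h]; exact Z.nil_zero _
    | succ m ih => exact fun b => ih (h b)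

/-- Homogeneous elements are combinations of monomials: by induction on the weight, and for a given
weight on the degree in the generators of weight two, with an Euler field in each step. -/
lemma mem_span_of_wt (k : ℕ) {x : A} (hx : x ∈ Z.Wt k) : x ∈ Z.span := by
  induction k using Nat.strong_induction_on generalizing x with
  | _ k ih =>
    suffices h : ∀ (m : ℕ) (x : A), x ∈ Z.Wt k → Z.Nil m x → x ∈ Z.span from
      h _ x hx (Z.nil_of_wt k hx)
    have hdp : ∀ x ∈ Z.Wt k, ∀ b, Z.dp b x ∈ Z.span := fun x hx b => by
      by_cases hk : k < 2
      · rw [Z.dp_low b k hk x hx]; exact Z.span.zero_mem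
      · obtain ⟨l, rfl⟩ : ∃ l, k = l + 2 := ⟨k - 2, by omega⟩
        exact ih l (by omega) (Z.dp_wt b l x hx)
    have hdp' : ∀ x ∈ Z.Wt k, ∀ b, Z.p b * Z.dp b x ∈ Z.Wt k := fun x hx b => by
      by_cases hk : k < 2
      · rw [Z.dp_low b k hk x hx, mul_zero]; exact Submodule.zero_mem _
      · obtain ⟨l, rfl⟩ : ∃ l, k = l + 2 := ⟨k - 2, by omega⟩
        exact Z.p_wt b l _ (Z.dp_wt b l x hx)
    intro m
    induction m with
    | zero =>
      intro x _ h
      rw [show x = 0 from h]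
      exact Z.span.zero_mem
    | succ m ihm =>
      intro x hx h
      rcases Nat.eq_zero_or_pos m with rfl | hm
      -- All `dp` kill `x`: the Euler field of the generators of weight one applies.
      · rcases Nat.eq_zero_or_pos k with rfl | hk
        · obtain ⟨f, rfl⟩ := Z.wt_zero x hx
          rw [Algebra.algebraMap_eq_smul_one, ← Z.monomial_zero]
          exact Z.span.smul_mem _ (Z.mem_span _)
        · refine Z.mem_span_of_nsmul hk.ne' ?_
          rw [← Z.euler_ξ k hx h]
          obtain ⟨l, rfl⟩ : ∃ l, k = l + 1 := ⟨k - 1, by omega⟩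
          exact Submodule.sum_mem _ fun i _ =>
            Z.ξ_mul_mem i (ih l (by omega) (Z.dξ_wt i l x hx))
      · refine Z.mem_span_of_nsmul hm.ne' ?_
        have h1 : Z.eulerP x ∈ Z.span := by
          rw [eulerP_apply]
          exact Submodule.sum_mem _ fun b _ => Z.p_mul_mem b (hdp x hx b)
        have h2 : Z.eulerP x ∈ Z.Wt k := by
          rw [eulerP_apply]
          exact Submodule.sum_mem _ fun b _ => hdp' x hx b
        have h3 := ihm _ (Submodule.sub_mem _ h2 (nsmul_mem hx m)) (Z.nil_eulerP m h)
        rw [show m • x = Z.eulerP x - (Z.eulerP x - m • x) by abel]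
        exact Z.span.sub_mem h1 h3

lemma span_eq_top : Z.span = ⊤ :=
  top_le_iff.1 fun x _ => (iSup_le fun k _ hy => Z.mem_span_of_wt k hy : ⨆ k, Z.Wt k ≤ Z.span)
    (Z.iSup_wt x)

lemma dp_prodξ_mul (a : Fin r) (S : Finset (Fin q)) (l : List (Fin q)) (x : A) :
    Z.dp a (prodξ Z.ξ S l * x) = prodξ Z.ξ S l * Z.dp a x := by
  induction l with
  | nil => simp [prodξ]
  | cons i l ih =>
    simp only [prodξ, List.map_cons, List.prod_cons] at ih ⊢
    split_ifs
    · rw [mul_assoc, Z.dp_ξ_mul, ih, mul_assoc]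
    · rw [one_mul, ih]

lemma dp_p_pow_mul (a b : Fin r) (n : ℕ) (x : A) : Z.dp a (Z.p b ^ n * x) =
    (if a = b then n • (Z.p b ^ (n - 1) * x) else 0) + Z.p b ^ n * Z.dp a x := by
  induction n with
  | zero => simp
  | succ n ih =>
    rw [pow_succ', mul_assoc, Z.dp_p_mul, ih]
    by_cases hab : a = b
    · simp only [hab, if_true, Nat.add_sub_cancel, mul_add, ← mul_assoc, ← pow_succ']
      rcases n with _ | n
      · simp
      · rw [Nat.add_sub_cancel, mul_nsmul_comm', succ_nsmul _ (n + 1)]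
        abel
    · simp [hab, mul_assoc]
where
  mul_nsmul_comm' {n : ℕ} {y x : A} {m : ℕ} : y * (m • (y ^ n * x)) = m • (y ^ (n + 1) * x) := by
    rw [mul_smul_comm, ← mul_assoc, ← pow_succ']

lemma dp_prodp (a : Fin r) (α : Fin r → ℕ) {l : List (Fin r)} (hl : l.Nodup) :
    Z.dp a (prodp Z.p α l) = if a ∈ l then α a • prodp Z.p (α - Pi.single a 1) l else 0 := by
  induction l with
  | nil => simp [prodp, Z.dp_one]
  | cons b l ih =>
    rw [List.nodup_cons] at hl
    have ih := ih hl.2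
    simp only [prodp, List.map_cons, List.prod_cons] at ih ⊢
    rw [dp_p_pow_mul, ih]
    by_cases hab : a = b
    · subst hab
      have : List.map (fun c => Z.p c ^ (α - Pi.single a 1 : Fin r → ℕ) c) l =
          List.map (fun c => Z.p c ^ α c) l := List.map_congr_left fun k hk => by
        have : k ≠ a := fun h => hl.1 (h ▸ hk)
        rw [Pi.sub_apply, Pi.single_eq_of_ne this, Nat.sub_zero]
      rw [if_pos rfl, if_neg hl.1, if_pos (List.mem_cons_self ..), mul_zero, add_zero, this,
        Pi.sub_apply, Pi.single_eq_same]
    · have h1 : (α - Pi.single a 1 : Fin r → ℕ) b = α b := by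
        rw [Pi.sub_apply, Pi.single_eq_of_ne (Ne.symm hab), Nat.sub_zero]
      by_cases hal : a ∈ l
      · rw [if_neg hab, if_pos hal, if_pos (List.mem_cons_of_mem _ hal), h1, zero_add,
          mul_smul_comm]
      · simp [hab, hal]

lemma dp_monomial (a : Fin r) (S : Finset (Fin q)) (α : Fin r → ℕ) :
    Z.dp a (monomial Z.ξ Z.p (S, α)) = α a • monomial Z.ξ Z.p (S, α - Pi.single a 1) := by
  rw [monomial_eq, dp_prodξ_mul, dp_prodp _ _ _ (List.nodup_finRange r), if_pos (List.mem_finRange a),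
    mul_smul_comm, monomial_eq]

lemma dξ_prodξ (i : Fin q) (S : Finset (Fin q)) {l : List (Fin q)} (hl : l.Nodup) :
    ∃ s : ℤˣ, Z.dξ i (prodξ Z.ξ S l) =
      if i ∈ S ∧ i ∈ l then s • prodξ Z.ξ (S.erase i) l else 0 := by
  induction l with
  | nil => exact ⟨1, by simp [prodξ, Z.dξ_one]⟩
  | cons j l ih =>
    rw [List.nodup_cons] at hl
    obtain ⟨s, hs⟩ := ih hl.2
    simp only [prodξ, List.map_cons, List.prod_cons] at hs ⊢
    by_cases hij : i = j
    · subst hij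
      refine ⟨1, ?_⟩
      have : List.map (fun c => if c ∈ S.erase i then Z.ξ c else 1) l =
          List.map (fun c => if c ∈ S then Z.ξ c else 1) l := List.map_congr_left fun k hk => by
        have : k ≠ i := fun h => hl.1 (h ▸ hk)
        simp [this]
      rw [if_neg (fun h => hl.1 h.2)] at hs
      by_cases hi : i ∈ S
      · rw [if_pos hi, Z.dξ_ξ_mul, hs, this]
        simp [hi]
      · simp [hi, hs]
    · have h1 : j ∈ S.erase i ↔ j ∈ S := by simp [Ne.symm hij]
      simp only [h1, List.mem_cons, hij, false_or]
      by_cases hj : j ∈ S <;> by_cases hi : i ∈ S ∧ i ∈ l <;>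
        simp only [hj, hi, if_true, if_false, one_mul, and_self] at hs ⊢
      · refine ⟨-s, ?_⟩
        rw [Z.dξ_ξ_mul, if_neg hij, zero_sub, hs, mul_smul_comm, Units.neg_smul]
      · exact ⟨1, by rw [Z.dξ_ξ_mul, if_neg hij, zero_sub, hs, mul_zero, neg_zero]⟩
      · exact ⟨s, hs⟩
      · exact ⟨1, hs⟩

/-- The products of generators of weight one are linearly independent: by induction on the degree,
which the derivations `dξ` lower. -/
lemma prodξ_independent (e : Finset (Fin q) →₀ R)
    (he : Finsupp.linearCombination R (fun S => prodξ Z.ξ S (List.finRange q)) e = 0) : e = 0 := by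
  choose s hs using fun i S => Z.dξ_prodξ i S (List.nodup_finRange q)
  simp only [List.mem_finRange, and_true] at hs
  -- the action of a derivation on coefficients
  let K : Fin q → (Finset (Fin q) →₀ R) →ₗ[R] Finset (Fin q) →₀ R := fun i =>
    Finsupp.linearCombination R fun S =>
      if i ∈ S then s i S • Finsupp.single (S.erase i) (1 : R) else 0
  have hK : ∀ i e, Z.dξ i (Finsupp.linearCombination R (fun S => prodξ Z.ξ S (List.finRange q)) e) =
      Finsupp.linearCombination R (fun S => prodξ Z.ξ S (List.finRange q)) (K i e) := by
    intro i e
    induction e using Finsupp.induction_linear with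
    | zero => simp
    | add e f h1 h2 => simp only [map_add, h1, h2]
    | single S c =>
      simp only [K, Finsupp.linearCombination_single, map_smul, hs]
      split_ifs
      · rcases Int.units_eq_one_or (s i S) with h | h <;> simp [h]
      · simp
  have hKa : ∀ i e S, i ∉ S → K i e S = s i (insert i S) • e (insert i S) := by
    intro i e S hi
    induction e using Finsupp.induction_linear with
    | zero => simp
    | add e f h1 h2 => simp only [map_add, Finsupp.add_apply, h1, h2, smul_add]
    | single T c =>
      simp only [K, Finsupp.linearCombination_single, Finsupp.smul_apply]
      by_cases hT : T = insert i S
      · subst hT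
        rcases Int.units_eq_one_or (s i (insert i S)) with h | h <;>
          simp [h, Finset.erase_insert hi]
      · rw [Finsupp.single_apply, if_neg hT, smul_zero]
        split_ifs with hiT
        · have : T.erase i ≠ S := fun h => hT (by rw [← h, Finset.insert_erase hiT])
          rcases Int.units_eq_one_or (s i T) with h | h <;> simp [h, this]
        · simp
  have main : ∀ (n : ℕ) (e : Finset (Fin q) →₀ R), (∀ S, n ≤ S.card → e S = 0) →
      Finsupp.linearCombination R (fun S => prodξ Z.ξ S (List.finRange q)) e = 0 → e = 0 := by
    intro n
    induction n with
    | zero =>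
      intro e h _
      ext S
      exact h S (Nat.zero_le _)
    | succ n ih =>
      intro e h he
      have h1 : ∀ S, S ≠ ∅ → e S = 0 := by
        intro S hS
        obtain ⟨i, hi⟩ := Finset.nonempty_iff_ne_empty.2 hS
        have h2 : K i e = 0 := by
          refine ih _ (fun T hT => ?_) (by rw [← hK, he, map_zero])
          by_cases hiT : i ∈ T
          · -- no monomial in the image contains the variable
            clear h he
            induction e using Finsupp.induction_linear with
            | zero => simp
            | add e f h1 h2 => simp only [map_add, Finsupp.add_apply, h1, h2, add_zero]
            | single U c =>
              simp only [K, Finsupp.linearCombination_single, Finsupp.smul_apply]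
              have : U.erase i ≠ T := fun h => by simp [← h] at hiT
              split_ifs
              · rcases Int.units_eq_one_or (s i U) with h | h <;>
                  simp [h, this]
              · simp
          · rw [hKa i e T hiT, h _ (by rw [Finset.card_insert_of_notMem hiT]; omega), smul_zero]
        have h3 := hKa i e (S.erase i) (by simp)
        rw [h2, Finset.insert_erase hi, Finsupp.zero_apply] at h3
        exact (smul_eq_zero_iff_eq (s i S)).1 h3.symm
      have h2 : e = Finsupp.single ∅ (e ∅) := by
        ext S
        by_cases hS : S = ∅
        · rw [hS, Finsupp.single_eq_same]
        · rw [h1 S hS, Finsupp.single_apply, if_neg (Ne.symm hS)]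
      rw [h2, Finsupp.linearCombination_single] at he
      have h3 : algebraMap R A (e ∅) = algebraMap R A 0 := by
        rw [map_zero, Algebra.algebraMap_eq_smul_one, ← he]
        simp [prodξ]
      rw [h2, Z.injective h3, Finsupp.single_zero]
  refine main (Fintype.card (Fin q) + 1) e (fun S hS => ?_) he
  exact absurd (Finset.card_le_univ S) (by omega)

/-- The monomials are linearly independent: the derivations `dp` reduce this to monomials in the
generators of weight one. -/
lemma independent (c : (Finset (Fin q) × (Fin r → ℕ)) →₀ R)
    (hc : Finsupp.linearCombination R (monomial Z.ξ Z.p) c = 0) : c = 0 := by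
  let L : Fin r → ((Finset (Fin q) × (Fin r → ℕ)) →₀ R) →ₗ[R]
      (Finset (Fin q) × (Fin r → ℕ)) →₀ R := fun a =>
    Finsupp.linearCombination R fun m => m.2 a • Finsupp.single (m.1, m.2 - Pi.single a 1) (1 : R)
  have hL : ∀ a c, Z.dp a (Finsupp.linearCombination R (monomial Z.ξ Z.p) c) =
      Finsupp.linearCombination R (monomial Z.ξ Z.p) (L a c) := by
    intro a c
    induction c using Finsupp.induction_linear with
    | zero => simp
    | add e f h1 h2 => simp only [map_add, h1, h2]
    | single m f =>
      obtain ⟨S, α⟩ := m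
      simp only [L, Finsupp.linearCombination_single, map_smul, dp_monomial, map_nsmul, one_smul]
  have hLa : ∀ a c S α, L a c (S, α) = (α a + 1) • c (S, α + Pi.single a 1) := by
    intro a c S α
    induction c using Finsupp.induction_linear with
    | zero => simp
    | add e f h1 h2 => simp only [map_add, Finsupp.add_apply, h1, h2, smul_add]
    | single m f =>
      obtain ⟨T, β⟩ := m
      simp only [L, Finsupp.linearCombination_single, Finsupp.smul_apply]
      by_cases hT : (T, β) = (S, α + Pi.single a 1)
      · obtain ⟨rfl, rfl⟩ := Prod.mk.inj hT
        simp [mul_comm]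
      · rw [Finsupp.single_apply (a := (T, β)), if_neg hT, smul_zero, Finsupp.single_apply]
        split_ifs with h
        · obtain ⟨rfl, rfl⟩ := Prod.mk.inj h
          have : β a = 0 := by
            by_contra h0
            refine hT (Prod.ext rfl ?_)
            ext b
            by_cases hb : b = a
            · subst hb; simp; omega
            · simp [hb]
          simp [this]
        · simp
  have main : ∀ (n : ℕ) (c : (Finset (Fin q) × (Fin r → ℕ)) →₀ R),
      (∀ S α, n ≤ ∑ a, α a → c (S, α) = 0) →
      Finsupp.linearCombination R (monomial Z.ξ Z.p) c = 0 → c = 0 := by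
    intro n
    induction n with
    | zero =>
      intro c h _
      ext ⟨S, α⟩
      exact h S α (Nat.zero_le _)
    | succ n ih =>
      intro c h hc
      have h1 : ∀ S α, α ≠ 0 → c (S, α) = 0 := by
        intro S α hα
        obtain ⟨a, ha⟩ := Function.ne_iff.1 hα
        have h2 : L a c = 0 := by
          refine ih _ (fun T β hβ => ?_) (by rw [← hL, hc, map_zero])
          rw [hLa, h, smul_zero]
          simp only [Pi.add_apply, Finset.sum_add_distrib, Finset.sum_pi_single', Finset.mem_univ,
            if_true]
          omega
        have h3 := hLa a c S (α - Pi.single a 1)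
        have h4 : α - Pi.single a 1 + Pi.single a 1 = α := by
          ext b
          by_cases hb : b = a
          · subst hb
            simp only [Pi.add_apply, Pi.sub_apply, Pi.single_eq_same]
            have : α b ≠ 0 := ha
            omega
          · simp [hb]
        rw [h2, h4, Finsupp.zero_apply, ← Nat.cast_smul_eq_nsmul R, smul_eq_mul] at h3
        exact ((Z.isUnit_natCast _ (Nat.succ_ne_zero _)).mul_right_eq_zero).1 h3.symm
      -- the remaining coefficients belong to the monomials in the generators of weight one
      have hinj : Function.Injective fun S : Finset (Fin q) => (S, (0 : Fin r → ℕ)) :=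
        fun S T h => (Prod.mk.inj h).1
      have h2 : c = Finsupp.embDomain ⟨_, hinj⟩ (Finsupp.comapDomain _ c hinj.injOn) := by
        ext ⟨S, α⟩
        by_cases hα : α = 0
        · subst hα
          exact (Finsupp.embDomain_apply_self ⟨_, hinj⟩ (Finsupp.comapDomain _ c hinj.injOn) S).symm
        · rw [h1 S α hα, Finsupp.embDomain_of_notMem_range]
          rintro ⟨T, hT⟩
          exact hα (Prod.mk.inj hT).2.symm
      rw [h2, Finsupp.linearCombination_embDomain] at hc
      have h3 := Z.prodξ_independent (Finsupp.comapDomain _ c hinj.injOn) (by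
        rw [← hc]
        congr 2
        ext S
        change _ = monomial Z.ξ Z.p (S, 0)
        rw [monomial_eq]
        simp [prodp])
      rw [h2, h3, Finsupp.embDomain_zero]
  refine main (c.support.sup (fun m => ∑ a, m.2 a) + 1) c (fun S α hα => ?_) hc
  by_contra h
  have := Finset.le_sup (f := fun m : Finset (Fin q) × (Fin r → ℕ) => ∑ a, m.2 a)
    (Finsupp.mem_support_iff.2 h)
  simp only at this
  omega

/-- Every element is a unique combination of monomials. -/
theorem existsUnique (x : A) : ∃! c : (Finset (Fin q) × (Fin r → ℕ)) →₀ R,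
    x = c.sum fun m f => f • monomial Z.ξ Z.p m := by
  have hx : x ∈ Z.span := by rw [Z.span_eq_top]; trivial
  obtain ⟨c, hc⟩ := (Finsupp.mem_span_range_iff_exists_finsupp).1 hx
  refine ⟨c, hc.symm, fun c' hc' => sub_eq_zero.1 (Z.independent _ ?_)⟩
  rw [map_sub, Finsupp.linearCombination_apply, Finsupp.linearCombination_apply, ← hc', hc, sub_self]

end DualCoord

end PreCourant

end

/-! ### The algebra of polynomial functions and its coordinates -/

noncomputable section

namespace PreCourant

open Filter Topology Shuf VBundle

variable {d : ℕ} {M : Type u} [TopologicalSpace M] [ChartedSpace (EuclideanSpace ℝ (Fin d)) M]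

/-- The algebra of polynomial functions over `U`. -/
def polyAlg (P : PreCourantAlgebroid d M) (U : Opens M) : Subalgebra ℝ (Amb P U) where
  carrier := {a | IsPoly a}
  mul_mem' ha hb := IsPoly.mul ha hb
  add_mem' ha hb := IsPoly.add ha hb
  algebraMap_mem' r := by
    rw [Set.mem_ofPred_eq, algebraMap_eq]
    exact isPoly_const contMDiff_const

variable {P : PreCourantAlgebroid d M} {U V W : Opens M}

/-- Smooth functions on `U` as polynomial functions. -/
def baseHom (P : PreCourantAlgebroid d M) (U : Opens M) : Fn d U →+* polyAlg P U where
  toFun f := ⟨const ⇑f, isPoly_const f.contMDiff⟩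
  map_one' := rfl
  map_mul' f g := Subtype.ext <| by
    change (const ⇑(f * g) : Amb P U) = const ⇑f * const ⇑g
    rw [const_mul]
    ext w : 1
    cases w
    · rfl
    · exact (mul_zero _).symm
  map_zero' := Subtype.ext <| by
    ext w : 1
    cases w <;> rfl
  map_add' f g := Subtype.ext <| by
    change (const ⇑(f + g) : Amb P U) = const ⇑f + const ⇑g
    ext w : 1
    cases w
    · rfl
    · exact (add_zero _).symm

instance : Algebra (Fn d U) (polyAlg P U) :=
  (baseHom P U).toAlgebra' fun f a => Subtype.ext <| by
    change const ⇑f * a.1 = a.1 * const ⇑f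
    rw [const_mul, mul_const]

lemma fn_smul_val (f : Fn d U) (a : polyAlg P U) : (f • a).1 = (f : U → ℝ) • a.1 := const_mul _ _

lemma eq_const_of_hom {a : Amb P U} (h : Hom a 0) : a = const (a []) := by
  ext w : 1
  match w with
  | [] => rfl
  | l :: w => exact h _ (by rw [wtw_cons]; rcases l with e | f <;> push_cast <;> simp <;> omega)

lemma IsPoly.eq_algebraMap {a : Amb P U} (ha : IsPoly a) (h : Hom a 0) :
    ∃ f : Fn d U, const ⇑f = a :=
  ⟨⟨a [], ha.smooth []⟩, (eq_const_of_hom h).symm⟩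

variable (P U) in
/-- The polynomial functions of weight `k`. -/
def wtPart (k : ℕ) : Submodule (Fn d U) (polyAlg P U) where
  carrier := {a | Hom a.1 k}
  add_mem' ha hb := Hom.add ha hb
  zero_mem' := hom_zero _
  smul_mem' f a ha := by
    rw [Set.mem_ofPred_eq, fn_smul_val]
    exact Hom.smul ha _

lemma mem_iSup_wtPart (a : polyAlg P U) : a ∈ ⨆ k, wtPart P U k := by
  obtain ⟨n, hn⟩ := a.2.exists_sum_proj
  have : a = ∑ k ∈ Finset.range n, ⟨Shuf.proj (k : ℤ) a.1, a.2.proj k⟩ := Subtype.ext <| by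
    rw [AddSubmonoidClass.coe_finsetSum]
    exact hn
  rw [this]
  exact Submodule.sum_mem _ fun k _ => Submodule.mem_iSup_of_mem k (hom_proj _ _)

section

variable [T2Space M] [IsManifold (𝓡 d) ∞ M]

lemma pb_const_const {f g : U → ℝ} : pb (const f : Amb P U) (const g) = 0 :=
  (pb_hom (hom_const f) (hom_const g)).eq_zero_of_neg (by norm_num)

lemma pb_one_const {a : Amb P U} (ha : Hom a 1) (g : U → ℝ) : pb a (const g) = 0 :=
  (pb_hom ha (hom_const g)).eq_zero_of_neg (by norm_num)

lemma pb_const_one {a : Amb P U} (ha : Hom a 1) (g : U → ℝ) : pb (const g) a = 0 :=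
  (pb_hom (hom_const g) ha).eq_zero_of_neg (by norm_num)

lemma pb_smul_right_of {a b : Amb P U} (ha : IsPoly a) (hb : IsPoly b) {s : ℤˣ} (hs : IsPar a s)
    (f : Fn d U) (h : pb a (const ⇑f) = 0) : pb a ((f : U → ℝ) • b) = (f : U → ℝ) • pb a b := by
  rw [← const_mul, pb_mul ha (isPoly_const f.contMDiff) hb hs, h, zero_mul, zero_add, θ_const,
    const_mul]

/-- The bracket with a fixed polynomial function that commutes with the functions on the base. -/
def adBase (a : Amb P U) (ha : IsPoly a) {s : ℤˣ} (hs : IsPar a s)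
    (h : ∀ f : Fn d U, pb a (const ⇑f) = 0) : polyAlg P U →ₗ[Fn d U] polyAlg P U where
  toFun b := ⟨pb a b.1, ha.pb b.2⟩
  map_add' b c := Subtype.ext <| pb_add_right ha b.2 c.2
  map_smul' f b := Subtype.ext <| by
    change pb a (f • b).1 = (f • (⟨pb a b.1, _⟩ : polyAlg P U)).1
    rw [fn_smul_val, fn_smul_val, pb_smul_right_of ha b.2 hs f (h f)]

variable (P V) in
/-- Coordinates of weights zero, one and two for polynomial functions: the brackets of `x` with `p`
and of `ξ` with `ξ` form invertible matrices, and the letters of weight one are combinations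
of the `ξ`. -/
structure PolyCoord (q r : ℕ) where
  m : M
  subset : ∀ y ∈ V, y ∈ (chartAt (EuclideanSpace ℝ (Fin d)) m).source
  x : Fin d → Fn d V
  x_apply : ∀ a y, x a y = chartAt (EuclideanSpace ℝ (Fin d)) m y.1 a
  ξ : Fin q → polyAlg P V
  p : Fin r → polyAlg P V
  ξ_hom : ∀ i, Hom (ξ i).1 1
  p_hom : ∀ a, Hom (p a).1 2
  G : Matrix (Fin q) (Fin q) (Fn d V)
  /-- The inverse of `G`. -/
  G' : Matrix (Fin q) (Fin q) (Fn d V)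
  G_eq : ∀ i j, pb (ξ i).1 (ξ j).1 = const ⇑(G i j)
  G'_mul : G' * G = 1
  X : Matrix (Fin d) (Fin r) (Fn d V)
  /-- The inverse of `X`. In particular, `r = d` unless `V` is empty. -/
  X' : Matrix (Fin r) (Fin d) (Fn d V)
  X_eq : ∀ b a, pb (const ⇑(x b)) (p a).1 = const ⇑(X b a)
  X'_mul : X' * X = 1
  mul_X' : X * X' = 1
  span : ∀ e : P.Sec, ∃ c : Fin q → Fn d V, hat V e = ∑ i, (c i • ξ i).1

lemma pb_const_apply {b : Amb P V} (hb : IsPoly b) {f : Fn d V} {g : Fn d M} {y : V}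
    (hg : ∀ᶠ z in 𝓝 y.1, ∀ h : z ∈ V, g z = f ⟨z, h⟩) (w : List (P.Sec ⊕ Fn d M)) :
    pb (const ⇑f) b w y = D (lf P g) b w y := by
  obtain ⟨W, hW, hWo, hy⟩ := eventually_nhds_iff.1 hg
  let W' : Opens M := ⟨W, hWo⟩ ⊓ V
  have h1 : resA (inf_le_right : W' ≤ V) (const ⇑f) = ι W' (lf P g) := by
    rw [resA_const]
    change const _ = const _
    congr 1
    ext z
    exact (hW z.1 z.2.1 z.2.2).symm
  have h2 := pb_res (inf_le_right : W' ≤ V) (isPoly_const (P := P) f.contMDiff) hb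
  rw [h1, pb_ι _ (hb.res _)] at h2
  exact congrFun (congrFun h2 w) ⟨y.1, hy, y.2⟩

/-- A function that commutes with the coordinates of the base commutes with all functions on
the base. -/
lemma pb_const_eq_zero {m : M} (hV : ∀ y ∈ V, y ∈ (chartAt (EuclideanSpace ℝ (Fin d)) m).source)
    {x : Fin d → Fn d V} (hx : ∀ a y, x a y = chartAt (EuclideanSpace ℝ (Fin d)) m y.1 a)
    {b : Amb P V} (hb : IsPoly b) (h : ∀ a, pb (const ⇑(x a)) b = 0) (f : Fn d V) :
    pb (const ⇑f) b = 0 := by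
  ext w y
  obtain ⟨g, hg⟩ := exists_fn_germ f.contMDiff y
  obtain ⟨X, hX⟩ := exists_coord m (hV y.1 y.2)
  rw [pb_const_apply hb hg]
  have h0 : IsDer y.1 fun _ : Fn d M => (0 : ℝ) := ⟨fun _ _ => by simp, fun _ _ => by simp,
    fun _ => rfl⟩
  refine (hb.rel'.isDer w y).ext_coord m (hV y.1 y.2) hX h0 (fun i => ?_) g
  have h1 : ∀ᶠ z in 𝓝 y.1, ∀ h : z ∈ V, X i z = x i ⟨z, h⟩ := by
    filter_upwards [hX i] with z hz h
    rw [hz, hx]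
  have h2 := pb_const_apply hb h1 w
  rw [h i] at h2
  exact h2.symm

namespace PolyCoord

variable {q r : ℕ} (z : PolyCoord P V q r)

/-- The bracket with a coordinate of the base. -/
def dx (b : Fin d) : polyAlg P V →ₗ[Fn d V] polyAlg P V :=
  adBase (const ⇑(z.x b)) (isPoly_const (z.x b).contMDiff) (s := 1)
    (by rw [IsPar, θ_const, one_smul]) fun _ => pb_const_const

/-- The bracket with a coordinate of weight one. -/
def dη (i : Fin q) : polyAlg P V →ₗ[Fn d V] polyAlg P V :=
  adBase (z.ξ i).1 (z.ξ i).2 (Hom.isPar (k := 1) (z.ξ_hom i)) fun f => pb_one_const (z.ξ_hom i) f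

lemma dη_val (i : Fin q) (y : polyAlg P V) : (z.dη i y).1 = pb (z.ξ i).1 y.1 := rfl

lemma isPar_x (b : Fin d) : IsPar (const ⇑(z.x b) : Amb P V) 1 := by rw [IsPar, θ_const, one_smul]

lemma isPar_ξ (i : Fin q) : IsPar (z.ξ i).1 (-1) := by
  simpa using Hom.isPar (k := 1) (z.ξ_hom i)

lemma isPar_p (a : Fin r) : IsPar (z.p a).1 1 := by
  simpa using Hom.isPar (k := 2) (z.p_hom a)

lemma isPoly_x (b : Fin d) : IsPoly (const ⇑(z.x b) : Amb P V) := isPoly_const (z.x b).contMDiff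

lemma dx_mul (b : Fin d) (y y' : polyAlg P V) : z.dx b (y * y') = z.dx b y * y' + y * z.dx b y' :=
  Subtype.ext <| by
    have := pb_mul (z.isPoly_x b) y.2 y'.2 (z.isPar_x b)
    rwa [θ_one] at this

lemma dx_ξ (b : Fin d) (i : Fin q) : z.dx b (z.ξ i) = 0 :=
  Subtype.ext <| pb_const_one (z.ξ_hom i) _

lemma dx_p (b : Fin d) (a : Fin r) : z.dx b (z.p a) = algebraMap _ _ (z.X b a) :=
  Subtype.ext <| z.X_eq b a

lemma dη_ξ_mul (i j : Fin q) (y : polyAlg P V) :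
    z.dη i (z.ξ j * y) = z.G i j • y - z.ξ j * z.dη i y := Subtype.ext <| by
  have h1 : θ (-1) (z.ξ j).1 = -(z.ξ j).1 := by
    rw [show θ (-1) (z.ξ j).1 = (-1 : ℤˣ) • (z.ξ j).1 from z.isPar_ξ j, Units.neg_smul, one_smul]
  have := pb_mul (z.ξ i).2 (z.ξ j).2 y.2 (z.isPar_ξ i)
  rw [h1, z.G_eq, const_mul, neg_mul, ← sub_eq_add_neg] at this
  rw [dη_val, MulMemClass.coe_mul, this, AddSubgroupClass.coe_sub, fn_smul_val]
  rfl

lemma dx_dx (b c : Fin d) (y : polyAlg P V) : z.dx b (z.dx c y) = z.dx c (z.dx b y) :=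
  Subtype.ext <| by
    have := jacobi (z.isPoly_x b) (z.isPoly_x c) y.2 (i := 0) (j := 0) (hom_const _) (hom_const _)
    rw [pb_const_const, pb_zero_left y.2, zero_add, θ_const] at this
    exact this

lemma dx_dη (b : Fin d) (i : Fin q) (y : polyAlg P V) : z.dx b (z.dη i y) = z.dη i (z.dx b y) :=
  Subtype.ext <| by
    have := jacobi (z.isPoly_x b) (z.ξ i).2 y.2 (i := 0) (j := 1) (hom_const _) (z.ξ_hom i)
    rw [pb_const_one (z.ξ_hom i), pb_zero_left y.2, zero_add, pow_zero, θ_one] at this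
    exact this

lemma dη_dη (i j : Fin q) (y : polyAlg P V) (h : ∀ b, z.dx b y = 0) :
    z.dη i (z.dη j y) = -z.dη j (z.dη i y) := Subtype.ext <| by
  have := jacobi (z.ξ i).2 (z.ξ j).2 y.2 (i := 1) (j := 1) (z.ξ_hom i) (z.ξ_hom j)
  rw [z.G_eq, pb_const_eq_zero z.subset z.x_apply y.2 (fun a => congrArg Subtype.val (h a)),
    zero_add, pow_one, show θ (-1) (z.ξ j).1 = (-1 : ℤˣ) • (z.ξ j).1 from z.isPar_ξ j,
    Units.neg_smul, one_smul, pb_neg_left (z.ξ j).2 ((z.ξ i).2.pb y.2)] at this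
  exact this

/-- The derivation dual to a coordinate of weight two. -/
def dp (a : Fin r) : polyAlg P V →ₗ[Fn d V] polyAlg P V := ∑ b, z.X' a b • z.dx b

/-- The derivation dual to a coordinate of weight one. -/
def dξ (i : Fin q) : polyAlg P V →ₗ[Fn d V] polyAlg P V := ∑ j, z.G' i j • z.dη j

lemma dp_apply (a : Fin r) (y : polyAlg P V) : z.dp a y = ∑ b, z.X' a b • z.dx b y := by
  simp [dp, LinearMap.sum_apply]

lemma dξ_apply (i : Fin q) (y : polyAlg P V) : z.dξ i y = ∑ j, z.G' i j • z.dη j y := by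
  simp [dξ, LinearMap.sum_apply]

lemma dx_eq (b : Fin d) (y : polyAlg P V) : z.dx b y = ∑ a, z.X b a • z.dp a y := by
  simp only [dp_apply, Finset.smul_sum, smul_smul]
  rw [Finset.sum_comm]
  simp only [← Finset.sum_smul]
  have : ∀ c, ∑ a, z.X b a * z.X' a c = if b = c then 1 else 0 := fun c => by
    rw [← Matrix.mul_apply, z.mul_X', Matrix.one_apply]
  simp [this]

lemma dη_eq (i : Fin q) (y : polyAlg P V) : z.dη i y = ∑ j, z.G i j • z.dξ j y := by
  simp only [dξ_apply, Finset.smul_sum, smul_smul]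
  rw [Finset.sum_comm]
  simp only [← Finset.sum_smul]
  have : ∀ c, ∑ a, z.G i a * z.G' a c = if i = c then 1 else 0 := fun c => by
    rw [← Matrix.mul_apply, mul_eq_one_comm.1 z.G'_mul, Matrix.one_apply]
  simp [this]

/-- A homogeneous function of positive weight vanishes if it commutes with all coordinates of
weight zero and one. -/
lemma eq_zero {k : ℕ} (hk : k ≠ 0) {y : polyAlg P V} (hy : Hom y.1 k) (h1 : ∀ b, z.dx b y = 0)
    (h2 : ∀ i, z.dη i y = 0) : y = 0 := by
  have hf : ∀ f : Fn d V, pb (const ⇑f) y.1 = 0 :=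
    pb_const_eq_zero z.subset z.x_apply y.2 fun a => congrArg Subtype.val (h1 a)
  have hl : ∀ l, D l y.1 = 0 := by
    rintro (e | f)
    · rw [← pb_hat e y.2]
      obtain ⟨c, hc⟩ := z.span e
      rw [hc]
      suffices h : ∀ s : Finset (Fin q), pb (∑ i ∈ s, (c i • z.ξ i)).1 y.1 = 0 by
        have := h Finset.univ
        rwa [AddSubmonoidClass.coe_finsetSum] at this
      intro s
      classical
      induction s using Finset.induction_on with
      | empty => exact pb_zero_left y.2
      | insert i s hi ih =>
        rw [Finset.sum_insert hi, AddMemClass.coe_add, pb_add_left (c i • z.ξ i).2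
          (∑ i ∈ s, c i • z.ξ i).2 y.2, ih, add_zero, fn_smul_val, ← const_mul]
        rw [mul_pb (isPoly_const (c i).contMDiff) (z.ξ i).2 y.2 (s := 1)
          (by rw [IsPar, θ_const, one_smul]) (z.isPar_ξ i) hy.isPar, hy.isPar, θ_one,
          pb_usmul_right _ (isPoly_const (c i).contMDiff) y.2, hf, ← dη_val, h2 i]
        simp
    · rw [← pb_ι (lf P f) y.2]
      exact hf (f.toOpen V)
  apply Subtype.ext
  ext w : 1
  match w with
  | [] => exact hy [] (by rw [wtw_nil]; exact_mod_cast Ne.symm hk)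
  | l :: w => exact congrFun (hl l) w

/-- The derivations dual to coordinates. -/
def dual : DualCoord (Fn d V) (polyAlg P V) q r where
  ξ := z.ξ
  p := z.p
  dξ := z.dξ
  dp := z.dp
  Wt := wtPart P V
  isUnit_natCast n hn := by
    have h : (n : Fn d V) = algebraMap ℝ (Fn d V) n := by simp
    rw [h]
    exact (IsUnit.mk0 (n : ℝ) (by exact_mod_cast hn)).map _
  ξ_ξ i j := Subtype.ext <| by
    have := (z.isPar_ξ i).mul_comm (z.ξ j).1
    rwa [show θ (-1) (z.ξ j).1 = (-1 : ℤˣ) • (z.ξ j).1 from z.isPar_ξ j, Units.neg_smul, one_smul,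
      neg_mul] at this
  p_ξ a i := Subtype.ext <| by simpa using (z.isPar_p a).mul_comm (z.ξ i).1
  p_p a b := Subtype.ext <| by simpa using (z.isPar_p a).mul_comm (z.p b).1
  dξ_one i := by
    rw [dξ_apply]
    refine Finset.sum_eq_zero fun j _ => ?_
    rw [show z.dη j 1 = 0 from Subtype.ext (pb_one_const (z.ξ_hom j) _), smul_zero]
  dp_one a := by
    rw [dp_apply]
    refine Finset.sum_eq_zero fun j _ => ?_
    rw [show z.dx j 1 = 0 from Subtype.ext pb_const_const, smul_zero]
  dξ_ξ_mul i j y := by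
    have : ∑ k, z.G' i k * z.G k j = if i = j then 1 else 0 := by
      rw [← Matrix.mul_apply, z.G'_mul, Matrix.one_apply]
    simp only [dξ_apply, dη_ξ_mul, smul_sub, Finset.sum_sub_distrib, smul_smul, ← Finset.sum_smul,
      this, Finset.mul_sum, mul_smul_comm]
    simp
  dp_ξ_mul a j y := by
    simp only [dp_apply, dx_mul, dx_ξ, zero_mul, zero_add, Finset.mul_sum, mul_smul_comm]
  dp_p_mul a b y := by
    have : ∑ c, z.X' a c * z.X c b = if a = b then 1 else 0 := by
      rw [← Matrix.mul_apply, z.X'_mul, Matrix.one_apply]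
    simp only [dp_apply, dx_mul, dx_p, ← Algebra.smul_def, smul_add, Finset.sum_add_distrib,
      smul_smul, ← Finset.sum_smul, this, Finset.mul_sum, mul_smul_comm]
    simp
  dp_dp a b y := by
    simp only [dp_apply, map_sum, map_smul, Finset.smul_sum]
    rw [Finset.sum_comm]
    refine Finset.sum_congr rfl fun i _ => Finset.sum_congr rfl fun j _ => ?_
    rw [z.dx_dx j i, smul_comm]
  dp_dξ a b y := by
    simp only [dp_apply, dξ_apply, map_sum, map_smul, Finset.smul_sum]
    rw [Finset.sum_comm]
    refine Finset.sum_congr rfl fun i _ => Finset.sum_congr rfl fun j _ => ?_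
    rw [z.dx_dη i j, smul_comm]
  dξ_dξ a b y h := by
    have h' : ∀ b, z.dx b y = 0 := fun b => by simp [dx_eq, h]
    simp only [dξ_apply, map_sum, map_smul, Finset.smul_sum]
    rw [Finset.sum_comm, ← Finset.sum_neg_distrib]
    refine Finset.sum_congr rfl fun i _ => ?_
    rw [← Finset.sum_neg_distrib]
    refine Finset.sum_congr rfl fun j _ => ?_
    rw [z.dη_dη i j y h', smul_neg, smul_neg, smul_comm]
  dξ_wt i k y hy := by
    rw [dξ_apply]
    refine Submodule.sum_mem _ fun j _ => Submodule.smul_mem _ _ ?_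
    have := pb_hom (z.ξ_hom j) (show Hom y.1 ((k + 1 : ℕ) : ℤ) from hy)
    rwa [show (1 : ℤ) + ((k + 1 : ℕ) : ℤ) - 2 = k by push_cast; ring] at this
  dξ_zero i y hy := by
    rw [dξ_apply]
    refine Finset.sum_eq_zero fun j _ => ?_
    rw [show z.dη j y = 0 from Subtype.ext ((pb_hom (z.ξ_hom j)
      (show Hom y.1 ((0 : ℕ) : ℤ) from hy)).eq_zero_of_neg (by norm_num)), smul_zero]
  dp_wt i k y hy := by
    rw [dp_apply]
    refine Submodule.sum_mem _ fun j _ => Submodule.smul_mem _ _ ?_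
    have := pb_hom (hom_const ⇑(z.x j)) (show Hom y.1 ((k + 2 : ℕ) : ℤ) from hy)
    rwa [show (0 : ℤ) + ((k + 2 : ℕ) : ℤ) - 2 = k by push_cast; ring] at this
  dp_low i k hk y hy := by
    rw [dp_apply]
    refine Finset.sum_eq_zero fun j _ => ?_
    rw [show z.dx j y = 0 from Subtype.ext ((pb_hom (hom_const ⇑(z.x j))
      (show Hom y.1 (k : ℤ) from hy)).eq_zero_of_neg (by omega)), smul_zero]
  ξ_wt i k y hy := by
    have := Hom.mul (z.ξ_hom i) (show Hom y.1 (k : ℤ) from hy)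
    rwa [show (1 : ℤ) + k = ((k + 1 : ℕ) : ℤ) by push_cast; ring] at this
  p_wt i k y hy := by
    have := Hom.mul (z.p_hom i) (show Hom y.1 (k : ℤ) from hy)
    rwa [show (2 : ℤ) + k = ((k + 2 : ℕ) : ℤ) by push_cast; ring] at this
  wt_zero y hy := by
    obtain ⟨f, hf⟩ := y.2.eq_algebraMap hy
    exact ⟨f, Subtype.ext hf⟩
  injective f g h := by
    ext y
    exact congrFun (congrFun (congrArg Subtype.val h) []) y
  iSup_wt := mem_iSup_wtPart
  sep k hk y hy h1 h2 := z.eq_zero hk hy (fun b => by simp [dx_eq, h2])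
    fun i => by simp [dη_eq, h1]

lemma existsUnique (y : polyAlg P V) : ∃! c : (Finset (Fin q) × (Fin r → ℕ)) →₀ Fn d V,
    y = c.sum fun m f => f • monomial z.ξ z.p m := z.dual.existsUnique y

end PolyCoord

end

end PreCourant

end

/-! ### Construction of polynomial functions of low weight -/

noncomputable section

namespace PreCourant

open Filter Topology Shuf VBundle

variable {d : ℕ} {M : Type u} [TopologicalSpace M] [ChartedSpace (EuclideanSpace ℝ (Fin d)) M]
variable {P : PreCourantAlgebroid d M} {U V W : Opens M}

/-- A function is polynomial if the letters map it to polynomial functions and the relations hold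
at its first two letters. -/
lemma IsPoly.of_D {a : Amb P U} (h : Rel a) (hD : ∀ l, IsPoly (Shuf.D l a))
    (hs : ContMDiff (𝓡 d) 𝓘(ℝ, ℝ) ∞ (a [])) (hb : ∃ n : ℕ, ∀ w, n < wtw w → a w = 0) :
    IsPoly a where
  rel
    | [] => h
    | l :: w => (hD l).rel w
  bdd := hb
  smooth
    | [] => hs
    | l :: w => (hD l).smooth w

/-- The function of weight one with the given pairings with sections. -/
def lin (α : P.Sec → U → ℝ) : Amb P U
  | [Sum.inl e] => α e
  | _ => 0

lemma D_lin_sec (α : P.Sec → U → ℝ) (e : P.Sec) : D (ls P e) (lin α) = const (α e) := by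
  ext w : 1
  cases w <;> rfl

lemma D_lin_fn (α : P.Sec → U → ℝ) (f : Fn d M) : D (lf P f) (lin α) = 0 := rfl

lemma lin_cons_cons (α : P.Sec → U → ℝ) (l l' : P.Sec ⊕ Fn d M) (w : List (P.Sec ⊕ Fn d M)) :
    lin α (l :: l' :: w) = 0 := by
  cases l <;> rfl

lemma const_add (f g : U → ℝ) : (const (f + g) : Amb P U) = const f + const g := by
  ext w : 1
  cases w
  · rfl
  · exact (add_zero _).symm

lemma smul_const (f g : U → ℝ) : f • (const g : Amb P U) = const (f * g) := by
  ext w : 1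
  cases w
  · rfl
  · exact mul_zero f

lemma hom_lin (α : P.Sec → U → ℝ) : Hom (lin α) 1 := by
  intro w hw
  match w, hw with
  | [], _ => rfl
  | [Sum.inl e'], hw => exact absurd rfl hw
  | [Sum.inr f], _ => rfl
  | l :: l' :: w, _ => exact lin_cons_cons α l l' w

lemma Hom.bdd {a : Amb P U} {k : ℕ} (h : Hom a k) : ∃ n : ℕ, ∀ w, n < wtw w → a w = 0 :=
  ⟨k, fun w hw => h w (by omega)⟩

lemma isPoly_lin {α : P.Sec → U → ℝ} (hs : ∀ e, ContMDiff (𝓡 d) 𝓘(ℝ, ℝ) ∞ (α e))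
    (hadd : ∀ e e', α (e + e') = α e + α e') (hsmul : ∀ f e, α (smulSec f e) = fr U f * α e) :
    IsPoly (lin α) := by
  refine IsPoly.of_D ?_ ?_ contMDiff_const (Hom.bdd (k := 1) (hom_lin α))
  · constructor
    · intro e e'
      rw [D_lin_sec, D_lin_sec, D_lin_sec, hadd, const_add]
    · intro f e
      rw [D_lin_sec, D_lin_sec, D_lin_fn, mul_zero, add_zero, smul_const, hsmul]
    · intros; simp [D_lin_fn]
    · intros; simp [D_lin_fn]
    · intros; simp [D_lin_fn]
    · intros; simp [D_lin_fn, D_lin_sec]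
    · intros; simp [D_lin_fn, D_lin_sec]
    · intros; simp [D_lin_fn]
  · rintro (e | f)
    · rw [D_lin_sec]; exact isPoly_const (hs e)
    · rw [D_lin_fn]; exact isPoly_zero

/-- The function of weight two with symbol `δ` whose brackets with two sections, the first
argument being applied first, are given by `Γ`. -/
def quad (δ : Fn d M → U → ℝ) (Γ : P.Sec → P.Sec → U → ℝ) : Amb P U
  | [Sum.inr f] => δ f
  | [Sum.inl e, Sum.inl e'] => Γ e e'
  | _ => 0

lemma D_quad_sec (δ : Fn d M → U → ℝ) (Γ : P.Sec → P.Sec → U → ℝ) (e : P.Sec) :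
    D (ls P e) (quad δ Γ) = lin (Γ e) := by
  ext w : 1
  match w with
  | [] => rfl
  | [Sum.inl e'] => rfl
  | [Sum.inr f] => rfl
  | Sum.inl _ :: l' :: w => rfl
  | Sum.inr _ :: l' :: w => rfl

lemma D_quad_fn (δ : Fn d M → U → ℝ) (Γ : P.Sec → P.Sec → U → ℝ) (f : Fn d M) :
    D (lf P f) (quad δ Γ) = const (δ f) := by
  ext w : 1
  cases w <;> rfl

lemma hom_of_D {a : Amb P U} {k : ℤ} (h0 : a [] = 0) (h : ∀ l, Hom (D l a) (k - Weighted.wt l)) :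
    Hom a k := by
  intro w hw
  match w with
  | [] => exact h0
  | l :: w => exact h l w (by rw [wtw_cons] at hw; push_cast at hw; omega)

lemma hom_quad (δ : Fn d M → U → ℝ) (Γ : P.Sec → P.Sec → U → ℝ) : Hom (quad δ Γ) 2 := by
  refine hom_of_D rfl ?_
  rintro (e | f)
  · rw [D_quad_sec]; exact hom_lin _
  · rw [D_quad_fn]; exact hom_const _

lemma lin_add (α β : P.Sec → U → ℝ) : lin (α + β) = lin α + lin β := by
  ext w : 1
  match w with
  | [] => exact (add_zero _).symm
  | [Sum.inl e'] => rfl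
  | [Sum.inr f] => exact (add_zero _).symm
  | Sum.inl _ :: l' :: w => exact (add_zero _).symm
  | Sum.inr _ :: l' :: w => exact (add_zero _).symm

lemma smul_lin (f : U → ℝ) (α : P.Sec → U → ℝ) : f • lin α = lin fun e => f * α e := by
  ext w : 1
  match w with
  | [] => exact mul_zero f
  | [Sum.inl e'] => rfl
  | [Sum.inr g] => exact mul_zero f
  | Sum.inl _ :: l' :: w => exact mul_zero f
  | Sum.inr _ :: l' :: w => exact mul_zero f

lemma hat_eq_lin (e : P.Sec) : hat U e = lin fun e' => fr U (P.pairing e e') := by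
  ext w : 1
  match w with
  | [] => rfl
  | [Sum.inl e'] => rfl
  | [Sum.inr f] => rfl
  | Sum.inl _ :: l' :: w => rfl
  | Sum.inr _ :: l' :: w => rfl

/-- A symbol is a derivation with smooth values. -/
structure IsSymbol (δ : Fn d M → U → ℝ) : Prop where
  smooth : ∀ f, ContMDiff (𝓡 d) 𝓘(ℝ, ℝ) ∞ (δ f)
  add : ∀ f g, δ (f + g) = δ f + δ g
  mul : ∀ f g, δ (f * g) = fr U f * δ g + fr U g * δ f
  const : ∀ r : ℝ, δ (algebraMap ℝ (Fn d M) r) = 0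

lemma isPoly_quad {δ : Fn d M → U → ℝ} {Γ : P.Sec → P.Sec → U → ℝ} (hδ : IsSymbol δ)
    (hs : ∀ e e', ContMDiff (𝓡 d) 𝓘(ℝ, ℝ) ∞ (Γ e e'))
    (hadd : ∀ e e' e'', Γ e (e' + e'') = Γ e e' + Γ e e'')
    (hsmul : ∀ e f e', Γ e (smulSec f e') = fr U f * Γ e e')
    (hadd' : ∀ e e' e'', Γ (e + e') e'' = Γ e e'' + Γ e' e'')
    (hsmul' : ∀ f e e', Γ (smulSec f e) e' = fr U f * Γ e e' + fr U (P.pairing e e') * δ f)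
    (hsymm : ∀ e e', Γ e e' + Γ e' e = δ (P.pairing e e')) : IsPoly (quad δ Γ) := by
  refine IsPoly.of_D ?_ ?_ contMDiff_const (Hom.bdd (k := 2) (hom_quad δ Γ))
  · constructor
    · intro e e'
      rw [D_quad_sec, D_quad_sec, D_quad_sec, ← lin_add]
      congr 1
      ext1 e''
      exact hadd' _ _ _
    · intro f e
      rw [D_quad_sec, D_quad_sec, D_quad_fn, mul_const, hat_eq_lin, smul_lin, smul_lin, ← lin_add]
      congr 1
      ext1 e''
      rw [hsmul', Pi.add_apply, mul_comm (δ f)]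
    · intro f g
      rw [D_quad_fn, D_quad_fn, D_quad_fn, hδ.add, const_add]
    · intro f g
      rw [D_quad_fn, D_quad_fn, D_quad_fn, hδ.mul, const_add, smul_const, smul_const]
    · intro r
      rw [D_quad_fn, hδ.const]
      ext w : 1
      cases w <;> rfl
    · intro e e'
      rw [D_quad_sec, D_quad_sec, D_lin_sec, D_lin_sec, D_quad_fn, ← const_add, ← hsymm, add_comm]
    · intro e f
      rw [D_quad_sec, D_quad_fn, D_lin_fn, D_const]
    · intro f g
      rw [D_quad_fn, D_quad_fn, D_const, D_const]
  · rintro (e | f)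
    · rw [D_quad_sec]; exact isPoly_lin (hs e) (hadd e) (hsmul e)
    · rw [D_quad_fn]; exact isPoly_const (hδ.smooth f)

/-- The function of weight three whose brackets with a section and a function are given by `R`,
and whose brackets with three sections by `T`. -/
def cubic (R : P.Sec → Fn d M → U → ℝ) (T : P.Sec → P.Sec → P.Sec → U → ℝ) : Amb P U
  | [Sum.inl e, Sum.inr f] => R e f
  | [Sum.inr f, Sum.inl e] => R e f
  | [Sum.inl e, Sum.inl e', Sum.inl e''] => T e e' e''
  | _ => 0

lemma D_cubic_sec (R : P.Sec → Fn d M → U → ℝ) (T : P.Sec → P.Sec → P.Sec → U → ℝ) (e : P.Sec) :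
    D (ls P e) (cubic R T) = quad (R e) (T e) := by
  ext w : 1
  match w with
  | [] => rfl
  | [Sum.inl e'] => rfl
  | [Sum.inr f] => rfl
  | [Sum.inl _, Sum.inl _] => rfl
  | [Sum.inl _, Sum.inr _] => rfl
  | [Sum.inr _, l] => cases l <;> rfl
  | Sum.inl _ :: Sum.inl _ :: l' :: w => rfl
  | Sum.inl _ :: Sum.inr _ :: l' :: w => rfl
  | Sum.inr _ :: l :: l' :: w => rfl

lemma D_cubic_fn (R : P.Sec → Fn d M → U → ℝ) (T : P.Sec → P.Sec → P.Sec → U → ℝ) (f : Fn d M) :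
    D (lf P f) (cubic R T) = lin fun e => R e f := by
  ext w : 1
  match w with
  | [] => rfl
  | [Sum.inl e'] => rfl
  | [Sum.inr f] => rfl
  | Sum.inl _ :: l' :: w => rfl
  | Sum.inr _ :: l' :: w => rfl

lemma hom_cubic (R : P.Sec → Fn d M → U → ℝ) (T : P.Sec → P.Sec → P.Sec → U → ℝ) :
    Hom (cubic R T) 3 := by
  refine hom_of_D rfl ?_
  rintro (e | f)
  · rw [D_cubic_sec]; exact hom_quad _ _
  · rw [D_cubic_fn]; exact hom_lin _

lemma quad_add (δ δ' : Fn d M → U → ℝ) (Γ Γ' : P.Sec → P.Sec → U → ℝ) :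
    quad (δ + δ') (Γ + Γ') = quad δ Γ + quad δ' Γ' := by
  ext w : 1
  match w with
  | [] => exact (add_zero _).symm
  | Sum.inl e :: w =>
    change D (ls P e) (quad (δ + δ') (Γ + Γ')) w = (D (ls P e) (quad δ Γ) + D (ls P e) (quad δ' Γ')) w
    rw [D_quad_sec, D_quad_sec, D_quad_sec, ← lin_add]
    rfl
  | Sum.inr f :: w =>
    change D (lf P f) (quad (δ + δ') (Γ + Γ')) w = (D (lf P f) (quad δ Γ) + D (lf P f) (quad δ' Γ')) w
    rw [D_quad_fn, D_quad_fn, D_quad_fn, ← const_add]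
    rfl

/-! ### Partial derivatives in a chart -/

/-- The partial derivative of a function in the chart at `m`. -/
def pd (m : M) (a : Fin d) (f : M → ℝ) (y : M) : ℝ :=
  fderiv ℝ (f ∘ (chartAt (EuclideanSpace ℝ (Fin d)) m).symm)
    (chartAt (EuclideanSpace ℝ (Fin d)) m y) (EuclideanSpace.single a 1)

section

variable [IsManifold (𝓡 d) ∞ M] {m : M} {f g : M → ℝ}
  (hU : ∀ y ∈ U, y ∈ (chartAt (EuclideanSpace ℝ (Fin d)) m).source)
include hU

lemma contDiffOn_chart_comp (hf : ContMDiffOn (𝓡 d) 𝓘(ℝ, ℝ) ∞ f U) :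
    ContDiffOn ℝ ∞ (f ∘ (chartAt (EuclideanSpace ℝ (Fin d)) m).symm)
      ((chartAt (EuclideanSpace ℝ (Fin d)) m).target ∩
        (chartAt (EuclideanSpace ℝ (Fin d)) m).symm ⁻¹' U) := by
  have hsymm : ContMDiffOn (𝓡 d) (𝓡 d) ∞ (chartAt (EuclideanSpace ℝ (Fin d)) m).symm
    (chartAt (EuclideanSpace ℝ (Fin d)) m).target := contMDiffOn_chart_symm
  exact contMDiffOn_iff_contDiffOn.1 (hf.comp (hsymm.mono Set.inter_subset_left) fun y hy => hy.2)

lemma chart_mem {y : M} (hy : y ∈ U) : chartAt (EuclideanSpace ℝ (Fin d)) m y ∈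
    (chartAt (EuclideanSpace ℝ (Fin d)) m).target ∩
      (chartAt (EuclideanSpace ℝ (Fin d)) m).symm ⁻¹' U := by
  refine ⟨(chartAt (EuclideanSpace ℝ (Fin d)) m).map_source (hU y hy), ?_⟩
  rw [Set.mem_preimage, (chartAt (EuclideanSpace ℝ (Fin d)) m).left_inv (hU y hy)]
  exact hy

lemma isOpen_chart : IsOpen ((chartAt (EuclideanSpace ℝ (Fin d)) m).target ∩
    (chartAt (EuclideanSpace ℝ (Fin d)) m).symm ⁻¹' U) :=
  (chartAt (EuclideanSpace ℝ (Fin d)) m).symm.isOpen_inter_preimage U.isOpen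

lemma differentiableAt_chart_comp (hf : ContMDiffOn (𝓡 d) 𝓘(ℝ, ℝ) ∞ f U) {y : M} (hy : y ∈ U) :
    DifferentiableAt ℝ (f ∘ (chartAt (EuclideanSpace ℝ (Fin d)) m).symm)
      (chartAt (EuclideanSpace ℝ (Fin d)) m y) :=
  ((contDiffOn_chart_comp hU hf).contDiffAt
    ((isOpen_chart hU).mem_nhds (chart_mem hU hy))).differentiableAt (by simp)

lemma contMDiffOn_pd (a : Fin d) (hf : ContMDiffOn (𝓡 d) 𝓘(ℝ, ℝ) ∞ f U) :
    ContMDiffOn (𝓡 d) 𝓘(ℝ, ℝ) ∞ (pd m a f) U := by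
  have h1 := (contDiffOn_chart_comp hU hf).fderiv_of_isOpen (m := ∞) (isOpen_chart hU) (by simp)
  have h2 : ContMDiffOn (𝓡 d) (𝓡 d) ∞ (chartAt (EuclideanSpace ℝ (Fin d)) m)
    (chartAt (EuclideanSpace ℝ (Fin d)) m).source := contMDiffOn_chart
  have h3 := (h1.clm_apply contDiffOn_const (g := fun _ => EuclideanSpace.single a 1)).contMDiffOn
  exact h3.comp (h2.mono hU) fun y hy => chart_mem hU hy

lemma pd_add (a : Fin d) (hf : ContMDiffOn (𝓡 d) 𝓘(ℝ, ℝ) ∞ f U)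
    (hg : ContMDiffOn (𝓡 d) 𝓘(ℝ, ℝ) ∞ g U) {y : M} (hy : y ∈ U) :
    pd m a (fun y => f y + g y) y = pd m a f y + pd m a g y := by
  have := fderiv_add (differentiableAt_chart_comp hU hf hy) (differentiableAt_chart_comp hU hg hy)
  exact congrArg (fun L => L (EuclideanSpace.single a 1)) this

lemma pd_mul (a : Fin d) (hf : ContMDiffOn (𝓡 d) 𝓘(ℝ, ℝ) ∞ f U)
    (hg : ContMDiffOn (𝓡 d) 𝓘(ℝ, ℝ) ∞ g U) {y : M} (hy : y ∈ U) :
    pd m a (fun y => f y * g y) y = f y * pd m a g y + g y * pd m a f y := by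
  have := fderiv_mul (differentiableAt_chart_comp hU hf hy) (differentiableAt_chart_comp hU hg hy)
  refine (congrArg (fun L => L (EuclideanSpace.single a 1)) this).trans ?_
  simp [pd, (chartAt (EuclideanSpace ℝ (Fin d)) m).left_inv (hU y hy)]

lemma pd_congr (a : Fin d) {y : M} (hy : y ∈ U) (h : f =ᶠ[𝓝 y] g) : pd m a f y = pd m a g y := by
  have h1 : f ∘ (chartAt (EuclideanSpace ℝ (Fin d)) m).symm =ᶠ[𝓝 (chartAt (EuclideanSpace ℝ (Fin d)) m y)]
      g ∘ (chartAt (EuclideanSpace ℝ (Fin d)) m).symm := by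
    have h2 := (chartAt (EuclideanSpace ℝ (Fin d)) m).continuousAt_symm
      ((chartAt (EuclideanSpace ℝ (Fin d)) m).map_source (hU y hy))
    rw [ContinuousAt, (chartAt (EuclideanSpace ℝ (Fin d)) m).left_inv (hU y hy)] at h2
    exact h2.eventually h
  rw [pd, pd, h1.fderiv_eq]

lemma pd_coord (a b : Fin d) {y : M} (hy : y ∈ U) :
    pd m a (fun y => chartAt (EuclideanSpace ℝ (Fin d)) m y b) y = if a = b then 1 else 0 := by
  have h1 : (fun y => chartAt (EuclideanSpace ℝ (Fin d)) m y b) ∘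
      (chartAt (EuclideanSpace ℝ (Fin d)) m).symm
      =ᶠ[𝓝 (chartAt (EuclideanSpace ℝ (Fin d)) m y)] (EuclideanSpace.proj b : EuclideanSpace ℝ (Fin d) →L[ℝ] ℝ) := by
    filter_upwards [(chartAt (EuclideanSpace ℝ (Fin d)) m).open_target.mem_nhds
      ((chartAt (EuclideanSpace ℝ (Fin d)) m).map_source (hU y hy))] with z hz
    simp [(chartAt (EuclideanSpace ℝ (Fin d)) m).right_inv hz]
  rw [pd, h1.fderiv_eq, ContinuousLinearMap.fderiv]
  simp [eq_comm]

end

lemma pd_const (m : M) (a : Fin d) (r : ℝ) (y : M) : pd m a (fun _ => r) y = 0 := by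
  have : (fun _ : M => r) ∘ (chartAt (EuclideanSpace ℝ (Fin d)) m).symm = fun _ => r := rfl
  rw [pd, this]
  simp

end PreCourant

end

/-! ### Existence of coordinates -/

noncomputable section

namespace PreCourant

open Filter Topology Shuf VBundle

variable {d : ℕ} {M : Type u} [TopologicalSpace M] [ChartedSpace (EuclideanSpace ℝ (Fin d)) M]
variable {P : PreCourantAlgebroid d M} {U V W : Opens M}

lemma contMDiff_restrict {f : M → ℝ} (hf : ContMDiffOn (𝓡 d) 𝓘(ℝ, ℝ) ∞ f U) :
    ContMDiff (𝓡 d) 𝓘(ℝ, ℝ) ∞ fun y : U => f y.1 :=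
  hf.comp_contMDiff contMDiff_subtype_val fun y => y.2

/-- A frame over an open set restricts to smaller open sets. -/
def VBundle.Frame.res {E : VBundle d M} (F : E.Frame V) (h : U ≤ V) : E.Frame U where
  e := F.e
  c := F.c
  sum_eq x hx := F.sum_eq x (h hx)
  c_e x hx := F.c_e x (h hx)
  smooth s i := (F.smooth s i).mono h

section

variable [T2Space M] [IsManifold (𝓡 d) ∞ M]

lemma contMDiffOn_coord {m : M} (hU : ∀ y ∈ U, y ∈ (chartAt (EuclideanSpace ℝ (Fin d)) m).source)
    (a : Fin d) : ContMDiffOn (𝓡 d) 𝓘(ℝ, ℝ) ∞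
      (fun y => chartAt (EuclideanSpace ℝ (Fin d)) m y a) U := by
  have h1 : ContMDiffOn (𝓡 d) (𝓡 d) ∞ (chartAt (EuclideanSpace ℝ (Fin d)) m)
    (chartAt (EuclideanSpace ℝ (Fin d)) m).source := contMDiffOn_chart
  have h2 : ContMDiff (𝓡 d) 𝓘(ℝ, ℝ) ∞ (fun z : EuclideanSpace ℝ (Fin d) => z a) := by
    rw [contMDiff_iff_contDiff]
    fun_prop
  exact (h2.comp_contMDiffOn h1).mono hU

/-- The coordinates of the chart at `m`, on an open subset of its domain. -/
def coordFn {m : M} (hU : ∀ y ∈ U, y ∈ (chartAt (EuclideanSpace ℝ (Fin d)) m).source)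
    (a : Fin d) : Fn d U :=
  ⟨fun y => chartAt (EuclideanSpace ℝ (Fin d)) m y.1 a, contMDiff_restrict (contMDiffOn_coord hU a)⟩

section momentum

variable {m : M} (hU : ∀ y ∈ U, y ∈ (chartAt (EuclideanSpace ℝ (Fin d)) m).source)
  (F : P.toVBundle.Frame U)

/-- The bracket of two sections with the momentum dual to a coordinate of the base. It comes from
the connection for which the frame is parallel, made compatible with the metric. -/
def momentumΓ (m : M) (F : P.toVBundle.Frame U) (a : Fin d) (e e' : P.Sec) (y : M) : ℝ :=
  (1 / 2) * (pd m a (P.pairing e e') y +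
    ∑ i, pd m a (fun y => F.c i y (e y)) y * P.pairing (F.e i) e' y -
    ∑ i, pd m a (fun y => F.c i y (e' y)) y * P.pairing e (F.e i) y)

/-- The momentum dual to a coordinate of the base. -/
def momentum (m : M) (F : P.toVBundle.Frame U) (a : Fin d) : Amb P U :=
  quad (fun f y => pd m a f y.1) fun e e' y => momentumΓ m F a e e' y.1

include hU

lemma isSymbol_pd (a : Fin d) : IsSymbol fun (f : Fn d M) (y : U) => pd m a f y.1 where
  smooth f := contMDiff_restrict (contMDiffOn_pd hU a f.contMDiff.contMDiffOn)
  add f g := by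
    ext y
    exact pd_add hU a f.contMDiff.contMDiffOn g.contMDiff.contMDiffOn y.2
  mul f g := by
    ext y
    exact pd_mul hU a f.contMDiff.contMDiffOn g.contMDiff.contMDiffOn y.2
  const r := by
    ext y
    exact pd_const m a r y.1

lemma momentumΓ_add_right (a : Fin d) (e e' e'' : P.Sec) {y : M} (hy : y ∈ U) :
    momentumΓ m F a e (e' + e'') y = momentumΓ m F a e e' y + momentumΓ m F a e e'' y := by
  have h1 : pd m a (P.pairing e (e' + e'')) y = pd m a (P.pairing e e') y +
      pd m a (P.pairing e e'') y := by
    rw [pairing_add_right]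
    exact pd_add hU a (P.pairing e e').contMDiff.contMDiffOn
      (P.pairing e e'').contMDiff.contMDiffOn hy
  have h2 : ∀ i, pd m a (fun y => F.c i y ((e' + e'') y)) y =
      pd m a (fun y => F.c i y (e' y)) y + pd m a (fun y => F.c i y (e'' y)) y := fun i => by
    rw [← pd_add hU a (F.smooth e' i) (F.smooth e'' i) hy]
    congr 1
    ext y
    exact map_add (F.c i y) _ _
  have h3 : ∀ i, P.pairing (F.e i) (e' + e'') y =
      P.pairing (F.e i) e' y + P.pairing (F.e i) e'' y := fun i => map_add (P.metric y _) _ _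
  simp only [momentumΓ, h1, h2, h3, mul_add, add_mul, Finset.sum_add_distrib]
  ring

lemma momentumΓ_smul_right (a : Fin d) (e : P.Sec) (f : Fn d M) (e' : P.Sec) {y : M} (hy : y ∈ U) :
    momentumΓ m F a e (smulSec f e') y = f y * momentumΓ m F a e e' y := by
  have h1 : pd m a (P.pairing e (smulSec f e')) y = f y * pd m a (P.pairing e e') y +
      P.pairing e e' y * pd m a f y := by
    rw [pairing_smul_right]
    exact pd_mul hU a f.contMDiff.contMDiffOn (P.pairing e e').contMDiff.contMDiffOn hy
  have h2 : ∀ i, pd m a (fun y => F.c i y (smulSec f e' y)) y =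
      f y * pd m a (fun y => F.c i y (e' y)) y + F.c i y (e' y) * pd m a f y := fun i => by
    rw [← pd_mul hU a f.contMDiff.contMDiffOn (F.smooth e' i) hy]
    congr 1
    ext y
    exact map_smul (F.c i y) _ _
  have h3 : ∀ i, P.pairing (F.e i) (smulSec f e') y = f y * P.pairing (F.e i) e' y := fun i =>
    map_smul (P.metric y _) _ _
  have h4 : P.pairing e e' y = ∑ i, F.c i y (e' y) * P.pairing e (F.e i) y := by
    change P.metric y (e y) (e' y) = _
    conv_lhs => rw [← F.sum_eq y hy (e' y)]
    rw [map_sum]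
    exact Finset.sum_congr rfl fun i _ => map_smul (P.metric y (e y)) _ _
  simp only [momentumΓ, h1, h2, h3, add_mul, Finset.sum_add_distrib, mul_assoc, mul_left_comm _ (f y),
    ← Finset.mul_sum, mul_left_comm _ (pd m a f y), h4]
  ring

lemma momentumΓ_symm (a : Fin d) (e e' : P.Sec) (y : M) :
    momentumΓ m F a e e' y + momentumΓ m F a e' e y = pd m a (P.pairing e e') y := by
  have h : ∀ i, P.pairing (F.e i) e y = P.pairing e (F.e i) y := fun i => by rw [pairing_comm]
  have h' : ∀ i, P.pairing (F.e i) e' y = P.pairing e' (F.e i) y := fun i => by rw [pairing_comm]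
  simp only [momentumΓ, h, h', pairing_comm e' e]
  ring

lemma contMDiffOn_momentumΓ (a : Fin d) (e e' : P.Sec) :
    ContMDiffOn (𝓡 d) 𝓘(ℝ, ℝ) ∞ (momentumΓ m F a e e') U := by
  have h1 := fun (e : P.Sec) i => contMDiffOn_pd hU a (F.smooth e i)
  have h2 := fun (e e' : P.Sec) => (P.pairing e e').contMDiff.contMDiffOn (s := (U : Set M))
  unfold momentumΓ
  refine contMDiffOn_const.mul (((contMDiffOn_pd hU a (h2 e e')).add
    (contMDiffOn_finsetSum fun i _ => (h1 e i).mul (h2 _ _))).sub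
    (contMDiffOn_finsetSum fun i _ => (h1 e' i).mul (h2 _ _)))

lemma isPoly_momentum (a : Fin d) : IsPoly (momentum m F a) := by
  have hs : ∀ e e' : P.Sec, ∀ y, momentumΓ m F a e e' y =
      pd m a (P.pairing e e') y - momentumΓ m F a e' e y := fun e e' y => by
    rw [← momentumΓ_symm hU F a e e' y]; ring
  refine isPoly_quad (isSymbol_pd hU a)
    (fun e e' => contMDiff_restrict (contMDiffOn_momentumΓ hU F a e e')) ?_ ?_ ?_ ?_ ?_
  · intro e e' e''
    ext y
    exact momentumΓ_add_right hU F a e e' e'' y.2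
  · intro e f e'
    ext y
    exact momentumΓ_smul_right hU F a e f e' y.2
  · intro e e' e''
    ext y
    change momentumΓ m F a (e + e') e'' y.1 = momentumΓ m F a e e'' y.1 + momentumΓ m F a e' e'' y.1
    have h1 := momentumΓ_add_right hU F a e'' e e' y.2
    have h2 : pd m a (P.pairing (e + e') e'') y.1 = pd m a (P.pairing e e'') y.1 +
        pd m a (P.pairing e' e'') y.1 := by
      rw [pairing_comm, pairing_add_right, pairing_comm e, pairing_comm e']
      exact congrFun ((isSymbol_pd hU a).add (P.pairing e'' e) (P.pairing e'' e')) y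
    rw [hs, hs e, hs e', h1, h2]
    ring
  · intro f e e'
    ext y
    change momentumΓ m F a (smulSec f e) e' y.1 =
      f y.1 * momentumΓ m F a e e' y.1 + P.pairing e e' y.1 * pd m a f y.1
    have h1 := momentumΓ_smul_right hU F a e' f e y.2
    have h2 : pd m a (P.pairing (smulSec f e) e') y.1 = f y.1 * pd m a (P.pairing e e') y.1 +
        P.pairing e e' y.1 * pd m a f y.1 := by
      rw [pairing_comm, pairing_smul_right, pairing_comm e]
      exact congrFun ((isSymbol_pd hU a).mul f (P.pairing e' e)) y
    rw [hs, hs e, h1, h2]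
    ring
  · intro e e'
    ext y
    exact momentumΓ_symm hU F a e e' y.1

lemma pb_coord_momentum (a b : Fin d) :
    pb (const ⇑(coordFn hU b)) (momentum m F a) = const fun _ => if a = b then 1 else 0 := by
  ext w y
  obtain ⟨X, hX⟩ := exists_coord m (hU y.1 y.2)
  rw [pb_const_apply (isPoly_momentum hU F a) (y := y) (g := X b)
    (by filter_upwards [hX b] with z hz _; exact hz), momentum, D_quad_fn]
  match w with
  | [] => exact (pd_congr hU a y.2 (hX b)).trans (pd_coord hU a b y.2)
  | l :: w => rfl

/-- Coordinates over an open set that carries a chart of the base and a frame of the bundle. -/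
def frameCoord : PolyCoord P U P.rank d where
  m := m
  subset := hU
  x := coordFn hU
  x_apply _ _ := rfl
  ξ i := ⟨hat U (F.e i), isPoly_hat _⟩
  p a := ⟨momentum m F a, isPoly_momentum hU F a⟩
  ξ_hom i := hom_hat _
  p_hom a := hom_quad _ _
  G := gram F
  G' := (gram F)⁻¹
  G_eq i j := by
    rw [pb_hat _ (isPoly_hat _), D_hat_inl, pairing_comm]
    rfl
  G'_mul := Matrix.nonsing_inv_mul _ (isUnit_gram F)
  X := 1
  X' := 1
  X_eq b a := by
    rw [pb_coord_momentum hU F a b, Matrix.one_apply]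
    simp only [eq_comm (a := a)]
    split_ifs <;> rfl
  X'_mul := mul_one _
  mul_X' := mul_one _
  span e := by
    refine ⟨fun i => ⟨fun y => F.c i y.1 (e y.1), contMDiff_restrict (F.smooth e i)⟩, ?_⟩
    have h1 : ∀ w, (hat U e : Amb P U) w = ∑ i, ((fun y : U => F.c i y.1 (e y.1)) • hat U (F.e i) : Amb P U) w := by
      intro w
      match w with
      | [] => simp
      | [Sum.inr f] => exact (Finset.sum_eq_zero fun i _ => mul_zero _).symm
      | l :: l' :: w =>
        rw [hat_cons_cons]
        refine (Finset.sum_eq_zero fun i _ => ?_).symm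
        rw [Shuf.smul_apply, hat_cons_cons, smul_zero]
      | [Sum.inl e'] =>
        ext y
        rw [Finset.sum_apply]
        change P.metric y.1 (e y.1) (e' y.1) =
          ∑ i, F.c i y.1 (e y.1) * P.metric y.1 (F.e i y.1) (e' y.1)
        conv_lhs => rw [← F.sum_eq y.1 y.2 (e y.1)]
        rw [map_sum, LinearMap.sum_apply]
        exact Finset.sum_congr rfl fun i _ => by
          rw [map_smul, LinearMap.smul_apply, smul_eq_mul]
    ext w : 1
    rw [h1, Shuf.sum_apply]
    exact Finset.sum_congr rfl fun i _ => congrFun (fn_smul_val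
      (⟨fun y => F.c i y.1 (e y.1), contMDiff_restrict (F.smooth e i)⟩ : Fn d U)
      (⟨hat U (F.e i), isPoly_hat _⟩ : polyAlg P U)).symm w

end momentum

/-- Coordinates restrict to smaller open sets. -/
def PolyCoord.res {q r : ℕ} (z : PolyCoord P V q r) (h : U ≤ V) : PolyCoord P U q r where
  m := z.m
  subset y hy := z.subset y (h hy)
  x a := (z.x a).res h
  x_apply a y := z.x_apply a _
  ξ i := ⟨resA h (z.ξ i).1, (z.ξ i).2.res h⟩
  p a := ⟨resA h (z.p a).1, (z.p a).2.res h⟩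
  ξ_hom i := Hom.mapHom _ (z.ξ_hom i)
  p_hom a := Hom.mapHom _ (z.p_hom a)
  G := Matrix.of fun i j => (z.G i j).res h
  G' := Matrix.of fun i j => (z.G' i j).res h
  G_eq i j := by
    rw [← pb_res h (z.ξ i).2 (z.ξ j).2, z.G_eq, resA_const]
    rfl
  G'_mul := res_mul h z.G'_mul
  X := Matrix.of fun i j => (z.X i j).res h
  X' := Matrix.of fun i j => (z.X' i j).res h
  X_eq b a := by
    have := congrArg (resA h) (z.X_eq b a)
    rw [pb_res h (z.isPoly_x b) (z.p a).2, resA_const, resA_const] at this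
    exact this
  X'_mul := res_mul h z.X'_mul
  mul_X' := res_mul h z.mul_X'
  span e := by
    obtain ⟨c, hc⟩ := z.span e
    refine ⟨fun i => (c i).res h, ?_⟩
    have h1 := congrArg (resA h) hc
    rw [resA_hat] at h1
    rw [h1]
    ext w : 1
    rw [Shuf.sum_apply]
    ext y
    rw [resA_apply, Shuf.sum_apply, Finset.sum_apply, Finset.sum_apply]
    refine Finset.sum_congr rfl fun i _ => ?_
    rw [fn_smul_val, fn_smul_val]
    rfl
where
  res_mul {m n : ℕ} (h : U ≤ V) {A : Matrix (Fin m) (Fin n) (Fn d V)}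
      {B : Matrix (Fin n) (Fin m) (Fn d V)} (hAB : A * B = 1) :
      (Matrix.of fun i j => (A i j).res h) * (Matrix.of fun i j => (B i j).res h) = 1 := by
    let φ : Fn d V →+* Fn d U := ⟨⟨⟨fun f => f.res h, rfl⟩, fun _ _ => rfl⟩, rfl, fun _ _ => rfl⟩
    have := congrArg (fun C => Matrix.map C φ) hAB
    simp only [Matrix.map_mul] at this
    rw [Matrix.map_one φ (map_zero φ) (map_one φ)] at this
    exact this

variable (P) in
/-- Around every point there is an open set that carries a chart and a frame. -/
lemma exists_chart_frame (m : M) : ∃ V : Opens M, m ∈ V ∧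
    (∀ y ∈ V, y ∈ (chartAt (EuclideanSpace ℝ (Fin d)) m).source) ∧
      Nonempty (P.toVBundle.Frame V) := by
  obtain ⟨V, hm, ⟨F⟩⟩ := exists_frame P.toVBundle m
  exact ⟨V ⊓ ⟨_, (chartAt (EuclideanSpace ℝ (Fin d)) m).open_source⟩,
    ⟨hm, mem_chart_source _ m⟩, fun y hy => hy.2, ⟨F.res inf_le_left⟩⟩

end

end PreCourant

end

/-! ### The symplectic N-manifold of a pre-Courant algebroid -/

noncomputable section

namespace PreCourant

open Filter Topology Shuf VBundle

variable {d : ℕ} {M : Type u} [TopologicalSpace M] [ChartedSpace (EuclideanSpace ℝ (Fin d)) M]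
variable [T2Space M] [IsManifold (𝓡 d) ∞ M]
variable {P : PreCourantAlgebroid d M} {U V W : Opens M}

variable (P U) in
/-- The polynomial functions of weight `k`, as a real vector space. -/
def degPart (k : ℕ) : Submodule ℝ (polyAlg P U) where
  carrier := {a | Hom a.1 k}
  add_mem' ha hb := Hom.add ha hb
  zero_mem' := hom_zero _
  smul_mem' r a ha := Hom.smul (a := a.1) ha r

lemma mem_degPart {k : ℕ} {a : polyAlg P U} : a ∈ degPart P U k ↔ Hom a.1 k := Iff.rfl

lemma isInternal_degPart : DirectSum.IsInternal (degPart P U) := by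
  refine DirectSum.isInternal_submodule_of_iSupIndep_of_iSup_eq_top ?_ ?_
  · intro k
    rw [Submodule.disjoint_def]
    intro a ha hb
    let K : Submodule ℝ (polyAlg P U) :=
      { carrier := {a | Shuf.proj (k : ℤ) a.1 = 0}
        add_mem' := fun {a b} ha hb => by
          change Shuf.proj (k : ℤ) (a.1 + b.1) = 0
          rw [map_add, show Shuf.proj (k : ℤ) a.1 = 0 from ha,
            show Shuf.proj (k : ℤ) b.1 = 0 from hb, add_zero]
        zero_mem' := map_zero _
        smul_mem' := fun r a ha => by
          change Shuf.proj (k : ℤ) (r • a.1) = 0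
          rw [rsmul_eq, const_mul, map_smul, show Shuf.proj (k : ℤ) a.1 = 0 from ha, smul_zero] }
    have h1 : (⨆ j, ⨆ (_ : j ≠ k), degPart P U j) ≤ K :=
      iSup_le fun j => iSup_le fun hj b hb => Hom.proj_ne hb (by exact_mod_cast hj.symm)
    exact Subtype.ext (((mem_degPart.1 ha).proj_eq).symm.trans (h1 hb))
  · refine top_le_iff.1 fun a _ => ?_
    obtain ⟨n, hn⟩ := a.2.exists_sum_proj
    have : a = ∑ k ∈ Finset.range n, ⟨Shuf.proj (k : ℤ) a.1, a.2.proj k⟩ := Subtype.ext <| by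
      rw [AddSubmonoidClass.coe_finsetSum]
      exact hn
    rw [this]
    exact Submodule.sum_mem _ fun k _ => Submodule.mem_iSup_of_mem k (hom_proj _ _)

instance instGradedDegPart : GradedAlgebra (degPart P U) :=
  { DirectSum.IsInternal.chooseDecomposition (degPart P U) isInternal_degPart with
    one_mem := hom_const _
    mul_mem := fun i j a b ha hb => by
      have := Hom.mul (mem_degPart.1 ha) (mem_degPart.1 hb)
      rwa [← Nat.cast_add] at this }

lemma neg_one_pow_mul (n : ℕ) (a : polyAlg P U) :
    ((-1) ^ n * a).1 = ((-1 : ℤˣ) ^ n) • a.1 := by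
  rcases Nat.even_or_odd n with hn | hn
  · simp [hn.neg_one_pow]
  · simp [hn.neg_one_pow]

lemma θ_of_hom {a : Amb P U} {j : ℕ} (h : Hom a j) (i : ℕ) :
    θ ((-1) ^ i) a = ((-1 : ℤˣ) ^ (i * j)) • a := by
  rw [h.isPar.θ_pow, ← pow_mul, mul_comm]

/-- Restriction of polynomial functions. -/
def resHom (h : U ≤ V) : polyAlg P V →ₐ[ℝ] polyAlg P U where
  toFun a := ⟨resA h a.1, a.2.res h⟩
  map_one' := Subtype.ext (resA_const h 1)
  map_mul' a b := Subtype.ext (resA_mul h a.1 b.1)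
  map_zero' := rfl
  map_add' a b := Subtype.ext (resA_add h a.1 b.1)
  commutes' r := Subtype.ext <| by
    change resA h (algebraMap ℝ (Amb P V) r) = algebraMap ℝ (Amb P U) r
    rw [algebraMap_eq, algebraMap_eq, resA_const]
    rfl

/-- Polynomial functions of a given weight that agree on overlaps glue. -/
lemma polyAlg_glue {ι : Type u} (V : ι → Opens M) (hV : ∀ i, V i ≤ U) (hU : U ≤ ⨆ i, V i) (k : ℕ)
    (s : ∀ i, polyAlg P (V i)) (hs : ∀ i, s i ∈ degPart P (V i) k)
    (h : ∀ i j, resHom (inf_le_left : V i ⊓ V j ≤ V i) (s i) =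
      resHom (inf_le_right : V i ⊓ V j ≤ V j) (s j)) :
    ∃! t : polyAlg P U, t ∈ degPart P U k ∧ ∀ i, resHom (hV i) t = s i := by
  have hcov : ∀ x : U, ∃ i, x.1 ∈ V i := fun x => by
    simpa using hU x.2
  choose i hi using hcov
  let t : Amb P U := fun w x => (s (i x)).1 w ⟨x.1, hi x⟩
  have ht : ∀ j, resA (hV j) t = (s j).1 := by
    intro j
    ext w y
    let x : U := Set.inclusion (hV j) y
    exact congrFun (congrFun (congrArg Subtype.val (h (i x) j)) w) ⟨y.1, hi x, y.2⟩
  have hloc : ∀ x : U, ∃ (W : Opens M) (hW : W ≤ U), x.1 ∈ W ∧ IsPoly (resA hW t) := fun x =>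
    ⟨V (i x), hV _, hi x, by rw [ht]; exact (s (i x)).2⟩
  have hk : Hom t k := fun w hw => by
    ext x
    exact congrFun (hs (i x) w hw) ⟨x.1, hi x⟩
  have hp : IsPoly t := by
    refine ⟨fun w => Rel.of_cover fun x => ?_, Hom.bdd hk, fun w x => ?_⟩
    · obtain ⟨W, hW, hx, h⟩ := hloc x
      exact ⟨W, hW, hx, by rw [← Dw_res]; exact h.rel w⟩
    · obtain ⟨W, hW, hx, h⟩ := hloc x
      have h1 : ContMDiffAt (𝓡 d) 𝓘(ℝ, ℝ) ∞ (fun y : W => extZero (t w) y.1) ⟨x.1, hx⟩ :=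
        (h.smooth w _).congr_of_eventuallyEq (Eventually.of_forall fun y =>
          extZero_of_mem (t w) (hW y.2))
      have h2 := contMDiffAt_subtype_iff.1 h1
      have h3 : ContMDiffAt (𝓡 d) 𝓘(ℝ, ℝ) ∞ (fun y : U => extZero (t w) y.1) x :=
        contMDiffAt_subtype_iff.2 h2
      exact h3.congr_of_eventuallyEq (Eventually.of_forall fun y =>
        (extZero_of_mem (t w) y.2).symm)
  refine ⟨⟨t, hp⟩, ⟨hk, fun j => Subtype.ext (ht j)⟩, fun t' ht' => Subtype.ext ?_⟩
  refine amb_ext_of_cover fun x => ⟨V (i x), hV _, hi x, ?_⟩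
  exact (congrArg Subtype.val (ht'.2 (i x))).trans (ht (i x)).symm

lemma map_monomial {A B : Type u} [Ring A] [Ring B] (φ : A →+* B) {q r : ℕ} (ξ : Fin q → A)
    (p : Fin r → A) (m : Finset (Fin q) × (Fin r → ℕ)) :
    φ (monomial ξ p m) = monomial (fun i => φ (ξ i)) (fun a => φ (p a)) m := by
  obtain ⟨S, α⟩ := m
  rw [monomial_eq, monomial_eq, map_mul, prodξ, prodξ, prodp, prodp, map_list_prod, map_list_prod,
    List.map_map, List.map_map]
  congr 2
  · refine List.map_congr_left fun i _ => ?_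
    simp only [Function.comp_apply]
    split_ifs <;> simp
  · refine List.map_congr_left fun a _ => ?_
    simp only [Function.comp_apply, map_pow]

lemma resHom_monomial {q r : ℕ} (h : U ≤ V) (ξ : Fin q → polyAlg P V) (p : Fin r → polyAlg P V)
    (m : Finset (Fin q) × (Fin r → ℕ)) :
    resHom h (monomial ξ p m) = monomial (fun i => resHom h (ξ i)) (fun a => resHom h (p a)) m :=
  map_monomial (resHom h).toRingHom ξ p m

lemma PolyCoord.free {q r : ℕ} (z : PolyCoord P V q r) (h : U ≤ V) (a : polyAlg P U) :
    ∃! c : (Finset (Fin q) × (Fin r → ℕ)) →₀ Fn d U,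
      a = c.sum fun s f => baseHom P U f * resHom h (monomial z.ξ z.p s) := by
  simp only [resHom_monomial]
  exact (z.res h).existsUnique a

variable (P) in
/-- The N-manifold of a pre-Courant algebroid. -/
def polyNManifold : NManifold d M where
  A U := polyAlg P U
  deg U := degPart P U
  graded_comm U i j a ha b hb := Subtype.ext <| by
    rw [neg_one_pow_mul, MulMemClass.coe_mul, (mem_degPart.1 ha).isPar.mul_comm,
      θ_of_hom (mem_degPart.1 hb), Shuf.usmul_mul]
    rfl
  res h := resHom h
  res_deg h k a ha := Hom.mapHom _ (mem_degPart.1 ha)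
  res_self _ _ := rfl
  res_res _ _ _ := rfl
  glue U V hV hU k s hs h := polyAlg_glue V hV hU k s hs h
  base U := { baseHom P U with
    commutes' := fun r => Subtype.ext <| by
      change const _ = algebraMap ℝ (Amb P U) r
      rw [algebraMap_eq]
      rfl }
  base_injective U f g h := by
    ext y
    exact congrFun (congrFun (congrArg Subtype.val h) []) y
  base_range U a := by
    refine ⟨fun h => ?_, ?_⟩
    · obtain ⟨f, hf⟩ := a.2.eq_algebraMap (mem_degPart.1 h)
      exact ⟨f, Subtype.ext hf⟩
    · rintro ⟨f, rfl⟩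
      exact hom_const _
  base_res h f := Subtype.ext (resA_const h _)
  q := P.rank
  r := d
  local_coord m := by
    obtain ⟨V, hm, hV, ⟨F⟩⟩ := exists_chart_frame P m
    exact ⟨V, hm, (frameCoord hV F).ξ, (frameCoord hV F).p, fun i => hom_hat _,
      fun a => hom_quad _ _, fun W h a => (frameCoord hV F).free h a⟩

/-- A matrix of this block form is invertible, also over a noncommutative ring. -/
lemma isUnit_fromBlocks {A : Type*} [Ring A] {l m n : Type} [Fintype l] [Fintype m] [Fintype n]
    [DecidableEq l] [DecidableEq m] [DecidableEq n] {X : Matrix l n A} {X' : Matrix n l A}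
    {Y : Matrix n l A} {Y' : Matrix l n A} {G G' : Matrix m m A} (C : Matrix m n A)
    (C' : Matrix n m A) (B : Matrix n n A) (hX : X * X' = 1) (hX' : X' * X = 1) (hY : Y * Y' = 1)
    (hY' : Y' * Y = 1) (hG : G * G' = 1) (hG' : G' * G = 1) :
    IsUnit (Matrix.fromBlocks (0 : Matrix l l A) (Matrix.fromCols (0 : Matrix l m A) X)
      (Matrix.fromRows (0 : Matrix m l A) Y) (Matrix.fromBlocks G C C' B)) := by
  have hX₂ : ∀ {k : Type} (Z : Matrix k n A), Z * X' * X = Z := fun Z => by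
    rw [Matrix.mul_assoc, hX', Matrix.mul_one]
  have hY₁ : ∀ {k : Type} (Z : Matrix n k A), Y * (Y' * Z) = Z := fun Z => by
    rw [← Matrix.mul_assoc, hY, Matrix.one_mul]
  have hG₁ : ∀ {k : Type} (Z : Matrix m k A), G * (G' * Z) = Z := fun Z => by
    rw [← Matrix.mul_assoc, hG, Matrix.one_mul]
  have hG₂ : ∀ {k : Type} (Z : Matrix k m A), Z * G' * G = Z := fun Z => by
    rw [Matrix.mul_assoc, hG', Matrix.mul_one]
  have e1 : (Matrix.fromBlocks 1 0 0 (Matrix.fromBlocks 1 0 0 1) :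
      Matrix (l ⊕ (m ⊕ n)) (l ⊕ (m ⊕ n)) A) = 1 := by
    rw [Matrix.fromBlocks_one, Matrix.fromBlocks_one]
  let K := Matrix.fromBlocks (Y' * (C' * (G' * (C * X'))) - Y' * (B * X'))
    (Matrix.fromCols (-(Y' * (C' * G'))) Y') (Matrix.fromRows (-(G' * (C * X'))) X')
    (Matrix.fromBlocks G' (0 : Matrix m n A) (0 : Matrix n m A) (0 : Matrix n n A))
  have f0 : (Matrix.fromCols 0 0 : Matrix l (m ⊕ n) A) = 0 := by
    ext i (j | j) <;> rfl
  have f1 : (Matrix.fromRows 0 0 : Matrix (m ⊕ n) l A) = 0 := by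
    ext (j | j) i <;> rfl
  refine isUnit_iff_exists.2 ⟨K, ?_, ?_⟩
  · rw [← e1, Matrix.fromBlocks_multiply]
    congr 1
    · rw [Matrix.fromCols_mul_fromRows]
      simp [hX]
    · rw [Matrix.fromCols_mul_fromBlocks]
      simp [f0]
    · rw [Matrix.fromRows_mul, Matrix.fromBlocks_mul_fromRows, ← f1]
      ext (i | i) j
      · simp [hG₁]
      · simp [Matrix.mul_sub, hY₁]
    · rw [Matrix.fromRows_mul_fromCols, Matrix.fromBlocks_multiply, Matrix.fromBlocks_add]
      simp [hG, hY, hY₁]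
  · rw [← e1, Matrix.fromBlocks_multiply]
    congr 1
    · rw [Matrix.fromCols_mul_fromRows]
      simp [hY']
    · rw [Matrix.mul_fromCols, Matrix.fromCols_mul_fromBlocks, ← f0]
      ext i (j | j)
      · simp [← Matrix.mul_assoc, hG₂]
      · simp [← Matrix.mul_assoc, hX₂, Matrix.sub_mul]
    · rw [Matrix.fromBlocks_mul_fromRows]
      simp [f1]
    · rw [Matrix.fromRows_mul_fromCols, Matrix.fromBlocks_multiply, Matrix.fromBlocks_add]
      simp [hG', hX', ← Matrix.mul_assoc, hX₂]

end PreCourant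

end

noncomputable section

namespace PreCourant

open Filter Topology Shuf VBundle

variable {d : ℕ} {M : Type u} [TopologicalSpace M] [ChartedSpace (EuclideanSpace ℝ (Fin d)) M]
variable {P : PreCourantAlgebroid d M} {U V W : Opens M}

lemma const_zero : (const 0 : Amb P U) = 0 := by
  ext w
  cases w <;> rfl

lemma amb_ext {a b : Amb P U} (h0 : a [] = b []) (h : ∀ l, D l a = D l b) : a = b := by
  ext w : 1
  cases w with
  | nil => exact h0
  | cons l w => exact congrFun (h l) w

variable [T2Space M] [IsManifold (𝓡 d) ∞ M]

variable (P U) in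
/-- The Poisson bracket as a bilinear map of polynomial functions. -/
def pbLin : polyAlg P U →ₗ[ℝ] polyAlg P U →ₗ[ℝ] polyAlg P U :=
  LinearMap.mk₂ ℝ (fun a b => ⟨pb a.1 b.1, a.2.pb b.2⟩)
    (fun a b c => Subtype.ext (pb_add_left a.2 b.2 c.2))
    (fun r a b => Subtype.ext (pb_smul_left r a.2 b.2))
    (fun a b c => Subtype.ext (pb_add_right a.2 b.2 c.2))
    (fun r a b => Subtype.ext (pb_smul_right r a.2 b.2))

lemma pbLin_val (a b : polyAlg P U) : (pbLin P U a b).1 = pb a.1 b.1 := rfl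

/-- The coordinates of the N-manifold of `P` given by a chart and a frame. -/
def frameCoordN {m : M} (hm : m ∈ U)
    (hU : ∀ y ∈ U, y ∈ (chartAt (EuclideanSpace ℝ (Fin d)) m).source)
    (F : P.toVBundle.Frame U) : (polyNManifold P).Coord m U where
  mem := hm
  subset := hU
  x := (frameCoord hU F).x
  ξ := (frameCoord hU F).ξ
  p := (frameCoord hU F).p
  x_apply := (frameCoord hU F).x_apply
  ξ_deg := (frameCoord hU F).ξ_hom
  p_deg := (frameCoord hU F).p_hom
  free _ h a := (frameCoord hU F).free h a

lemma isUnit_bracket_frameCoordN {m : M} (hm : m ∈ U)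
    (hU : ∀ y ∈ U, y ∈ (chartAt (EuclideanSpace ℝ (Fin d)) m).source)
    (F : P.toVBundle.Frame U) : IsUnit (Matrix.of fun i j =>
      pbLin P U ((frameCoordN hm hU F).all i) ((frameCoordN hm hU F).all j)) := by
  let z := frameCoord hU F
  let β : Fn d U →+* polyAlg P U := baseHom P U
  have hmul : ∀ {k l : ℕ} {A : Matrix (Fin k) (Fin l) (Fn d U)} {B : Matrix (Fin l) (Fin k) (Fn d U)},
      A * B = 1 → A.map β * B.map β = 1 := fun h => by
    rw [← Matrix.map_mul, h, Matrix.map_one β (map_zero β) (map_one β)]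
  have hneg : ∀ {k l : ℕ} {A : Matrix (Fin k) (Fin l) (Fn d U)} {B : Matrix (Fin l) (Fin k) (Fn d U)},
      A * B = 1 → (-A.map β) * (-B.map β) = 1 := fun h => by
    rw [Matrix.neg_mul, Matrix.mul_neg, neg_neg, hmul h]
  have ht : ∀ {k l : ℕ} {A : Matrix (Fin k) (Fin l) (Fn d U)} {B : Matrix (Fin l) (Fin k) (Fn d U)},
      A * B = 1 → B.transpose * A.transpose = 1 := fun h => by
    rw [← Matrix.transpose_mul, h, Matrix.transpose_one]
  have h := isUnit_fromBlocks (X := z.X.map β) (X' := z.X'.map β) (Y := -z.X.transpose.map β)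
    (Y' := -z.X'.transpose.map β) (G := z.G.map β) (G' := z.G'.map β)
    (Matrix.of fun i a => pbLin P U (z.ξ i) (z.p a))
    (Matrix.of fun a i => pbLin P U (z.p a) (z.ξ i))
    (Matrix.of fun a b => pbLin P U (z.p a) (z.p b))
    (hmul z.mul_X') (hmul z.X'_mul) (hneg (ht z.X'_mul)) (hneg (ht z.mul_X'))
    (hmul (mul_eq_one_comm.1 z.G'_mul)) (hmul z.G'_mul)
  have hp : ∀ a b, pb (z.p a).1 (const ⇑(z.x b)) = -const ⇑(z.X b a) := fun a b => by
    rw [← z.X_eq, pb_antisymm (z.p a).2 (z.isPoly_x b) (z.isPar_p a), θ_one]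
  refine Eq.mpr (congrArg IsUnit (Matrix.ext fun i j => Subtype.ext ?_)) h
  rcases i with b | i | a <;> rcases j with b' | j | a'
  · exact pb_const_const
  · exact pb_const_one (z.ξ_hom j) _
  · exact z.X_eq b a'
  · exact pb_one_const (z.ξ_hom i) _
  · exact z.G_eq i j
  · rfl
  · exact hp a b'
  · rfl
  · rfl

lemma pbLin_antisymm {i j : ℕ} {a b : polyAlg P U} (ha : a ∈ degPart P U i)
    (hb : b ∈ degPart P U j) : pbLin P U a b = -((-1) ^ (i * j) * pbLin P U b a) :=
  Subtype.ext <| by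
    change pb a.1 b.1 = -((-1) ^ (i * j) * pbLin P U b a).1
    rw [neg_one_pow_mul, pbLin_val, pb_antisymm a.2 b.2 (mem_degPart.1 ha).isPar,
      θ_of_hom (mem_degPart.1 hb), pb_usmul_left _ b.2 a.2]

lemma pbLin_mul {i j : ℕ} {a b : polyAlg P U} (ha : a ∈ degPart P U i) (hb : b ∈ degPart P U j)
    (c : polyAlg P U) :
    pbLin P U a (b * c) = pbLin P U a b * c + (-1) ^ (i * j) * (b * pbLin P U a c) :=
  Subtype.ext <| by
    change pb a.1 (b.1 * c.1) = pb a.1 b.1 * c.1 + ((-1) ^ (i * j) * (b * pbLin P U a c)).1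
    rw [neg_one_pow_mul, MulMemClass.coe_mul, pbLin_val, pb_mul a.2 b.2 c.2
      (mem_degPart.1 ha).isPar, θ_of_hom (mem_degPart.1 hb), Shuf.usmul_mul]

lemma pbLin_jacobi {i j : ℕ} {a b : polyAlg P U} (ha : a ∈ degPart P U i)
    (hb : b ∈ degPart P U j) (c : polyAlg P U) :
    pbLin P U a (pbLin P U b c) =
      pbLin P U (pbLin P U a b) c + (-1) ^ (i * j) * pbLin P U b (pbLin P U a c) :=
  Subtype.ext <| by
    change pb a.1 (pb b.1 c.1) = pb (pb a.1 b.1) c.1 +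
      ((-1) ^ (i * j) * pbLin P U b (pbLin P U a c)).1
    rw [neg_one_pow_mul, pbLin_val, pbLin_val, jacobi a.2 b.2 c.2 (mem_degPart.1 ha)
      (mem_degPart.1 hb), θ_of_hom (mem_degPart.1 hb), pb_usmul_left _ b.2 (a.2.pb c.2)]

variable (P) in
/-- The symplectic N-manifold of a pre-Courant algebroid. -/
def polySymplectic : SymplecticNManifold d M where
  toNManifold := polyNManifold P
  bracket U := pbLin P U
  bracket_res h a b := Subtype.ext (pb_res h a.2 b.2)
  bracket_deg U i j k h a ha b hb := by
    have := pb_hom (mem_degPart.1 ha) (mem_degPart.1 hb)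
    rwa [show (i : ℤ) + j - 2 = k by omega] at this
  bracket_low U i j h a ha b hb := Subtype.ext <|
    (pb_hom (mem_degPart.1 ha) (mem_degPart.1 hb)).eq_zero_of_neg (by omega)
  bracket_antisymm U i j a ha b hb := pbLin_antisymm ha hb
  bracket_leibniz U i j a ha b hb c := pbLin_mul ha hb c
  bracket_jacobi U i j a ha b hb c := pbLin_jacobi ha hb c
  bracket_nondeg m := by
    obtain ⟨V, hm, hV, ⟨F⟩⟩ := exists_chart_frame P m
    exact ⟨V, frameCoordN hm hV F, isUnit_bracket_frameCoordN hm hV F⟩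

/-! ### The potential of a pre-Courant algebroid -/

lemma pairing_apply (e e' : P.Sec) (x : M) : P.pairing e e' x = P.metric x (e x) (e' x) := rfl

lemma act_apply (e : P.Sec) (f : Fn d M) (x : M) :
    P.act e f x = mvfderiv (𝓡 d) f x (P.anchor x (e x)) := rfl

/-- Sections are determined by their pairings. -/
lemma pairing_ext {s t : P.Sec} (h : ∀ e, P.pairing s e = P.pairing t e) : s = t :=
  Sec.ext fun x => fib_ext fun e => congrArg (fun f : Fn d M => f x) (h e)

lemma pairing_add_left (e e' e'' : P.Sec) :
    P.pairing (e + e') e'' = P.pairing e e'' + P.pairing e' e'' := by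
  rw [pairing_comm, pairing_add_right, pairing_comm e'', pairing_comm e'']

lemma pairing_smul_left (f : Fn d M) (e e' : P.Sec) :
    P.pairing (smulSec f e) e' = f * P.pairing e e' := by
  rw [pairing_comm, pairing_smul_right, pairing_comm e']

lemma act_add (e : P.Sec) (f g : Fn d M) : P.act e (f + g) = P.act e f + P.act e g :=
  Fn.ext fun x => (isDer_mvfderiv x _).add f g

lemma act_mul (e : P.Sec) (f g : Fn d M) : P.act e (f * g) = f * P.act e g + g * P.act e f :=
  Fn.ext fun x => (isDer_mvfderiv x _).mul f g

lemma act_const (e : P.Sec) (r : ℝ) : P.act e (algebraMap ℝ (Fn d M) r) = 0 :=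
  Fn.ext fun x => (isDer_mvfderiv x _).const r

lemma add_act (e e' : P.Sec) (f : Fn d M) : P.act (e + e') f = P.act e f + P.act e' f :=
  Fn.ext fun x => by
    change mvfderiv (𝓡 d) f x (P.anchor x (e x + e' x)) = _
    rw [map_add, map_add]
    rfl

lemma smul_act (f : Fn d M) (e : P.Sec) (g : Fn d M) : P.act (smulSec f e) g = f * P.act e g :=
  Fn.ext fun x => by
    change mvfderiv (𝓡 d) g x (P.anchor x (f x • e x)) = _
    rw [map_smul, map_smul]
    rfl

lemma pairing_circ (e e₁ e₂ : P.Sec) : P.act e (P.pairing e₁ e₂) =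
    P.pairing (P.circ e e₁) e₂ + P.pairing e₁ (P.circ e e₂) :=
  Fn.ext fun x => P.circ_metric e e₁ e₂ x

lemma pairing_circ_symm (e₁ e₂ e : P.Sec) : P.pairing (P.circ e₁ e₂) e + P.pairing (P.circ e₂ e₁) e =
    P.act e (P.pairing e₁ e₂) :=
  Fn.ext fun x => by
    have := P.circ_symm e₁ e₂ x (e x)
    rw [map_add] at this
    exact this

lemma act_circ (e₁ e₂ : P.Sec) (f : Fn d M) :
    P.act (P.circ e₁ e₂) f = P.act e₁ (P.act e₂ f) - P.act e₂ (P.act e₁ f) :=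
  Fn.ext fun x => P.anchor_circ e₁ e₂ f x

lemma circ_add (e e' e'' : P.Sec) : P.circ e (e' + e'') = P.circ e e' + P.circ e e'' :=
  pairing_ext fun t => by
    have h := pairing_circ e (e' + e'') t
    rw [pairing_add_left, act_add, pairing_circ, pairing_circ, pairing_add_left] at h
    rw [pairing_add_left]
    linear_combination -h

lemma circ_smul (e : P.Sec) (f : Fn d M) (e' : P.Sec) :
    P.circ e (smulSec f e') = smulSec f (P.circ e e') + smulSec (P.act e f) e' :=
  pairing_ext fun t => by
    have h := pairing_circ e (smulSec f e') t
    rw [pairing_smul_left, act_mul, pairing_circ, pairing_smul_left] at h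
    rw [pairing_add_left, pairing_smul_left, pairing_smul_left]
    linear_combination -h

lemma add_circ (e e' e'' : P.Sec) : P.circ (e + e') e'' = P.circ e e'' + P.circ e' e'' :=
  pairing_ext fun t => by
    have h := pairing_circ_symm (e + e') e'' t
    rw [pairing_add_left, act_add, ← pairing_circ_symm, ← pairing_circ_symm, circ_add,
      pairing_add_left] at h
    rw [pairing_add_left]
    linear_combination h

variable (P) in
/-- The potential: its iterated brackets with sections and functions are the pairings
`⟨e₁ ∘ e₂, e₃⟩` and the derivatives `ρ(e) f`. -/
def potential : Amb P ⊤ :=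
  cubic (fun e f => fr ⊤ (P.act e f)) fun e e' e'' => fr ⊤ (P.pairing (P.circ e e') e'')

lemma hom_potential : Hom (potential P) 3 := hom_cubic _ _

lemma D_sec_potential (e : P.Sec) : D (ls P e) (potential P) =
    quad (fun f => fr ⊤ (P.act e f)) fun e' e'' => fr ⊤ (P.pairing (P.circ e e') e'') :=
  D_cubic_sec _ _ _

lemma D_fn_potential (f : Fn d M) :
    D (lf P f) (potential P) = lin fun e => fr ⊤ (P.act e f) := D_cubic_fn _ _ _

lemma isPoly_D_potential (l : P.Sec ⊕ Fn d M) : IsPoly (D l (potential P)) := by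
  rcases l with e | f
  · rw [D_sec_potential]
    refine isPoly_quad ⟨fun f => contMDiff_fr _, fun f g => ?_, fun f g => ?_, fun r => ?_⟩
      (fun e' e'' => contMDiff_fr _) (fun e₁ e₂ e₃ => ?_) (fun e₁ f e₂ => ?_)
      (fun e₁ e₂ e₃ => ?_) (fun f e₁ e₂ => ?_) fun e₁ e₂ => ?_
    · rw [act_add]; rfl
    · rw [act_mul]; rfl
    · rw [act_const]; rfl
    · rw [pairing_add_right]; rfl
    · rw [pairing_smul_right]; rfl
    · rw [circ_add, pairing_add_left]; rfl
    · rw [circ_smul, pairing_add_left, pairing_smul_left, pairing_smul_left, mul_comm (P.act e f)]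
      rfl
    · rw [pairing_circ, pairing_comm e₁]
      rfl
  · rw [D_fn_potential]
    refine isPoly_lin (fun e => contMDiff_fr _) (fun e e' => ?_) fun g e => ?_
    · rw [add_act]; rfl
    · rw [smul_act]; rfl

/-- The relations for the potential. Those for the action of `f • e` and for supercommutators follow
from the Leibniz rule and from `e₁ ∘ e₂ + e₂ ∘ e₁ = 𝒟⟨e₁, e₂⟩`. -/
lemma rel_potential : Rel (potential P) where
  add_sec e e' := by
    rw [D_sec_potential, D_sec_potential, D_sec_potential, ← quad_add]
    congr 1
    · funext f
      rw [add_act]; rfl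
    · funext e₁ e₂
      rw [add_circ, pairing_add_left]; rfl
  smul_sec f e := by
    rw [D_sec_potential, D_sec_potential, D_fn_potential]
    refine amb_ext ?_ fun l => ?_
    · ext y
      change (0 : ℝ) = f y * 0 + 0 * 0
      ring
    rw [map_add, map_smul, D_mul]
    rcases l with e' | g
    · rw [D_quad_sec, D_quad_sec, D_hat_inl, D_lin_sec, const_mul, mul_const, θ_hat,
        show sg (ls P e') = -1 from rfl, hat_eq_lin, Units.neg_smul, one_smul, smul_neg, smul_lin,
        smul_lin, smul_lin, ← sub_eq_add_neg, ← add_sub_assoc, ← lin_add, eq_sub_iff_add_eq,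
        ← lin_add]
      congr 1
      funext t
      have h1 := pairing_circ_symm (smulSec f e) e' t
      have h2 := pairing_circ_symm e e' t
      rw [pairing_smul_left, act_mul, circ_smul, pairing_add_left, pairing_smul_left,
        pairing_smul_left, ← h2] at h1
      have : P.pairing (P.circ (smulSec f e) e') t + P.act e' f * P.pairing e t =
          f * P.pairing (P.circ e e') t + P.pairing e e' * P.act t f := by
        linear_combination h1
      exact congrArg (fr ⊤) this
    · rw [D_quad_fn, D_quad_fn, D_hat_inr, zero_mul, D_lin_fn, mul_zero, add_zero, add_zero,
        smul_const, smul_act]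
      rfl
  add_fn f g := by
    rw [D_fn_potential, D_fn_potential, D_fn_potential, ← lin_add]
    congr 1
    funext e
    rw [act_add]; rfl
  mul_fn f g := by
    rw [D_fn_potential, D_fn_potential, D_fn_potential, smul_lin, smul_lin, ← lin_add]
    congr 1
    funext e
    rw [act_mul]; rfl
  const_fn r := by
    rw [D_fn_potential]
    refine amb_ext rfl fun l => ?_
    rcases l with e | f
    · rw [D_lin_sec, act_const, map_zero]
      exact const_zero
    · rfl
  comm_sec e e' := by
    rw [D_sec_potential, D_sec_potential, D_quad_sec, D_quad_sec, D_fn_potential, ← lin_add]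
    congr 1
    funext t
    rw [← pairing_circ_symm, add_comm]
    rfl
  comm_sec_fn e f := by
    rw [D_fn_potential, D_sec_potential, D_lin_sec, D_quad_fn]
  comm_fn f g := by
    rw [D_fn_potential, D_fn_potential, D_lin_fn, D_lin_fn]

lemma isPoly_potential : IsPoly (potential P) :=
  .of_D rel_potential isPoly_D_potential contMDiff_const (Hom.bdd (k := 3) hom_potential)

/-- Global polynomial functions of weight one are sections. -/
lemma exists_hat {a : Amb P ⊤} (ha : IsPoly a) (h : Hom a 1) : ∃ e : P.Sec, hat ⊤ e = a := by
  choose t ht using fun x : M => ha.exists_sec ⟨x, trivial⟩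
  let e : P.Sec := secOfGerm (fun x => t x x) fun x => ⟨t x, by
    filter_upwards [ht x] with y hy
    refine fib_ext fun e' => ?_
    rw [hy trivial, (ht y).self_of_nhds trivial]⟩
  refine ⟨e, ?_⟩
  refine amb_ext (by rw [h [] (by simp [wtw]), hom_hat e [] (by simp [wtw])]) fun l => ?_
  rcases l with e' | f
  · rw [D_hat_inl, eq_const_of_hom (a := D (ls P e') a) (by simpa using h.D (ls P e'))]
    congr 1
    funext y
    exact (ht y.1).self_of_nhds trivial e'
  · rw [D_hat_inr, (h.D (lf P f)).eq_zero_of_neg (by change (1 : ℤ) - 2 < 0; decide)]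

lemma hat_injective : Function.Injective (hat ⊤ : P.Sec → Amb P ⊤) := fun _ _ h =>
  Sec.ext fun x => fib_ext fun t => congrFun (congrFun h [ls P t]) ⟨x, trivial⟩

/-- The section `𝒟 f` is a left zero of the pre-bracket, because the kernel of the anchor is
coisotropic. -/
lemma D_fn_potential_eq_hat (f : Fn d M) : ∃ e : P.Sec,
    D (lf P f) (potential P) = hat ⊤ e ∧ D (ls P e) (potential P) = 0 := by
  obtain ⟨e, he⟩ := exists_hat (isPoly_D_potential (lf P f))
    (by simpa using hom_potential.D (lf P f))
  refine ⟨e, he.symm, ?_⟩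
  have h1 : ∀ t, P.pairing e t = P.act t f := fun t => Fn.ext fun x =>
    (congrFun (congrFun he [ls P t]) ⟨x, trivial⟩)
  -- `𝒟 f` is orthogonal to the kernel of the anchor.
  have h2 : ∀ g, P.act e g = 0 := fun g => Fn.ext fun x => by
    have : P.anchor x (e x) = 0 := P.coisotropic x _ fun w hw => by
      obtain ⟨t, rfl⟩ := exists_sec P.toVBundle w
      have := congrArg (fun f : Fn d M => f x) (h1 t)
      simp only [pairing_apply, act_apply, hw, map_zero] at this
      exact this
    rw [act_apply, this, map_zero]
    rfl
  have h3 : ∀ t s, P.pairing (P.circ e t) s = 0 := fun t s => by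
    have k1 := pairing_circ_symm e t s
    have k2 := pairing_circ t e s
    rw [h1, h1, act_circ] at k2
    rw [h1] at k1
    linear_combination k1 + k2
  rw [D_sec_potential]
  refine amb_ext rfl fun l => ?_
  rcases l with t | g
  · rw [D_quad_sec, map_zero]
    refine amb_ext rfl fun l => ?_
    rcases l with s | g
    · rw [D_lin_sec, h3, map_zero]
      exact const_zero
    · rfl
  · rw [D_quad_fn, h2, map_zero]
    exact const_zero

/-- The potential is pre-homological: `{f, {Θ, Θ}}` is twice the bracket of `{f, Θ} = 𝒟 f` with `Θ`,
up to sign. -/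
lemma D_pb_potential (f : Fn d M) : D (lf P f) (pb (potential P) (potential P)) = 0 := by
  obtain ⟨e, h1, h2⟩ := D_fn_potential_eq_hat (P := P) f
  rw [D_pb, sg_inr, θ_one, h1, pb_hat e isPoly_potential, h2,
    show hat ⊤ e = ι ⊤ (ls P e) from rfl,
    pb_ι_right _ isPoly_potential (Hom.isPar (k := 3) hom_potential), h2, smul_zero, neg_zero,
    add_zero]

variable (P) in
/-- The symplectic almost Lie 2-algebroid of a pre-Courant algebroid. -/
def polySympl : SymplecticAlmostLie2Algebroid d M where
  toSymplecticNManifold := polySymplectic P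
  Θ := (⟨potential P, isPoly_potential⟩ : polyAlg P ⊤)
  Θ_deg := hom_potential
  Θ_almost f := Subtype.ext <| by
    have hp := isPoly_potential (P := P)
    have h4 : Hom (pb (potential P) (potential P)) (4 : ℕ) := pb_hom hom_potential hom_potential
    change pb (pb (potential P) (potential P)) (ι ⊤ (lf P f)) = 0
    rw [pb_ι_right _ (hp.pb hp) h4.isPar, D_pb_potential, smul_zero, neg_zero]

variable (P) in
/-- The pre-Courant algebroid is derived from its symplectic almost Lie 2-algebroid. -/
def polyDerived : DerivedData (polySympl P) P where
  φ := Equiv.ofBijective (fun e => ⟨(⟨hat ⊤ e, isPoly_hat e⟩ : polyAlg P ⊤), hom_hat e⟩)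
    ⟨fun _ _ h => hat_injective (congrArg (fun a => a.1.1) h), fun a => by
      obtain ⟨e, he⟩ := exists_hat a.1.2 a.2
      exact ⟨e, Subtype.ext (Subtype.ext he)⟩⟩
  φ_add s t := Subtype.ext <| by
    change hat ⊤ (s + t) = hat ⊤ s + hat ⊤ t
    simp only [hat_eq_lin, ← lin_add]
    congr 1
    funext e
    rw [pairing_add_left]
    rfl
  φ_smul f s t h := Subtype.ext <| by
    have : t = smulSec f s := Sec.ext h
    change hat ⊤ t = const (fr ⊤ f) * hat ⊤ s
    rw [const_mul, this, hat_eq_lin, hat_eq_lin, smul_lin]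
    congr 1
    funext e
    rw [pairing_smul_left]
    rfl
  pairing_eq s t := Subtype.ext <| by
    change const (fr ⊤ (P.pairing s t)) = pb (hat ⊤ s) (hat ⊤ t)
    rw [pb_hat s (isPoly_hat t), D_hat_inl, pairing_comm]
  anchor_eq s f := Subtype.ext <| by
    have hp := isPoly_potential (P := P)
    change const (fr ⊤ (P.act s f)) = -pb (pb (potential P) (ι ⊤ (ls P s))) (ι ⊤ (lf P f))
    rw [pb_ι_right (ls P s) hp (Hom.isPar (k := 3) hom_potential),
      show -(((-1 : ℤˣ) ^ 3) ^ Weighted.wt (ls P s) • D (ls P s) (potential P)) =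
        D (ls P s) (potential P) by
          rw [show ((-1 : ℤˣ) ^ 3) ^ Weighted.wt (ls P s) = -1 from rfl]
          simp,
      pb_ι_right _ (hp.D _) (Hom.isPar (k := 2) (hom_potential.D (ls P s))), D_sec_potential,
      D_quad_fn]
    simp
  circ_eq s t := Subtype.ext <| by
    have hp := isPoly_potential (P := P)
    change hat ⊤ (P.circ s t) = -pb (pb (potential P) (ι ⊤ (ls P s))) (ι ⊤ (ls P t))
    rw [pb_ι_right (ls P s) hp (Hom.isPar (k := 3) hom_potential),
      show -(((-1 : ℤˣ) ^ 3) ^ Weighted.wt (ls P s) • D (ls P s) (potential P)) =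
        D (ls P s) (potential P) by
          rw [show ((-1 : ℤˣ) ^ 3) ^ Weighted.wt (ls P s) = -1 from rfl]
          simp,
      pb_ι_right _ (hp.D _) (Hom.isPar (k := 2) (hom_potential.D (ls P s))), D_sec_potential,
      D_quad_sec, hat_eq_lin]
    simp

end PreCourant

end

/-! ### Functions on N-manifolds of degree 2 -/

noncomputable section

namespace PreCourant

open Filter Topology

variable {d : ℕ} {M : Type u} [TopologicalSpace M] [ChartedSpace (EuclideanSpace ℝ (Fin d)) M]
variable {U V W : Opens M}

namespace NManifold

variable {N : NManifold d M}

variable (N) in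
lemma deg_induction {p : N.A U → Prop} (h0 : p 0) (hadd : ∀ a b, p a → p b → p (a + b))
    (hdeg : ∀ k, ∀ a ∈ N.deg U k, p a) (a : N.A U) : p a :=
  DirectSum.Decomposition.inductionOn (N.deg U) h0 (fun a => hdeg _ a.1 a.2) hadd a

variable (N U) in
/-- The projection onto the functions of weight `k`. -/
def prj (k : ℕ) : N.A U →ₗ[ℝ] N.A U := GradedAlgebra.proj (N.deg U) k

lemma prj_mem (k : ℕ) (a : N.A U) : N.prj U k a ∈ N.deg U k :=
  (DirectSum.decompose (N.deg U) a k).2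

lemma prj_of_mem {k : ℕ} {a : N.A U} (h : a ∈ N.deg U k) : N.prj U k a = a :=
  DirectSum.decompose_of_mem_same _ h

lemma prj_of_ne {k j : ℕ} {a : N.A U} (h : a ∈ N.deg U k) (hj : k ≠ j) : N.prj U j a = 0 :=
  DirectSum.decompose_of_mem_ne _ h hj

lemma exists_sum_prj (a : N.A U) : ∃ s : Finset ℕ, a = ∑ k ∈ s, N.prj U k a := by
  classical
  exact ⟨_, (DirectSum.sum_support_decompose (N.deg U) a).symm⟩

lemma ext_prj {a b : N.A U} (h : ∀ k, N.prj U k a = N.prj U k b) : a = b := by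
  obtain ⟨s, hs⟩ := exists_sum_prj (a - b)
  rw [← sub_eq_zero, hs]
  exact Finset.sum_eq_zero fun k _ => by rw [map_sub, h, sub_self]

lemma res_prj (h : U ≤ V) (k : ℕ) (a : N.A V) : N.res h (N.prj V k a) = N.prj U k (N.res h a) := by
  induction a using N.deg_induction with
  | h0 => simp
  | hadd a b ha hb => simp only [map_add, ha, hb]
  | hdeg j a ha =>
    by_cases hj : j = k
    · subst hj
      rw [prj_of_mem ha, prj_of_mem (N.res_deg h _ a ha)]
    · rw [prj_of_ne ha hj, prj_of_ne (N.res_deg h _ a ha) hj, map_zero]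

/-- A function is zero if it is locally zero. -/
lemma eq_of_cover {a b : N.A U}
    (h : ∀ x ∈ U, ∃ (V : Opens M) (hV : V ≤ U), x ∈ V ∧ N.res hV a = N.res hV b) : a = b := by
  refine ext_prj fun k => ?_
  choose V hV hx heq using fun x : U => h x.1 x.2
  obtain ⟨t, -, ht⟩ := N.glue U V hV (fun x hx' => Opens.mem_iSup.2 ⟨⟨x, hx'⟩, hx _⟩) k
    (fun i => N.res (hV i) (N.prj U k a)) (fun i => N.res_deg _ _ _ (prj_mem _ _))
    (fun i j => by rw [N.res_res, N.res_res])
  rw [ht _ ⟨prj_mem _ _, fun i => rfl⟩, ht (N.prj U k b) ⟨prj_mem _ _, fun i => by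
    rw [res_prj, res_prj, heq]⟩]

lemma base_mem (f : Fn d U) : N.base U f ∈ N.deg U 0 := (N.base_range U _).2 ⟨f, rfl⟩

/-- The part of weight zero, as a smooth function. -/
def valFun (a : N.A U) : Fn d U := ((N.base_range U _).1 (prj_mem 0 a)).choose

lemma base_valFun (a : N.A U) : N.base U (valFun a) = N.prj U 0 a :=
  ((N.base_range U _).1 (prj_mem 0 a)).choose_spec

variable (N U) in
/-- The value of a function on the N-manifold along `M`: its part of weight zero. -/
def val : N.A U →+* Fn d U where
  toFun a := valFun a
  map_one' := N.base_injective U <| by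
    rw [base_valFun, map_one (N.base U), prj_of_mem (SetLike.one_mem_graded (N.deg U))]
  map_zero' := N.base_injective U <| by rw [base_valFun, map_zero, map_zero]
  map_add' a b := N.base_injective U <| by
    rw [map_add, base_valFun, base_valFun, base_valFun, map_add]
  map_mul' a b := N.base_injective U <| by
    rw [map_mul, base_valFun, base_valFun, base_valFun]
    exact (GradedRing.projZeroRingHom (N.deg U)).map_mul a b

lemma base_val (a : N.A U) : N.base U (N.val U a) = N.prj U 0 a := base_valFun a

lemma val_base (f : Fn d U) : N.val U (N.base U f) = f :=
  N.base_injective U (by rw [base_val, prj_of_mem (base_mem f)])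

lemma base_val_of_mem {a : N.A U} (h : a ∈ N.deg U 0) : N.base U (N.val U a) = a := by
  rw [base_val, prj_of_mem h]

lemma val_of_mem {k : ℕ} (hk : k ≠ 0) {a : N.A U} (h : a ∈ N.deg U k) : N.val U a = 0 :=
  N.base_injective U (by rw [base_val, prj_of_ne h hk, map_zero])

lemma val_smul (r : ℝ) (a : N.A U) : N.val U (r • a) = r • N.val U a :=
  N.base_injective U (by rw [base_val, map_smul, map_smul, base_val])

lemma val_res (h : U ≤ V) (a : N.A V) : N.val U (N.res h a) = (N.val V a).res h :=
  N.base_injective U (by rw [base_val, ← res_prj, ← base_val, N.base_res])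

lemma base_comm (f : Fn d U) (a : N.A U) : N.base U f * a = a * N.base U f := by
  induction a using N.deg_induction with
  | h0 => simp
  | hadd a b ha hb => rw [mul_add, add_mul, ha, hb]
  | hdeg j a ha =>
    rw [N.graded_comm U 0 j _ (base_mem f) a ha]
    simp

lemma base_mul_mem {k : ℕ} (f : Fn d U) {a : N.A U} (h : a ∈ N.deg U k) :
    N.base U f * a ∈ N.deg U k := by
  simpa using SetLike.mul_mem_graded (base_mem f) h

lemma prj_base_mul (k : ℕ) (f : Fn d U) (a : N.A U) :
    N.prj U k (N.base U f * a) = N.base U f * N.prj U k a := by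
  induction a using N.deg_induction with
  | h0 => simp
  | hadd a b ha hb => simp only [mul_add, map_add, ha, hb]
  | hdeg j a ha =>
    by_cases hj : j = k
    · subst hj
      rw [prj_of_mem ha, prj_of_mem (base_mul_mem f ha)]
    · rw [prj_of_ne ha hj, prj_of_ne (base_mul_mem f ha) hj, mul_zero]

lemma res_fn (h : U ≤ ⊤) (f : Fn d M) : N.res h (N.fn f) = N.base U (f.toOpen U) := N.base_res h _

lemma monomial_mem {q r : ℕ} {ξ : Fin q → N.A U} {p : Fin r → N.A U}
    (hξ : ∀ i, ξ i ∈ N.deg U 1) (hp : ∀ a, p a ∈ N.deg U 2) (S : Finset (Fin q)) (α : Fin r → ℕ) :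
    monomial ξ p (S, α) ∈ N.deg U (S.card + ∑ a, α a * 2) := by
  have h1 := SetLike.list_prod_ofFn_mem_graded (A := N.deg U) (fun i => if i ∈ S then 1 else 0)
    (fun i => if i ∈ S then ξ i else 1) fun i => by
      split_ifs
      · exact hξ i
      · exact SetLike.one_mem_graded _
  have h2 := SetLike.list_prod_ofFn_mem_graded (A := N.deg U) (fun a => α a • 2)
    (fun a => p a ^ α a) fun a => SetLike.pow_mem_graded _ (hp a)
  rw [List.sum_ofFn] at h1 h2
  rw [Finset.sum_boole, Finset.filter_mem_eq_inter, Finset.univ_inter] at h1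
  exact SetLike.mul_mem_graded h1 h2

lemma monomial_singleton {A : Type u} [Ring A] {q r : ℕ} (ξ : Fin q → A) (p : Fin r → A)
    (i : Fin q) : monomial ξ p ({i}, 0) = ξ i := by
  rw [monomial_eq, prodξ, prodp]
  have h1 : ∀ l : List (Fin q), l.Nodup →
      (l.map fun j => if j ∈ ({i} : Finset (Fin q)) then ξ j else 1).prod =
        if i ∈ l then ξ i else 1 := fun l hl => by
    induction l with
    | nil => simp
    | cons j l ih =>
      rw [List.map_cons, List.prod_cons, ih hl.of_cons]
      have := (List.nodup_cons.1 hl).1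
      by_cases hj : j = i
      · subst hj
        simp [this]
      · simp [hj, Ne.symm hj]
  rw [h1 _ (List.nodup_finRange q), if_pos (List.mem_finRange i)]
  simp

/-- Functions of weight one are combinations of the coordinates of weight one. -/
lemma Coord.span {m : M} (z : N.Coord m U) (h : V ≤ U) {a : N.A V} (ha : a ∈ N.deg V 1) :
    ∃ c : Fin N.q → Fn d V, a = ∑ i, N.base V (c i) * N.res h (z.ξ i) := by
  let K : Submodule ℝ (N.A V) :=
    { carrier := {b | ∃ c : Fin N.q → Fn d V, b = ∑ i, N.base V (c i) * N.res h (z.ξ i)}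
      add_mem' := by
        rintro _ _ ⟨c, rfl⟩ ⟨c', rfl⟩
        exact ⟨c + c', by simp [add_mul, Finset.sum_add_distrib]⟩
      zero_mem' := ⟨0, by simp⟩
      smul_mem' := by
        rintro r _ ⟨c, rfl⟩
        exact ⟨r • c, by simp [Finset.smul_sum]⟩ }
  obtain ⟨c, hc, -⟩ := z.free V h a
  rw [← prj_of_mem ha, hc, Finsupp.sum, map_sum]
  refine K.sum_mem fun m _ => ?_
  obtain ⟨S, α⟩ := m
  rw [prj_base_mul]
  have hm := N.res_deg h _ _ (monomial_mem z.ξ_deg z.p_deg S α)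
  by_cases hw : S.card + ∑ a, α a * 2 = 1
  · have hS : S.card = 1 := by
      have : ∑ a, α a * 2 = 2 * ∑ a, α a := by rw [← Finset.sum_mul, mul_comm]
      omega
    have hα : α = 0 := by
      have : ∑ a, α a * 2 = 0 := by omega
      funext a
      have := Finset.sum_eq_zero_iff.1 this a (Finset.mem_univ a)
      simpa using this
    obtain ⟨i, rfl⟩ := Finset.card_eq_one.1 hS
    subst hα
    rw [hw] at hm
    rw [prj_of_mem hm, monomial_singleton]
    exact ⟨Pi.single i (c ({i}, 0)), by
      rw [Finset.sum_eq_single i]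
      · simp
      · intro j _ hj
        simp [hj]
      · simp⟩
  · rw [prj_of_ne hm hw, mul_zero]
    exact K.zero_mem

variable [T2Space M] [IsManifold (𝓡 d) ∞ M]

/-- Functions of a given weight extend from a neighbourhood of a point. -/
lemma exists_extension {k : ℕ} {a : N.A V} (ha : a ∈ N.deg V k) {x : M} (hx : x ∈ V) :
    ∃ b ∈ N.deg ⊤ k, ∃ (W : Opens M) (hW : W ≤ V), x ∈ W ∧ N.res le_top b = N.res hW a := by
  obtain ⟨χ, h1, hχ⟩ := exists_bump (d := d) V.2 hx
  obtain ⟨W₀, hW₀, hW₀o, hxW₀⟩ := eventually_nhds_iff.1 h1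
  let Z : Opens M := ⟨(tsupport χ)ᶜ, (isClosed_tsupport χ).isOpen_compl⟩
  let C : ULift.{u} Bool → Opens M := fun i => bif i.down then V else Z
  let s : ∀ i, N.A (C i) := fun i => match i with
    | ⟨true⟩ => N.base V (χ.toOpen V) * a
    | ⟨false⟩ => 0
  have hzero : ∀ (O : Opens M) (hO : O ≤ V), O ≤ Z →
      N.res hO (N.base V (χ.toOpen V) * a) = 0 := fun O hO hZ => by
    rw [map_mul, N.base_res, show (χ.toOpen V).res hO = 0 from Fn.ext fun y =>
      (image_eq_zero_of_notMem_tsupport (f := ⇑χ) (x := y.1) (hZ y.2) :), map_zero, zero_mul]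
  obtain ⟨b, ⟨hb, hres⟩, -⟩ := N.glue ⊤ C (fun _ => le_top) (fun y _ => by
      rw [Opens.mem_iSup]
      by_cases hy : y ∈ tsupport χ
      · exact ⟨⟨true⟩, hχ hy⟩
      · exact ⟨⟨false⟩, hy⟩) k s (fun i => by
        rcases i with ⟨_ | _⟩
        · exact (N.deg _ k).zero_mem
        · exact base_mul_mem _ ha) (fun i j => by
        rcases i with ⟨_ | _⟩ <;> rcases j with ⟨_ | _⟩
        · rfl
        · exact (map_zero _).trans (hzero _ _ inf_le_left).symm
        · exact (hzero _ _ inf_le_right).trans (map_zero _).symm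
        · rfl)
  refine ⟨b, hb, ⟨W₀, hW₀o⟩ ⊓ V, inf_le_right, ⟨hxW₀, hx⟩, ?_⟩
  have h2 := hres ⟨true⟩
  have h3 : N.res (le_top : V ≤ ⊤) b = N.base V (χ.toOpen V) * a := h2
  rw [← N.res_res inf_le_right le_top, h3, map_mul, N.base_res]
  rw [show (χ.toOpen V).res inf_le_right = (1 : Fn d ↥((⟨W₀, hW₀o⟩ : Opens M) ⊓ V)) from
    Fn.ext fun y => hW₀ _ y.2.1, map_one, one_mul]

end NManifold

end PreCourant

end

/-! ### Expansion of functions by iterated brackets -/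

noncomputable section

namespace PreCourant

open Filter Topology Shuf VBundle

variable {d : ℕ} {M : Type u} [TopologicalSpace M] [ChartedSpace (EuclideanSpace ℝ (Fin d)) M]
variable {U V W : Opens M}

namespace SymplecticNManifold

variable {S : SymplecticNManifold d M}

lemma neg_one_pow_mul_self (n : ℕ) (a : S.A U) : (-1) ^ n * ((-1) ^ n * a) = a := by
  rw [← mul_assoc, ← pow_add, ← two_mul, pow_mul]
  simp

lemma bracket_one (a : S.A U) : S.bracket U a 1 = 0 := by
  induction a using S.deg_induction with
  | h0 => simp
  | hadd a b ha hb => rw [map_add, LinearMap.add_apply, ha, hb, add_zero]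
  | hdeg k a ha =>
    have := S.bracket_leibniz U k 0 a ha 1 (SetLike.one_mem_graded (S.deg U)) 1
    simpa using this

/-- The Leibniz rule in the first argument, for products with a function of weight zero. -/
lemma bracket_base_mul (f : Fn d U) {j : ℕ} {b : S.A U} (hb : b ∈ S.deg U j) (a : S.A U) :
    S.bracket U (S.base U f * b) a =
      S.base U f * S.bracket U b a + b * S.bracket U (S.base U f) a := by
  induction a using S.deg_induction with
  | h0 => simp
  | hadd a a' ha ha' => simp only [map_add, ha, ha', mul_add]; abel
  | hdeg k a ha =>
    have hf := NManifold.base_mem (N := S.toNManifold) f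
    have hc : S.bracket U (S.base U f) a * b =
        (-1) ^ (j * k) * (b * S.bracket U (S.base U f) a) := by
      rcases lt_or_ge k 2 with hk | hk
      · rw [S.bracket_low U 0 k (by omega) _ hf _ ha]
        simp
      · have h := S.bracket_deg U 0 k (k - 2) (by omega) _ hf _ ha
        rw [S.graded_comm U _ _ _ h b hb]
        obtain ⟨k, rfl⟩ := Nat.exists_eq_add_of_le' hk
        rw [Nat.add_sub_cancel, mul_comm k j, mul_add, pow_add, mul_comm j 2, pow_mul (-1) 2 j]
        simp
    rw [S.bracket_antisymm U j k _ (NManifold.base_mul_mem f hb) a ha,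
      S.bracket_leibniz U k 0 a ha _ hf b, S.bracket_antisymm U k 0 a ha _ hf,
      S.bracket_antisymm U k j a ha b hb, mul_comm k j]
    simp only [mul_zero, pow_zero, one_mul, neg_mul, mul_neg, mul_add, hc, neg_one_pow_mul_self]
    rw [NManifold.base_comm (N := S.toNManifold) f ((-1) ^ (j * k) * _), mul_assoc,
      neg_one_pow_mul_self, NManifold.base_comm (N := S.toNManifold) f]
    abel

end SymplecticNManifold

namespace DerivedData

variable {S : SymplecticAlmostLie2Algebroid d M} {P : PreCourantAlgebroid d M} (D : DerivedData S P)

/-- The function on the N-manifold that corresponds to a section or a function on `M`. -/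
def lt (U : Opens M) : P.Sec ⊕ Fn d M → S.A U :=
  Sum.elim (fun e => S.res le_top (D.φ e)) fun f => S.base U (f.toOpen U)

lemma lt_mem (l : P.Sec ⊕ Fn d M) : D.lt U l ∈ S.deg U (2 - Weighted.wt l) := by
  rcases l with e | f
  · exact S.res_deg _ _ _ (D.φ e).2
  · exact NManifold.base_mem _

lemma lt_res (h : U ≤ V) (l : P.Sec ⊕ Fn d M) : S.res h (D.lt V l) = D.lt U l := by
  rcases l with e | f
  · exact S.res_res _ _ _
  · exact S.base_res _ _

lemma wt_le (l : P.Sec ⊕ Fn d M) : Weighted.wt l ≤ 2 := by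
  rcases l with e | f <;> simp

lemma bracket_lt_mem {k : ℕ} {a : S.A U} (l : P.Sec ⊕ Fn d M)
    (ha : a ∈ S.deg U (Weighted.wt l + k)) : S.bracket U (D.lt U l) a ∈ S.deg U k :=
  S.bracket_deg U _ _ _ (by have := wt_le l; omega) _ (D.lt_mem l) _ ha

lemma bracket_lt_eq_zero {k : ℕ} {a : S.A U} (l : P.Sec ⊕ Fn d M) (ha : a ∈ S.deg U k)
    (hk : k < Weighted.wt l) : S.bracket U (D.lt U l) a = 0 :=
  S.bracket_low U _ _ (by have := wt_le l; omega) _ (D.lt_mem l) _ ha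

/-- The value along `M` of the iterated brackets of a function with the letters of a word. -/
def jetAux : List (P.Sec ⊕ Fn d M) → S.A U → U → ℝ
  | [], a => ⇑(S.val U a)
  | l :: w, a => jetAux w (S.bracket U (D.lt U l) a)

/-- The expansion of a function on the N-manifold: the function on words given by the values of its
iterated brackets with the letters. -/
def jet (a : S.A U) : Amb P U := fun w => D.jetAux w a

lemma jet_nil (a : S.A U) : D.jet a [] = ⇑(S.val U a) := rfl

lemma D_jet (l : P.Sec ⊕ Fn d M) (a : S.A U) :
    Shuf.D l (D.jet a) = D.jet (S.bracket U (D.lt U l) a) := rfl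

lemma jet_cons (l : P.Sec ⊕ Fn d M) (w : List (P.Sec ⊕ Fn d M)) (a : S.A U) :
    D.jet a (l :: w) = D.jet (S.bracket U (D.lt U l) a) w := rfl

lemma jet_add (a b : S.A U) : D.jet (a + b) = D.jet a + D.jet b := by
  ext w : 1
  induction w generalizing a b with
  | nil => rw [jet_nil, map_add]; rfl
  | cons l w ih => rw [jet_cons, map_add, ih]; rfl

lemma jet_smul (r : ℝ) (a : S.A U) : D.jet (r • a) = r • D.jet a := by
  ext w : 1
  induction w generalizing a with
  | nil => rw [jet_nil, NManifold.val_smul]; rfl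
  | cons l w ih => rw [jet_cons, map_smul, ih]; rfl

lemma jet_zero : D.jet (0 : S.A U) = 0 := by simpa using D.jet_smul (0 : ℝ) (0 : S.A U)

lemma jet_neg (a : S.A U) : D.jet (-a) = -D.jet a := by simpa using D.jet_smul (-1 : ℝ) a

lemma jet_neg_one_pow (n : ℕ) (a : S.A U) : D.jet ((-1) ^ n * a) = ((-1 : ℤˣ) ^ n) • D.jet a := by
  rcases Nat.even_or_odd n with hn | hn
  · simp [hn.neg_one_pow]
  · simp [hn.neg_one_pow, jet_neg]

lemma hom_jet {k : ℕ} {a : S.A U} (ha : a ∈ S.deg U k) : Hom (D.jet a) k := by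
  intro w hw
  induction w generalizing k a with
  | nil =>
    rw [jet_nil, NManifold.val_of_mem (fun h => hw (by rw [h]; rfl)) ha]
    rfl
  | cons l w ih =>
    rw [jet_cons]
    rcases lt_or_ge k (Weighted.wt l) with hk | hk
    · rw [D.bracket_lt_eq_zero l ha hk, jet_zero]
      rfl
    · obtain ⟨k, rfl⟩ := Nat.exists_eq_add_of_le hk
      refine ih (D.bracket_lt_mem l ha) fun h => hw ?_
      rw [wtw_cons]
      push_cast
      rw [h]

lemma jet_base (f : Fn d U) : D.jet (S.base U f) = const ⇑f := by
  refine amb_ext ?_ fun l => ?_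
  · rw [jet_nil, NManifold.val_base]
    rfl
  · rw [D_jet, D.bracket_lt_eq_zero l (NManifold.base_mem f) (by rcases l with e | f <;> simp),
      jet_zero]
    rfl

/-- The expansion turns products into shuffle products, by the Leibniz rule. -/
lemma jet_mul (a b : S.A U) : D.jet (a * b) = D.jet a * D.jet b := by
  ext w : 1
  induction w generalizing a b with
  | nil => rw [jet_nil, map_mul]; rfl
  | cons l w ih =>
    induction a using S.deg_induction with
    | h0 => rw [zero_mul, jet_zero, zero_mul]
    | hadd a a' ha ha' =>
      rw [add_mul, jet_add, jet_add, add_mul, Shuf.add_apply, Shuf.add_apply, ha, ha']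
    | hdeg k a ha =>
      rw [jet_cons, S.bracket_leibniz U _ _ _ (D.lt_mem l) _ ha, mul_cons, D_jet, D_jet, jet_add,
        Shuf.add_apply, ih, jet_neg_one_pow, ((D.hom_jet ha).isPar).θ_sg, Shuf.usmul_mul]
      congr 1
      rw [Shuf.usmul_apply, Shuf.usmul_apply, ih]
      congr 1
      rcases l with e | f
      · simp
      · simp [← pow_mul, mul_comm k 2, pow_mul (-1 : ℤˣ) 2 k]

lemma jet_res (h : U ≤ V) (a : S.A V) : D.jet (S.res h a) = resA h (D.jet a) := by
  ext w : 1
  induction w generalizing a with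
  | nil => rw [jet_nil, NManifold.val_res]; rfl
  | cons l w ih => rw [jet_cons, ← D.lt_res h, ← S.bracket_res, ih]; rfl

lemma bracket_lt_sec (e e' : P.Sec) : S.bracket U (D.lt U (ls P e)) (D.lt U (ls P e')) =
    D.lt U (lf P (P.pairing e e')) := by
  change S.bracket U (S.res le_top (D.φ e)) (S.res le_top (D.φ e')) = _
  rw [← S.bracket_res, ← D.pairing_eq, NManifold.res_fn]
  rfl

lemma jet_lt (l : P.Sec ⊕ Fn d M) : D.jet (D.lt U l) = ι U l := by
  rcases l with e | f
  · refine amb_ext ?_ fun l => ?_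
    · rw [jet_nil, NManifold.val_of_mem (by simp) (D.lt_mem (ls P e))]
      rfl
    · rw [D_jet]
      rcases l with e' | f
      · rw [bracket_lt_sec, pairing_comm]
        exact (D.jet_base _).trans (D_hat_inl e e').symm
      · rw [D.bracket_lt_eq_zero (lf P f) (D.lt_mem (ls P e)) (by simp), jet_zero]
        rfl
  · exact D.jet_base _

lemma lt_add_sec (e e' : P.Sec) :
    D.lt U (ls P (e + e')) = D.lt U (ls P e) + D.lt U (ls P e') := by
  change S.res le_top (D.φ (e + e')).1 = _
  rw [D.φ_add, map_add]
  rfl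

lemma lt_smul_sec (f : Fn d M) (e : P.Sec) :
    D.lt U (ls P (smulSec f e)) = S.base U (f.toOpen U) * D.lt U (ls P e) := by
  change S.res le_top (D.φ (smulSec f e)).1 = _
  rw [D.φ_smul f e _ fun _ => rfl, map_mul, NManifold.res_fn]
  rfl

/-- Expansions satisfy the relations, by the Leibniz rule and the Jacobi identity in `S`. -/
lemma rel_jet (a : S.A U) : Rel (D.jet a) where
  add_sec e e' := by
    rw [D_jet, lt_add_sec, map_add, LinearMap.add_apply, jet_add]
    rfl
  smul_sec f e := by
    rw [D_jet, lt_smul_sec, SymplecticNManifold.bracket_base_mul _ (D.lt_mem (ls P e)), jet_add,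
      jet_mul, jet_mul, jet_base, jet_lt, const_mul]
    rfl
  add_fn f g := by
    rw [D_jet, show D.lt U (lf P (f + g)) = D.lt U (lf P f) + D.lt U (lf P g) from
      map_add (S.base U) (f.toOpen U) (g.toOpen U), map_add, LinearMap.add_apply, jet_add]
    rfl
  mul_fn f g := by
    rw [D_jet, show D.lt U (lf P (f * g)) = S.base U (f.toOpen U) * D.lt U (lf P g) from
      map_mul (S.base U) (f.toOpen U) (g.toOpen U),
      SymplecticNManifold.bracket_base_mul _ (D.lt_mem (lf P g)), jet_add,
      jet_mul, jet_mul, jet_base, jet_lt, const_mul]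
    change _ + const _ * _ = _
    rw [const_mul]
    rfl
  const_fn r := by
    rw [D_jet, show D.lt U (lf P (algebraMap ℝ _ r)) = r • 1 from by
      rw [← Algebra.algebraMap_eq_smul_one]
      exact (S.base U).commutes r]
    have h : S.bracket U 1 a = 0 := by
      induction a using S.deg_induction with
      | h0 => simp
      | hadd a b ha hb => rw [map_add, ha, hb, add_zero]
      | hdeg k a ha =>
        rw [S.bracket_antisymm U 0 k 1 (SetLike.one_mem_graded (S.deg U)) a ha,
          SymplecticNManifold.bracket_one]
        simp
    rw [map_smul, LinearMap.smul_apply, h, smul_zero, jet_zero]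
  comm_sec e e' := by
    rw [D_jet, D_jet, D_jet, D_jet, D_jet, ← bracket_lt_sec, ← jet_add,
      S.bracket_jacobi U 1 1 _ (D.lt_mem (ls P e)) _ (D.lt_mem (ls P e'))]
    simp
  comm_sec_fn e f := by
    rw [D_jet, D_jet, D_jet, D_jet,
      S.bracket_jacobi U 1 0 _ (D.lt_mem (ls P e)) _ (D.lt_mem (lf P f)),
      D.bracket_lt_eq_zero (ls P e) (D.lt_mem (lf P f)) (by simp)]
    simp
  comm_fn f g := by
    rw [D_jet, D_jet, D_jet, D_jet,
      S.bracket_jacobi U 0 0 _ (D.lt_mem (lf P f)) _ (D.lt_mem (lf P g)),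
      D.bracket_lt_eq_zero (lf P f) (D.lt_mem (lf P g)) (by simp)]
    simp

lemma isPoly_jet (a : S.A U) : IsPoly (D.jet a) where
  rel w := by
    induction w generalizing a with
    | nil => exact D.rel_jet a
    | cons l w ih => exact ih _
  bdd := by
    induction a using S.deg_induction with
    | h0 => exact ⟨0, fun w _ => by rw [jet_zero]; rfl⟩
    | hadd a b ha hb =>
      obtain ⟨m, hm⟩ := ha
      obtain ⟨n, hn⟩ := hb
      exact ⟨max m n, fun w hw => by
        rw [jet_add, Shuf.add_apply, hm w (by omega), hn w (by omega), add_zero]⟩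
    | hdeg k a ha => exact Hom.bdd (D.hom_jet ha)
  smooth w := by
    induction w generalizing a with
    | nil => exact (S.val U a).contMDiff
    | cons l w ih => exact ih _

/-- The expansion as a homomorphism of algebras. -/
def jetHom (U : Opens M) : S.A U →ₐ[ℝ] polyAlg P U where
  toFun a := ⟨D.jet a, D.isPoly_jet a⟩
  map_one' := Subtype.ext <| by
    change D.jet 1 = 1
    rw [← map_one (S.base U), jet_base]
    rfl
  map_mul' a b := Subtype.ext (D.jet_mul a b)
  map_zero' := Subtype.ext D.jet_zero
  map_add' a b := Subtype.ext (D.jet_add a b)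
  commutes' r := Subtype.ext <| by
    change D.jet (algebraMap ℝ (S.A U) r) = algebraMap ℝ (Amb P U) r
    rw [← (S.base U).commutes, jet_base, algebraMap_eq]
    rfl

lemma jetHom_val (a : S.A U) : (D.jetHom U a).1 = D.jet a := rfl

lemma jetHom_base (f : Fn d U) : D.jetHom U (S.base U f) = baseHom P U f := Subtype.ext (D.jet_base f)

lemma jetHom_res (h : U ≤ V) (a : S.A V) : D.jetHom U (S.res h a) = resHom h (D.jetHom V a) :=
  Subtype.ext (D.jet_res h a)

end DerivedData

end PreCourant

end

/-! ### The expansion is an isomorphism -/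

noncomputable section

namespace PreCourant

open Filter Topology Shuf VBundle

variable {d : ℕ} {M : Type u} [TopologicalSpace M] [ChartedSpace (EuclideanSpace ℝ (Fin d)) M]
variable [T2Space M] [IsManifold (𝓡 d) ∞ M]
variable {U V W : Opens M}

namespace SymplecticNManifold

variable {S : SymplecticNManifold d M}

/-- Nondegeneracy of the bracket in terms of the values along `M`: the brackets of the coordinates
of weight one, and those of the coordinates of weight zero with those of weight two, form
invertible matrices. -/
lemma exists_inverse {m : M} (z : S.Coord m U)
    (hz : IsUnit (Matrix.of fun i j => S.bracket U (z.all i) (z.all j))) :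
    ∃ (G' : Matrix (Fin S.q) (Fin S.q) (Fn d U)) (X' : Matrix (Fin S.r) (Fin d) (Fn d U)),
      G' * (Matrix.of fun i j => S.val U (S.bracket U (z.ξ i) (z.ξ j))) = 1 ∧
      X' * (Matrix.of fun b a => S.val U (S.bracket U (S.base U (z.x b)) (z.p a))) = 1 ∧
      (Matrix.of fun b a => S.val U (S.bracket U (S.base U (z.x b)) (z.p a))) * X' = 1 := by
  -- For reasons of weight, the only nonzero blocks of the matrix of values along `M` are those of
  -- `x` with `p`, of `ξ` with `ξ` and of `p` with `x`.
  obtain ⟨L, h1, h2⟩ := isUnit_iff_exists.1 (hz.map (S.val U).mapMatrix)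
  let K : Matrix (Fin d ⊕ Fin S.q ⊕ Fin S.r) (Fin d ⊕ Fin S.q ⊕ Fin S.r) (Fn d U) :=
    (S.val U).mapMatrix (Matrix.of fun i j => S.bracket U (z.all i) (z.all j))
  have hx : ∀ b, z.all (Sum.inl b) ∈ S.deg U 0 := fun b => NManifold.base_mem _
  have hξ : ∀ i, z.all (Sum.inr (Sum.inl i)) ∈ S.deg U 1 := z.ξ_deg
  have hp : ∀ a, z.all (Sum.inr (Sum.inr a)) ∈ S.deg U 2 := z.p_deg
  have hval : ∀ {i j k} {a b : S.A U}, a ∈ S.deg U i → b ∈ S.deg U j → k + 2 = i + j → k ≠ 0 →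
      S.val U (S.bracket U a b) = 0 := fun ha hb h hk =>
    NManifold.val_of_mem hk (S.bracket_deg U _ _ _ h _ ha _ hb)
  have hlow : ∀ {i j} {a b : S.A U}, a ∈ S.deg U i → b ∈ S.deg U j → i + j < 2 →
      S.val U (S.bracket U a b) = 0 := fun ha hb h => by
    rw [S.bracket_low U _ _ h _ ha _ hb, map_zero]
  have kxx : ∀ a b, K (Sum.inl a) (Sum.inl b) = 0 := fun a b => hlow (hx a) (hx b) (by simp)
  have kxξ : ∀ a b, K (Sum.inl a) (Sum.inr (Sum.inl b)) = 0 := fun a b =>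
    hlow (hx a) (hξ b) (by simp)
  have kξx : ∀ a b, K (Sum.inr (Sum.inl a)) (Sum.inl b) = 0 := fun a b =>
    hlow (hξ a) (hx b) (by simp)
  have kξp : ∀ a b, K (Sum.inr (Sum.inl a)) (Sum.inr (Sum.inr b)) = 0 := fun a b =>
    hval (hξ a) (hp b) (k := 1) rfl one_ne_zero
  have kpξ : ∀ a b, K (Sum.inr (Sum.inr a)) (Sum.inr (Sum.inl b)) = 0 := fun a b =>
    hval (hp a) (hξ b) (k := 1) rfl one_ne_zero
  have kpp : ∀ a b, K (Sum.inr (Sum.inr a)) (Sum.inr (Sum.inr b)) = 0 := fun a b =>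
    hval (hp a) (hp b) (k := 2) rfl two_ne_zero
  have hKL : K * L = 1 := h1
  have hLK : L * K = 1 := h2
  have eKL : ∀ i j, ∑ k, K i k * L k j = if i = j then 1 else 0 := fun i j =>
    (congrFun (congrFun hKL i) j).trans Matrix.one_apply
  have eLK : ∀ i j, ∑ k, L i k * K k j = if i = j then 1 else 0 := fun i j =>
    (congrFun (congrFun hLK i) j).trans Matrix.one_apply
  simp only [Fintype.sum_sum_type] at eKL eLK
  refine ⟨Matrix.of fun i j => L (Sum.inr (Sum.inl i)) (Sum.inr (Sum.inl j)),
    Matrix.of fun a b => L (Sum.inr (Sum.inr a)) (Sum.inl b), Matrix.ext fun i j => ?_,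
    Matrix.ext fun i j => ?_, Matrix.ext fun i j => ?_⟩
  · have := eLK (Sum.inr (Sum.inl i)) (Sum.inr (Sum.inl j))
    rw [Matrix.one_apply, Matrix.mul_apply]
    simp [kxξ, kpξ] at this
    exact this
  · have := eLK (Sum.inr (Sum.inr i)) (Sum.inr (Sum.inr j))
    rw [Matrix.one_apply, Matrix.mul_apply]
    simp [kξp, kpp] at this
    exact this
  · have := eKL (Sum.inl i) (Sum.inl j)
    rw [Matrix.one_apply, Matrix.mul_apply]
    simp [kxx, kxξ] at this
    exact this

end SymplecticNManifold

namespace DerivedData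

variable {S : SymplecticAlmostLie2Algebroid d M} {P : PreCourantAlgebroid d M} (D : DerivedData S P)

/-- Functions of weight at most one are locally given by letters. -/
lemma exists_lt {k : ℕ} (hk : k ≤ 1) {a : S.A U} (ha : a ∈ S.deg U k) {x : M} (hx : x ∈ U) :
    ∃ (V : Opens M) (hV : V ≤ U), x ∈ V ∧ ∃ l, S.res hV a = D.lt V l := by
  obtain rfl | rfl : k = 0 ∨ k = 1 := by omega
  · obtain ⟨f, rfl⟩ := (S.base_range U a).1 ha
    obtain ⟨g, hg⟩ := exists_fn_germ f.contMDiff ⟨x, hx⟩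
    obtain ⟨O, hO, hOo, hxO⟩ := eventually_nhds_iff.1 hg
    refine ⟨⟨O, hOo⟩ ⊓ U, inf_le_right, ⟨hxO, hx⟩, lf P g, ?_⟩
    rw [S.base_res]
    exact congrArg _ (Fn.ext fun y => (hO y.1 y.2.1 y.2.2).symm)
  · obtain ⟨b, hb, V, hV, hxV, h⟩ := NManifold.exists_extension ha hx
    refine ⟨V, hV, hxV, ls P (D.φ.symm ⟨b, hb⟩), ?_⟩
    rw [← h]
    change _ = S.res le_top (D.φ (D.φ.symm ⟨b, hb⟩)).1
    rw [Equiv.apply_symm_apply]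

lemma jet_bracket_left {k : ℕ} (hk : k ≤ 1) {a : S.A U} (ha : a ∈ S.deg U k) (b : S.A U) :
    D.jet (S.bracket U a b) = pb (D.jet a) (D.jet b) := by
  refine amb_ext_of_cover fun x => ?_
  obtain ⟨V, hV, hx, l, hl⟩ := D.exists_lt hk ha x.2
  refine ⟨V, hV, hx, ?_⟩
  rw [← jet_res, S.bracket_res, pb_res hV (D.isPoly_jet a) (D.isPoly_jet b), ← jet_res, ← jet_res,
    hl, jet_lt, pb_ι l (D.isPoly_jet _)]
  rfl

lemma jet_bracket_right {j k : ℕ} (hk : k ≤ 1) {a b : S.A U} (ha : a ∈ S.deg U j)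
    (hb : b ∈ S.deg U k) : D.jet (S.bracket U a b) = pb (D.jet a) (D.jet b) := by
  rw [S.bracket_antisymm U j k a ha b hb, jet_neg, jet_neg_one_pow, D.jet_bracket_left hk hb,
    pb_antisymm (D.isPoly_jet a) (D.isPoly_jet b) (D.hom_jet ha).isPar, θ_of_hom (D.hom_jet hb),
    pb_usmul_left _ (D.isPoly_jet b) (D.isPoly_jet a)]

/-- The expansion preserves brackets. As letters act by derivations of both brackets, it is enough
to compare values at the empty word, where one of two homogeneous functions may be assumed to have
weight at most one and hence to be locally a letter. -/
lemma jet_bracket (a b : S.A U) : D.jet (S.bracket U a b) = pb (D.jet a) (D.jet b) := by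
  have hadd : ∀ {a a' b : S.A U} {w}, D.jet (S.bracket U a b) w = pb (D.jet a) (D.jet b) w →
      D.jet (S.bracket U a' b) w = pb (D.jet a') (D.jet b) w →
        D.jet (S.bracket U (a + a') b) w = pb (D.jet (a + a')) (D.jet b) w := fun h h' => by
    rw [map_add, LinearMap.add_apply, jet_add, jet_add,
      pb_add_left (D.isPoly_jet _) (D.isPoly_jet _) (D.isPoly_jet _), Shuf.add_apply,
      Shuf.add_apply, h, h']
  have hzero : ∀ (b : S.A U) w, D.jet (S.bracket U 0 b) w = pb (D.jet (0 : S.A U)) (D.jet b) w :=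
    fun b w => by rw [map_zero, LinearMap.zero_apply, jet_zero, pb_zero_left (D.isPoly_jet _)]
  ext w : 1
  induction w generalizing a b with
  | nil =>
    induction a using S.deg_induction with
    | h0 => exact hzero b _
    | hadd a a' ha ha' => exact hadd ha ha'
    | hdeg i a ha =>
      induction b using S.deg_induction with
      | h0 => rw [map_zero, jet_zero, pb_zero_right (D.isPoly_jet _)]
      | hadd b b' hb hb' =>
        rw [map_add, jet_add, jet_add,
          pb_add_right (D.isPoly_jet _) (D.isPoly_jet _) (D.isPoly_jet _), Shuf.add_apply,
          Shuf.add_apply, hb, hb']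
      | hdeg j b hb =>
        by_cases hi : i ≤ 1
        · rw [D.jet_bracket_left hi ha]
        by_cases hj : j ≤ 1
        · rw [D.jet_bracket_right hj ha hb]
        -- In weights at least two, the bracket has positive weight.
        rw [D.hom_jet (S.bracket_deg U i j (i + j - 2) (by omega) a ha b hb) [] (by
            change ((0 : ℕ) : ℤ) ≠ _; omega),
          pb_hom (D.hom_jet ha) (D.hom_jet hb) [] (by change ((0 : ℕ) : ℤ) ≠ _; omega)]
  | cons l w ih =>
    induction a using S.deg_induction with
    | h0 => exact hzero b _
    | hadd a a' ha ha' => exact hadd ha ha'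
    | hdeg k a ha =>
      change _ = Shuf.D l (pb (D.jet a) (D.jet b)) w
      rw [jet_cons, S.bracket_jacobi U _ _ _ (D.lt_mem l) _ ha, D_pb, D_jet, D_jet, jet_add,
        Shuf.add_apply, Shuf.add_apply, ih, jet_neg_one_pow, ((D.hom_jet ha).isPar).θ_sg,
        pb_usmul_left _ (D.isPoly_jet _) (D.isPoly_jet _)]
      congr 1
      rw [Shuf.usmul_apply, Shuf.usmul_apply, ih]
      congr 1
      rcases l with e | f
      · simp
      · simp [← pow_mul, mul_comm k 2, pow_mul (-1 : ℤˣ) 2 k]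

/-- The expansions of coordinates on the N-manifold are coordinates for polynomial functions. -/
lemma exists_polyCoord {m : M} (z : S.Coord m U)
    (hz : IsUnit (Matrix.of fun i j => S.bracket U (z.all i) (z.all j))) :
    ∃ Z : PolyCoord P U S.q S.r, (Z.ξ = fun i => D.jetHom U (z.ξ i)) ∧
      Z.p = fun a => D.jetHom U (z.p a) := by
  obtain ⟨G', X', h1, h2, h3⟩ := SymplecticNManifold.exists_inverse z hz
  have hbr : ∀ {a b : S.A U}, S.bracket U a b ∈ S.deg U 0 →
      pb (D.jet a) (D.jet b) = const ⇑(S.val U (S.bracket U a b)) := fun h => by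
    rw [← D.jet_bracket, ← D.jet_base, NManifold.base_val_of_mem h]
  exact ⟨{
    m := m
    subset := z.subset
    x := z.x
    x_apply := z.x_apply
    ξ := fun i => D.jetHom U (z.ξ i)
    p := fun a => D.jetHom U (z.p a)
    ξ_hom := fun i => D.hom_jet (z.ξ_deg i)
    p_hom := fun a => D.hom_jet (z.p_deg a)
    G := Matrix.of fun i j => S.val U (S.bracket U (z.ξ i) (z.ξ j))
    G' := G'
    G_eq := fun i j => hbr (S.bracket_deg U 1 1 0 rfl _ (z.ξ_deg i) _ (z.ξ_deg j))
    G'_mul := h1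
    X := Matrix.of fun b a => S.val U (S.bracket U (S.base U (z.x b)) (z.p a))
    X' := X'
    X_eq := fun b a => by
      have := hbr (S.bracket_deg U 0 2 0 rfl _ (NManifold.base_mem (z.x b)) _ (z.p_deg a))
      rwa [D.jet_base] at this
    X'_mul := h2
    mul_X' := h3
    span := fun e => by
      obtain ⟨c, hc⟩ := z.span le_rfl (D.lt_mem (ls P e))
      refine ⟨c, ?_⟩
      have h := congrArg (fun a => (D.jetHom U a).1) hc
      simp only [map_sum, AddSubmonoidClass.coe_finsetSum, S.res_self, map_mul, jetHom_base] at h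
      rw [jetHom_val, jet_lt] at h
      exact h }, rfl, rfl⟩

/-- The expansion is bijective over a coordinate domain, where both sides are free on monomials in
corresponding coordinates. -/
lemma jetHom_bijective_of_coord {m : M} (z : S.Coord m U)
    (hz : IsUnit (Matrix.of fun i j => S.bracket U (z.all i) (z.all j))) (h : V ≤ U) :
    Function.Bijective (D.jetHom V) := by
  obtain ⟨Z, h1, h2⟩ := D.exists_polyCoord z hz
  have hmap : ∀ c : (Finset (Fin S.q) × (Fin S.r → ℕ)) →₀ Fn d V,
      D.jetHom V (c.sum fun s f => S.base V f * S.res h (monomial z.ξ z.p s)) =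
        c.sum fun s f => baseHom P V f * resHom h (monomial Z.ξ Z.p s) := fun c => by
    rw [Finsupp.sum, Finsupp.sum, map_sum]
    refine Finset.sum_congr rfl fun s _ => ?_
    rw [map_mul, jetHom_base, jetHom_res, h1, h2]
    congr 2
    exact map_monomial (D.jetHom U).toRingHom z.ξ z.p s
  constructor
  · intro a b hab
    obtain ⟨c, hc, -⟩ := z.free V h a
    obtain ⟨c', hc', -⟩ := z.free V h b
    have hcc : c = c' := by
      obtain ⟨c₀, -, hu⟩ := Z.free h (D.jetHom V a)
      rw [hu c (by dsimp only; rw [← hmap, ← hc]), hu c' (by dsimp only; rw [← hmap, ← hc', hab])]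
    rw [hc, hc', hcc]
  · intro y
    obtain ⟨c, hc, -⟩ := Z.free h y
    exact ⟨_, (hmap c).trans hc.symm⟩

lemma prj_jet (k : ℕ) (a : S.A U) : D.jet (S.prj U k a) = Shuf.proj (k : ℤ) (D.jet a) := by
  induction a using S.deg_induction with
  | h0 => rw [map_zero, jet_zero, map_zero]
  | hadd a b ha hb => rw [map_add, jet_add, jet_add, map_add, ha, hb]
  | hdeg j a ha =>
    by_cases hj : j = k
    · subst hj
      rw [NManifold.prj_of_mem ha, (D.hom_jet ha).proj_eq]
    · rw [NManifold.prj_of_ne ha hj, (D.hom_jet ha).proj_ne (by exact_mod_cast Ne.symm hj), jet_zero]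

lemma jetHom_injective : Function.Injective (D.jetHom U) := fun a b h =>
  NManifold.eq_of_cover fun x hx => by
    obtain ⟨V, z, hz⟩ := S.bracket_nondeg x
    refine ⟨V ⊓ U, inf_le_right, ⟨z.mem, hx⟩,
      (D.jetHom_bijective_of_coord z hz inf_le_left).1 ?_⟩
    rw [jetHom_res, jetHom_res, h]

lemma jetHom_surjective : Function.Surjective (D.jetHom U) := by
  intro y
  -- Only functions of a given weight glue, so that local preimages are projected first.
  have key : ∀ k : ℕ, ∃ a : S.A U, (D.jetHom U a).1 = Shuf.proj (k : ℤ) y.1 := by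
    intro k
    choose V z hz using fun x : U => S.bracket_nondeg x.1
    choose a ha using fun x : U => (D.jetHom_bijective_of_coord (z x) (hz x)
      (inf_le_left : V x ⊓ U ≤ V x)).2 (resHom inf_le_right y)
    have hs : ∀ x, D.jetHom _ (S.prj _ k (a x)) =
        resHom inf_le_right ⟨Shuf.proj (k : ℤ) y.1, y.2.proj k⟩ := fun x => Subtype.ext <| by
      rw [jetHom_val, prj_jet, ← jetHom_val, ha]
      exact (mapHom_proj _ _ _).symm
    obtain ⟨t, ⟨-, ht⟩, -⟩ := S.glue U (fun x : U => V x ⊓ U) (fun x => inf_le_right)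
      (fun x hx => Opens.mem_iSup.2 ⟨⟨x, hx⟩, (z ⟨x, hx⟩).mem, hx⟩) k
      (fun x => S.prj _ k (a x)) (fun x => NManifold.prj_mem _ _) fun x x' =>
        D.jetHom_injective <| by
          rw [jetHom_res, jetHom_res, hs, hs]
          rfl
    refine ⟨t, amb_ext_of_cover fun x => ⟨V x ⊓ U, inf_le_right, ⟨(z x).mem, x.2⟩, ?_⟩⟩
    rw [jetHom_val, ← jet_res, ht, ← jetHom_val, hs]
    rfl
  choose a ha using key
  obtain ⟨n, hn⟩ := y.2.exists_sum_proj
  refine ⟨∑ k ∈ Finset.range n, a k, Subtype.ext ?_⟩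
  rw [map_sum, AddSubmonoidClass.coe_finsetSum]
  exact (Finset.sum_congr rfl fun k _ => ha k).trans hn.symm

lemma jet_injective : Function.Injective (D.jet : S.A U → Amb P U) := fun _ _ h =>
  D.jetHom_injective (Subtype.ext h)

lemma mem_deg_iff {k : ℕ} {a : S.A U} : Hom (D.jet a) k ↔ a ∈ S.deg U k := by
  refine ⟨fun h => ?_, D.hom_jet⟩
  have : S.prj U k a = a := D.jet_injective (by rw [prj_jet, h.proj_eq])
  exact this ▸ NManifold.prj_mem k a

lemma jet_φ (e : P.Sec) : D.jet (D.φ e).1 = hat ⊤ e := by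
  have := D.jet_lt (U := ⊤) (ls P e)
  rwa [show D.lt ⊤ (ls P e) = (D.φ e).1 from S.res_self _ _] at this

lemma lt_top_sec (e : P.Sec) : D.lt ⊤ (ls P e) = (D.φ e).1 := S.res_self _ _

/-- The expansion of `Θ` is the potential, as its iterated brackets with letters are the derived
anchor and bracket. -/
lemma jet_potential : D.jet S.Θ = potential P := by
  have hΘ : ∀ s, S.bracket ⊤ (D.lt ⊤ (ls P s)) S.Θ = S.bracket ⊤ S.Θ (D.φ s) := fun s => by
    rw [lt_top_sec, S.bracket_antisymm ⊤ 1 3 _ (D.φ s).2 _ S.Θ_deg]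
    simp [Odd.neg_one_pow (show Odd 3 by decide)]
  have h2 : ∀ s, S.bracket ⊤ S.Θ (D.φ s) ∈ S.deg ⊤ 2 := fun s =>
    S.bracket_deg ⊤ 3 1 2 rfl _ S.Θ_deg _ (D.φ s).2
  have hρ : ∀ s f, Shuf.D (lf P f) (Shuf.D (ls P s) (D.jet S.Θ)) = const (fr ⊤ (P.act s f)) := by
    intro s f
    rw [D_jet, D_jet, hΘ]
    change D.jet (S.bracket ⊤ (S.fn f) _) = _
    rw [S.bracket_antisymm ⊤ 0 2 (S.fn f) (NManifold.base_mem _) _ (h2 s)]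
    simp only [zero_mul, pow_zero, one_mul]
    rw [← D.anchor_eq]
    exact D.jet_base _
  have hc : ∀ s t, Shuf.D (ls P t) (Shuf.D (ls P s) (D.jet S.Θ)) = hat ⊤ (P.circ s t) := by
    intro s t
    rw [D_jet, D_jet, hΘ, lt_top_sec, S.bracket_antisymm ⊤ 1 2 _ (D.φ t).2 _ (h2 s)]
    rw [← jet_φ, D.circ_eq]
    simp
  have h3 := D.hom_jet S.Θ_deg
  refine amb_ext (h3 [] (by change (0 : ℤ) ≠ 3; decide)) fun l => ?_
  rcases l with s | f
  · rw [D_sec_potential]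
    refine amb_ext ((h3.D (ls P s)) [] (by change (0 : ℤ) ≠ 3 - 1; decide)) fun l => ?_
    rcases l with t | f
    · rw [hc, D_quad_sec, hat_eq_lin]
    · rw [hρ, D_quad_fn]
  · rw [D_fn_potential]
    refine amb_ext ((h3.D (lf P f)) [] (by change (0 : ℤ) ≠ 3 - 2; decide)) fun l => ?_
    rcases l with s | g
    · rw [(D.rel_jet S.Θ).comm_sec_fn, hρ, D_lin_sec]
    · rw [D_lin_fn]
      exact ((h3.D (lf P f)).D (lf P g)).eq_zero_of_neg (by change (3 : ℤ) - 2 - 2 < 0; decide)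

/-- A symplectic almost Lie 2-algebroid is isomorphic to the polynomial functions of any
pre-Courant algebroid that is derived from it. -/
def isoPoly : SymplecticAlmostLie2Algebroid.Iso S (polySympl P) where
  map U := AlgEquiv.ofBijective (D.jetHom U) ⟨D.jetHom_injective, D.jetHom_surjective⟩
  map_res h a := D.jetHom_res h a
  map_deg _ _ _ := D.mem_deg_iff
  map_base _ f := D.jetHom_base f
  map_bracket _ a b := Subtype.ext (D.jet_bracket a b)
  map_Θ := Subtype.ext D.jet_potential

lemma isoPoly_φ (e : P.Sec) : D.isoPoly.map ⊤ (D.φ e) = (polyDerived P).φ e :=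
  Subtype.ext (D.jet_φ e)

end DerivedData

end PreCourant

end

/-! ### Correspondence of isomorphisms -/

noncomputable section

namespace PreCourant

open Filter Topology Shuf VBundle

variable {d : ℕ} {M : Type u} [TopologicalSpace M] [ChartedSpace (EuclideanSpace ℝ (Fin d)) M]
variable [T2Space M] [IsManifold (𝓡 d) ∞ M]
variable {U V W : Opens M}
variable {S S' : SymplecticAlmostLie2Algebroid d M} {P P' : PreCourantAlgebroid d M}

lemma SymplecticAlmostLie2Algebroid.Iso.ext {a a' : Iso S S'} (h : ∀ U x, a.map U x = a'.map U x) :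
    a = a' := by
  have : a.map = a'.map := funext fun U => AlgEquiv.ext (h U)
  cases a
  cases a'
  congr

lemma SymplecticAlmostLie2Algebroid.Iso.map_fn (a : Iso S S') (f : Fn d M) :
    a.map ⊤ (S.fn f) = S'.fn f := a.map_base _ _

namespace DerivedData

/-- Transport of an identification along an isomorphism of symplectic almost Lie 2-algebroids. -/
def push (D : DerivedData S P) (a : SymplecticAlmostLie2Algebroid.Iso S S') :
    DerivedData S' P where
  φ := D.φ.trans
    { toFun := fun x => ⟨a.map ⊤ x.1, (a.map_deg ⊤ 1 _).2 x.2⟩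
      invFun := fun y => ⟨(a.map ⊤).symm y.1, (a.map_deg ⊤ 1 _).1 (by simp)⟩
      left_inv := fun x => Subtype.ext ((a.map ⊤).symm_apply_apply _)
      right_inv := fun y => Subtype.ext ((a.map ⊤).apply_symm_apply _) }
  φ_add s t := by
    change a.map ⊤ (D.φ (s + t)).1 = _
    rw [D.φ_add, map_add]
    rfl
  φ_smul f s t h := by
    change a.map ⊤ (D.φ t).1 = _
    rw [D.φ_smul f s t h, map_mul, a.map_fn]
    rfl
  pairing_eq s t := by
    rw [← a.map_fn, D.pairing_eq, a.map_bracket]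
    rfl
  anchor_eq s f := by
    rw [← a.map_fn, D.anchor_eq, map_neg, a.map_bracket, a.map_bracket, a.map_Θ, a.map_fn]
    rfl
  circ_eq s t := by
    change a.map ⊤ (D.φ (P.circ s t)).1 = _
    rw [D.circ_eq, map_neg, a.map_bracket, a.map_bracket, a.map_Θ]
    rfl

/-- Transport of an identification along an isomorphism of pre-Courant algebroids. -/
def pull (D : DerivedData S P') (b : PreCourantAlgebroid.Iso P P') : DerivedData S P where
  φ := b.onSec.trans D.φ
  φ_add s t := by
    have : b.onSec (s + t) = b.onSec s + b.onSec t := Sec.ext fun x => by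
      rw [sec_add_apply, b.onSec_apply, b.onSec_apply, b.onSec_apply, sec_add_apply, map_add]
    change (D.φ (b.onSec (s + t))).1 = _
    rw [this, D.φ_add]
    rfl
  φ_smul f s t h := D.φ_smul f _ _ fun x => by
    rw [b.onSec_apply, b.onSec_apply, h, map_smul]
  pairing_eq s t := by
    have : P.pairing s t = P'.pairing (b.onSec s) (b.onSec t) := Fn.ext fun x => by
      rw [pairing_apply, pairing_apply, b.onSec_apply, b.onSec_apply, b.metric_eq]
    rw [this, D.pairing_eq]
    rfl
  anchor_eq s f := by
    have : P.act s f = P'.act (b.onSec s) f := Fn.ext fun x => by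
      rw [act_apply, act_apply, b.onSec_apply, b.anchor_eq]
    rw [this, D.anchor_eq]
    rfl
  circ_eq s t := by
    change (D.φ (b.onSec (P.circ s t))).1 = _
    rw [b.circ_eq, D.circ_eq]
    rfl

lemma jet_push (D : DerivedData S P) (a : SymplecticAlmostLie2Algebroid.Iso S S') (x : S.A U) :
    (D.push a).jet (a.map U x) = D.jet x := by
  have hlt : ∀ l, (D.push a).lt U l = a.map U (D.lt U l) := fun l => by
    rcases l with e | f
    · exact (a.map_res _ _).symm
    · exact (a.map_base _ _).symm
  ext w : 1
  induction w generalizing x with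
  | nil =>
    rw [jet_nil, jet_nil]
    congr 1
    refine S'.base_injective U ?_
    rw [NManifold.base_val, ← a.map_base, NManifold.base_val]
    induction x using S.deg_induction with
    | h0 => simp
    | hadd x y hx hy => simp only [map_add, hx, hy]
    | hdeg k x hx =>
      have hx' := (a.map_deg U k x).2 hx
      by_cases hk : k = 0
      · subst hk
        rw [NManifold.prj_of_mem hx, NManifold.prj_of_mem hx']
      · rw [NManifold.prj_of_ne hx hk, NManifold.prj_of_ne hx' hk, map_zero]
  | cons l w ih => rw [jet_cons, hlt, ← a.map_bracket, ih]; rfl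

/-- An isomorphism is determined by its action on functions of weight one. -/
lemma iso_ext (D : DerivedData S P) {a a' : SymplecticAlmostLie2Algebroid.Iso S S'}
    (h : ∀ e, a.map ⊤ (D.φ e).1 = a'.map ⊤ (D.φ e).1) : a = a' := by
  refine SymplecticAlmostLie2Algebroid.Iso.ext fun U x => (D.push a').jet_injective ?_
  have hD : D.push a = D.push a' := by
    have : (D.push a).φ = (D.push a').φ := Equiv.ext fun e => Subtype.ext (h e)
    revert this
    generalize D.push a = D₁
    generalize D.push a' = D₂
    intro this
    cases D₁
    cases D₂
    congr
  rw [jet_push, ← hD, jet_push]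

/-- Pre-Courant algebroids that are derived from the same data are isomorphic. -/
def isoOfSame (D : DerivedData S P) (D' : DerivedData S P') : PreCourantAlgebroid.Iso P P' := by
  let σ : P.Sec ≃ P'.Sec := D.φ.trans D'.φ.symm
  have hσ : ∀ s, D'.φ (σ s) = D.φ s := fun s => D'.φ.apply_symm_apply _
  have hinj : Function.Injective S.fn := fun f g h => Fn.ext fun x =>
    congrArg (fun k : Fn d (⊤ : Opens M) => k ⟨x, trivial⟩) (S.base_injective ⊤ h)
  have hpair : ∀ s t, P'.pairing (σ s) (σ t) = P.pairing s t := fun s t => hinj <| by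
    rw [D'.pairing_eq, hσ, hσ, ← D.pairing_eq]
  have hact : ∀ s f, P'.act (σ s) f = P.act s f := fun s f => hinj <| by
    rw [D'.anchor_eq, hσ, ← D.anchor_eq]
  have hcirc : ∀ s t, σ (P.circ s t) = P'.circ (σ s) (σ t) := fun s t =>
    D'.φ.injective <| Subtype.ext <| by rw [hσ, D.circ_eq, D'.circ_eq, hσ, hσ]
  -- The value of `σ s` at a point depends only on the value of `s`, by nondegeneracy.
  have hval : ∀ (s t : P.Sec) (x : M), s x = t x → σ s x = σ t x := fun s t x h =>
    fib_ext fun e => by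
      have h1 := congrArg (fun f : Fn d M => f x) (hpair s (σ.symm e))
      have h2 := congrArg (fun f : Fn d M => f x) (hpair t (σ.symm e))
      simp only [pairing_apply, Equiv.apply_symm_apply, h] at h1 h2
      rw [h1, h2]
  have hval' : ∀ (s t : P'.Sec) (x : M), s x = t x → σ.symm s x = σ.symm t x := fun s t x h =>
    fib_ext fun e => by
      have h1 := congrArg (fun f : Fn d M => f x) (hpair (σ.symm s) e)
      have h2 := congrArg (fun f : Fn d M => f x) (hpair (σ.symm t) e)
      simp only [pairing_apply, Equiv.apply_symm_apply, h] at h1 h2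
      rw [← h1, ← h2]
  have hadd : ∀ s t, σ (s + t) = σ s + σ t := fun s t => D'.φ.injective <| Subtype.ext <| by
    rw [hσ, D.φ_add, D'.φ_add, hσ, hσ]
  have hsmul : ∀ (f : Fn d M) s, σ (smulSec f s) = smulSec f (σ s) := fun f s =>
    D'.φ.injective <| Subtype.ext <| by
      rw [hσ, D.φ_smul f s _ fun _ => rfl, D'.φ_smul f (σ s) _ fun _ => rfl, hσ]
  let sec : ∀ x, P.fib x → P.Sec := fun x v => (exists_sec P.toVBundle v).choose
  have hsec : ∀ x v, sec x v x = v := fun x v => (exists_sec P.toVBundle v).choose_spec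
  let sec' : ∀ x, P'.fib x → P'.Sec := fun x v => (exists_sec P'.toVBundle v).choose
  have hsec' : ∀ x v, sec' x v x = v := fun x v => (exists_sec P'.toVBundle v).choose_spec
  let onFib : ∀ x, P.fib x ≃ₗ[ℝ] P'.fib x := fun x =>
    { toFun := fun v => σ (sec x v) x
      map_add' := fun v w => by
        rw [hval (sec x (v + w)) (sec x v + sec x w) x (by
          rw [sec_add_apply, hsec, hsec, hsec]), hadd, sec_add_apply]
      map_smul' := fun r v => by
        rw [hval (sec x (r • v)) (smulSec (algebraMap ℝ (Fn d M) r) (sec x v)) x (by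
          change _ = r • sec x v x
          rw [hsec, hsec]), hsmul]
        rfl
      invFun := fun v => σ.symm (sec' x v) x
      left_inv := fun v => by
        change σ.symm (sec' x (σ (sec x v) x)) x = v
        rw [hval' (sec' x (σ (sec x v) x)) (σ (sec x v)) x (hsec' x _), Equiv.symm_apply_apply,
          hsec]
      right_inv := fun v => by
        change σ (sec x (σ.symm (sec' x v) x)) x = v
        rw [hval (sec x (σ.symm (sec' x v) x)) (σ.symm (sec' x v)) x (hsec x _),
          Equiv.apply_symm_apply, hsec'] }
  have happ : ∀ (s : P.Sec) x, onFib x (s x) = σ s x := fun s x => hval _ _ x (hsec x _)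
  exact
    { onFib := onFib
      onSec := σ
      onSec_apply := fun s x => (happ s x).symm
      metric_eq := fun x v w => by
        have := congrArg (fun f : Fn d M => f x) (hpair (sec x v) (sec x w))
        simp only [pairing_apply, hsec] at this
        exact this
      anchor_eq := fun x v => tangent_ext fun f => by
        have := congrArg (fun f : Fn d M => f x) (hact (sec x v) f)
        simp only [act_apply, hsec] at this
        exact this
      circ_eq := hcirc }

lemma isoOfSame_onSec (D : DerivedData S P) (D' : DerivedData S P') (s : P.Sec) :
    D'.φ ((D.isoOfSame D').onSec s) = D.φ s := D'.φ.apply_symm_apply _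

end DerivedData

lemma PreCourantAlgebroid.Iso.ext {b b' : Iso P P'} (h : ∀ s, b.onSec s = b'.onSec s) : b = b' := by
  have h1 : b.onSec = b'.onSec := Equiv.ext h
  have h2 : b.onFib = b'.onFib := funext fun x => LinearEquiv.ext fun v => by
    obtain ⟨s, rfl⟩ := exists_sec P.toVBundle v
    rw [← b.onSec_apply, ← b'.onSec_apply, h]
  cases b
  cases b'
  congr

/-- Every isomorphism of symplectic almost Lie 2-algebroids comes from exactly one isomorphism of
derived pre-Courant algebroids. -/
lemma existsUnique_iso_right (D : DerivedData S P) (D' : DerivedData S' P')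
    (a : SymplecticAlmostLie2Algebroid.Iso S S') :
    ∃! b : PreCourantAlgebroid.Iso P P', Corresponds D D' a b := by
  refine ⟨(D.push a).isoOfSame D', fun s => ?_, fun b hb => ?_⟩
  · rw [DerivedData.isoOfSame_onSec]
    rfl
  · refine PreCourantAlgebroid.Iso.ext fun s => D'.φ.injective <| Subtype.ext ?_
    rw [DerivedData.isoOfSame_onSec, ← hb s]
    rfl

/-- Every isomorphism of derived pre-Courant algebroids comes from exactly one isomorphism of
symplectic almost Lie 2-algebroids. -/
lemma existsUnique_iso_left (D : DerivedData S P) (D' : DerivedData S' P')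
    (b : PreCourantAlgebroid.Iso P P') :
    ∃! a : SymplecticAlmostLie2Algebroid.Iso S S', Corresponds D D' a b := by
  refine ⟨D.isoPoly.trans (D'.pull b).isoPoly.symm, fun s => ?_, fun a ha => D.iso_ext fun e => ?_⟩
  · change ((D'.pull b).isoPoly.map ⊤).symm (D.isoPoly.map ⊤ (D.φ s)) = _
    rw [AlgEquiv.symm_apply_eq, D.isoPoly_φ, ← (D'.pull b).isoPoly_φ]
    rfl
  · rw [ha e]
    change _ = ((D'.pull b).isoPoly.map ⊤).symm (D.isoPoly.map ⊤ (D.φ e))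
    rw [eq_comm, AlgEquiv.symm_apply_eq, D.isoPoly_φ, ← (D'.pull b).isoPoly_φ]
    rfl

end PreCourant

end

/-! ### Vector bundles from local frames -/

noncomputable section

namespace PreCourant

open Filter Topology

variable {d : ℕ} {M : Type u} [TopologicalSpace M] [ChartedSpace (EuclideanSpace ℝ (Fin d)) M]

/-- A family of real vector spaces over `M` with local linear coordinates around every point, the
changes of which are smooth. -/
structure FrameAtlas (d q : ℕ) {M : Type u} [TopologicalSpace M]
    [ChartedSpace (EuclideanSpace ℝ (Fin d)) M] (E : M → Type u) [∀ x, AddCommGroup (E x)]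
    [∀ x, Module ℝ (E x)] where
  U : M → Opens M
  mem : ∀ m, m ∈ U m
  /-- The coordinates of a vector. -/
  c : ∀ _ : M, ∀ x, E x →ₗ[ℝ] (Fin q → ℝ)
  /-- The vector with given coordinates. -/
  e : ∀ _ : M, ∀ x, (Fin q → ℝ) →ₗ[ℝ] E x
  c_e : ∀ m, ∀ x ∈ U m, ∀ v, c m x (e m x v) = v
  e_c : ∀ m, ∀ x ∈ U m, ∀ v, e m x (c m x v) = v
  smooth : ∀ m m' v i,
    ContMDiffOn (𝓡 d) 𝓘(ℝ, ℝ) ∞ (fun x => c m' x (e m x v) i) (U m ∩ U m')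

namespace FrameAtlas

variable {q : ℕ} {E : M → Type u} [∀ x, AddCommGroup (E x)] [∀ x, Module ℝ (E x)]
variable (A : FrameAtlas d q E)

/-- The pretrivialization given by local linear coordinates. -/
def pretrivialization (m : M) : Bundle.Pretrivialization (Fin q → ℝ)
    (Bundle.TotalSpace.proj : Bundle.TotalSpace (Fin q → ℝ) E → M) where
  toFun p := (p.1, A.c m p.1 p.2)
  invFun p := ⟨p.1, A.e m p.1 p.2⟩
  source := Bundle.TotalSpace.proj ⁻¹' (A.U m)
  target := (A.U m : Set M) ×ˢ Set.univ
  map_source' p hp := ⟨hp, trivial⟩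
  map_target' p hp := hp.1
  left_inv' p hp := by
    change (⟨p.1, A.e m p.1 (A.c m p.1 p.2)⟩ : Bundle.TotalSpace (Fin q → ℝ) E) = p
    rw [A.e_c m p.1 hp]
  right_inv' p hp := by
    change (p.1, A.c m p.1 (A.e m p.1 p.2)) = p
    rw [A.c_e m p.1 hp.1]
  open_target := (A.U m).isOpen.prod isOpen_univ
  baseSet := A.U m
  open_baseSet := (A.U m).isOpen
  source_eq := rfl
  target_eq := rfl
  proj_toFun _ _ := rfl

lemma pretrivialization_symm (m : M) {x : M} (hx : x ∈ A.U m) (v : Fin q → ℝ) :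
    (A.pretrivialization m).symm x v = A.e m x v := by
  have h1 := (A.pretrivialization m).apply_mk_symm (b := x) hx v
  have h2 : A.c m x ((A.pretrivialization m).symm x v) = v := congrArg Prod.snd h1
  rw [← A.e_c m x hx ((A.pretrivialization m).symm x v), h2]

/-- The changes of coordinates. -/
def change (m m' : M) (x : M) : (Fin q → ℝ) →L[ℝ] (Fin q → ℝ) :=
  LinearMap.toContinuousLinearMap (A.c m' x ∘ₗ A.e m x)

lemma contMDiffOn_change (m m' : M) : ContMDiffOn (𝓡 d) 𝓘(ℝ, (Fin q → ℝ) →L[ℝ] (Fin q → ℝ)) ∞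
    (A.change m m') (A.U m ∩ A.U m') := by
  let L : (Fin q → Fin q → ℝ) →ₗ[ℝ] (Fin q → ℝ) →L[ℝ] (Fin q → ℝ) :=
    LinearMap.toContinuousLinearMap.toLinearMap ∘ₗ Matrix.toLin'.toLinearMap ∘ₗ
      (Matrix.ofLinearEquiv ℝ).toLinearMap
  have h : ∀ x, A.change m m' x = L fun i j => A.c m' x (A.e m x (Pi.single j 1)) i := fun x =>
    congrArg LinearMap.toContinuousLinearMap
      (Matrix.toLin'_toMatrix' (A.c m' x ∘ₗ A.e m x)).symm
  refine ContMDiffOn.congr ?_ fun x _ => h x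
  exact L.toContinuousLinearMap.contMDiff.comp_contMDiffOn <| contMDiffOn_pi_space.2 fun i =>
    contMDiffOn_pi_space.2 fun j => A.smooth m m' _ i

/-- The topology on a fibre that comes from its coordinates. -/
abbrev topFib (x : M) : TopologicalSpace (E x) := .induced (A.c x x) inferInstance

/-- The prebundle of a family of vector spaces with smooth changes of coordinates. -/
def prebundle : letI := A.topFib; VectorPrebundle ℝ (Fin q → ℝ) E :=
  letI := A.topFib
  { pretrivializationAtlas := Set.range A.pretrivialization
    pretrivialization_linear' := by
      rintro _ ⟨m, rfl⟩
      exact ⟨fun b _ => (A.c m b).isLinear⟩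
    pretrivializationAt := A.pretrivialization
    mem_base_pretrivializationAt := A.mem
    pretrivialization_mem_atlas := fun m => ⟨m, rfl⟩
    exists_coordChange := by
      rintro _ ⟨m, rfl⟩ _ ⟨m', rfl⟩
      exact ⟨A.change m m', (A.contMDiffOn_change m m').continuousOn, fun b hb v => by
        rw [A.pretrivialization_symm m hb.1]
        rfl⟩
    totalSpaceMk_isInducing := fun b => isInducing_const_prod.2 ⟨rfl⟩ }

lemma isContMDiff : letI := A.topFib; A.prebundle.IsContMDiff (𝓡 d) ∞ :=
  letI := A.topFib
  ⟨by
    rintro _ ⟨m, rfl⟩ _ ⟨m', rfl⟩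
    exact ⟨A.change m m', A.contMDiffOn_change m m', fun b hb v => by
      rw [A.pretrivialization_symm m hb.1]
      rfl⟩⟩

/-- The vector bundle of a family of vector spaces with smooth changes of coordinates. -/
def vBundle : VBundle d M :=
  letI := A.topFib
  letI := A.prebundle.totalSpaceTopology
  letI := A.prebundle.toFiberBundle
  haveI := A.prebundle.toVectorBundle
  haveI := A.isContMDiff
  haveI := A.prebundle.contMDiffVectorBundle (n := ∞) (𝓡 d)
  { rank := q
    fib := E }

lemma contMDiff_iff {s : ∀ x, A.vBundle.fib x} :
    ContMDiff (𝓡 d) ((𝓡 d).prod 𝓘(ℝ, Fin A.vBundle.rank → ℝ)) ∞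
      (fun x => Bundle.TotalSpace.mk' (Fin A.vBundle.rank → ℝ) x (s x)) ↔
    ∀ m i, ContMDiffAt (𝓡 d) 𝓘(ℝ, ℝ) ∞ (fun x => A.c m x (s x) i) m := by
  refine forall_congr' fun m => ?_
  exact (Bundle.contMDiffAt_section m).trans contMDiffAt_pi_space

lemma contMDiffOn_coord (s : A.vBundle.Sec) (m : M) (i : Fin q) :
    ContMDiffOn (𝓡 d) 𝓘(ℝ, ℝ) ∞ (fun x => A.c m x (s x) i) (A.U m) := by
  let t := trivializationAt (Fin A.vBundle.rank → ℝ) A.vBundle.fib m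
  have h : ContMDiffOn (𝓡 d) 𝓘(ℝ, Fin A.vBundle.rank → ℝ) ∞ (fun x => (t ⟨x, s x⟩).2) t.baseSet :=
    (t.contMDiffOn_section_baseSet_iff).1 s.contMDiff.contMDiffOn
  exact contMDiffOn_pi_space.1 h i

end FrameAtlas

end PreCourant

end

/-! ### The pre-Courant algebroid derived from a symplectic almost Lie 2-algebroid -/

noncomputable section

namespace PreCourant

open Filter Topology VBundle

variable {d : ℕ} {M : Type u} [TopologicalSpace M] [ChartedSpace (EuclideanSpace ℝ (Fin d)) M]

namespace SymplecticAlmostLie2Algebroid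

variable (S : SymplecticAlmostLie2Algebroid d M)

/-- The global functions of weight one. -/
abbrev Odd : Submodule ℝ (S.A ⊤) := S.deg ⊤ 1

variable {S}

lemma fn_mem (f : Fn d M) : S.fn f ∈ S.deg ⊤ 0 := NManifold.base_mem _

lemma bracket_odd_mem (a b : S.Odd) : S.bracket ⊤ a b ∈ S.deg ⊤ 0 :=
  S.bracket_deg ⊤ 1 1 0 rfl _ a.2 _ b.2

lemma bracket_odd_fn (a : S.Odd) (f : Fn d M) : S.bracket ⊤ a (S.fn f) = 0 :=
  S.bracket_low ⊤ 1 0 (by simp) _ a.2 _ (fn_mem f)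

lemma bracket_odd_comm (a b : S.Odd) : S.bracket ⊤ (a : S.A ⊤) b = S.bracket ⊤ (b : S.A ⊤) a := by
  rw [S.bracket_antisymm ⊤ 1 1 _ a.2 _ b.2]
  simp

variable (S) in
/-- The pairing `{a, b}` of functions of weight one at a point of `M`. -/
def form (x : M) : S.Odd →ₗ[ℝ] S.Odd →ₗ[ℝ] ℝ :=
  LinearMap.mk₂ ℝ (fun a b => S.val ⊤ (S.bracket ⊤ a b) ⟨x, trivial⟩)
    (fun a b c => by simp only [Submodule.coe_add, map_add, LinearMap.add_apply]; rfl)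
    (fun r a b => by
      simp only [Submodule.coe_smul, map_smul, LinearMap.smul_apply, NManifold.val_smul]; rfl)
    (fun a b c => by simp only [Submodule.coe_add, map_add]; rfl)
    (fun r a b => by simp only [Submodule.coe_smul, map_smul, NManifold.val_smul]; rfl)

lemma form_apply (x : M) (a b : S.Odd) :
    S.form x a b = S.val ⊤ (S.bracket ⊤ a b) ⟨x, trivial⟩ := rfl

lemma form_comm (x : M) (a b : S.Odd) : S.form x a b = S.form x b a := by
  rw [form_apply, bracket_odd_comm, form_apply]

lemma contMDiff_form (a b : S.Odd) :
    ContMDiff (𝓡 d) 𝓘(ℝ, ℝ) ∞ fun x => S.form x a b := fun x =>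
  (contMDiffAt_subtype_iff (U := (⊤ : Opens M)) (x := ⟨x, trivial⟩)
    (f := fun x => S.form x a b)).1 ((S.val ⊤ (S.bracket ⊤ (a : S.A ⊤) b)).contMDiff ⟨x, trivial⟩)

/-- The smooth function `{a, b}`. -/
def formFn (a b : S.Odd) : Fn d M := ⟨fun x => S.form x a b, contMDiff_form a b⟩

lemma fn_formFn (a b : S.Odd) : S.fn (formFn a b) = S.bracket ⊤ (a : S.A ⊤) b :=
  NManifold.base_val_of_mem (bracket_odd_mem a b)

lemma form_res {U : Opens M} {x : M} (hx : x ∈ U) (a b : S.Odd) : S.form x a b =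
    S.val U (S.bracket U (S.res le_top a) (S.res le_top b)) ⟨x, hx⟩ := by
  rw [← S.bracket_res, NManifold.val_res]
  rfl

/-- The product of a smooth function and a function of weight one. -/
def fnMul (f : Fn d M) (a : S.Odd) : S.Odd := ⟨S.fn f * a, NManifold.base_mul_mem _ a.2⟩

lemma form_fnMul (x : M) (f : Fn d M) (a b : S.Odd) :
    S.form x (fnMul f a) b = f x * S.form x a b := by
  have h : S.bracket ⊤ (S.fn f * a) b = S.fn f * S.bracket ⊤ (a : S.A ⊤) b := by
    rw [NManifold.fn, SymplecticNManifold.bracket_base_mul _ a.2,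
      S.bracket_low ⊤ 0 1 (by simp) _ (NManifold.base_mem _) _ b.2, mul_zero, add_zero]
  rw [form_apply, form_apply]
  change S.val ⊤ (S.bracket ⊤ (S.fn f * a) b) _ = _
  rw [h, map_mul, NManifold.fn, NManifold.val_base]
  rfl

/-! #### Identities for the potential -/

variable (S) in
/-- The function `{Θ, f}` of weight one. -/
def diff (f : Fn d M) : S.Odd :=
  ⟨S.bracket ⊤ S.Θ (S.fn f), S.bracket_deg ⊤ 3 0 1 rfl _ S.Θ_deg _ (fn_mem f)⟩

variable (S) in
/-- The function `{Θ, a}` of weight two. -/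
def ham (a : S.Odd) : S.A ⊤ := S.bracket ⊤ S.Θ a

lemma ham_mem (a : S.Odd) : S.ham a ∈ S.deg ⊤ 2 := S.bracket_deg ⊤ 3 1 2 rfl _ S.Θ_deg _ a.2

variable (S) in
/-- The derived bracket `-{{Θ, a}, b}`. -/
def der (a b : S.Odd) : S.Odd :=
  ⟨-S.bracket ⊤ (S.ham a) b, (S.deg ⊤ 1).neg_mem (S.bracket_deg ⊤ 2 1 1 rfl _ (ham_mem a) _ b.2)⟩

lemma ham_fn (a : S.Odd) (f : Fn d M) :
    S.bracket ⊤ (S.ham a) (S.fn f) = S.bracket ⊤ a (S.diff f) := by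
  have h := S.bracket_jacobi ⊤ 3 1 _ S.Θ_deg _ a.2 (S.fn f)
  rw [bracket_odd_fn, map_zero] at h
  have h' : S.bracket ⊤ (S.ham a) (S.fn f) + -S.bracket ⊤ (a : S.A ⊤) (S.diff f) = 0 := by
    rw [h]
    simp [ham, diff, pow_succ]
  exact add_neg_eq_zero.1 h'

lemma diff_add (f g : Fn d M) : S.diff (f + g) = S.diff f + S.diff g := Subtype.ext <| by
  change S.bracket ⊤ S.Θ (S.base ⊤ (f.toOpen ⊤ + g.toOpen ⊤)) = _
  rw [map_add, map_add]
  rfl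

lemma diff_mul (f g : Fn d M) : S.diff (f * g) = fnMul f (S.diff g) + fnMul g (S.diff f) :=
  Subtype.ext <| by
    change S.bracket ⊤ S.Θ (S.base ⊤ (f.toOpen ⊤ * g.toOpen ⊤)) = _
    rw [map_mul, S.bracket_leibniz ⊤ 3 0 _ S.Θ_deg _ (NManifold.base_mem _), mul_zero, pow_zero,
      one_mul, ← NManifold.base_comm, add_comm]
    rfl

lemma diff_const (r : ℝ) : S.diff (algebraMap ℝ (Fn d M) r) = 0 := Subtype.ext <| by
  change S.bracket ⊤ S.Θ (S.base ⊤ (algebraMap ℝ _ r)) = 0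
  rw [AlgHom.commutes, Algebra.algebraMap_eq_smul_one, map_smul,
    SymplecticNManifold.bracket_one, smul_zero]

lemma two_nsmul_eq_zero {a : S.A ⊤} (h : a = -a) : a = 0 := by
  have h2 : (2 : ℝ) • a = 0 := by
    rw [two_smul]
    nth_rw 1 [h]
    exact neg_add_cancel a
  exact (smul_eq_zero.1 h2).resolve_left two_ne_zero

/-- `{Θ, {Θ, f}}` is half of `{{Θ, Θ}, f}`. -/
lemma bracket_Θ_diff (f : Fn d M) : S.bracket ⊤ S.Θ (S.diff f) = 0 := by
  have h := S.bracket_jacobi ⊤ 3 3 _ S.Θ_deg _ S.Θ_deg (S.fn f)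
  rw [S.Θ_almost] at h
  refine two_nsmul_eq_zero (h.trans ?_)
  simp [diff, pow_succ]

lemma bracket_diff_diff (f g : Fn d M) :
    S.bracket ⊤ (S.diff f : S.A ⊤) (S.diff g) = 0 := by
  rw [← ham_fn, ham, bracket_Θ_diff, map_zero, LinearMap.zero_apply]

lemma bracket_ham_ham_fn (a b : S.Odd) (f : Fn d M) :
    S.bracket ⊤ (S.bracket ⊤ (S.ham a) (S.ham b)) (S.fn f) =
      S.bracket ⊤ (S.ham a) (S.bracket ⊤ (S.ham b) (S.fn f)) -
        S.bracket ⊤ (S.ham b) (S.bracket ⊤ (S.ham a) (S.fn f)) := by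
  rw [S.bracket_jacobi ⊤ 2 2 _ (ham_mem a) _ (ham_mem b)]
  simp [pow_succ]

/-- The failure of `{Θ, Θ}` to vanish, which enters through `{Θ, {Θ, a}}`, does not affect functions
on `M`. -/
lemma bracket_bracket_Θ_ham_fn (a b : S.Odd) (f : Fn d M) :
    S.bracket ⊤ (S.bracket ⊤ (S.bracket ⊤ S.Θ (S.ham a)) b) (S.fn f) = 0 := by
  have hT : S.bracket ⊤ S.Θ S.Θ ∈ S.deg ⊤ 4 := S.bracket_deg ⊤ 3 3 4 rfl _ S.Θ_deg _ S.Θ_deg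
  have hH : S.bracket ⊤ S.Θ (S.ham a) ∈ S.deg ⊤ 3 :=
    S.bracket_deg ⊤ 3 2 3 rfl _ S.Θ_deg _ (ham_mem a)
  have h1 : (2 : ℝ) • S.bracket ⊤ S.Θ (S.ham a) = S.bracket ⊤ (S.bracket ⊤ S.Θ S.Θ) a := by
    have h := S.bracket_jacobi ⊤ 3 3 _ S.Θ_deg _ S.Θ_deg a
    rw [two_smul]
    nth_rw 1 [ham, h]
    simp [ham, pow_succ]
  have h2 : S.bracket ⊤ (S.bracket ⊤ S.Θ (S.ham a)) (S.fn f) = 0 := by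
    have h := S.bracket_jacobi ⊤ 4 1 _ hT _ a.2 (S.fn f)
    rw [bracket_odd_fn, S.Θ_almost, map_zero, map_zero, mul_zero, add_zero, ← h1, map_smul,
      LinearMap.smul_apply] at h
    exact (smul_eq_zero.1 h.symm).resolve_left two_ne_zero
  have h := S.bracket_jacobi ⊤ 3 1 _ hH _ b.2 (S.fn f)
  rw [bracket_odd_fn, h2, map_zero, map_zero, mul_zero, add_zero] at h
  exact h.symm

lemma ham_der_fn (a b : S.Odd) (f : Fn d M) : S.bracket ⊤ (S.ham (S.der a b)) (S.fn f) =
    -(S.bracket ⊤ (S.ham a) (S.bracket ⊤ (S.ham b) (S.fn f)) -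
      S.bracket ⊤ (S.ham b) (S.bracket ⊤ (S.ham a) (S.fn f))) := by
  have h : S.ham (S.der a b) = -(S.bracket ⊤ (S.bracket ⊤ S.Θ (S.ham a)) b +
      S.bracket ⊤ (S.ham a) (S.ham b)) := by
    rw [ham, der, map_neg, S.bracket_jacobi ⊤ 3 2 _ S.Θ_deg _ (ham_mem a)]
    simp [ham, pow_succ]
  rw [h, map_neg, map_add, LinearMap.neg_apply, LinearMap.add_apply, bracket_bracket_Θ_ham_fn,
    zero_add, bracket_ham_ham_fn]

lemma der_add_der (a b : S.Odd) : S.der a b + S.der b a = -S.diff (formFn a b) :=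
  Subtype.ext <| by
    change -S.bracket ⊤ (S.ham a) b + -S.bracket ⊤ (S.ham b) a =
      -S.bracket ⊤ S.Θ (S.fn (formFn a b))
    rw [fn_formFn, S.bracket_jacobi ⊤ 3 1 _ S.Θ_deg _ a.2,
      S.bracket_antisymm ⊤ 1 2 _ a.2 (S.bracket ⊤ S.Θ b) (ham_mem b)]
    simp [ham, pow_succ]
    abel

lemma ham_formFn (a b c : S.Odd) : -S.bracket ⊤ (S.ham a) (S.fn (formFn b c)) =
    S.bracket ⊤ (S.der a b : S.A ⊤) c + S.bracket ⊤ (b : S.A ⊤) (S.der a c) := by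
  rw [fn_formFn, S.bracket_jacobi ⊤ 2 1 _ (ham_mem a) _ b.2]
  simp [der, pow_succ]
  abel

end SymplecticAlmostLie2Algebroid

end PreCourant

end

noncomputable section

namespace PreCourant

open Filter Topology VBundle

variable {d : ℕ} {M : Type u} [TopologicalSpace M] [ChartedSpace (EuclideanSpace ℝ (Fin d)) M]
variable [T2Space M] [IsManifold (𝓡 d) ∞ M]

namespace SymplecticAlmostLie2Algebroid

variable {S : SymplecticAlmostLie2Algebroid d M}

/-- Around every point there are global functions of weight one that restrict to coordinates of
weight one, together with the inverse of the matrix of their brackets. -/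
structure OddFrame (S : SymplecticAlmostLie2Algebroid d M) (m : M) where
  U : Opens M
  mem : m ∈ U
  e : Fin S.q → S.Odd
  G' : Matrix (Fin S.q) (Fin S.q) (Fn d U)
  G'_mul : ∀ (x : U) i k, ∑ j, G' i j x * S.form x.1 (e j) (e k) = if i = k then 1 else 0
  span : ∀ V : Opens M, V ≤ U → ∀ a ∈ S.deg V 1, ∃ f : Fin S.q → Fn d V,
    a = ∑ i, S.base V (f i) * S.res le_top (e i)

lemma exists_oddFrame (m : M) : Nonempty (OddFrame S m) := by
  obtain ⟨U, z, hz⟩ := S.bracket_nondeg m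
  obtain ⟨G', -, hG, -, -⟩ := SymplecticNManifold.exists_inverse z hz
  choose e he W hW hm hres using fun i => NManifold.exists_extension (z.ξ_deg i) z.mem
  let O : Opens M := ⟨⋂ i, (W i : Set M), isOpen_iInter_of_finite fun i => (W i).isOpen⟩ ⊓ U
  have hOW : ∀ i, O ≤ W i := fun i x hx => Set.mem_iInter.1 hx.1 i
  have hOU : O ≤ U := inf_le_right
  have hres' : ∀ i, S.res (le_top : O ≤ ⊤) (e i) = S.res hOU (z.ξ i) := fun i => by
    rw [← S.res_res (hOW i) le_top, hres, S.res_res]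
  refine ⟨⟨O, ⟨Set.mem_iInter.2 hm, z.mem⟩, fun i => ⟨e i, he i⟩,
    Matrix.of fun i j => (G' i j).res hOU, fun x i k => ?_, fun V h a ha => ?_⟩⟩
  · have h1 := congrArg (fun f : Fn d U => f (Set.inclusion hOU x)) (congrFun (congrFun hG i) k)
    simp only [Matrix.mul_apply, Fn.sum_apply, Matrix.one_apply] at h1
    have h2 : ∀ j, S.form x.1 ⟨e j, he j⟩ ⟨e k, he k⟩ =
        S.val U (S.bracket U (z.ξ j) (z.ξ k)) (Set.inclusion hOU x) := fun j => by
      rw [form_res x.2]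
      change S.val O (S.bracket O (S.res le_top (e j)) (S.res le_top (e k))) x = _
      rw [hres', hres', ← S.bracket_res, NManifold.val_res]
      rfl
    simp only [h2]
    refine Eq.trans ?_ (h1.trans ?_)
    · rfl
    · split_ifs <;> rfl
  · obtain ⟨c, hc⟩ := z.span (h.trans hOU) ha
    refine ⟨c, hc.trans (Finset.sum_congr rfl fun i _ => ?_)⟩
    rw [← S.res_res h hOU, ← hres', S.res_res]

namespace OddFrame

variable {m : M} (F : OddFrame S m)

/-- The coefficients of a function of weight one at a point, with respect to a frame. -/
def coeff (x : M) : S.Odd →ₗ[ℝ] (Fin S.q → ℝ) :=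
  LinearMap.pi fun i => ∑ j, extZero (F.G' i j) x • (S.form x).flip (F.e j)

lemma coeff_apply (x : M) (a : S.Odd) (i : Fin S.q) :
    F.coeff x a i = ∑ j, extZero (F.G' i j) x * S.form x a (F.e j) := by
  simp [coeff]

lemma contMDiffOn_coeff (a : S.Odd) (i : Fin S.q) :
    ContMDiffOn (𝓡 d) 𝓘(ℝ, ℝ) ∞ (fun x => F.coeff x a i) F.U := by
  simp only [coeff_apply]
  refine contMDiffOn_finsetSum fun j _ => ContMDiffOn.mul ?_ (contMDiff_form a _).contMDiffOn
  intro x hx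
  refine ContMDiffAt.contMDiffWithinAt ?_
  refine (contMDiffAt_subtype_iff (U := F.U) (x := ⟨x, hx⟩) (f := extZero (F.G' i j))).1 ?_
  refine ((F.G' i j).contMDiff ⟨x, hx⟩).congr_of_eventuallyEq (Eventually.of_forall fun y => ?_)
  exact extZero_of_mem _ y.2

lemma coeff_sum {x : M} (hx : x ∈ F.U) (v : Fin S.q → ℝ) {a : S.Odd}
    (h : ∀ b, S.form x a b = ∑ k, v k * S.form x (F.e k) b) : F.coeff x a = v := by
  funext i
  rw [coeff_apply]
  simp only [h, extZero_of_mem _ hx, Finset.mul_sum]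
  rw [Finset.sum_comm]
  have h1 := fun k => F.G'_mul ⟨x, hx⟩ i k
  calc ∑ k, ∑ j, F.G' i j ⟨x, hx⟩ * (v k * S.form x (F.e k) (F.e j))
      = ∑ k, v k * ∑ j, F.G' i j ⟨x, hx⟩ * S.form x (F.e j) (F.e k) :=
        Finset.sum_congr rfl fun k _ => by
          rw [Finset.mul_sum]
          exact Finset.sum_congr rfl fun j _ => by rw [form_comm x (F.e k)]; ring
    _ = v i := by simp [h1]

lemma val_bracket_sum {V : Opens M} (x : V) (f : Fin S.q → Fn d V) (b : S.Odd) :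
    S.val V (S.bracket V (∑ i, S.base V (f i) * S.res le_top (F.e i)) (S.res le_top b)) x =
      ∑ i, f i x * S.form x.1 (F.e i) b := by
  rw [map_sum, LinearMap.sum_apply, map_sum, Fn.sum_apply]
  refine Finset.sum_congr rfl fun i _ => ?_
  rw [SymplecticNManifold.bracket_base_mul _ (S.res_deg _ _ _ (F.e i).2),
    S.bracket_low V 0 1 (by simp) _ (NManifold.base_mem _) _ (S.res_deg _ _ _ b.2), mul_zero,
    add_zero, map_mul, NManifold.val_base, form_res x.2]
  rfl

lemma form_eq_sum {x : M} (hx : x ∈ F.U) (a b : S.Odd) :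
    S.form x a b = ∑ i, F.coeff x a i * S.form x (F.e i) b := by
  obtain ⟨f, hf⟩ := F.span F.U le_rfl _ (S.res_deg le_top 1 _ a.2)
  have h : ∀ b, S.form x a b = ∑ i, f i ⟨x, hx⟩ * S.form x (F.e i) b := fun b => by
    rw [form_res hx, hf, F.val_bracket_sum]
  rw [F.coeff_sum hx (fun i => f i ⟨x, hx⟩) h, h]

end OddFrame

/-- A function of weight one is zero if its brackets with functions of weight one vanish. -/
lemma eq_zero_of_bracket {V : Opens M} {a : S.A V} (ha : a ∈ S.deg V 1)
    (h : ∀ (b : S.Odd) (x : V), S.val V (S.bracket V a (S.res le_top b)) x = 0) : a = 0 := by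
  refine NManifold.eq_of_cover fun x hx => ?_
  obtain ⟨F⟩ := exists_oddFrame (S := S) x
  refine ⟨V ⊓ F.U, inf_le_left, ⟨hx, F.mem⟩, ?_⟩
  obtain ⟨f, hf⟩ := F.span (V ⊓ F.U) inf_le_right _ (S.res_deg inf_le_left 1 a ha)
  have h1 : ∀ i, f i = 0 := fun i => Fn.ext fun y => by
    have h2 : ∀ b, S.form y.1 0 b = ∑ i, f i y * S.form y.1 (F.e i) b := fun b => by
      rw [← F.val_bracket_sum y f b, ← hf, map_zero, LinearMap.zero_apply,
        ← S.res_res inf_le_left le_top, ← S.bracket_res, NManifold.val_res]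
      exact (h b _).symm
    have h3 := congrFun (F.coeff_sum y.2.2 (fun i => f i y) h2) i
    rw [map_zero] at h3
    exact h3.symm
  rw [map_zero, hf]
  exact Finset.sum_eq_zero fun i _ => by rw [h1, map_zero, zero_mul]

/-! #### The vector bundle -/

variable (S) in
/-- The fibre at `x`: functions of weight one modulo those whose brackets with all functions of
weight one vanish at `x`. -/
abbrev Fib (x : M) : Type u := S.Odd ⧸ LinearMap.ker (S.form x)

variable (S) in
/-- The value of a function of weight one at a point. -/
def ev (x : M) : S.Odd →ₗ[ℝ] S.Fib x := (LinearMap.ker (S.form x)).mkQ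

lemma ev_surjective (x : M) : Function.Surjective (S.ev x) := Submodule.mkQ_surjective _

lemma ev_eq_iff {x : M} {a b : S.Odd} : S.ev x a = S.ev x b ↔ ∀ c, S.form x a c = S.form x b c := by
  rw [ev, Submodule.mkQ_apply, Submodule.mkQ_apply, Submodule.Quotient.eq, LinearMap.mem_ker,
    map_sub, sub_eq_zero, LinearMap.ext_iff]

lemma OddFrame.ker_le {m : M} (F : OddFrame S m) (x : M) :
    LinearMap.ker (S.form x) ≤ LinearMap.ker (F.coeff x) := fun a ha => by
  rw [LinearMap.mem_ker] at ha ⊢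
  funext i
  rw [F.coeff_apply]
  simp [ha]

variable (S) in
/-- A choice of frames. -/
def frame (m : M) : OddFrame S m := (exists_oddFrame m).some

variable (S) in
/-- The local coordinates on the fibres given by the frames. -/
def atlas : FrameAtlas d S.q S.Fib where
  U m := (S.frame m).U
  mem m := (S.frame m).mem
  c m x := (LinearMap.ker (S.form x)).liftQ ((S.frame m).coeff x) ((S.frame m).ker_le x)
  e m x := S.ev x ∘ₗ Fintype.linearCombination ℝ (S.frame m).e
  c_e m x hx v := (S.frame m).coeff_sum hx v fun b => by
    simp [Fintype.linearCombination_apply]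
  e_c m x hx v := by
    obtain ⟨a, rfl⟩ := ev_surjective x v
    refine ev_eq_iff.2 fun b => ?_
    rw [(S.frame m).form_eq_sum hx a b]
    simp [Fintype.linearCombination_apply, ev]
  smooth m m' v i := ((S.frame m').contMDiffOn_coeff _ i).mono Set.inter_subset_right

variable (S) in
/-- The vector bundle whose sections are the functions of weight one. -/
def bundle : VBundle d M := S.atlas.vBundle

/-- A function of weight one as a section. -/
def toSec (a : S.Odd) : S.bundle.Sec :=
  ⟨fun x => S.ev x a, S.atlas.contMDiff_iff.2 fun m i =>
    ((S.frame m).contMDiffOn_coeff a i).contMDiffAt ((S.frame m).U.isOpen.mem_nhds (S.frame m).mem)⟩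

lemma toSec_injective : Function.Injective (toSec : S.Odd → S.bundle.Sec) := fun a b h => by
  have h1 : ∀ x c, S.form x a c = S.form x b c := fun x =>
    ev_eq_iff.1 (congrArg (fun s : S.bundle.Sec => s x) h)
  refine sub_eq_zero.1 (Subtype.ext (eq_zero_of_bracket (a - b).2 fun c x => ?_))
  have h2 := S.res_self ⊤ (c : S.A ⊤)
  have h3 : S.form x.1 (a - b) c = 0 := by
    rw [map_sub, LinearMap.sub_apply, h1, sub_self]
  rw [h2]
  exact h3

lemma toSec_surjective : Function.Surjective (toSec : S.Odd → S.bundle.Sec) := by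
  intro s
  have hloc : ∀ m : M, ∃ (W : Opens M) (a : S.Odd), m ∈ W ∧ ∀ y ∈ W, S.ev y a = s y := by
    intro m
    let F := S.frame m
    have hs : ∀ i, ContMDiffOn (𝓡 d) 𝓘(ℝ, ℝ) ∞ (fun x => S.atlas.c m x (s x) i) F.U :=
      fun i => S.atlas.contMDiffOn_coord s m i
    choose f hf using fun i => exists_fn_eventuallyEq (d := d) F.U.isOpen F.mem (hs i)
    obtain ⟨O, hO, hOo, hmO⟩ := eventually_nhds_iff.1 (eventually_all.2 hf)
    refine ⟨⟨O, hOo⟩ ⊓ F.U, ∑ i, fnMul (f i) (F.e i), ⟨hmO, F.mem⟩, fun y hy => ?_⟩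
    rw [← S.atlas.e_c m y hy.2 (s y)]
    refine ev_eq_iff.2 fun b => ?_
    rw [map_sum, LinearMap.sum_apply, Fintype.linearCombination_apply, map_sum,
      LinearMap.sum_apply]
    refine Finset.sum_congr rfl fun i _ => ?_
    rw [form_fnMul, hO y hy.1 i, map_smul]
    rfl
  choose W a hm ha using hloc
  obtain ⟨t, ⟨ht, htr⟩, -⟩ := S.glue ⊤ W (fun _ => le_top) (fun x _ => Opens.mem_iSup.2 ⟨x, hm x⟩) 1
    (fun i => S.res le_top (a i)) (fun i => S.res_deg _ _ _ (a i).2) (fun i j => by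
      rw [S.res_res, S.res_res, ← sub_eq_zero, ← map_sub]
      refine eq_zero_of_bracket (S.res_deg _ _ _ (a i - a j).2) fun b x => ?_
      have h1 : S.form x.1 (a i) b = S.form x.1 (a j) b :=
        ev_eq_iff.1 ((ha i x.1 x.2.1).trans (ha j x.1 x.2.2).symm) b
      have h2 := form_res x.2 (a i - a j) b
      rw [map_sub, LinearMap.sub_apply, h1, sub_self] at h2
      exact h2.symm)
  refine ⟨⟨t, ht⟩, Sec.ext fun x => (ev_eq_iff.2 fun b => ?_).trans (ha x x (hm x))⟩
  rw [form_res (hm x), form_res (hm x), htr]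

end SymplecticAlmostLie2Algebroid

end PreCourant

end

noncomputable section

namespace PreCourant

open Filter Topology VBundle

variable {d : ℕ} {M : Type u} [TopologicalSpace M] [ChartedSpace (EuclideanSpace ℝ (Fin d)) M]
variable [T2Space M] [IsManifold (𝓡 d) ∞ M]

namespace SymplecticAlmostLie2Algebroid

variable {S : SymplecticAlmostLie2Algebroid d M}

/-! #### Metric, anchor and pre-bracket -/

variable (S) in
/-- The metric on the fibres. -/
def metric (x : M) : S.Fib x →ₗ[ℝ] S.Fib x →ₗ[ℝ] ℝ :=
  (LinearMap.ker (S.form x)).liftQ ((LinearMap.ker (S.form x)).liftQ (S.form x) le_rfl).flip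
    fun a ha => LinearMap.ext fun v => by
      obtain ⟨b, rfl⟩ := ev_surjective x v
      change S.form x b a = 0
      rw [form_comm, LinearMap.mem_ker.1 ha, LinearMap.zero_apply]

lemma metric_ev (x : M) (a b : S.Odd) : S.metric x (S.ev x a) (S.ev x b) = S.form x a b :=
  form_comm x b a

lemma isDer_diff (x : M) (a : S.Odd) : IsDer x fun f => -S.form x a (S.diff f) where
  add f g := by rw [diff_add, map_add, neg_add]
  mul f g := by
    rw [diff_mul, map_add, form_comm x a (fnMul f _), form_comm x a (fnMul g _), form_fnMul,
      form_fnMul, form_comm x _ a, form_comm x _ a]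
    ring
  const r := by rw [diff_const, map_zero, neg_zero]

variable (S) in
/-- The value at `x` of the vector field `f ↦ -{a, {Θ, f}}`. -/
def anchorVec (x : M) (a : S.Odd) : TangentSpace (𝓡 d) x := (isDer_diff x a).exists_vec.choose

lemma mvfderiv_anchorVec (x : M) (a : S.Odd) (f : Fn d M) :
    mvfderiv (𝓡 d) f x (S.anchorVec x a) = -S.form x a (S.diff f) :=
  (isDer_diff x a).exists_vec.choose_spec f

variable (S) in
/-- The anchor on functions of weight one: `a` acts on `f` by `-{a, {Θ, f}}`. -/
def anchorOdd (x : M) : S.Odd →ₗ[ℝ] TangentSpace (𝓡 d) x where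
  toFun := S.anchorVec x
  map_add' a b := tangent_ext fun f => by
    rw [map_add, mvfderiv_anchorVec, mvfderiv_anchorVec, mvfderiv_anchorVec, map_add,
      LinearMap.add_apply, neg_add]
  map_smul' r a := tangent_ext fun f => by
    rw [RingHom.id_apply, map_smul, mvfderiv_anchorVec, mvfderiv_anchorVec, map_smul,
      LinearMap.smul_apply, smul_neg]

lemma mvfderiv_anchorOdd (x : M) (a : S.Odd) (f : Fn d M) :
    mvfderiv (𝓡 d) f x (S.anchorOdd x a) = -S.form x a (S.diff f) := mvfderiv_anchorVec x a f

variable (S) in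
/-- The anchor on the fibres. -/
def anchor (x : M) : S.Fib x →ₗ[ℝ] TangentSpace (𝓡 d) x :=
  (LinearMap.ker (S.form x)).liftQ (S.anchorOdd x) fun a ha => tangent_ext fun f => by
    rw [mvfderiv_anchorOdd, LinearMap.mem_ker.1 ha, LinearMap.zero_apply, neg_zero, map_zero]

lemma mvfderiv_anchor (x : M) (a : S.Odd) (f : Fn d M) :
    mvfderiv (𝓡 d) f x (S.anchor x (S.ev x a)) = -S.form x a (S.diff f) :=
  mvfderiv_anchorOdd x a f

/-- A vector orthogonal to the kernel of the anchor is the value of some `{Θ, f}`, and these lie in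
the kernel. -/
lemma anchor_coisotropic (x : M) (v : S.Fib x)
    (h : ∀ w, S.anchor x w = 0 → S.metric x v w = 0) : S.anchor x v = 0 := by
  have h1 : S.metric x v ∈ LinearMap.range (S.anchor x).dualMap := by
    rw [LinearMap.range_dualMap_eq_dualAnnihilator_ker, Submodule.mem_dualAnnihilator]
    exact h
  obtain ⟨l, hl⟩ := h1
  obtain ⟨f, hf⟩ := exists_differential (d := d) l
  obtain ⟨a, rfl⟩ := ev_surjective x v
  have h2 : S.ev x a = S.ev x (-S.diff f) := ev_eq_iff.2 fun b => by
    rw [← metric_ev, ← hl, LinearMap.dualMap_apply, ← hf, mvfderiv_anchor, map_neg,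
      LinearMap.neg_apply, form_comm]
  refine tangent_ext fun g => ?_
  rw [h2, mvfderiv_anchor, map_neg, LinearMap.neg_apply, form_apply, bracket_diff_diff]
  simp

lemma fn_injective : Function.Injective S.fn := fun _ _ h => Fn.ext fun x =>
  congrArg (fun k : Fn d (⊤ : Opens M) => k ⟨x, trivial⟩) (S.base_injective ⊤ h)

/-- The derivative of a function along the anchor of a function of weight one. -/
def actFn (a : S.Odd) (f : Fn d M) : Fn d M := -formFn a (S.diff f)

lemma mvfderiv_anchor_eq (x : M) (a : S.Odd) (f : Fn d M) :
    mvfderiv (𝓡 d) f x (S.anchor x (S.ev x a)) = actFn a f x := mvfderiv_anchor x a f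

lemma fn_actFn (a : S.Odd) (f : Fn d M) :
    S.fn (actFn a f) = -S.bracket ⊤ (S.ham a) (S.fn f) := by
  rw [ham_fn, ← fn_formFn]
  exact map_neg (S.base ⊤) _

lemma actFn_der (a b : S.Odd) (f : Fn d M) :
    actFn (S.der a b) f = actFn a (actFn b f) - actFn b (actFn a f) := fn_injective <| by
  have : S.fn (actFn a (actFn b f) - actFn b (actFn a f)) =
    S.fn (actFn a (actFn b f)) - S.fn (actFn b (actFn a f)) :=
      map_sub (S.base ⊤) ((actFn a (actFn b f)).toOpen ⊤) ((actFn b (actFn a f)).toOpen ⊤)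
  rw [this, fn_actFn, fn_actFn, fn_actFn, fn_actFn, fn_actFn, ham_der_fn, map_neg, map_neg]
  abel

lemma actFn_formFn (a b c : S.Odd) :
    actFn a (formFn b c) = formFn (S.der a b) c + formFn b (S.der a c) := fn_injective <| by
  rw [fn_actFn, ham_formFn, ← fn_formFn, ← fn_formFn]
  exact (map_add (S.base ⊤) _ _).symm

variable (S) in
/-- Functions of weight one are the sections of the bundle. -/
def secEquiv : S.Odd ≃ S.bundle.Sec := Equiv.ofBijective toSec ⟨toSec_injective, toSec_surjective⟩

lemma secEquiv_apply (a : S.Odd) (x : M) : S.secEquiv a x = S.ev x a := rfl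

lemma ev_symm (s : S.bundle.Sec) (x : M) : S.ev x (S.secEquiv.symm s) = s x := by
  rw [← secEquiv_apply, Equiv.apply_symm_apply]

lemma metric_eq_formFn (s t : S.bundle.Sec) (x : M) : S.metric x (s x) (t x) =
    formFn (S.secEquiv.symm s) (S.secEquiv.symm t) x := by
  rw [← ev_symm s, ← ev_symm t]
  exact metric_ev _ _ _

lemma anchor_eq_actFn (s : S.bundle.Sec) (f : Fn d M) (x : M) :
    mvfderiv (𝓡 d) f x (S.anchor x (s x)) = actFn (S.secEquiv.symm s) f x := by
  rw [← ev_symm s]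
  exact mvfderiv_anchor_eq _ _ _

lemma funext_metric (s t : S.bundle.Sec) : (fun x => S.metric x (s x) (t x)) =
    ⇑(formFn (S.secEquiv.symm s) (S.secEquiv.symm t)) := funext (metric_eq_formFn s t)

lemma funext_anchor (s : S.bundle.Sec) (f : Fn d M) :
    (fun x => mvfderiv (𝓡 d) f x (S.anchor x (s x))) = ⇑(actFn (S.secEquiv.symm s) f) :=
  funext (anchor_eq_actFn s f)

variable (S) in
/-- The derived bracket `-{{Θ, s}, t}` on sections. -/
def circ (s t : S.bundle.Sec) : S.bundle.Sec :=
  S.secEquiv (S.der (S.secEquiv.symm s) (S.secEquiv.symm t))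

lemma symm_circ (s t : S.bundle.Sec) :
    S.secEquiv.symm (S.circ s t) = S.der (S.secEquiv.symm s) (S.secEquiv.symm t) :=
  S.secEquiv.symm_apply_apply _

lemma anchor_circ (s t : S.bundle.Sec) (f : Fn d M) (x : M) :
    mvfderiv (𝓡 d) f x (S.anchor x (S.circ s t x)) =
      mvfderiv (𝓡 d) (fun y => mvfderiv (𝓡 d) f y (S.anchor y (t y))) x (S.anchor x (s x)) -
      mvfderiv (𝓡 d) (fun y => mvfderiv (𝓡 d) f y (S.anchor y (s y))) x (S.anchor x (t x)) := by
  rw [funext_anchor, funext_anchor, anchor_eq_actFn, anchor_eq_actFn, anchor_eq_actFn, symm_circ,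
    actFn_der]
  rfl

lemma circ_symm (s t : S.bundle.Sec) (x : M) (v : S.Fib x) :
    S.metric x (S.circ s t x + S.circ t s x) v =
      mvfderiv (𝓡 d) (fun y => S.metric y (s y) (t y)) x (S.anchor x v) := by
  obtain ⟨c, rfl⟩ := ev_surjective x v
  rw [funext_metric, mvfderiv_anchor]
  have h := metric_ev x (S.der (S.secEquiv.symm s) (S.secEquiv.symm t) +
    S.der (S.secEquiv.symm t) (S.secEquiv.symm s)) c
  rw [map_add] at h
  refine h.trans ?_
  rw [der_add_der, map_neg, LinearMap.neg_apply, form_comm]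

lemma circ_metric (a b c : S.bundle.Sec) (x : M) :
    mvfderiv (𝓡 d) (fun y => S.metric y (b y) (c y)) x (S.anchor x (a x)) =
      S.metric x (S.circ a b x) (c x) + S.metric x (b x) (S.circ a c x) := by
  rw [funext_metric, anchor_eq_actFn, metric_eq_formFn, metric_eq_formFn, actFn_formFn, symm_circ,
    symm_circ]
  rfl

lemma symm_add (s t : S.bundle.Sec) :
    S.secEquiv.symm (s + t) = S.secEquiv.symm s + S.secEquiv.symm t := by
  rw [Equiv.symm_apply_eq]
  refine Sec.ext fun x => ?_
  rw [secEquiv_apply, map_add, ev_symm, ev_symm]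
  rfl

lemma symm_smul (f : Fn d M) (s t : S.bundle.Sec) (h : ∀ x, t x = f x • s x) :
    S.secEquiv.symm t = fnMul f (S.secEquiv.symm s) := by
  rw [Equiv.symm_apply_eq]
  refine Sec.ext fun x => (h x).trans ?_
  rw [secEquiv_apply, ← ev_symm s]
  refine (map_smul (S.ev x) _ _).symm.trans (ev_eq_iff.2 fun c => ?_)
  rw [form_fnMul, map_smul]
  rfl

variable (S) in
/-- The derived pre-Courant algebroid. -/
def preCourant : PreCourantAlgebroid d M where
  toVBundle := S.bundle
  metric := S.metric
  metric_symm x v w := by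
    obtain ⟨a, rfl⟩ := ev_surjective x v
    obtain ⟨b, rfl⟩ := ev_surjective x w
    exact (metric_ev x a b).trans ((form_comm x a b).trans (metric_ev x b a).symm)
  metric_nondeg x v h := by
    obtain ⟨a, rfl⟩ := ev_surjective x v
    exact ((Submodule.Quotient.mk_eq_zero _).2 <| LinearMap.mem_ker.2 <| LinearMap.ext fun b =>
      (metric_ev x a b).symm.trans (h (S.ev x b)) :)
  metric_smooth s t := (formFn _ _).contMDiff.congr (metric_eq_formFn s t)
  anchor := S.anchor
  anchor_smooth s f := (actFn _ _).contMDiff.congr (anchor_eq_actFn s f)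
  coisotropic := anchor_coisotropic
  circ := S.circ
  anchor_circ := anchor_circ
  circ_symm := circ_symm
  circ_metric := circ_metric

variable (S) in
/-- `S.preCourant` is derived from `S`, through the identification of functions of weight one with
sections. -/
def derived : DerivedData S S.preCourant where
  φ := S.secEquiv.symm
  φ_add s t := congrArg Subtype.val (symm_add s t)
  φ_smul f s t h := congrArg Subtype.val (symm_smul f s t h)
  pairing_eq s t := (congrArg S.fn (Fn.ext fun x => metric_eq_formFn s t x)).trans (fn_formFn _ _)
  anchor_eq s f := (congrArg S.fn (Fn.ext fun x => anchor_eq_actFn s f x)).trans (fn_actFn _ f)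
  circ_eq s t := congrArg Subtype.val (symm_circ s t)

end SymplecticAlmostLie2Algebroid

end PreCourant

end

noncomputable section

namespace PreCourant

variable {d : ℕ} {M : Type u} [TopologicalSpace M] [ChartedSpace (EuclideanSpace ℝ (Fin d)) M]
variable [T2Space M] [IsManifold (𝓡 d) ∞ M]

variable (d M) in
/-- The isomorphism class of the derived pre-Courant algebroid. -/
def derivedClass : Quotient (SymplecticAlmostLie2Algebroid.isoSetoid d M) →
    Quotient (PreCourantAlgebroid.isoSetoid d M) :=
  Quotient.map (fun S => S.preCourant) fun S S' ⟨a⟩ =>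
    ⟨(S.derived.push a).isoOfSame S'.derived⟩

variable (d M) in
/-- The isomorphism class of the algebroid of polynomial functions. -/
def polyClass : Quotient (PreCourantAlgebroid.isoSetoid d M) →
    Quotient (SymplecticAlmostLie2Algebroid.isoSetoid d M) :=
  Quotient.map (fun P => polySympl P) fun P P' ⟨b⟩ =>
    ⟨(existsUnique_iso_left (polyDerived P) (polyDerived P') b).choose⟩

variable (d M) in
/-- The bijection between isomorphism classes given by the derived pre-Courant algebroid. -/
def classEquiv : Quotient (SymplecticAlmostLie2Algebroid.isoSetoid d M) ≃
    Quotient (PreCourantAlgebroid.isoSetoid d M) where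
  toFun := derivedClass d M
  invFun := polyClass d M
  left_inv := by
    rintro ⟨S⟩
    exact Quotient.sound (s := SymplecticAlmostLie2Algebroid.isoSetoid d M)
      ⟨S.derived.isoPoly.symm⟩
  right_inv := by
    rintro ⟨P⟩
    exact Quotient.sound (s := PreCourantAlgebroid.isoSetoid d M)
      ⟨(polySympl P).derived.isoOfSame (polyDerived P)⟩

lemma classEquiv_mk (S : SymplecticAlmostLie2Algebroid d M) (P : PreCourantAlgebroid d M) :
    classEquiv d M (Quotient.mk _ S) = Quotient.mk _ P ↔ Nonempty (DerivedData S P) := by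
  have h : (Quotient.mk (PreCourantAlgebroid.isoSetoid d M) S.preCourant) = Quotient.mk _ P ↔
      Nonempty (PreCourantAlgebroid.Iso S.preCourant P) := Quotient.eq
  exact h.trans ⟨fun ⟨b⟩ => ⟨S.derived.pull b.symm⟩, fun ⟨D⟩ => ⟨S.derived.isoOfSame D⟩⟩

end PreCourant

end

theorem theorem3p1 (d : ℕ) (M : Type u) [TopologicalSpace M] [T2Space M]
    [SecondCountableTopology M] [ChartedSpace (EuclideanSpace ℝ (Fin d)) M]
    [IsManifold (𝓡 d) ∞ M] :
    (∃ Φ : Quotient (PreCourant.SymplecticAlmostLie2Algebroid.isoSetoid d M) ≃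
        Quotient (PreCourant.PreCourantAlgebroid.isoSetoid d M),
      ∀ (S : PreCourant.SymplecticAlmostLie2Algebroid d M)
        (P : PreCourant.PreCourantAlgebroid d M),
        Φ (Quotient.mk _ S) = Quotient.mk _ P ↔ Nonempty (PreCourant.DerivedData S P)) ∧
    (∀ (S S' : PreCourant.SymplecticAlmostLie2Algebroid d M)
        (P P' : PreCourant.PreCourantAlgebroid d M)
        (D : PreCourant.DerivedData S P) (D' : PreCourant.DerivedData S' P'),
      (∀ a : PreCourant.SymplecticAlmostLie2Algebroid.Iso S S',
        ∃! b : PreCourant.PreCourantAlgebroid.Iso P P', PreCourant.Corresponds D D' a b) ∧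
      (∀ b : PreCourant.PreCourantAlgebroid.Iso P P',
        ∃! a : PreCourant.SymplecticAlmostLie2Algebroid.Iso S S',
          PreCourant.Corresponds D D' a b)) :=
  ⟨⟨PreCourant.classEquiv d M, PreCourant.classEquiv_mk⟩, fun _ _ _ _ D D' =>
    ⟨PreCourant.existsUnique_iso_right D D',
      PreCourant.existsUnique_iso_left D D'⟩⟩
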